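/- **Setting.** All spaces are real. Let $\tilde E$ be a separable Banach space, let $A$ generate a strongly continuous semigroup on $\tilde E$, let $H$ be a separable Hilbert space, and let $E$ be a separable Banach space with $D(A)\subset E\subset\tilde E$ with continuous and dense embeddings ($D(A)$ with the graph norm). Let $F:E\to\tilde E$ be strongly measurable and bounded on bounded sets, and let $G:E\to\mathscr L(H,\tilde E)$ be bounded on bounded sets with $x\mapsto G(x)h$ strongly measurable for every $h\in H$. An *$H$-cylindrical Wiener process* $W_H$ on a probability space $(\Omega,\Sigma,\mathbb P)$ is a bounded linear map $L^2(0,\infty;H)\to L^2(\Omega)$ with centered Gaussian values such that $\mathbb E[W_H(f)W_H(g)]=[f,g]_{L^2(0,\infty;H)}$; put $W_H(t)h:=W_H(\mathbf 1_{(0,t]}\otimes h)$. It is a Wiener process *with respect to* a filtration $\mathbb F=(\mathscr F_t)_{t\ge 0}$ if every $W_H(t)h$ is (has a version that is) $\mathscr F_t$-measurable and $W_H(t)h-W_H(s)h$ is independent of $\mathscr F_s$ for $s\le t$. A *weak solution* of equation $[A,F,G]$ is a tuple $((\Omega,\Sigma,\mathbb P),\mathbb F,W_H,\mathbf X)$ of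 a filtered probability space, such a $W_H$ with respect to $\mathbb F$, and an $\mathbb F$-progressive $E$-valued process $\mathbf X$ with continuous paths such that for all $x^*\in D(A^*)$ and $t\ge 0$, $\mathbb P$-a.s., $$\langle X(t),x^*\rangle=\langle X(0),x^*\rangle+\int_0^t\langle X(s),A^*x^*\rangle\,ds+\int_0^t\langle F(X(s)),x^*\rangle\,ds+\int_0^t G(X(s))^*x^*\,dW_H(s),$$ the last term being the Itô integral of an $H$-valued process. Let $\mathscr D$ be the set of functions $f:E\to\mathbb R$, $f(x)=\varphi(\langle x,x_1^*\rangle,\dots,\langle x,x_n^*\rangle)$ with $n\in\mathbb N$, $\varphi\in C^2(\mathbb R^n)$, $x_k^*\in D(A^*)$, and for such $f$ let, with the derivatives of $\varphi$ evaluated at $(\langle x,x_1^*\rangle,\dots,\langle x,x_n^*\rangle)$, $$\mathscr L_{[A,F,G]}f(x)=\sum_{k}\frac{\partial\varphi}{\partial u_k}\big[\langle x,A^*x_k^*\rangle+\langle F(x),x_k^*\rangle\big]+\frac12\sum_{k,l}\big[G(x)^*x_k^*,G(x)^*x_l^*\big]_H\frac{\partial^2\varphi}{\partial u_k\partial u_l}.$$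 Let $\mathscr L^{\min}_{[A,F,G]}$ be the restriction of $\mathscr L_{[A,F,G]}$ to $\{\langle\cdot,x^*\rangle^j: x^*\in D(A^*),\ j=1,2\}$. On $C([0,\infty);E)$, with its Borel $\sigma$-algebra and the coordinate filtration $\mathscr B_t=\sigma(\mathbf x(s):s\le t)$, a probability measure $\mathbf P$ *solves the local martingale problem* for an operator $\mathscr L$ if for every $f\in D(\mathscr L)$ the process $\mathbf M^f(t)=f(\mathbf x(t))-\int_0^t\mathscr Lf(\mathbf x(s))\,ds$ is a local martingale under $\mathbf P$, i.e. there are $(\mathscr B_t)$-stopping times $\tau_n\uparrow\infty$ $\mathbf P$-a.s. such that $\mathbf M^f(t\wedge\tau_n)-\mathbf M^f(0)$, $t\ge 0$, is a martingale for every $n$. **Theorem.** 1. If $\mathbf X$ is a weak solution of $[A,F,G]$, then the law of $\mathbf X$ on $C([0,\infty);E)$ solves the local martingale problem for $\mathscr L_{[A,F,G]}$. 2. Conversely, if $\mathbf P$ solves the local martingale problem for $\mathscr L^{\min}_{[A,F,G]}$, then there is a weak solution $((\Omega,\Sigma,\mathbb Q),\mathbb F,W_H,\mathbf X)$ of $[A,F,G]$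 with distribution $\mathbf P$. It can be chosen so that $(\Omega,\Sigma,\mathbb F,\mathbb Q)$ is, via the map $\mathbf X:\Omega\to C([0,\infty);E)$, an extension of $(C([0,\infty);E),\mathscr B,(\mathscr B_t),\mathbf P)$: $\mathbf X$ carries $\mathbb Q$ to $\mathbf P$, $\mathbf X^{-1}(\mathscr B_t)\subset\mathscr F_t$, and $\mathbb Q(\mathbf X\in B\mid\mathscr F_t)=\mathbf P(B\mid\mathscr B_t)\circ\mathbf X$ a.s. for all $t\ge0$ and all Borel sets $B$. -/

import Mathlib

open MeasureTheory ProbabilityTheory Filter Topology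
open scoped NNReal ENNReal

universe u v w z

/-! ### Path space, canonical filtration, local martingales, local martingale problems -/

/-- The Borel `σ`-algebra of the path space `C([0,∞); E)`, which carries the topology of uniform
convergence on compact sets. -/
instance pathMeasurableSpace {E : Type*} [TopologicalSpace E] : MeasurableSpace C(ℝ≥0, E) :=
  borel _

instance pathBorelSpace {E : Type*} [TopologicalSpace E] : BorelSpace C(ℝ≥0, E) := ⟨rfl⟩

/-- The filtration `𝓑_t = σ(x(s) : s ≤ t)` generated by the coordinate maps on path space. -/
def pathFiltration (E : Type*) [TopologicalSpace E] [MeasurableSpace E] [BorelSpace E] :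
    Filtration ℝ≥0 (pathMeasurableSpace (E := E)) where
  seq t := ⨆ s ≤ t, MeasurableSpace.comap (fun x : C(ℝ≥0, E) => x s) inferInstance
  mono' _ _ hij := biSup_mono fun _ h => le_trans h hij
  le' _ := iSup₂_le fun s _ =>
    ((ContinuousEvalConst.continuous_eval_const s).measurable).comap_le

/-- `M` is a local martingale: there are stopping times `τ n`, almost surely increasing to `∞`,
such that the stopped and centred processes `M (t ∧ τ n) - M 0` are martingales.
(Centring means that no integrability of `M 0` is required.) -/
def IsLocalMartingale {Ω : Type*} {mΩ : MeasurableSpace Ω} (M : ℝ≥0 → Ω → ℝ)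
    (𝓕 : Filtration ℝ≥0 mΩ) (P : Measure Ω) : Prop :=
  ∃ τ : ℕ → Ω → WithTop ℝ≥0, IsLocalizingSequence 𝓕 τ P ∧
    ∀ n, Martingale (fun t ω => stoppedProcess M (τ n) t ω - M 0 ω) 𝓕 P

/-- The process `M^{f}(t) = f(x(t)) - ∫₀ᵗ g(x(s)) ds` on path space, where `g = 𝓛 f`. -/
noncomputable def martingaleProblemProcess {E : Type*} [TopologicalSpace E] (f g : E → ℝ) :
    ℝ≥0 → C(ℝ≥0, E) → ℝ :=
  fun t x => f (x t) - ∫ s in (0 : ℝ)..t, g (x s.toNNReal)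

/-- A probability measure `P` on path space solves the local martingale problem for the operator
whose graph is `L` if for every `(f, 𝓛 f) ∈ L` the process `M^f` is a local martingale under `P`
with respect to the coordinate filtration. -/
def SolvesLocalMartingaleProblem {E : Type*} [TopologicalSpace E] [MeasurableSpace E]
    [BorelSpace E] (L : Set ((E → ℝ) × (E → ℝ))) (P : Measure C(ℝ≥0, E)) : Prop :=
  IsProbabilityMeasure P ∧
    ∀ p ∈ L, IsLocalMartingale (martingaleProblemProcess p.1 p.2) (pathFiltration E) P

/-! ### Semigroups, generators, Banach space adjoints -/

/-- Strongly continuous semigroups of bounded operators. -/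
structure IsC0Semigroup {X : Type*} [NormedAddCommGroup X] [NormedSpace ℝ X]
    (S : ℝ≥0 → X →L[ℝ] X) : Prop where
  zero : S 0 = ContinuousLinearMap.id ℝ X
  add : ∀ s t, S (s + t) = (S s).comp (S t)
  strong_continuity : ∀ x, Tendsto (fun t => S t x) (𝓝 0) (𝓝 x)

/-- `A` is the generator of `S`: `x ∈ D(A)` and `A x = y` if and only if
`(S(t) x - x) / t → y` as `t ↓ 0`. -/
def IsGenerator {X : Type*} [NormedAddCommGroup X] [NormedSpace ℝ X]
    (S : ℝ≥0 → X →L[ℝ] X) (A : X →ₗ.[ℝ] X) : Prop :=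
  ∀ x y : X, (x, y) ∈ A.graph ↔
    Tendsto (fun t : ℝ≥0 => (t : ℝ)⁻¹ • (S t x - x)) (𝓝[>] 0) (𝓝 y)

/-- `x* ∈ D(A*)` and `A* x* = y*`, i.e. `⟨A x, x*⟩ = ⟨x, y*⟩` for all `x ∈ D(A)`.
When `A` is densely defined (as generators are), `y*` is determined by `x*`. -/
def IsAdjointPair {X : Type*} [NormedAddCommGroup X] [NormedSpace ℝ X]
    (A : X →ₗ.[ℝ] X) (xs ys : StrongDual ℝ X) : Prop :=
  ∀ x : A.domain, xs (A x) = ys x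

/-- `T* x* ∈ H` for a bounded operator `T : H → X` and `x* ∈ X*`, where `H* ≃ H` by Riesz;
thus `[T* x*, h]_H = ⟨T h, x*⟩`. -/
noncomputable def hilbertAdjoint {H X : Type*} [NormedAddCommGroup H] [InnerProductSpace ℝ H]
    [CompleteSpace H] [NormedAddCommGroup X] [NormedSpace ℝ X]
    (T : H →L[ℝ] X) (xs : StrongDual ℝ X) : H :=
  (InnerProductSpace.toDual ℝ H).symm (xs.comp T)

/-! ### The coefficients and the associated operators -/

/-- Standing hypotheses on the coefficients `A`, `F`, `G` and on the embedding `ι : E → X`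
(where `X` is the larger space, on which the semigroup acts). -/
structure IsAdmissibleCoefficients {E X H : Type*}
    [NormedAddCommGroup E] [NormedSpace ℝ E] [MeasurableSpace E]
    [NormedAddCommGroup X] [NormedSpace ℝ X]
    [NormedAddCommGroup H] [InnerProductSpace ℝ H]
    (ι : E →L[ℝ] X) (A : X →ₗ.[ℝ] X) (F : E → X) (G : E → H →L[ℝ] X) : Prop where
  generator : ∃ S : ℝ≥0 → X →L[ℝ] X, IsC0Semigroup S ∧ IsGenerator S A
  embedding_injective : Function.Injective ι
  embedding_dense : DenseRange ι
  domain_subset : ∀ x ∈ A.domain, x ∈ Set.range ι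
  domain_dense : Dense {e : E | ι e ∈ A.domain}
  /-- the embedding of `D(A)`, with the graph norm, into `E` is continuous -/
  domain_continuous : ∃ C : ℝ, ∀ (e : E) (h : ι e ∈ A.domain),
    ‖e‖ ≤ C * (‖ι e‖ + ‖A ⟨ι e, h⟩‖)
  F_measurable : StronglyMeasurable F
  F_bounded : ∀ s : Set E, Bornology.IsBounded s → Bornology.IsBounded (F '' s)
  G_measurable : ∀ h : H, StronglyMeasurable fun x => G x h
  G_bounded : ∀ s : Set E, Bornology.IsBounded s → Bornology.IsBounded (G '' s)

section Operators

variable {E X H : Type*}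
  [NormedAddCommGroup E] [NormedSpace ℝ E]
  [NormedAddCommGroup X] [NormedSpace ℝ X]
  [NormedAddCommGroup H] [InnerProductSpace ℝ H] [CompleteSpace H]

/-- The value at `x` of `L_{[A,F,G]} f` for `f = φ(⟨·, x₁*⟩, …, ⟨·, xₙ*⟩)`, where
`xs k = xₖ*` and `ys k = A* xₖ*`. -/
noncomputable def cylindricalL (ι : E →L[ℝ] X) (F : E → X) (G : E → H →L[ℝ] X) {n : ℕ}
    (φ : (Fin n → ℝ) → ℝ) (xs ys : Fin n → StrongDual ℝ X) (x : E) : ℝ :=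
  (∑ k, fderiv ℝ φ (fun i => xs i (ι x)) (Pi.single k 1) * (ys k (ι x) + xs k (F x))) +
  1 / 2 * ∑ k, ∑ l,
    inner ℝ (hilbertAdjoint (G x) (xs k)) (hilbertAdjoint (G x) (xs l)) *
      fderiv ℝ (fun a => fderiv ℝ φ a (Pi.single l 1)) (fun i => xs i (ι x)) (Pi.single k 1)

/-- The graph of the operator `𝓛_{[A,F,G]}`: the pairs `(f, L_{[A,F,G]} f)` where
`f = φ(⟨·, x₁*⟩, …, ⟨·, xₙ*⟩)` with `φ ∈ C²(ℝⁿ)` and `x₁*, …, xₙ* ∈ D(A*)`. -/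
def operatorGraph (ι : E →L[ℝ] X) (A : X →ₗ.[ℝ] X) (F : E → X) (G : E → H →L[ℝ] X) :
    Set ((E → ℝ) × (E → ℝ)) :=
  {p | ∃ (n : ℕ) (φ : (Fin n → ℝ) → ℝ) (xs ys : Fin n → StrongDual ℝ X),
    ContDiff ℝ 2 φ ∧ (∀ k, IsAdjointPair A (xs k) (ys k)) ∧
    p.1 = (fun x => φ (fun i => xs i (ι x))) ∧ p.2 = cylindricalL ι F G φ xs ys}

/-- `𝓓_min`: the functions `⟨·, x*⟩` and `⟨·, x*⟩²` with `x* ∈ D(A*)`. -/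
def minDomain (ι : E →L[ℝ] X) (A : X →ₗ.[ℝ] X) : Set (E → ℝ) :=
  {f | ∃ xs ys : StrongDual ℝ X, IsAdjointPair A xs ys ∧
    ((f = fun x => xs (ι x)) ∨ (f = fun x => xs (ι x) ^ 2))}

/-- The graph of the minimal operator, the restriction of `𝓛_{[A,F,G]}` to `𝓓_min`. -/
def minOperatorGraph (ι : E →L[ℝ] X) (A : X →ₗ.[ℝ] X) (F : E → X) (G : E → H →L[ℝ] X) :
    Set ((E → ℝ) × (E → ℝ)) :=
  {p ∈ operatorGraph ι A F G | p.1 ∈ minDomain ι A}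

end Operators

/-! ### Cylindrical Wiener processes and stochastic integrals -/

section Wiener

variable {Ω : Type*} {mΩ : MeasurableSpace Ω} {P : Measure Ω}
  {H : Type*} [NormedAddCommGroup H] [InnerProductSpace ℝ H]

/-- `W(t) h = W(1_{(0,t]} ⊗ h)` for a bounded linear map `W : L²(0,∞; H) → L²(Ω)`. -/
noncomputable def wienerAt
    (W : Lp H 2 (volume.restrict (Set.Ioi (0 : ℝ))) →L[ℝ] Lp ℝ 2 P) (t : ℝ≥0) (h : H) : Ω → ℝ :=
  W (indicatorConstLp 2 (measurableSet_Ioc : MeasurableSet (Set.Ioc (0 : ℝ) t))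
    (((Measure.restrict_apply_le _ _).trans_lt measure_Ioc_lt_top).ne) h)

/-- `W` is an `H`-cylindrical Wiener process with respect to the filtration `𝓕`. The random
variables `W(t) h` are elements of `L²(Ω)`, so adaptedness means that they have an
`𝓕 t`-measurable representative. -/
structure IsCylindricalWiener (𝓕 : Filtration ℝ≥0 mΩ)
    (W : Lp H 2 (volume.restrict (Set.Ioi (0 : ℝ))) →L[ℝ] Lp ℝ 2 P) : Prop where
  gaussian : ∀ f, HasGaussianLaw (W f : Ω → ℝ) P
  centered : ∀ f, ∫ ω, (W f : Ω → ℝ) ω ∂P = 0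
  covariance : ∀ f g, ∫ ω, (W f : Ω → ℝ) ω * (W g : Ω → ℝ) ω ∂P = inner ℝ f g
  adapted : ∀ t h, AEStronglyMeasurable[𝓕 t] (wienerAt W t h) P
  indep_increments : ∀ s t, s ≤ t → ∀ h,
    Indep (MeasurableSpace.comap (fun ω => wienerAt W t h ω - wienerAt W s h ω) inferInstance)
      (𝓕 s) P

/-- Elementary adapted `H`-valued processes `∑ᵢ 1_{(aᵢ, bᵢ]} ξᵢ hᵢ` with `ξᵢ` bounded and
`𝓕 (aᵢ)`-measurable. -/
structure ElementaryProcess (𝓕 : Filtration ℝ≥0 mΩ) (H : Type*) where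
  n : ℕ
  a : Fin n → ℝ≥0
  b : Fin n → ℝ≥0
  le : ∀ i, a i ≤ b i
  ξ : Fin n → Ω → ℝ
  measurable : ∀ i, StronglyMeasurable[𝓕 (a i)] (ξ i)
  bounded : ∀ i, ∃ C : ℝ, ∀ ω, |ξ i ω| ≤ C
  h : Fin n → H

/-- The value at time `s` of an elementary process. -/
noncomputable def ElementaryProcess.eval {𝓕 : Filtration ℝ≥0 mΩ} (Φ : ElementaryProcess 𝓕 H)
    (s : ℝ≥0) (ω : Ω) : H :=
  ∑ i, (Set.Ioc (Φ.a i) (Φ.b i)).indicator (fun _ => Φ.ξ i ω • Φ.h i) s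

/-- The stochastic integral `∫₀ᵗ Φ dW = ∑ᵢ ξᵢ (W(t ∧ bᵢ) hᵢ - W(t ∧ aᵢ) hᵢ)` of an elementary
process. -/
noncomputable def ElementaryProcess.integral {𝓕 : Filtration ℝ≥0 mΩ} (Φ : ElementaryProcess 𝓕 H)
    (W : Lp H 2 (volume.restrict (Set.Ioi (0 : ℝ))) →L[ℝ] Lp ℝ 2 P) (t : ℝ≥0) (ω : Ω) : ℝ :=
  ∑ i, Φ.ξ i ω *
    (wienerAt W (min t (Φ.b i)) (Φ.h i) ω - wienerAt W (min t (Φ.a i)) (Φ.h i) ω)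

/-- The process `I` is (a version with almost surely continuous paths of) the stochastic integral
`I(t) = ∫₀ᵗ Φ(s) dW(s)` of the progressive `H`-valued process `Φ`: there are elementary processes
`Φₙ` such that, for every `t`, in probability `∫₀ᵗ ‖Φₙ(s) - Φ(s)‖² ds → 0` and
`∫₀ᵗ Φₙ dW → I(t)`. Such an `I` exists if and only if `∫₀ᵗ ‖Φ(s)‖² ds < ∞` almost surely for all
`t`, and it is unique up to indistinguishability. -/
def IsStochasticIntegral (𝓕 : Filtration ℝ≥0 mΩ)
    (W : Lp H 2 (volume.restrict (Set.Ioi (0 : ℝ))) →L[ℝ] Lp ℝ 2 P)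
    (Φ : ℝ≥0 → Ω → H) (I : ℝ≥0 → Ω → ℝ) : Prop :=
  (∀ᵐ ω ∂P, Continuous fun t => I t ω) ∧
  ∃ Φn : ℕ → ElementaryProcess 𝓕 H, ∀ t : ℝ≥0,
    (∀ ε : ℝ≥0∞, 0 < ε → Tendsto (fun n => P {ω | ε ≤ ∫⁻ s in Set.Ioc (0 : ℝ) t,
      ‖(Φn n).eval s.toNNReal ω - Φ s.toNNReal ω‖ₑ ^ 2}) atTop (𝓝 0)) ∧
    TendstoInMeasure P (fun n => (Φn n).integral W t) atTop (I t)

end Wiener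

/-! ### Weak solutions and extensions -/

/-- `((Ω, Σ, P), 𝓕, W, X)` is a (stochastically and analytically) weak solution of `[A,F,G]`.
The continuous process `X` is given by its path map `Ω → C([0,∞); E)`. -/
structure IsWeakSolution {E X H : Type*}
    [NormedAddCommGroup E] [NormedSpace ℝ E] [MeasurableSpace E]
    [NormedAddCommGroup X] [NormedSpace ℝ X]
    [NormedAddCommGroup H] [InnerProductSpace ℝ H] [CompleteSpace H]
    (ι : E →L[ℝ] X) (A : X →ₗ.[ℝ] X) (F : E → X) (G : E → H →L[ℝ] X)
    {Ω : Type*} {mΩ : MeasurableSpace Ω} (P : Measure Ω) (𝓕 : Filtration ℝ≥0 mΩ)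
    (W : Lp H 2 (volume.restrict (Set.Ioi (0 : ℝ))) →L[ℝ] Lp ℝ 2 P)
    (Y : Ω → C(ℝ≥0, E)) : Prop where
  probability : IsProbabilityMeasure P
  wiener : IsCylindricalWiener 𝓕 W
  progressive : IsProgressive 𝓕 (fun t ω => Y ω t)
  equation : ∀ xs ys : StrongDual ℝ X, IsAdjointPair A xs ys →
    ∃ I : ℝ≥0 → Ω → ℝ,
      IsStochasticIntegral 𝓕 W (fun s ω => hilbertAdjoint (G (Y ω s)) xs) I ∧
      ∀ t : ℝ≥0, ∀ᵐ ω ∂P,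
        xs (ι (Y ω t)) = xs (ι (Y ω 0))
          + (∫ s in (0 : ℝ)..t, ys (ι (Y ω s.toNNReal)))
          + (∫ s in (0 : ℝ)..t, xs (F (Y ω s.toNNReal)))
          + I t ω

/-- `(Ω, Σ, P, 𝓕)` is, through `π : Ω → Ω₀`, an extension of the filtered probability space
`(Ω₀, Σ₀, P₀, 𝓕₀)`: `π` carries `P` to `P₀`, it is adapted, and conditioning an event of `Ω₀` on
`𝓕 t` is the same as conditioning it on `𝓕₀ t`. -/
structure IsFilteredExtension {Ω Ω₀ : Type*} {mΩ : MeasurableSpace Ω} {mΩ₀ : MeasurableSpace Ω₀}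
    (P : Measure Ω) (𝓕 : Filtration ℝ≥0 mΩ) (P₀ : Measure Ω₀) (𝓕₀ : Filtration ℝ≥0 mΩ₀)
    (π : Ω → Ω₀) : Prop where
  measurePreserving : MeasurePreserving π P P₀
  comap_le : ∀ t, MeasurableSpace.comap π (𝓕₀ t) ≤ 𝓕 t
  condExp_eq : ∀ (t : ℝ≥0) (B : Set Ω₀), MeasurableSet B →
    P[(π ⁻¹' B).indicator (fun _ => (1 : ℝ)) | 𝓕 t] =ᵐ[P]
      fun ω => (P₀[B.indicator (fun _ => (1 : ℝ)) | 𝓕₀ t]) (π ω)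

set_option linter.unusedSectionVars false

/-! Both directions pass through one notion, `IsSolutionMeasure`: for every radius `R` and every
`x*` in `D(A*)`, the coordinate `⟨x(t), x*⟩` minus its initial value and its drift, stopped on
leaving the ball of radius `R`, is a square integrable martingale whose bracket is the integral of
`‖G(x)* x*‖²` up to the exit time. Since `F` and `G` are bounded on bounded sets, stopping makes all
processes bounded on bounded time intervals, and the exit times increase to infinity along every
continuous path.

The stochastic calculus rests on bracket systems: families of pairs `(N, φ)` of a square integrable
martingale and a bounded progressive Hilbert space valued integrand, such that `N N'` has bracket `∫
⟪φ, φ'⟫ dr`. This structure survives elementary integration (`BracketSystem.gen`) and limits in mean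
square (`BracketSystem.intClosure`), and the resulting isometry produces stochastic integrals
(`BracketSystem.exists_intClosure`). It serves for the Wiener process, for the coordinate
martingales on path space, and for the two together on a product space.

From a weak solution to the martingale problem: the stopped stochastic integral of `G(X)* x*` is an
element of the closure of the elementary integrals, and it agrees with the stopped martingale part
of the coordinate (`IsWeakSolution.ae_eq_martStop`). Hence the law of `X` is a solution measure
(`IsWeakSolution.isSolutionMeasure`). Itô's formula (`IsItoSystem.condZero_comp`), applied to
finitely many stopped coordinates, then gives the local martingale property for every cylindrical
`C²` function (`IsSolutionMeasure.solves`).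

From the minimal problem back to a weak solution: optional stopping turns the local martingales for
`⟨·, x*⟩` and `⟨·, x*⟩²` into bounded ones, and integration by parts identifies the bracket, so that
`P` is a solution measure (`isSolutionMeasure_of_min`). It remains to represent the coordinate
martingales as integrals against a Wiener process. They may carry too little noise for this, so path
space is multiplied by a space with an independent cylindrical Wiener process `W'`. Let `p(e)` be
the orthogonal projection of `H` onto the closed span `V(e)` of the vectors `G(e)* x*`. The new
process integrates `p(X) h` against the coordinate martingales and `h - p(X) h` against `W'`.
Integrability of `p(X) h` comes from Gram–Schmidt applied to countably many vectors `G(e)* d_j` that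
span `V(e)` (`IsSolutionMeasure.exists_isometry`). As `h ↦ (p h, h - p h)` is an isometry, the
brackets of the new process are `t ⟪h, h'⟫`, and Lévy's characterization
(`BracketSystem.exists_isCylindricalWiener`) makes it a cylindrical Wiener process. As `p` fixes
`G(X)* x*`, integrating this coefficient against it returns the coordinate martingale
(`IsSolutionMeasure.exists_isWeakSolution`). An independent factor does not change conditional
probabilities of path events, whence the extension property. -/

section

open TopologicalSpace (SeparableSpace)

variable {Ω : Type*} {mΩ : MeasurableSpace Ω} {P : Measure Ω} {𝓕 : Filtration ℝ≥0 mΩ}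
  {K : Type*} [NormedAddCommGroup K] [InnerProductSpace ℝ K]
  {Base : (ℝ≥0 → Ω → ℝ) → (ℝ≥0 → Ω → K) → Prop}
  {E X H : Type*} [NormedAddCommGroup E] [NormedSpace ℝ E]
  [SeparableSpace E] [MeasurableSpace E] [BorelSpace E]
  [NormedAddCommGroup X] [NormedSpace ℝ X]
  [NormedAddCommGroup H] [InnerProductSpace ℝ H]
  {ι : E →L[ℝ] X} {A : X →ₗ.[ℝ] X} {F : E → X} {G : E → H →L[ℝ] X}

/-! ### Vanishing conditional expectations, tested on the sets of a sub-σ-algebra -/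

section CondZero

variable {Ω : Type*} {m mΩ : MeasurableSpace Ω} {P : Measure Ω}

/-- The integral of `f` over every `m`-measurable set vanishes. -/
def CondZero (m : MeasurableSpace Ω) {mΩ : MeasurableSpace Ω} (P : Measure Ω) (f : Ω → ℝ) : Prop :=
  ∀ B, MeasurableSet[m] B → ∫ ω in B, f ω ∂P = 0

lemma CondZero.condExp_eq_zero (hm : m ≤ mΩ) [IsFiniteMeasure P] {f : Ω → ℝ}
    (hf : Integrable f P) (h : CondZero m P f) : P[f | m] =ᵐ[P] 0 := by
  refine (ae_eq_condExp_of_forall_setIntegral_eq hm hf (fun s _ _ => integrableOn_zero)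
    (fun s hs _ => ?_) aestronglyMeasurable_zero).symm
  simp [h s hs]

lemma CondZero.integral_mul_eq_zero (hm : m ≤ mΩ) [IsFiniteMeasure P] {f η : Ω → ℝ}
    (hf : Integrable f P) (h : CondZero m P f) (hη : AEStronglyMeasurable[m] η P)
    (hi : Integrable (fun ω => η ω * f ω) P) : ∫ ω, η ω * f ω ∂P = 0 := by
  have h1 := condExp_mul_of_aestronglyMeasurable_left hη hi hf
  have h2 := h.condExp_eq_zero hm hf
  rw [← integral_condExp hm]
  rw [integral_congr_ae (g := fun _ => (0 : ℝ))]
  · simp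
  · filter_upwards [h1, h2] with ω h1 h2
    have : P[(fun ω => η ω * f ω) | m] ω = P[(η * f) | m] ω := rfl
    rw [this, h1]; simp [h2]

lemma CondZero.mul (hm : m ≤ mΩ) [IsFiniteMeasure P] {f η : Ω → ℝ}
    (hf : Integrable f P) (h : CondZero m P f) (hη : AEStronglyMeasurable[m] η P)
    (hi : Integrable (fun ω => η ω * f ω) P) : CondZero m P (fun ω => η ω * f ω) := by
  intro B hB
  have hη' : AEStronglyMeasurable[m] (B.indicator η) P :=
    ⟨B.indicator (hη.mk η), hη.stronglyMeasurable_mk.indicator hB, by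
      filter_upwards [hη.ae_eq_mk] with ω h
      by_cases hω : ω ∈ B <;> simp [hω, h]⟩
  have := h.integral_mul_eq_zero hm hf (η := B.indicator η) hη' (by
    have := hi.indicator (hm _ hB)
    refine this.congr (ae_of_all _ fun ω => ?_)
    by_cases hω : ω ∈ B <;> simp [hω])
  rw [← integral_indicator (hm _ hB)]
  rw [← this]
  congr 1; ext ω
  by_cases hω : ω ∈ B <;> simp [hω]

lemma CondZero.add {f g : Ω → ℝ} (hf : Integrable f P) (hg : Integrable g P)
    (h : CondZero m P f) (h' : CondZero m P g) : CondZero m P (fun ω => f ω + g ω) := by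
  intro B hB
  rw [integral_add hf.integrableOn hg.integrableOn, h B hB, h' B hB, add_zero]

lemma CondZero.const_mul {f : Ω → ℝ} (h : CondZero m P f) (c : ℝ) :
    CondZero m P (fun ω => c * f ω) := by
  intro B hB
  rw [integral_const_mul, h B hB, mul_zero]

lemma CondZero.zero : CondZero m P (fun _ : Ω => (0 : ℝ)) := fun B _ => by simp

lemma CondZero.congr {f g : Ω → ℝ} (h : CondZero m P f) (hfg : ∀ᵐ ω ∂P, f ω = g ω) :
    CondZero m P g := fun B hB => by
  rw [← h B hB]
  exact integral_congr_ae (ae_restrict_of_ae (hfg.mono fun ω h => h.symm))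

lemma CondZero.mono {m' : MeasurableSpace Ω} (hmm : m' ≤ m) {f : Ω → ℝ} (h : CondZero m P f) :
    CondZero m' P f := fun B hB => h B (hmm _ hB)

lemma CondZero.of_tendsto {f : Ω → ℝ} {F : ℕ → Ω → ℝ} (bound : Ω → ℝ)
    (hF : ∀ n, CondZero m P (F n)) (hFm : ∀ n, AEStronglyMeasurable (F n) P)
    (hb : Integrable bound P) (hbound : ∀ n, ∀ᵐ ω ∂P, ‖F n ω‖ ≤ bound ω)
    (hlim : ∀ᵐ ω ∂P, Tendsto (fun n => F n ω) atTop (𝓝 (f ω))) : CondZero m P f := by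
  intro B hB
  have := tendsto_integral_of_dominated_convergence (μ := P.restrict B) bound
    (fun n => (hFm n).restrict) hb.integrableOn (fun n => ae_restrict_of_ae (hbound n))
    (ae_restrict_of_ae hlim)
  simp only [hF _ B hB] at this
  exact (tendsto_nhds_unique this tendsto_const_nhds)

/-- Convergence in `L¹` preserves `CondZero`. -/
lemma CondZero.of_tendsto_L1 {f : Ω → ℝ} {F : ℕ → Ω → ℝ}
    (hF : ∀ n, CondZero m P (F n)) (hFi : ∀ n, Integrable (F n) P) (hf : Integrable f P)
    (hlim : Tendsto (fun n => ∫ ω, |F n ω - f ω| ∂P) atTop (𝓝 0)) : CondZero m P f := by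
  intro B hB
  have h1 : ∀ n, |∫ ω in B, f ω ∂P| ≤ ∫ ω, |F n ω - f ω| ∂P := fun n => by
    have h2 : ∫ ω in B, (F n ω - f ω) ∂P = - ∫ ω in B, f ω ∂P := by
      rw [integral_sub (hFi n).integrableOn hf.integrableOn, hF n B hB, zero_sub]
    calc |∫ ω in B, f ω ∂P| = |∫ ω in B, (F n ω - f ω) ∂P| := by rw [h2, abs_neg]
      _ ≤ ∫ ω in B, |F n ω - f ω| ∂P := abs_integral_le_integral_abs
      _ ≤ _ := setIntegral_le_integral ((hFi n).sub hf).abs (ae_of_all _ fun _ => abs_nonneg _)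
  have := ge_of_tendsto' hlim h1
  exact abs_eq_zero.1 (le_antisymm this (abs_nonneg _))

end CondZero

/-! ### Time integrals of bounded progressive processes -/

section TimeIntegral

variable {Ω : Type*} {mΩ : MeasurableSpace Ω} {P : Measure Ω}

/-- The process `∫₀ᵗ c(r) dr`. -/
noncomputable def timeInt (c : ℝ≥0 → Ω → ℝ) (t : ℝ≥0) (ω : Ω) : ℝ :=
  ∫ r in (0 : ℝ)..t, c r.toNNReal ω

/-- Bounded progressively measurable processes. -/
structure IsBoundedProg {K : Type*} [NormedAddCommGroup K] (𝓕 : Filtration ℝ≥0 mΩ)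
    (φ : ℝ≥0 → Ω → K) : Prop where
  prog : IsStronglyProgressive 𝓕 φ
  bdd : ∃ C : ℝ, ∀ t ω, ‖φ t ω‖ ≤ C

/-- Truncating time at `t` turns progressive measurability, which concerns `[0,t] × Ω`, into joint
measurability on `ℝ × Ω` with `𝓕 t` on the second factor. In this form Fubini's theorem makes time
integrals `𝓕 t`-measurable. -/
lemma MeasureTheory.IsStronglyProgressive.stronglyMeasurable_min {K : Type*} [TopologicalSpace K]
    {𝓕 : Filtration ℝ≥0 mΩ} {φ : ℝ≥0 → Ω → K} (h : IsStronglyProgressive 𝓕 φ) (t : ℝ≥0) :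
    StronglyMeasurable[Prod.instMeasurableSpace (m₂ := 𝓕 t)]
      (fun p : ℝ × Ω => φ (min p.1.toNNReal t) p.2) := by
  have h1 := h t
  refine h1.comp_measurable (g := fun p : ℝ × Ω =>
    ((⟨min p.1.toNNReal t, Set.mem_Iic.2 (min_le_right _ _)⟩ : Set.Iic t), p.2)) ?_
  refine Measurable.prodMk (m := Prod.instMeasurableSpace (m₂ := 𝓕 t)) ?_ ?_
  · refine Measurable.subtype_mk ?_
    have : Measurable (fun r : ℝ => min r.toNNReal t) := measurable_real_toNNReal.min measurable_const
    exact this.comp (@measurable_fst _ _ _ (𝓕 t))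
  · exact @measurable_snd _ _ _ (𝓕 t)

lemma MeasureTheory.IsStronglyProgressive.stronglyMeasurable_uncurry {K : Type*} [TopologicalSpace K]
    [TopologicalSpace.PseudoMetrizableSpace K]
    {𝓕 : Filtration ℝ≥0 mΩ} {φ : ℝ≥0 → Ω → K} (h : IsStronglyProgressive 𝓕 φ) :
    StronglyMeasurable (fun p : ℝ × Ω => φ p.1.toNNReal p.2) := by
  refine stronglyMeasurable_of_tendsto atTop
    (f := fun (n : ℕ) (p : ℝ × Ω) => φ (min p.1.toNNReal n) p.2) (fun n => ?_) ?_
  · refine (h.stronglyMeasurable_min (n : ℝ≥0)).mono ?_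
    exact sup_le_sup le_rfl (MeasurableSpace.comap_mono (𝓕.le _))
  · rw [tendsto_pi_nhds]
    intro p
    obtain ⟨n, hn⟩ := exists_nat_ge p.1.toNNReal
    refine tendsto_const_nhds.congr' ?_
    filter_upwards [eventually_ge_atTop n] with k hk
    rw [min_eq_left]
    exact hn.trans (by exact_mod_cast hk)

lemma MeasureTheory.IsStronglyProgressive.stronglyMeasurable_section {K : Type*} [TopologicalSpace K]
    [TopologicalSpace.PseudoMetrizableSpace K]
    {𝓕 : Filtration ℝ≥0 mΩ} {φ : ℝ≥0 → Ω → K} (h : IsStronglyProgressive 𝓕 φ) (ω : Ω) :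
    StronglyMeasurable (fun r : ℝ => φ r.toNNReal ω) :=
  h.stronglyMeasurable_uncurry.comp_measurable (measurable_id.prodMk measurable_const)

lemma MeasureTheory.IsStronglyProgressive.timeInt {𝓕 : Filtration ℝ≥0 mΩ} {c : ℝ≥0 → Ω → ℝ}
    (h : IsStronglyProgressive 𝓕 c) (t : ℝ≥0) : StronglyMeasurable[𝓕 t] (timeInt c t) := by
  have h1 := h.stronglyMeasurable_min t
  have h2 : StronglyMeasurable[𝓕 t] fun ω =>
      ∫ r, c (min r.toNNReal t) ω ∂(volume.restrict (Set.Ioc (0 : ℝ) t)) :=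
    @StronglyMeasurable.integral_prod_left ℝ Ω ℝ _ (𝓕 t) _ _ _ _
      (fun (r : ℝ) ω => c (min r.toNNReal t) ω) h1
  convert h2 using 2 with ω
  unfold _root_.timeInt
  rw [intervalIntegral.integral_of_le (show (0 : ℝ) ≤ (t : ℝ) from t.2)]
  refine setIntegral_congr_fun measurableSet_Ioc fun r hr => ?_
  rw [min_eq_left]
  exact Real.toNNReal_le_iff_le_coe.2 hr.2

namespace IsBoundedProg

variable {K : Type*} [NormedAddCommGroup K] {𝓕 : Filtration ℝ≥0 mΩ} {φ : ℝ≥0 → Ω → K}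

lemma integrable_section (h : IsBoundedProg 𝓕 φ) (ω : Ω) (a b : ℝ) :
    IntervalIntegrable (fun r : ℝ => φ r.toNNReal ω) volume a b := by
  obtain ⟨C, hC⟩ := h.bdd
  rw [intervalIntegrable_iff]
  have : IsFiniteMeasure (volume.restrict (Set.uIoc a b)) :=
    ⟨by rw [Measure.restrict_apply_univ, Set.uIoc]; exact measure_Ioc_lt_top⟩
  exact Integrable.of_bound ((h.prog.stronglyMeasurable_section ω).aestronglyMeasurable) C
    (ae_of_all _ fun r => hC _ _)

lemma zero : IsBoundedProg 𝓕 (fun _ _ => (0 : K)) :=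
  ⟨isStronglyProgressive_const 𝓕 (0 : K), 0, by simp⟩

lemma const (k : K) : IsBoundedProg 𝓕 (fun _ _ => k) :=
  ⟨isStronglyProgressive_const 𝓕 k, ‖k‖, by simp⟩

lemma add {ψ : ℝ≥0 → Ω → K} (h : IsBoundedProg 𝓕 φ) (h' : IsBoundedProg 𝓕 ψ) :
    IsBoundedProg 𝓕 (fun t ω => φ t ω + ψ t ω) := by
  obtain ⟨C, hC⟩ := h.bdd
  obtain ⟨D, hD⟩ := h'.bdd
  exact ⟨fun i => (h.prog i).add (h'.prog i), C + D, fun t ω =>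
    (norm_add_le _ _).trans (add_le_add (hC _ _) (hD _ _))⟩

lemma smul [NormedSpace ℝ K] {u : ℝ≥0 → Ω → ℝ} (hu : IsBoundedProg 𝓕 u)
    (h : IsBoundedProg 𝓕 φ) : IsBoundedProg 𝓕 (fun t ω => u t ω • φ t ω) := by
  obtain ⟨C, hC⟩ := hu.bdd
  obtain ⟨D, hD⟩ := h.bdd
  refine ⟨fun i => (hu.prog i).smul (h.prog i), C * D, fun t ω => ?_⟩
  rw [norm_smul]
  exact mul_le_mul (hC _ _) (hD _ _) (norm_nonneg _) ((norm_nonneg _).trans (hC t ω))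

lemma const_smul [NormedSpace ℝ K] (h : IsBoundedProg 𝓕 φ) (c : ℝ) :
    IsBoundedProg 𝓕 (fun t ω => c • φ t ω) := (const c).smul h

lemma inner [InnerProductSpace ℝ K] {ψ : ℝ≥0 → Ω → K} (h : IsBoundedProg 𝓕 φ)
    (h' : IsBoundedProg 𝓕 ψ) : IsBoundedProg 𝓕 (fun t ω => inner ℝ (φ t ω) (ψ t ω)) := by
  obtain ⟨C, hC⟩ := h.bdd
  obtain ⟨D, hD⟩ := h'.bdd
  refine ⟨fun i => (h.prog i).inner (h'.prog i), C * D, fun t ω => ?_⟩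
  exact (norm_inner_le_norm _ _).trans
    (mul_le_mul (hC _ _) (hD _ _) (norm_nonneg _) ((norm_nonneg _).trans (hC t ω)))

lemma step {ξ : Ω → ℝ} {a b : ℝ≥0} (hξ : StronglyMeasurable[𝓕 a] ξ)
    (hb : ∃ C : ℝ, ∀ ω, |ξ ω| ≤ C) :
    IsBoundedProg 𝓕 (fun t ω => (Set.Ioc a b).indicator (fun _ => ξ ω) t) := by
  obtain ⟨C, hC⟩ := hb
  refine ⟨fun i => ?_, C, fun t ω => ?_⟩
  · by_cases hai : a ≤ i
    · have h1 : StronglyMeasurable[Prod.instMeasurableSpace (m₂ := 𝓕 i)]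
          (fun p : Set.Iic i × Ω => ξ p.2) :=
        (hξ.mono (𝓕.mono hai)).comp_measurable (@measurable_snd _ _ _ (𝓕 i))
      have h2 : MeasurableSet[Prod.instMeasurableSpace (m₂ := 𝓕 i)]
          {p : Set.Iic i × Ω | (p.1 : ℝ≥0) ∈ Set.Ioc a b} := by
        have : Measurable (fun p : Set.Iic i => (p : ℝ≥0)) := measurable_subtype_coe
        exact (this.comp (@measurable_fst _ _ _ (𝓕 i))) measurableSet_Ioc
      have h3 := h1.indicator h2
      have e : (fun p : Set.Iic i × Ω => (Set.Ioc a b).indicator (fun _ => ξ p.2) (p.1 : ℝ≥0)) =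
          {p : Set.Iic i × Ω | (p.1 : ℝ≥0) ∈ Set.Ioc a b}.indicator (fun p => ξ p.2) := by
        ext p
        by_cases hp : (p.1 : ℝ≥0) ∈ Set.Ioc a b
        · rw [Set.indicator_of_mem hp, Set.indicator_of_mem (by exact hp)]
        · rw [Set.indicator_of_notMem hp, Set.indicator_of_notMem (by exact hp)]
      rw [e]; exact h3
    · have e : (fun p : Set.Iic i × Ω => (Set.Ioc a b).indicator (fun _ => ξ p.2) (p.1 : ℝ≥0)) =
          fun _ => 0 := by
        ext p
        have : (p.1 : ℝ≥0) ∉ Set.Ioc a b := fun h => hai (h.1.le.trans p.1.2)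
        rw [Set.indicator_of_notMem this]
      rw [e]; exact stronglyMeasurable_const
  · by_cases ht : t ∈ Set.Ioc a b
    · simpa [ht] using hC ω
    · simpa [ht] using (abs_nonneg _).trans (hC ω)

end IsBoundedProg

lemma timeInt_sub {𝓕 : Filtration ℝ≥0 mΩ} {c : ℝ≥0 → Ω → ℝ} (hc : IsBoundedProg 𝓕 c)
    (s t : ℝ≥0) (ω : Ω) : timeInt c t ω - timeInt c s ω = ∫ r in (s : ℝ)..t, c r.toNNReal ω := by
  unfold timeInt
  rw [intervalIntegral.integral_interval_sub_left]
  exacts [hc.integrable_section ω _ _, hc.integrable_section ω _ _]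

lemma timeInt_zero (c : ℝ≥0 → Ω → ℝ) (ω : Ω) : timeInt c 0 ω = 0 := by simp [timeInt]

lemma abs_timeInt_sub_le {𝓕 : Filtration ℝ≥0 mΩ} {c : ℝ≥0 → Ω → ℝ} (hc : IsBoundedProg 𝓕 c)
    {C : ℝ} {s t : ℝ≥0} (hst : s ≤ t) (ω : Ω) (hC : ∀ r, s ≤ r → r ≤ t → |c r ω| ≤ C) :
    |timeInt c t ω - timeInt c s ω| ≤ C * (t - s) := by
  rw [timeInt_sub hc]
  have := intervalIntegral.norm_integral_le_of_norm_le_const (a := (s : ℝ)) (b := t)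
    (f := fun r => c r.toNNReal ω) (C := C) (fun r hr => by
      rw [Set.uIoc_of_le (by exact_mod_cast hst)] at hr
      exact hC _ (NNReal.le_toNNReal_of_coe_le hr.1.le) (Real.toNNReal_le_iff_le_coe.2 hr.2))
  rwa [abs_of_nonneg (sub_nonneg.2 (by exact_mod_cast hst))] at this

lemma continuous_timeInt {𝓕 : Filtration ℝ≥0 mΩ} {c : ℝ≥0 → Ω → ℝ} (hc : IsBoundedProg 𝓕 c)
    (ω : Ω) : Continuous fun t => timeInt c t ω := by
  have : Continuous fun t : ℝ => ∫ r in (0 : ℝ)..t, c r.toNNReal ω :=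
    intervalIntegral.continuous_primitive (fun a b => hc.integrable_section ω a b) 0
  exact this.comp NNReal.continuous_coe

lemma IsBoundedProg.integrable_timeInt {𝓕 : Filtration ℝ≥0 mΩ} {c : ℝ≥0 → Ω → ℝ}
    [IsFiniteMeasure P] (hc : IsBoundedProg 𝓕 c) (t : ℝ≥0) : Integrable (timeInt c t) P := by
  obtain ⟨C, hC⟩ := hc.bdd
  refine Integrable.of_bound
    ((hc.prog.timeInt t).mono (𝓕.le t)).aestronglyMeasurable (C * t) (ae_of_all _ fun ω => ?_)
  have := abs_timeInt_sub_le hc (zero_le : 0 ≤ t) ω (C := C) fun r _ _ => hC r ω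
  simpa [timeInt_zero] using this

lemma timeInt_add {𝓕 : Filtration ℝ≥0 mΩ} {c d : ℝ≥0 → Ω → ℝ} (hc : IsBoundedProg 𝓕 c)
    (hd : IsBoundedProg 𝓕 d) (t : ℝ≥0) (ω : Ω) :
    timeInt (fun r ω => c r ω + d r ω) t ω = timeInt c t ω + timeInt d t ω :=
  intervalIntegral.integral_add (hc.integrable_section ω _ _) (hd.integrable_section ω _ _)

lemma timeInt_const_mul (c : ℝ≥0 → Ω → ℝ) (k : ℝ) (t : ℝ≥0) (ω : Ω) :
    timeInt (fun r ω => k * c r ω) t ω = k * timeInt c t ω :=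
  intervalIntegral.integral_const_mul _ _

/-- The process `ξ (N(t ∧ b) - N(t ∧ a))`. -/
def transform (ξ : Ω → ℝ) (a b : ℝ≥0) (N : ℝ≥0 → Ω → ℝ) (t : ℝ≥0) (ω : Ω) : ℝ :=
  ξ ω * (N (min t b) ω - N (min t a) ω)

/-- The bracket side of elementary integration: multiplying an integrand by `ξ 1_{(a,b]}` acts on
its time integral by the same operation `transform` that acts on the martingale. -/
lemma timeInt_step_mul {𝓕 : Filtration ℝ≥0 mΩ} {c : ℝ≥0 → Ω → ℝ} (hc : IsBoundedProg 𝓕 c)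
    (ξ : Ω → ℝ) {a b : ℝ≥0} (hab : a ≤ b) (t : ℝ≥0) (ω : Ω) :
    timeInt (fun r ω => (Set.Ioc a b).indicator (fun _ => ξ ω) r * c r ω) t ω =
      transform ξ a b (timeInt c) t ω := by
  unfold transform
  rw [timeInt_sub hc]
  have hle : ((min t a : ℝ≥0) : ℝ) ≤ (min t b : ℝ≥0) := by
    exact_mod_cast min_le_min le_rfl hab
  unfold timeInt
  rw [← intervalIntegral.integral_const_mul]
  rw [intervalIntegral.integral_of_le (show (0 : ℝ) ≤ (t : ℝ) from t.2),
    intervalIntegral.integral_of_le hle, ← integral_indicator measurableSet_Ioc,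
    ← integral_indicator measurableSet_Ioc]
  congr 1; ext r
  by_cases hr : r ∈ Set.Ioc (0 : ℝ) t
  · have e : (r.toNNReal : ℝ) = r := Real.coe_toNNReal _ hr.1.le
    by_cases h2 : r.toNNReal ∈ Set.Ioc a b
    · have h3 : r ∈ Set.Ioc ((min t a : ℝ≥0) : ℝ) ((min t b : ℝ≥0) : ℝ) := by
        constructor
        · refine lt_of_le_of_lt (NNReal.coe_le_coe.2 (min_le_right _ _)) ?_
          rw [← e]; exact_mod_cast h2.1
        · rw [← e]; norm_cast
          exact le_min (Real.toNNReal_le_iff_le_coe.2 hr.2) h2.2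
      rw [Set.indicator_of_mem hr, Set.indicator_of_mem h3]
      simp only [Set.indicator_of_mem h2]
    · have h3 : r ∉ Set.Ioc ((min t a : ℝ≥0) : ℝ) ((min t b : ℝ≥0) : ℝ) := by
        rintro ⟨h3, h4⟩
        apply h2
        rw [← e] at h3 h4
        norm_cast at h3 h4
        refine ⟨?_, h4.trans (min_le_right _ _)⟩
        rcases min_lt_iff.1 h3 with h5 | h5
        · exact absurd (Real.toNNReal_le_iff_le_coe.2 hr.2) (not_le.2 h5)
        · exact h5
      rw [Set.indicator_of_mem hr, Set.indicator_of_notMem h3]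
      simp only [Set.indicator_of_notMem h2, zero_mul]
  · have h3 : r ∉ Set.Ioc ((min t a : ℝ≥0) : ℝ) ((min t b : ℝ≥0) : ℝ) := by
      rintro ⟨h3, h4⟩
      exact hr ⟨lt_of_le_of_lt (NNReal.coe_nonneg _) h3,
        h4.trans (NNReal.coe_le_coe.2 (min_le_left _ _))⟩
    rw [Set.indicator_of_notMem hr, Set.indicator_of_notMem h3]

end TimeIntegral

/-! ### Square integrable martingales and their brackets -/

section Brackets

/-- Square integrable martingales (adapted up to null sets). -/
structure L2Mart (𝓕 : Filtration ℝ≥0 mΩ) (P : Measure Ω) (N : ℝ≥0 → Ω → ℝ) : Prop where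
  memLp : ∀ t, MemLp (N t) 2 P
  adapted : ∀ t, AEStronglyMeasurable[𝓕 t] (N t) P
  mart : ∀ s t, s ≤ t → CondZero (𝓕 s) P (fun ω => N t ω - N s ω)

/-- `C` is a bracket of `N` and `N'`. -/
structure BracketPair (𝓕 : Filtration ℝ≥0 mΩ) (P : Measure Ω) (N N' C : ℝ≥0 → Ω → ℝ) : Prop where
  integrable : ∀ t, Integrable (C t) P
  cond : ∀ s t, s ≤ t → CondZero (𝓕 s) P
    (fun ω => (N t ω - N s ω) * (N' t ω - N' s ω) - (C t ω - C s ω))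

lemma MeasureTheory.MemLp.bdd_mul_two {ξ f : Ω → ℝ} (hf : MemLp f 2 P)
    (hξ : AEStronglyMeasurable ξ P) {C : ℝ} (hC : ∀ ω, |ξ ω| ≤ C) :
    MemLp (fun ω => ξ ω * f ω) 2 P := by
  refine MemLp.of_le_mul (c := C) hf (hξ.mul hf.1) (ae_of_all _ fun ω => ?_)
  rw [norm_mul]
  exact mul_le_mul_of_nonneg_right (hC ω) (norm_nonneg _)

/-- Intersecting `(s,t]` with `(a,b]` leaves either nothing or an interval `(x,y]` with `a ≤ x`, so
that `ξ` is known at its left endpoint. The interval does not depend on `N`, hence it serves a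
martingale and its bracket simultaneously. -/
lemma transform_sub_cases (ξ : Ω → ℝ) {a b s t : ℝ≥0} (hab : a ≤ b) (hst : s ≤ t) :
    (∀ (N : ℝ≥0 → Ω → ℝ) ω, transform ξ a b N t ω - transform ξ a b N s ω = 0) ∨
    ∃ x y, s ≤ x ∧ x ≤ y ∧ y ≤ t ∧ a ≤ x ∧ ∀ (N : ℝ≥0 → Ω → ℝ) ω,
      transform ξ a b N t ω - transform ξ a b N s ω = ξ ω * (N y ω - N x ω) := by
  unfold transform
  rcases le_total t a with h1 | h1
  · left; intro N ω
    rw [min_eq_left h1, min_eq_left (h1.trans hab), min_eq_left (hst.trans h1),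
      min_eq_left (hst.trans (h1.trans hab))]
    ring
  rcases le_total b s with h2 | h2
  · left; intro N ω
    rw [min_eq_right h2, min_eq_right (hab.trans h2), min_eq_right (h2.trans hst),
      min_eq_right h1]
    ring
  right
  refine ⟨max a s, min t b, le_max_right _ _, ?_, min_le_left _ _, le_max_left _ _, ?_⟩
  · exact max_le (le_min h1 hab) (le_min hst h2)
  · intro N ω
    rw [min_eq_right h1, min_eq_left h2]
    rcases le_total a s with h3 | h3
    · rw [min_eq_right h3, max_eq_right h3]; ring
    · rw [min_eq_left h3, max_eq_left h3]; ring

namespace L2Mart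

variable {N N' : ℝ≥0 → Ω → ℝ}

lemma memLp_sub (h : L2Mart 𝓕 P N) (s t : ℝ≥0) : MemLp (fun ω => N t ω - N s ω) 2 P :=
  (h.memLp t).sub (h.memLp s)

lemma adapted_sub (h : L2Mart 𝓕 P N) {s t r : ℝ≥0} (hs : s ≤ r) (ht : t ≤ r) :
    AEStronglyMeasurable[𝓕 r] (fun ω => N t ω - N s ω) P :=
  ((h.adapted t).mono (𝓕.mono ht)).sub ((h.adapted s).mono (𝓕.mono hs))

variable [IsProbabilityMeasure P]

lemma integrable_sub (h : L2Mart 𝓕 P N) (s t : ℝ≥0) : Integrable (fun ω => N t ω - N s ω) P :=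
  (h.memLp_sub s t).integrable one_le_two

lemma zero : L2Mart 𝓕 P (fun _ _ => 0) where
  memLp _ := by simp
  adapted _ := aestronglyMeasurable_const
  mart _ _ _ := by simpa using CondZero.zero

lemma add (h : L2Mart 𝓕 P N) (h' : L2Mart 𝓕 P N') : L2Mart 𝓕 P (fun t ω => N t ω + N' t ω) where
  memLp t := (h.memLp t).add (h'.memLp t)
  adapted t := (h.adapted t).add (h'.adapted t)
  mart s t hst := by
    refine ((h.mart s t hst).add (h.integrable_sub s t) (h'.integrable_sub s t)
      (h'.mart s t hst)).congr (ae_of_all _ fun ω => ?_)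
    ring

lemma smul (h : L2Mart 𝓕 P N) (c : ℝ) : L2Mart 𝓕 P (fun t ω => c * N t ω) where
  memLp t := (h.memLp t).const_mul c
  adapted t := (h.adapted t).const_mul c
  mart s t hst := by
    refine ((h.mart s t hst).const_mul c).congr (ae_of_all _ fun ω => ?_)
    ring

lemma transform (h : L2Mart 𝓕 P N) {ξ : Ω → ℝ} {a b : ℝ≥0} (hab : a ≤ b)
    (hξ : StronglyMeasurable[𝓕 a] ξ) (hb : ∃ C : ℝ, ∀ ω, |ξ ω| ≤ C) :
    L2Mart 𝓕 P (transform ξ a b N) where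
  memLp t := by
    obtain ⟨C, hC⟩ := hb
    exact (h.memLp_sub _ _).bdd_mul_two ((hξ.mono (𝓕.le a)).aestronglyMeasurable) hC
  adapted t := by
    rcases le_total a t with hat | hat
    · exact ((hξ.mono (𝓕.mono hat)).aestronglyMeasurable).mul
        (h.adapted_sub (min_le_left _ _) (min_le_left _ _))
    · have : _root_.transform ξ a b N t = fun _ => 0 := by
        ext ω; simp [_root_.transform, min_eq_left hat, min_eq_left (hat.trans hab)]
      rw [this]; exact aestronglyMeasurable_const
  mart s t hst := by
    rcases transform_sub_cases ξ hab hst with h0 | ⟨x, y, hsx, hxy, hyt, hax, h1⟩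
    · simpa only [h0] using CondZero.zero
    · simp only [h1]
      obtain ⟨C, hC⟩ := hb
      refine CondZero.mono (𝓕.mono hsx) ?_
      refine (h.mart x y hxy).mul (𝓕.le x) (h.integrable_sub _ _)
        ((hξ.mono (𝓕.mono hax)).aestronglyMeasurable) ?_
      exact ((h.memLp_sub _ _).bdd_mul_two
        ((hξ.mono (𝓕.le a)).aestronglyMeasurable) hC).integrable one_le_two

end L2Mart

namespace BracketPair

variable [IsProbabilityMeasure P] {N N' N'' C C' : ℝ≥0 → Ω → ℝ}

lemma symm (h : BracketPair 𝓕 P N N' C) : BracketPair 𝓕 P N' N C where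
  integrable := h.integrable
  cond s t hst := (h.cond s t hst).congr (ae_of_all _ fun ω => by ring)

lemma congr (h : BracketPair 𝓕 P N N' C) (hC : ∀ t, ∀ᵐ ω ∂P, C t ω = C' t ω) :
    BracketPair 𝓕 P N N' C' where
  integrable t := (h.integrable t).congr (hC t)
  cond s t hst := (h.cond s t hst).congr (by
    filter_upwards [hC t, hC s] with ω h1 h2
    rw [h1, h2])

lemma integrable_cond (h : BracketPair 𝓕 P N N' C) (hN : L2Mart 𝓕 P N) (hN' : L2Mart 𝓕 P N')
    (s t : ℝ≥0) :
    Integrable (fun ω => (N t ω - N s ω) * (N' t ω - N' s ω) - (C t ω - C s ω)) P :=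
  ((hN.memLp_sub s t).integrable_mul (hN'.memLp_sub s t)).sub
    ((h.integrable t).sub (h.integrable s))

lemma zero : BracketPair 𝓕 P (fun _ _ => 0) N' (fun _ _ => 0) where
  integrable _ := integrable_const _
  cond s t hst := by simpa using CondZero.zero

lemma add (h : BracketPair 𝓕 P N N'' C) (h' : BracketPair 𝓕 P N' N'' C')
    (hN : L2Mart 𝓕 P N) (hN' : L2Mart 𝓕 P N') (hN'' : L2Mart 𝓕 P N'') :
    BracketPair 𝓕 P (fun t ω => N t ω + N' t ω) N'' (fun t ω => C t ω + C' t ω) where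
  integrable t := (h.integrable t).add (h'.integrable t)
  cond s t hst := ((h.cond s t hst).add (h.integrable_cond hN hN'' s t)
    (h'.integrable_cond hN' hN'' s t) (h'.cond s t hst)).congr (ae_of_all _ fun ω => by ring)

lemma smul (h : BracketPair 𝓕 P N N' C) (c : ℝ) :
    BracketPair 𝓕 P (fun t ω => c * N t ω) N' (fun t ω => c * C t ω) where
  integrable t := (h.integrable t).const_mul c
  cond s t hst := ((h.cond s t hst).const_mul c).congr (ae_of_all _ fun ω => by ring)

lemma _root_.L2Mart.condZero_mul_future (hN : L2Mart 𝓕 P N) {f : Ω → ℝ} {x y : ℝ≥0} (hxy : x ≤ y)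
    (hf : MemLp f 2 P) (hfm : AEStronglyMeasurable[𝓕 x] f P) :
    CondZero (𝓕 x) P (fun ω => f ω * (N y ω - N x ω)) :=
  (hN.mart x y hxy).mul (𝓕.le x) (hN.integrable_sub _ _) hfm
    (hf.integrable_mul (hN.memLp_sub x y))

/-- Only one factor is transformed. The increment of `N'` over `[s,t]` is split at `x` and `y`: the
part after `y` is killed by the martingale property of `N'`, the part before `x` by that of `N`, and
the middle part is the bracket identity multiplied by `ξ`. -/
lemma transform (h : BracketPair 𝓕 P N N' C) (hN : L2Mart 𝓕 P N) (hN' : L2Mart 𝓕 P N')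
    {ξ : Ω → ℝ} {a b : ℝ≥0} (hab : a ≤ b)
    (hξ : StronglyMeasurable[𝓕 a] ξ) (hb : ∃ C : ℝ, ∀ ω, |ξ ω| ≤ C) :
    BracketPair 𝓕 P (transform ξ a b N) N' (transform ξ a b C) where
  integrable t := by
    obtain ⟨K, hK⟩ := hb
    exact ((h.integrable _).sub (h.integrable _)).bdd_mul
      ((hξ.mono (𝓕.le a)).aestronglyMeasurable) (ae_of_all _ hK)
  cond s t hst := by
    rcases transform_sub_cases ξ hab hst with h0 | ⟨x, y, hsx, hxy, hyt, hax, h1⟩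
    · simpa only [h0, zero_mul, sub_zero] using CondZero.zero
    · simp only [h1]
      obtain ⟨K, hK⟩ := hb
      have hξ0 := (hξ.mono (𝓕.le a)).aestronglyMeasurable (μ := P)
      have hξx := (hξ.mono (𝓕.mono hax)).aestronglyMeasurable (μ := P)
      have hξN : MemLp (fun ω => ξ ω * (N y ω - N x ω)) 2 P :=
        (hN.memLp_sub x y).bdd_mul_two hξ0 hK
      have hξNm : AEStronglyMeasurable[𝓕 y] (fun ω => ξ ω * (N y ω - N x ω)) P :=
        (hξx.mono (𝓕.mono hxy)).mul (hN.adapted_sub hxy le_rfl)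
      have hξN' : MemLp (fun ω => ξ ω * (N' x ω - N' s ω)) 2 P :=
        (hN'.memLp_sub s x).bdd_mul_two hξ0 hK
      have hξNm' : AEStronglyMeasurable[𝓕 x] (fun ω => ξ ω * (N' x ω - N' s ω)) P :=
        hξx.mul (hN'.adapted_sub hsx le_rfl)
      have e1 := (hN'.condZero_mul_future hyt hξN hξNm).mono (𝓕.mono (hsx.trans hxy))
      have e2 := (hN.condZero_mul_future hxy hξN' hξNm').mono (𝓕.mono hsx)
      have hint := (h.integrable_cond hN hN' x y).bdd_mul hξ0 (ae_of_all _ hK)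
      have e3 := ((h.cond x y hxy).mul (𝓕.le x) (h.integrable_cond hN hN' x y) hξx hint).mono
        (𝓕.mono hsx)
      refine ((e1.add (hξN.integrable_mul (hN'.memLp_sub y t))
        (hξN'.integrable_mul (hN.memLp_sub x y)) e2).add
        ((hξN.integrable_mul (hN'.memLp_sub y t)).add
        (hξN'.integrable_mul (hN.memLp_sub x y))) hint e3).congr (ae_of_all _ fun ω => ?_)
      simp only [Pi.add_apply, Pi.mul_apply]
      ring

end BracketPair

end Brackets

/-! ### Elementary stochastic integrals generated by a bracket system -/

section Gen

/-- `Gen 𝓕 Base N φ` means that `φ` is an elementary integrand built on the integrands of the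
family `Base` of pairs `(N, φ)`, and that `N` is its elementary stochastic integral. -/
inductive Gen (𝓕 : Filtration ℝ≥0 mΩ) (Base : (ℝ≥0 → Ω → ℝ) → (ℝ≥0 → Ω → K) → Prop) :
    (ℝ≥0 → Ω → ℝ) → (ℝ≥0 → Ω → K) → Prop
  | zero : Gen 𝓕 Base (fun _ _ => 0) (fun _ _ => 0)
  | base {N φ} : Base N φ → Gen 𝓕 Base N φ
  | add {N N' φ φ'} : Gen 𝓕 Base N φ → Gen 𝓕 Base N' φ' →
      Gen 𝓕 Base (fun t ω => N t ω + N' t ω) (fun t ω => φ t ω + φ' t ω)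
  | smul {N φ} (c : ℝ) : Gen 𝓕 Base N φ →
      Gen 𝓕 Base (fun t ω => c * N t ω) (fun t ω => c • φ t ω)
  | transform {N φ} {ξ : Ω → ℝ} {a b : ℝ≥0} : a ≤ b → StronglyMeasurable[𝓕 a] ξ →
      (∃ C : ℝ, ∀ ω, |ξ ω| ≤ C) → Gen 𝓕 Base N φ →
      Gen 𝓕 Base (_root_.transform ξ a b N)
        (fun t ω => (Set.Ioc a b).indicator (fun _ => ξ ω) t • φ t ω)

/-- A family of pairs `(N, φ)` of square integrable martingales with brackets
`∫ ⟪φ, φ'⟫ dr`. -/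
structure BracketSystem (𝓕 : Filtration ℝ≥0 mΩ) (P : Measure Ω)
    (Base : (ℝ≥0 → Ω → ℝ) → (ℝ≥0 → Ω → K) → Prop) : Prop where
  mart : ∀ {N φ}, Base N φ → L2Mart 𝓕 P N
  prog : ∀ {N φ}, Base N φ → IsBoundedProg 𝓕 φ
  bracket : ∀ {N φ N' φ'}, Base N φ → Base N' φ' →
    BracketPair 𝓕 P N N' (timeInt fun r ω => inner ℝ (φ r ω) (φ' r ω))

variable [IsProbabilityMeasure P]

lemma BracketSystem.gen_mart (h : BracketSystem 𝓕 P Base) {N φ} (hN : Gen 𝓕 Base N φ) :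
    L2Mart 𝓕 P N := by
  induction hN with
  | zero => exact L2Mart.zero
  | base hb => exact h.mart hb
  | add _ _ h1 h2 => exact h1.add h2
  | smul c _ h1 => exact h1.smul c
  | transform hab hξ hC _ h1 => exact h1.transform hab hξ hC

lemma BracketSystem.gen_prog (h : BracketSystem 𝓕 P Base) {N φ} (hN : Gen 𝓕 Base N φ) :
    IsBoundedProg 𝓕 φ := by
  induction hN with
  | zero => exact IsBoundedProg.zero
  | base hb => exact h.prog hb
  | add _ _ h1 h2 => exact h1.add h2
  | smul c _ h1 => exact h1.const_smul c
  | transform hab hξ hC _ h1 => exact (IsBoundedProg.step hξ hC).smul h1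

/-- The induction runs over the left argument while the right one stays fixed. Two applications with
a symmetry in between cover all pairs of generated processes. -/
lemma BracketSystem.gen_bracket_left (h : BracketSystem 𝓕 P Base) {N φ N' φ'}
    (hN : Gen 𝓕 Base N φ) (hN' : L2Mart 𝓕 P N') (hφ' : IsBoundedProg 𝓕 φ')
    (hb : ∀ {M ψ}, Base M ψ → BracketPair 𝓕 P M N' (timeInt fun r ω => inner ℝ (ψ r ω) (φ' r ω))) :
    BracketPair 𝓕 P N N' (timeInt fun r ω => inner ℝ (φ r ω) (φ' r ω)) := by
  induction hN with
  | zero =>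
    refine BracketPair.zero.congr fun t => ae_of_all _ fun ω => ?_
    simp [timeInt]
  | base hb' => exact hb hb'
  | add g1 g2 h1 h2 =>
    refine (h1.add h2 (h.gen_mart g1) (h.gen_mart g2) hN').congr fun t => ae_of_all _ fun ω => ?_
    simp only [inner_add_left]
    exact (timeInt_add ((h.gen_prog g1).inner hφ') ((h.gen_prog g2).inner hφ') t ω).symm
  | smul c g1 h1 =>
    refine (h1.smul c).congr fun t => ae_of_all _ fun ω => ?_
    simp only [real_inner_smul_left]
    exact (timeInt_const_mul _ _ _ _).symm
  | transform hab hξ hC g1 h1 =>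
    refine (h1.transform (h.gen_mart g1) hN' hab hξ hC).congr fun t => ae_of_all _ fun ω => ?_
    simp only [real_inner_smul_left]
    exact (timeInt_step_mul ((h.gen_prog g1).inner hφ') _ hab t ω).symm

/-- Since generated pairs form a bracket system again, results on bracket systems such as the
isometry hold for elementary integrals too, and the construction can be repeated on top of a
closure. -/
theorem BracketSystem.gen (h : BracketSystem 𝓕 P Base) : BracketSystem 𝓕 P (Gen 𝓕 Base) where
  mart := h.gen_mart
  prog := h.gen_prog
  bracket {N φ N' φ'} hN hN' := by
    refine h.gen_bracket_left hN (h.gen_mart hN') (h.gen_prog hN') fun {M ψ} hM => ?_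
    have := h.gen_bracket_left hN' (h.mart hM) (h.prog hM) fun {M' ψ'} hM' => h.bracket hM' hM
    refine this.symm.congr fun t => ae_of_all _ fun ω => ?_
    simp only [real_inner_comm]

/-- The isometry property on events. -/
lemma BracketSystem.setIntegral_sq (h : BracketSystem 𝓕 P Base) {N φ}
    (hN : Base N φ) {s t : ℝ≥0} (hst : s ≤ t) {B : Set Ω} (hB : MeasurableSet[𝓕 s] B) :
    ∫ ω in B, (N t ω - N s ω) ^ 2 ∂P =
      ∫ ω in B, (∫ r in (s : ℝ)..t, ‖φ r.toNNReal ω‖ ^ 2) ∂P := by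
  have h1 := (h.bracket hN hN).cond s t hst B hB
  have h2 := h.bracket hN hN
  have i1 : Integrable (fun ω => (N t ω - N s ω) * (N t ω - N s ω)) (P.restrict B) :=
    ((h.mart hN).memLp_sub s t |>.integrable_mul ((h.mart hN).memLp_sub s t)).integrableOn
  have i2 : Integrable (fun ω => timeInt (fun r ω => inner ℝ (φ r ω) (φ r ω)) t ω -
      timeInt (fun r ω => inner ℝ (φ r ω) (φ r ω)) s ω) (P.restrict B) :=
    ((h2.integrable t).sub (h2.integrable s)).integrableOn
  have h3 := (integral_sub i1 i2).symm.trans h1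
  rw [sub_eq_zero] at h3
  simp only [sq]
  rw [h3]
  congr 1; ext ω
  rw [timeInt_sub ((h.prog hN).inner (h.prog hN))]
  simp only [real_inner_self_eq_norm_sq, sq]

end Gen

/-! ### Stopped times `t ∧ τ` -/

section StopAt

/-- The time `t ∧ τ`. -/
noncomputable def stopAt (t : ℝ≥0) (τ : WithTop ℝ≥0) : ℝ≥0 := (min (t : WithTop ℝ≥0) τ).untopA

lemma stopAt_top (t : ℝ≥0) : stopAt t ⊤ = t := by
  unfold stopAt
  rw [min_eq_left le_top]; exact WithTop.untopD_coe _ _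

lemma stopAt_coe (t c : ℝ≥0) : stopAt t (c : WithTop ℝ≥0) = min t c := by
  unfold stopAt
  rw [← WithTop.coe_min]; exact WithTop.untopD_coe _ _

lemma stopAt_le (t : ℝ≥0) (τ : WithTop ℝ≥0) : stopAt t τ ≤ t := by
  induction τ using WithTop.recTopCoe with
  | top => rw [stopAt_top]
  | coe c => rw [stopAt_coe]; exact min_le_left _ _

lemma stopAt_mono {s t : ℝ≥0} (h : s ≤ t) (τ : WithTop ℝ≥0) : stopAt s τ ≤ stopAt t τ := by
  induction τ using WithTop.recTopCoe with
  | top => simpa only [stopAt_top]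
  | coe c => simp only [stopAt_coe]; exact min_le_min_right _ h

lemma lt_stopAt_iff {r t : ℝ≥0} {τ : WithTop ℝ≥0} :
    r < stopAt t τ ↔ r < t ∧ (r : WithTop ℝ≥0) < τ := by
  induction τ using WithTop.recTopCoe with
  | top => rw [stopAt_top]; exact ⟨fun h => ⟨h, WithTop.coe_lt_top r⟩, fun h => h.1⟩
  | coe c => rw [stopAt_coe, lt_min_iff, WithTop.coe_lt_coe]

lemma stopAt_of_le {t : ℝ≥0} {τ : WithTop ℝ≥0} (h : (t : WithTop ℝ≥0) ≤ τ) : stopAt t τ = t := by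
  induction τ using WithTop.recTopCoe with
  | top => rw [stopAt_top]
  | coe c => rw [stopAt_coe]; exact min_eq_left (by exact_mod_cast h)

lemma stopAt_eq_of_ge {s t : ℝ≥0} {τ : WithTop ℝ≥0} (hst : s ≤ t) (h : τ ≤ (s : WithTop ℝ≥0)) :
    stopAt t τ = stopAt s τ := by
  induction τ using WithTop.recTopCoe with
  | top => exact absurd h (not_le.2 (WithTop.coe_lt_top s))
  | coe c =>
    have h' : c ≤ s := by exact_mod_cast h
    rw [stopAt_coe, stopAt_coe, min_eq_right h', min_eq_right (h'.trans hst)]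

lemma continuous_stopAt (τ : WithTop ℝ≥0) : Continuous fun t => stopAt t τ := by
  induction τ using WithTop.recTopCoe with
  | top => simp only [stopAt_top]; exact continuous_id
  | coe c => simp only [stopAt_coe]; exact continuous_id.min continuous_const

lemma stopAt_stopAt (t : ℝ≥0) {σ τ : WithTop ℝ≥0} (h : σ ≤ τ) :
    stopAt (stopAt t σ) τ = stopAt t σ := by
  apply stopAt_of_le
  induction σ using WithTop.recTopCoe with
  | top => rw [top_le_iff.1 h]; exact le_top
  | coe c =>
    rw [stopAt_coe]
    exact le_trans (by exact_mod_cast min_le_right _ _) h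

end StopAt

/-! ### Discretized stopping times on equidistant grids -/

section Grid

/-- Equidistant points from `s` to `t`. -/
noncomputable def grid (s t : ℝ≥0) (m : ℕ) (j : ℕ) : ℝ≥0 := s + j * ((t - s) / m)

lemma grid_zero (s t : ℝ≥0) (m : ℕ) : grid s t m 0 = s := by simp [grid]

lemma grid_last {s t : ℝ≥0} (hst : s ≤ t) {m : ℕ} (hm : m ≠ 0) : grid s t m m = t := by
  unfold grid
  rw [mul_div_cancel₀ _ (by exact_mod_cast hm), add_tsub_cancel_of_le hst]

lemma grid_succ (s t : ℝ≥0) (m j : ℕ) : grid s t m (j + 1) = grid s t m j + (t - s) / m := by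
  unfold grid; push_cast; ring

lemma grid_mono (s t : ℝ≥0) (m : ℕ) : Monotone (grid s t m) :=
  monotone_nat_of_le_succ fun j => by rw [grid_succ]; exact le_self_add

lemma le_grid (s t : ℝ≥0) (m j : ℕ) : s ≤ grid s t m j := le_self_add

lemma grid_le {s t : ℝ≥0} (hst : s ≤ t) {m j : ℕ} (hj : j ≤ m) : grid s t m j ≤ t := by
  rcases Nat.eq_zero_or_pos m with rfl | hm
  · simp [grid, hst]
  · exact (grid_mono s t m hj).trans (grid_last hst hm.ne').le

lemma coe_grid_succ_sub (s t : ℝ≥0) (hst : s ≤ t) (m j : ℕ) :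
    (grid s t m (j + 1) : ℝ) - grid s t m j = (t - s : ℝ) / m := by
  rw [grid_succ]; push_cast; rw [NNReal.coe_sub hst]; ring

lemma tendsto_mesh (s t : ℝ≥0) : Tendsto (fun m : ℕ => (t - s) / (m : ℝ≥0)) atTop (𝓝 0) :=
  by
  rw [← NNReal.tendsto_coe]
  push_cast
  exact tendsto_const_div_atTop_nhds_zero_nat _

/-- The first of the points `g 0, …, g k` at or after `τ` (the last one if there is none). -/
noncomputable def gridStop (g : ℕ → ℝ≥0) (τ : WithTop ℝ≥0) : ℕ → ℝ≥0
  | 0 => g 0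
  | k + 1 => if (g k : WithTop ℝ≥0) < τ then g (k + 1) else gridStop g τ k

lemma gridStop_eq {g : ℕ → ℝ≥0} (hg : Monotone g) {τ : WithTop ℝ≥0} {k : ℕ}
    (h : (g k : WithTop ℝ≥0) < τ) : gridStop g τ k = g k := by
  cases k with
  | zero => rfl
  | succ k =>
    have : (g k : WithTop ℝ≥0) < τ :=
      lt_of_le_of_lt (WithTop.coe_le_coe.2 (hg (Nat.le_succ k))) h
    exact if_pos this

/-- The cells that begin before `τ` form an initial segment of the grid, so the sum telescopes up to
the discretized stopping time. -/
lemma sum_gridStop {g : ℕ → ℝ≥0} (hg : Monotone g) (τ : WithTop ℝ≥0) (f : ℝ≥0 → ℝ) (k : ℕ) :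
    ∑ j ∈ Finset.range k, (if (g j : WithTop ℝ≥0) < τ then (1 : ℝ) else 0) *
      (f (g (j + 1)) - f (g j)) = f (gridStop g τ k) - f (g 0) := by
  induction k with
  | zero => simp [gridStop]
  | succ k ih =>
    rw [Finset.sum_range_succ, ih]
    by_cases h : (g k : WithTop ℝ≥0) < τ
    · rw [gridStop_eq hg h, if_pos h, gridStop, if_pos h]; ring
    · rw [if_neg h, gridStop, if_neg h]; ring

lemma gridStop_le {g : ℕ → ℝ≥0} (hg : Monotone g) (τ : WithTop ℝ≥0) (k : ℕ) :
    gridStop g τ k ≤ g k := by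
  induction k with
  | zero => exact le_rfl
  | succ k ih =>
    unfold gridStop
    split_ifs
    · exact le_rfl
    · exact ih.trans (hg (Nat.le_succ k))

/-- The discretization delays `τ` by at most one cell; the maximum with `g 0` covers the case that
`τ` precedes the grid. -/
lemma gridStop_bounds {g : ℕ → ℝ≥0} (hg : Monotone g) {h : ℝ≥0} (hh : ∀ j, g (j + 1) ≤ g j + h)
    (τ : WithTop ℝ≥0) (k : ℕ) : max (g 0) (stopAt (g k) τ) ≤ gridStop g τ k ∧
      gridStop g τ k ≤ max (g 0) (stopAt (g k) τ) + h := by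
  induction k with
  | zero =>
    simp only [gridStop]
    exact ⟨max_le le_rfl (stopAt_le _ _), (le_max_left _ _).trans le_self_add⟩
  | succ k ih =>
    by_cases hk : (g k : WithTop ℝ≥0) < τ
    · have e : gridStop g τ (k + 1) = g (k + 1) := if_pos hk
      rw [e]
      refine ⟨max_le (hg (Nat.zero_le _)) (stopAt_le _ _), (hh k).trans ?_⟩
      gcongr
      refine le_max_of_le_right ?_
      calc g k = stopAt (g k) τ := (stopAt_of_le hk.le).symm
        _ ≤ _ := stopAt_mono (hg (Nat.le_succ k)) τ
    · have e : gridStop g τ (k + 1) = gridStop g τ k := if_neg hk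
      rw [e, stopAt_eq_of_ge (hg (Nat.le_succ k)) (not_lt.1 hk)]
      exact ih

lemma tendsto_gridStop {s t : ℝ≥0} (hst : s ≤ t) (τ : WithTop ℝ≥0) :
    Tendsto (fun m => gridStop (grid s t m) τ m) atTop (𝓝 (max s (stopAt t τ))) := by
  have h1 : Tendsto (fun m : ℕ => max s (stopAt t τ) + (t - s) / (m : ℝ≥0)) atTop
      (𝓝 (max s (stopAt t τ))) := by
    simpa using (tendsto_const_nhds (x := max s (stopAt t τ))).add (tendsto_mesh s t)
  refine tendsto_of_tendsto_of_tendsto_of_le_of_le' tendsto_const_nhds h1 ?_ ?_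
  all_goals
    filter_upwards [eventually_ne_atTop 0] with m hm
    have := gridStop_bounds (grid_mono s t m) (h := (t - s) / m) (fun j => (grid_succ s t m j).le) τ m
    rw [grid_zero, grid_last hst hm] at this
  exacts [this.1, this.2]

lemma apply_max_stopAt {s t : ℝ≥0} (hst : s ≤ t) (τ : WithTop ℝ≥0) (f : ℝ≥0 → ℝ) :
    f (max s (stopAt t τ)) - f s = f (stopAt t τ) - f (stopAt s τ) := by
  rcases le_total (s : WithTop ℝ≥0) τ with h | h
  · rw [stopAt_of_le h, max_eq_right]
    conv_lhs => rw [← stopAt_of_le h]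
    exact stopAt_mono hst τ
  · rw [stopAt_eq_of_ge hst h, max_eq_left (stopAt_le _ _)]; ring

/-- The sum of the increments of `f` over the cells of a grid which start before `τ`. -/
noncomputable def stoppedSum (s t : ℝ≥0) (m : ℕ) (τ : WithTop ℝ≥0) (f : ℝ≥0 → ℝ) : ℝ :=
  ∑ j ∈ Finset.range m, (if (grid s t m j : WithTop ℝ≥0) < τ then (1 : ℝ) else 0) *
      (f (grid s t m (j + 1)) - f (grid s t m j))

lemma stoppedSum_eq (s t : ℝ≥0) (m : ℕ) (τ : WithTop ℝ≥0) (f : ℝ≥0 → ℝ) :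
    stoppedSum s t m τ f = f (gridStop (grid s t m) τ m) - f s := by
  unfold stoppedSum
  rw [sum_gridStop (grid_mono s t m), grid_zero]

lemma tendsto_stoppedSum {s t : ℝ≥0} (hst : s ≤ t) (τ : WithTop ℝ≥0) {f : ℝ≥0 → ℝ}
    (hf : Continuous f) : Tendsto (fun m => stoppedSum s t m τ f) atTop
      (𝓝 (f (stopAt t τ) - f (stopAt s τ))) := by
  simp only [stoppedSum_eq]
  rw [← apply_max_stopAt hst]
  exact ((hf.tendsto _).comp (tendsto_gridStop hst τ)).sub_const _

lemma abs_stoppedSum_le {s t : ℝ≥0} (hst : s ≤ t) (m : ℕ) (τ : WithTop ℝ≥0) {f : ℝ≥0 → ℝ} {C : ℝ}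
    (hC : ∀ r ≤ t, |f r| ≤ C) : |stoppedSum s t m τ f| ≤ 2 * C := by
  rw [stoppedSum_eq]
  have h1 := hC (gridStop (grid s t m) τ m)
    ((gridStop_le (grid_mono s t m) τ m).trans (grid_le hst le_rfl))
  have h2 := hC s hst
  exact (abs_sub _ _).trans (by linarith)

end Grid

/-! ### Optional stopping of brackets -/

section Stopping

/-- Continuous adapted processes, bounded on bounded time intervals. -/
structure IsBddContinuous (𝓕 : Filtration ℝ≥0 mΩ) (N : ℝ≥0 → Ω → ℝ) : Prop where
  adapted : StronglyAdapted 𝓕 N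
  continuous : ∀ ω, Continuous fun t => N t ω
  bdd : ∀ T : ℝ≥0, ∃ C : ℝ, ∀ t ≤ T, ∀ ω, |N t ω| ≤ C

lemma IsBoundedProg.isBddContinuous_timeInt {c : ℝ≥0 → Ω → ℝ} (hc : IsBoundedProg 𝓕 c) :
    IsBddContinuous 𝓕 (timeInt c) where
  adapted t := hc.prog.timeInt t
  continuous ω := continuous_timeInt hc ω
  bdd T := by
    obtain ⟨C, hC⟩ := hc.bdd
    refine ⟨C * T, fun t ht ω => ?_⟩
    have h0 : 0 ≤ C := (norm_nonneg _).trans (hC 0 ω)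
    have := abs_timeInt_sub_le hc (zero_le : 0 ≤ t) ω (C := C) fun r _ _ => hC r ω
    rw [timeInt_zero] at this
    simp only [sub_zero, NNReal.coe_zero] at this
    exact this.trans (mul_le_mul_of_nonneg_left (by exact_mod_cast ht) h0)

namespace IsBddContinuous

variable {N N' : ℝ≥0 → Ω → ℝ}

lemma add (h : IsBddContinuous 𝓕 N) (h' : IsBddContinuous 𝓕 N') :
    IsBddContinuous 𝓕 (fun t ω => N t ω + N' t ω) := by
  refine ⟨fun t => (h.adapted t).add (h'.adapted t),
    fun ω => (h.continuous ω).add (h'.continuous ω), fun T => ?_⟩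
  obtain ⟨C, hC⟩ := h.bdd T
  obtain ⟨D, hD⟩ := h'.bdd T
  exact ⟨C + D, fun t ht ω => (abs_add_le _ _).trans (add_le_add (hC t ht ω) (hD t ht ω))⟩

lemma smul (h : IsBddContinuous 𝓕 N) (c : ℝ) : IsBddContinuous 𝓕 (fun t ω => c * N t ω) := by
  refine ⟨fun t => (h.adapted t).const_mul c, fun ω => (h.continuous ω).const_mul c, fun T => ?_⟩
  obtain ⟨C, hC⟩ := h.bdd T
  exact ⟨|c| * C, fun t ht ω => by
    rw [abs_mul]; exact mul_le_mul_of_nonneg_left (hC t ht ω) (abs_nonneg _)⟩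

lemma transform (h : IsBddContinuous 𝓕 N) {ξ : Ω → ℝ} {a b : ℝ≥0} (hab : a ≤ b)
    (hξ : StronglyMeasurable[𝓕 a] ξ) (hb : ∃ C : ℝ, ∀ ω, |ξ ω| ≤ C) :
    IsBddContinuous 𝓕 (transform ξ a b N) := by
  refine ⟨fun t => ?_, fun ω => ?_, fun T => ?_⟩
  · rcases le_total a t with hat | hat
    · exact (hξ.mono (𝓕.mono hat)).mul (((h.adapted _).mono (𝓕.mono (min_le_left _ _))).sub
        ((h.adapted _).mono (𝓕.mono (min_le_left _ _))))
    · have : _root_.transform ξ a b N t = fun _ => 0 := by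
        ext ω; simp [_root_.transform, min_eq_left hat, min_eq_left (hat.trans hab)]
      rw [this]; exact stronglyMeasurable_const
  · exact continuous_const.mul (((h.continuous ω).comp (continuous_id.min continuous_const)).sub
      ((h.continuous ω).comp (continuous_id.min continuous_const)))
  · obtain ⟨C, hC⟩ := hb
    obtain ⟨D, hD⟩ := h.bdd T
    refine ⟨C * (2 * D), fun t ht ω => ?_⟩
    unfold _root_.transform
    rw [abs_mul]
    refine mul_le_mul (hC ω) ?_ (abs_nonneg _) ((abs_nonneg _).trans (hC ω))
    have h1 := hD (min t b) ((min_le_left _ _).trans ht) ω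
    have h2 := hD (min t a) ((min_le_left _ _).trans ht) ω
    exact (abs_sub _ _).trans (by linarith)

lemma stopped (h : IsBddContinuous 𝓕 N) {τ : Ω → WithTop ℝ≥0} (hτ : IsStoppingTime 𝓕 τ) :
    IsBddContinuous 𝓕 (fun t ω => N (stopAt t (τ ω)) ω) where
  adapted := StronglyAdapted.stoppedProcess h.adapted h.continuous hτ
  continuous ω := (h.continuous ω).comp (continuous_stopAt _)
  bdd T := by
    obtain ⟨C, hC⟩ := h.bdd T
    exact ⟨C, fun t ht ω => hC _ ((stopAt_le _ _).trans ht) ω⟩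

lemma memLp [IsFiniteMeasure P] (h : IsBddContinuous 𝓕 N) (t : ℝ≥0) (p : ℝ≥0∞) :
    MemLp (N t) p P := by
  obtain ⟨C, hC⟩ := h.bdd t
  exact MemLp.of_bound ((h.adapted t).mono (𝓕.le t)).aestronglyMeasurable C
    (ae_of_all _ fun ω => hC t le_rfl ω)

lemma integrable [IsFiniteMeasure P] (h : IsBddContinuous 𝓕 N) (t : ℝ≥0) : Integrable (N t) P :=
  (h.memLp t 1).integrable le_rfl

lemma stronglyMeasurable (h : IsBddContinuous 𝓕 N) (t : ℝ≥0) : StronglyMeasurable (N t) :=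
  (h.adapted t).mono (𝓕.le t)

end IsBddContinuous

lemma MeasureTheory.IsStoppingTime.stronglyMeasurable_lt {τ : Ω → WithTop ℝ≥0}
    (hτ : IsStoppingTime 𝓕 τ) (t : ℝ≥0) :
    StronglyMeasurable[𝓕 t] (fun ω => if (t : WithTop ℝ≥0) < τ ω then (1 : ℝ) else 0) := by
  have : MeasurableSet[𝓕 t] {ω | (t : WithTop ℝ≥0) < τ ω} := hτ.measurableSet_gt t
  exact StronglyMeasurable.ite this stronglyMeasurable_const stronglyMeasurable_const

lemma abs_ite_one_le (p : Prop) [Decidable p] : |if p then (1 : ℝ) else 0| ≤ 1 := by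
  split_ifs <;> simp

variable [IsProbabilityMeasure P] {N N' C : ℝ≥0 → Ω → ℝ}

lemma condZero_sum {ι : Type*} {m : MeasurableSpace Ω} (s : Finset ι) {f : ι → Ω → ℝ}
    (hf : ∀ i ∈ s, Integrable (f i) P) (h : ∀ i ∈ s, CondZero m P (f i)) :
    CondZero m P (fun ω => ∑ i ∈ s, f i ω) := by
  intro B hB
  rw [integral_finsetSum _ fun i hi => (hf i hi).integrableOn]
  exact Finset.sum_eq_zero fun i hi => h i hi B hB

/-- On a grid, the stopped process is a sum of transforms of `N` by the indicators of `g_j < τ`, to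
which `BracketPair.transform` applies. Refining the grid, path continuity and dominated convergence
give the limit. Only the stopped factor and the bracket need bounded continuous paths; `N'` is an
arbitrary square integrable martingale. -/
lemma BracketPair.stopped (hb : BracketPair 𝓕 P N N' C) (hN : L2Mart 𝓕 P N)
    (hN' : L2Mart 𝓕 P N') (hc : IsBddContinuous 𝓕 N) (hC : IsBddContinuous 𝓕 C)
    {τ : Ω → WithTop ℝ≥0} (hτ : IsStoppingTime 𝓕 τ) :
    BracketPair 𝓕 P (fun t ω => N (stopAt t (τ ω)) ω) N' (fun t ω => C (stopAt t (τ ω)) ω) where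
  integrable t := (hC.stopped hτ).integrable t
  cond s t hst := by
    obtain ⟨D, hD⟩ := hc.bdd t
    obtain ⟨E, hE⟩ := hC.bdd t
    have hmeas : ∀ {M : ℝ≥0 → Ω → ℝ}, IsBddContinuous 𝓕 M → ∀ m : ℕ,
        StronglyMeasurable (fun ω => stoppedSum s t m (τ ω) (M · ω)) := by
      intro M hM m
      unfold stoppedSum
      refine Finset.stronglyMeasurable_fun_sum _ fun j _ => ?_
      exact ((hτ.stronglyMeasurable_lt _).mono (𝓕.le _)).mul
        ((hM.stronglyMeasurable _).sub (hM.stronglyMeasurable _))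
    refine CondZero.of_tendsto (F := fun m ω => stoppedSum s t m (τ ω) (N · ω) *
      (N' t ω - N' s ω) - stoppedSum s t m (τ ω) (C · ω))
      (fun ω => 2 * D * |N' t ω - N' s ω| + 2 * E)
      (fun m => ?_) (fun m => ?_) ?_ (fun m => ae_of_all _ fun ω => ?_)
      (ae_of_all _ fun ω => ?_)
    · set T : ℕ → (ℝ≥0 → Ω → ℝ) → ℝ≥0 → Ω → ℝ := fun j => _root_.transform (fun ω =>
        if (grid s t m j : WithTop ℝ≥0) < τ ω then (1 : ℝ) else 0) (grid s t m j) (grid s t m (j + 1))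
      have hj : ∀ j, BracketPair 𝓕 P (T j N) N' (T j C) := fun j =>
        hb.transform hN hN' (grid_mono s t m (Nat.le_succ j)) (hτ.stronglyMeasurable_lt _)
          ⟨1, fun ω => abs_ite_one_le _⟩
      have hjm : ∀ j, L2Mart 𝓕 P (T j N) := fun j =>
        hN.transform (grid_mono s t m (Nat.le_succ j)) (hτ.stronglyMeasurable_lt _)
          ⟨1, fun ω => abs_ite_one_le _⟩
      refine (condZero_sum (Finset.range m) (fun j _ => (hj j).integrable_cond (hjm j) hN' s t)
        fun j _ => (hj j).cond s t hst).congr (ae_of_all _ fun ω => ?_)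
      rw [Finset.sum_sub_distrib, ← Finset.sum_mul]
      have hkey : ∀ M : ℝ≥0 → Ω → ℝ, ∑ j ∈ Finset.range m, (T j M t ω - T j M s ω) =
          stoppedSum s t m (τ ω) (M · ω) := fun M => Finset.sum_congr rfl fun j hj => by
        simp only [T, _root_.transform]
        rw [min_eq_right (grid_le hst (Finset.mem_range.1 hj)),
          min_eq_right (grid_le hst (Finset.mem_range.1 hj).le), min_eq_left (le_grid s t m j),
          min_eq_left (le_grid s t m (j + 1))]
        ring
      rw [hkey, hkey]
    · exact ((hmeas hc m).aestronglyMeasurable.mul (hN'.memLp_sub s t).1).sub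
        (hmeas hC m).aestronglyMeasurable
    · exact ((hN'.integrable_sub s t).abs.const_mul _).add (integrable_const _)
    · rw [Real.norm_eq_abs]
      refine (abs_sub _ _).trans (add_le_add ?_ ?_)
      · rw [abs_mul]
        exact mul_le_mul_of_nonneg_right (abs_stoppedSum_le hst m _ fun r hr => hD r hr ω)
          (abs_nonneg _)
      · exact abs_stoppedSum_le hst m _ fun r hr => hE r hr ω
    · exact ((tendsto_stoppedSum hst _ (hc.continuous ω)).mul_const _).sub
        (tendsto_stoppedSum hst _ (hC.continuous ω))

end Stopping

/-! ### Second order Taylor expansion on one cell of a grid -/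

section Taylor

variable {V : Type*} [NormedAddCommGroup V] [NormedSpace ℝ V]

/-- The mean value inequality is used twice: for `Dφ` minus its linearization at `z`, and then for
the second order remainder along the segment `x ↦ z + x h`. -/
lemma abs_taylor_two_le {φ : V → ℝ} (hφ : ContDiff ℝ 2 φ) {z y : V} {θ : ℝ}
    (hθ : ∀ w ∈ segment ℝ z y, ‖fderiv ℝ (fderiv ℝ φ) w - fderiv ℝ (fderiv ℝ φ) z‖ ≤ θ) :
    |φ y - φ z - fderiv ℝ φ z (y - z) - 1 / 2 * fderiv ℝ (fderiv ℝ φ) z (y - z) (y - z)| ≤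
      θ * ‖y - z‖ ^ 2 := by
  have hd1 : Differentiable ℝ φ := hφ.differentiable (by norm_num)
  have hd2 : Differentiable ℝ (fderiv ℝ φ) :=
    (hφ.fderiv_right (m := 1) (by norm_num)).differentiable (by norm_num)
  set h := y - z with hh
  have hseg : ∀ x ∈ Set.Icc (0 : ℝ) 1, ∀ u ∈ segment ℝ z (z + x • h), u ∈ segment ℝ z y := by
    intro x hx u hu
    have hxy : z + x • h ∈ segment ℝ z y := by
      rw [segment_eq_image']
      exact ⟨x, hx, rfl⟩
    exact (convex_segment z y).segment_subset (left_mem_segment ℝ z y) hxy hu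
  have hbd : ∀ x ∈ Set.Icc (0 : ℝ) 1,
      ‖fderiv ℝ φ (z + x • h) - fderiv ℝ φ z - fderiv ℝ (fderiv ℝ φ) z (x • h)‖ ≤
        θ * ‖x • h‖ := by
    intro x hx
    have := (convex_segment z (z + x • h)).norm_image_sub_le_of_norm_fderiv_le' (𝕜 := ℝ)
      (f := fderiv ℝ φ) (φ := fderiv ℝ (fderiv ℝ φ) z) (C := θ)
      (fun w _ => hd2 w) (fun w hw => hθ w (hseg x hx w hw))
      (left_mem_segment ℝ _ _) (right_mem_segment ℝ _ _)
    simpa using this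
  have hθ0 : 0 ≤ θ :=
    le_trans (by positivity) (hθ z (left_mem_segment ℝ z y))
  have key := norm_image_sub_le_of_norm_deriv_le_segment_01'
    (f := fun x : ℝ => φ (z + x • h) - x * fderiv ℝ φ z h -
      x ^ 2 / 2 * fderiv ℝ (fderiv ℝ φ) z h h)
    (f' := fun x => fderiv ℝ φ (z + x • h) h - fderiv ℝ φ z h -
      x * fderiv ℝ (fderiv ℝ φ) z h h) (C := θ * ‖h‖ ^ 2) (fun x hx => by
        refine HasDerivAt.hasDerivWithinAt ?_
        have h1 : HasDerivAt (fun x : ℝ => z + x • h) h x := by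
          simpa using ((hasDerivAt_id x).smul_const h).const_add z
        have h2 := (hd1 (z + x • h)).hasFDerivAt.comp_hasDerivAt x h1
        have h3 : HasDerivAt (fun x : ℝ => x * fderiv ℝ φ z h) (fderiv ℝ φ z h) x := by
          simpa using (hasDerivAt_id x).mul_const (fderiv ℝ φ z h)
        have h4 : HasDerivAt (fun x : ℝ => x ^ 2 / 2 * fderiv ℝ (fderiv ℝ φ) z h h)
            (x * fderiv ℝ (fderiv ℝ φ) z h h) x := by
          have := ((hasDerivAt_pow 2 x).div_const 2).mul_const (fderiv ℝ (fderiv ℝ φ) z h h)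
          simpa using this
        exact (h2.sub h3).sub h4) (fun x hx => by
        have h1 := hbd x ⟨hx.1, hx.2.le⟩
        have h2 : fderiv ℝ φ (z + x • h) h - fderiv ℝ φ z h - x * fderiv ℝ (fderiv ℝ φ) z h h =
          (fderiv ℝ φ (z + x • h) - fderiv ℝ φ z - fderiv ℝ (fderiv ℝ φ) z (x • h)) h := by
          simp
        rw [h2]
        refine (ContinuousLinearMap.le_opNorm _ _).trans ?_
        calc _ ≤ θ * ‖x • h‖ * ‖h‖ := mul_le_mul_of_nonneg_right h1 (norm_nonneg _)
          _ ≤ θ * ‖h‖ * ‖h‖ := by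
            gcongr
            rw [norm_smul, Real.norm_eq_abs, abs_of_nonneg hx.1]
            exact mul_le_of_le_one_left (norm_nonneg _) hx.2.le
          _ = _ := by ring)
  have e : z + h = y := by rw [hh]; abel
  rw [Real.norm_eq_abs] at key
  refine le_trans (le_of_eq ?_) key
  congr 1
  simp only [one_smul, zero_smul, e, add_zero]
  ring

lemma fderiv_apply_eq_sum {n : ℕ} (L : (Fin n → ℝ) →L[ℝ] ℝ) (v : Fin n → ℝ) :
    L v = ∑ k, L (Pi.single k 1) * v k := by
  conv_lhs => rw [pi_eq_sum_univ' v]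
  rw [map_sum]
  refine Finset.sum_congr rfl fun k _ => ?_
  rw [map_smul, smul_eq_mul, mul_comm]

lemma bilin_apply_eq_sum {n : ℕ} (L : (Fin n → ℝ) →L[ℝ] (Fin n → ℝ) →L[ℝ] ℝ) (v : Fin n → ℝ) :
    L v v = ∑ k, ∑ l, L (Pi.single k 1) (Pi.single l 1) * (v k * v l) := by
  have h1 : L v v = ∑ k, (L (Pi.single k 1) v) * v k := by
    have := fderiv_apply_eq_sum (L.flip v) v
    simpa using this
  rw [h1]
  refine Finset.sum_congr rfl fun k _ => ?_
  rw [fderiv_apply_eq_sum (L (Pi.single k 1)) v, Finset.sum_mul]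
  exact Finset.sum_congr rfl fun l _ => by ring

/-- The integrand of the finite variation part in the Itô formula. -/
noncomputable def itoIntegrand {n : ℕ} (φ : (Fin n → ℝ) → ℝ) (z b : Fin n → ℝ)
    (a : Fin n → Fin n → ℝ) : ℝ :=
  ∑ k, fderiv ℝ φ z (Pi.single k 1) * b k +
    1 / 2 * ∑ k, ∑ l, fderiv ℝ (fderiv ℝ φ) z (Pi.single k 1) (Pi.single l 1) * a k l

lemma norm_single_one {n : ℕ} (k : Fin n) : ‖(Pi.single k 1 : Fin n → ℝ)‖ = 1 := by
  rw [Pi.norm_single]; simp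

lemma abs_apply_single_le {n : ℕ} (L : (Fin n → ℝ) →L[ℝ] ℝ) (k : Fin n) :
    |L (Pi.single k 1)| ≤ ‖L‖ := by
  have := L.le_opNorm (Pi.single k 1)
  rwa [norm_single_one, mul_one] at this

lemma abs_apply_single_single_le {n : ℕ} (L : (Fin n → ℝ) →L[ℝ] (Fin n → ℝ) →L[ℝ] ℝ)
    (k l : Fin n) : |L (Pi.single k 1) (Pi.single l 1)| ≤ ‖L‖ := by
  have := L.le_opNorm (Pi.single k 1)
  rw [norm_single_one, mul_one] at this
  exact (abs_apply_single_le _ _).trans this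

lemma abs_mul_integral_sub_le {d f : ℝ → ℝ} {p q C θ : ℝ} (hd : Continuous d)
    (hf : IntervalIntegrable f volume p q) (hpq : p ≤ q) (hfC : ∀ r, |f r| ≤ C)
    (hθ : 0 ≤ θ) (hdθ : ∀ r ∈ Set.Icc p q, |d p - d r| ≤ θ) :
    |d p * (∫ r in p..q, f r) - ∫ r in p..q, d r * f r| ≤ θ * C * (q - p) := by
  rw [← intervalIntegral.integral_const_mul, ← intervalIntegral.integral_sub (hf.const_mul _)
    (hf.continuousOn_mul hd.continuousOn), ← abs_of_nonneg (sub_nonneg.2 hpq), ← Real.norm_eq_abs]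
  refine intervalIntegral.norm_integral_le_of_norm_le_const fun r hr => ?_
  rw [Set.uIoc_of_le hpq] at hr
  rw [← sub_mul, norm_mul]
  exact mul_le_mul (hdθ r ⟨hr.1.le, hr.2⟩) (hfC r) (norm_nonneg _) hθ

lemma intervalIntegral_itoIntegrand {n : ℕ} {φ : (Fin n → ℝ) → ℝ} (hφ : ContDiff ℝ 2 φ)
    {z : ℝ → Fin n → ℝ} (hz : Continuous z) {b : Fin n → ℝ → ℝ} {a : Fin n → Fin n → ℝ → ℝ}
    {p q : ℝ} (hb : ∀ k, IntervalIntegrable (b k) volume p q)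
    (ha : ∀ k l, IntervalIntegrable (a k l) volume p q) :
    IntervalIntegrable (fun r => itoIntegrand φ (z r) (fun k => b k r) (fun k l => a k l r))
      volume p q ∧
    ∫ r in p..q, itoIntegrand φ (z r) (fun k => b k r) (fun k l => a k l r) =
      (∑ k, ∫ r in p..q, fderiv ℝ φ (z r) (Pi.single k 1) * b k r) +
      1 / 2 * ∑ k, ∑ l, ∫ r in p..q,
        fderiv ℝ (fderiv ℝ φ) (z r) (Pi.single k 1) (Pi.single l 1) * a k l r := by
  have hcd1 : Continuous fun r => fderiv ℝ φ (z r) :=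
    (hφ.continuous_fderiv (by norm_num)).comp hz
  have hcd2 : Continuous fun r => fderiv ℝ (fderiv ℝ φ) (z r) :=
    ((hφ.fderiv_right (m := 1) (by norm_num)).continuous_fderiv (by norm_num)).comp hz
  have hib : ∀ k, IntervalIntegrable (fun r => fderiv ℝ φ (z r) (Pi.single k 1) * b k r)
      volume p q :=
    fun k => (hb k).continuousOn_mul ((hcd1.clm_apply continuous_const).continuousOn)
  have hia : ∀ k l, IntervalIntegrable (fun r =>
      fderiv ℝ (fderiv ℝ φ) (z r) (Pi.single k 1) (Pi.single l 1) * a k l r) volume p q :=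
    fun k l => (ha k l).continuousOn_mul
      (((hcd2.clm_apply continuous_const).clm_apply continuous_const).continuousOn)
  have I1 : IntervalIntegrable (fun r => ∑ k, fderiv ℝ φ (z r) (Pi.single k 1) * b k r)
      volume p q := by
    have := IntervalIntegrable.sum Finset.univ (fun k _ => hib k)
    simpa only [Finset.sum_fn] using this
  have I2 : ∀ k, IntervalIntegrable (fun r => ∑ l,
      fderiv ℝ (fderiv ℝ φ) (z r) (Pi.single k 1) (Pi.single l 1) * a k l r) volume p q := by
    intro k
    have := IntervalIntegrable.sum Finset.univ (fun l _ => hia k l)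
    simpa only [Finset.sum_fn] using this
  have I3 : IntervalIntegrable (fun r => ∑ k, ∑ l,
      fderiv ℝ (fderiv ℝ φ) (z r) (Pi.single k 1) (Pi.single l 1) * a k l r) volume p q := by
    have := IntervalIntegrable.sum Finset.univ (fun k _ => I2 k)
    simpa only [Finset.sum_fn] using this
  refine ⟨I1.add (I3.const_mul _), ?_⟩
  unfold itoIntegrand
  rw [intervalIntegral.integral_add I1 (I3.const_mul _), intervalIntegral.integral_const_mul,
    intervalIntegral.integral_finsetSum fun k _ => hib k,
    intervalIntegral.integral_finsetSum fun k _ => I2 k]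
  congr 2
  exact Finset.sum_congr rfl fun k _ => intervalIntegral.integral_finsetSum fun l _ => hia k l

/-- Error in one cell of the discretized Itô formula. -/
lemma abs_ito_cell_le {n : ℕ} {φ : (Fin n → ℝ) → ℝ} (hφ : ContDiff ℝ 2 φ)
    {z : ℝ → Fin n → ℝ} (hz : Continuous z) {b : Fin n → ℝ → ℝ} {a : Fin n → Fin n → ℝ → ℝ}
    {p q T C θ : ℝ} (hpq : p ≤ q) (hT : q - p ≤ T) (hC0 : 0 ≤ C) {ΔM : Fin n → ℝ}
    (hb : ∀ k, IntervalIntegrable (b k) volume p q)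
    (ha : ∀ k l, IntervalIntegrable (a k l) volume p q)
    (hΔ : ∀ k, z q k - z p k = (∫ r in p..q, b k r) + ΔM k)
    (hbC : ∀ k, ∀ r, |b k r| ≤ C) (haC : ∀ k l, ∀ r, |a k l r| ≤ C)
    (hD2 : ‖fderiv ℝ (fderiv ℝ φ) (z p)‖ ≤ C)
    (h1 : ∀ r ∈ Set.Icc p q, ‖fderiv ℝ φ (z p) - fderiv ℝ φ (z r)‖ ≤ θ)
    (h2 : ∀ r ∈ Set.Icc p q,
      ‖fderiv ℝ (fderiv ℝ φ) (z p) - fderiv ℝ (fderiv ℝ φ) (z r)‖ ≤ θ)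
    (h3 : ∀ w ∈ segment ℝ (z p) (z q),
      ‖fderiv ℝ (fderiv ℝ φ) w - fderiv ℝ (fderiv ℝ φ) (z p)‖ ≤ θ)
    (hMθ : ‖ΔM‖ ≤ θ) (hbθ : C * (q - p) ≤ θ) :
    |φ (z q) - φ (z p) - (∫ r in p..q, itoIntegrand φ (z r) (fun k => b k r) (fun k l => a k l r))
      - ((∑ k, fderiv ℝ φ (z p) (Pi.single k 1) * ΔM k) +
        1 / 2 * ∑ k, ∑ l, fderiv ℝ (fderiv ℝ φ) (z p) (Pi.single k 1) (Pi.single l 1) *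
          (ΔM k * ΔM l - ∫ r in p..q, a k l r))| ≤
      θ * ((n * C + 2 * C ^ 2 + n ^ 2 * C + 2 * C ^ 2 * T) * (q - p) + 2 * ‖ΔM‖ ^ 2) := by
  have h3 := abs_taylor_two_le hφ h3
  have hcd1 : Continuous fun r => fderiv ℝ φ (z r) :=
    (hφ.continuous_fderiv (by norm_num)).comp hz
  have hcd2 : Continuous fun r => fderiv ℝ (fderiv ℝ φ) (z r) :=
    ((hφ.fderiv_right (m := 1) (by norm_num)).continuous_fderiv (by norm_num)).comp hz
  rw [(intervalIntegral_itoIntegrand hφ hz hb ha).2]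
  generalize φ (z q) - φ (z p) = Δφ at *
  obtain ⟨D1, e1⟩ : ∃ D1 : ℝ → _, ∀ r, D1 r = fderiv ℝ φ (z r) := ⟨_, fun _ => rfl⟩
  obtain ⟨D2, e2⟩ : ∃ D2 : ℝ → _, ∀ r, D2 r = fderiv ℝ (fderiv ℝ φ) (z r) := ⟨_, fun _ => rfl⟩
  simp only [← e1, ← e2] at hcd1 hcd2 hD2 h1 h2 h3 ⊢
  have hθ : 0 ≤ θ := (norm_nonneg _).trans hMθ
  have hqp : 0 ≤ q - p := sub_nonneg.2 hpq
  obtain ⟨Δb, hΔb⟩ : ∃ Δb : Fin n → ℝ, ∀ k, Δb k = ∫ r in p..q, b k r := ⟨_, fun _ => rfl⟩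
  obtain e : z q - z p = Δb + ΔM := by ext k; simp [hΔ k, hΔb k]
  rw [e] at h3
  have hΔbn : ‖Δb‖ ≤ C * (q - p) := by
    refine (pi_norm_le_iff_of_nonneg (by positivity)).2 fun k => ?_
    rw [hΔb, ← abs_of_nonneg hqp]
    exact intervalIntegral.norm_integral_le_of_norm_le_const fun r _ => hbC k r
  -- Keeping only the martingale part in the quadratic term drops three terms that contain `Δb`,
  -- each at most `C² θ (q - p)`.
  have t2 : |D2 p (Δb + ΔM) (Δb + ΔM) - D2 p ΔM ΔM| ≤ 4 * (C ^ 2 * θ * (q - p)) := by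
    have bd : ∀ u v : Fin n → ℝ, ‖u‖ * ‖v‖ ≤ C * (q - p) * θ →
        |D2 p u v| ≤ C * (C * (q - p) * θ) := fun u v h => by
      have := (D2 p).le_opNorm₂ u v
      rw [Real.norm_eq_abs, mul_assoc] at this
      exact this.trans (mul_le_mul hD2 h (by positivity) hC0)
    have c2 : ‖Δb‖ * ‖ΔM‖ ≤ C * (q - p) * θ := mul_le_mul hΔbn hMθ (norm_nonneg _) (by positivity)
    have b1 := abs_le.1 (bd Δb Δb (mul_le_mul hΔbn (hΔbn.trans hbθ) (norm_nonneg _)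
      (by positivity)))
    have b2 := abs_le.1 (bd Δb ΔM c2)
    have b3 := abs_le.1 (bd ΔM Δb (by rwa [mul_comm]))
    have d0 : 0 ≤ C * (C * (q - p) * θ) := by positivity
    simp only [map_add, add_apply]
    rw [abs_le]
    constructor <;> linarith
  -- Here `(q - p)²` is estimated by `T (q - p)`, so that the sum over all cells stays bounded.
  have hn2 : ‖Δb + ΔM‖ ^ 2 ≤ 2 * (C ^ 2 * T * (q - p)) + 2 * ‖ΔM‖ ^ 2 := by
    have e2 : ‖Δb + ΔM‖ ^ 2 ≤ (C * (q - p) + ‖ΔM‖) ^ 2 := by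
      gcongr
      exact (norm_add_le _ _).trans (by gcongr)
    nlinarith [sq_nonneg (C * (q - p) - ‖ΔM‖), mul_le_mul_of_nonneg_left
      (mul_le_mul_of_nonneg_right hT hqp) (sq_nonneg C)]
  have hs1 : |∑ k, D1 p (Pi.single k 1) * Δb k -
      ∑ k, ∫ r in p..q, D1 r (Pi.single k 1) * b k r| ≤ n * (θ * C * (q - p)) := by
    rw [← Finset.sum_sub_distrib]
    refine (Finset.abs_sum_le_sum_abs _ _).trans ((Finset.sum_le_sum fun k _ => ?_).trans
      (by simp : ∑ _ : Fin n, θ * C * (q - p) ≤ _))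
    rw [hΔb]
    exact abs_mul_integral_sub_le (hcd1.clm_apply continuous_const) (hb k) hpq (hbC k) hθ
      fun r hr => (abs_apply_single_le (D1 p - D1 r) k).trans (h1 r hr)
  have hs3 : |∑ k, ∑ l, D2 p (Pi.single k 1) (Pi.single l 1) * (∫ r in p..q, a k l r) -
      ∑ k, ∑ l, ∫ r in p..q, D2 r (Pi.single k 1) (Pi.single l 1) * a k l r| ≤
      n * (n * (θ * C * (q - p))) := by
    simp only [← Finset.sum_sub_distrib]
    refine (Finset.abs_sum_le_sum_abs _ _).trans ((Finset.sum_le_sum fun k _ =>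
      (Finset.abs_sum_le_sum_abs _ _).trans (Finset.sum_le_sum fun l _ => ?_)).trans
      (by simp : ∑ _ : Fin n, ∑ _ : Fin n, θ * C * (q - p) ≤ _))
    exact abs_mul_integral_sub_le ((hcd2.clm_apply continuous_const).clm_apply continuous_const)
      (ha k l) hpq (haC k l) hθ
      fun r hr => (abs_apply_single_single_le (D2 p - D2 r) k l).trans (h2 r hr)
  have hx1 := h3.trans (mul_le_mul_of_nonneg_left hn2 hθ)
  rw [(D1 p).map_add, fderiv_apply_eq_sum (D1 p) Δb, fderiv_apply_eq_sum (D1 p) ΔM] at hx1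
  have n4 : 0 ≤ (n : ℝ) * (n * (θ * C * (q - p))) := by positivity
  simp only [mul_sub, Finset.sum_sub_distrib, ← bilin_apply_eq_sum (D2 p) ΔM]
  rw [abs_le] at hx1 hs1 t2 hs3 ⊢
  constructor <;> linarith [hx1.1, hx1.2, hs1.1, hs1.2, t2.1, t2.2, hs3.1, hs3.2]

end Taylor

/-- A substitute for the Cauchy–Schwarz inequality: products are bounded by Young's inequality with
a free parameter `c`; one takes `c` small first and then lets `k` tend to infinity. -/
lemma tendsto_zero_of_le_mul_add {x e : ℕ → ℝ} {A : ℝ} (hx : ∀ k, 0 ≤ x k)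
    (he : Tendsto e atTop (𝓝 0)) (h : ∀ c > 0, ∀ k, x k ≤ c * A + c⁻¹ * e k) :
    Tendsto x atTop (𝓝 0) := by
  rw [Metric.tendsto_atTop]
  intro ε hε
  obtain ⟨c, hc, hcA⟩ : ∃ c > 0, c * A < ε / 2 := by
    refine ⟨ε / 2 / (|A| + 1), by positivity, ?_⟩
    rw [div_mul_eq_mul_div, div_lt_iff₀ (by positivity)]
    exact mul_lt_mul_of_pos_left ((le_abs_self A).trans_lt (lt_add_one _)) (by positivity)
  have h1 : Tendsto (fun k => c * A + c⁻¹ * e k) atTop (𝓝 (c * A + c⁻¹ * 0)) :=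
    (he.const_mul _).const_add _
  have h2 : c * A + c⁻¹ * 0 < ε := by linarith
  obtain ⟨n, hn⟩ := eventually_atTop.1 (h1.eventually (gt_mem_nhds h2))
  refine ⟨n, fun k hk => ?_⟩
  rw [Real.dist_eq, sub_zero, abs_of_nonneg (hx k)]
  exact (h c hc k).trans_lt (hn k hk)

/-! ### Tools for Itô's formula: convergence of the error and small cells -/

section ItoFormula

lemma abs_mul_le_mul_sq_add {c : ℝ} (hc : 0 < c) (a b : ℝ) : |a * b| ≤ c * b ^ 2 + c⁻¹ * a ^ 2 := by
  have h : c⁻¹ * (|a| - c * |b|) ^ 2 = c⁻¹ * a ^ 2 - 2 * (|a| * |b|) + c * b ^ 2 := by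
    rw [← sq_abs a, ← sq_abs b]; field_simp; ring
  have h1 : 0 ≤ c⁻¹ * (|a| - c * |b|) ^ 2 := by positivity
  rw [abs_mul]
  linarith [mul_nonneg (abs_nonneg a) (abs_nonneg b)]

/-- The ratio `r = |E| / (1 + S)` is bounded and tends to zero pointwise, hence `r²` tends to zero
in mean; as `S` is bounded in mean square, Young's inequality carries this over to `r (1 + S) =
|E|`. -/
lemma tendsto_integral_abs_of_ratio [IsProbabilityMeasure P] {E S : ℕ → Ω → ℝ}
    (hE : ∀ m, AEStronglyMeasurable (E m) P) (hS : ∀ m, MemLp (S m) 2 P) (hS0 : ∀ m ω, 0 ≤ S m ω)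
    {C θ₀ : ℝ} (hC : ∀ m, ∫ ω, S m ω ^ 2 ∂P ≤ C) (hb : ∀ m ω, |E m ω| ≤ θ₀ * (1 + S m ω))
    (hlim : ∀ ω, ∀ θ > 0, ∀ᶠ m in atTop, |E m ω| ≤ θ * (1 + S m ω)) :
    Tendsto (fun m => ∫ ω, |E m ω| ∂P) atTop (𝓝 0) := by
  have hpos : ∀ m ω, 0 < 1 + S m ω := fun m ω => by linarith [hS0 m ω]
  set r : ℕ → Ω → ℝ := fun m ω => |E m ω| / (1 + S m ω) with hr
  have hr0 : ∀ m ω, 0 ≤ r m ω := fun m ω => div_nonneg (abs_nonneg _) (hpos m ω).le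
  have hrb : ∀ m ω, r m ω ≤ θ₀ := fun m ω => (div_le_iff₀ (hpos m ω)).2 (hb m ω)
  have hrm : ∀ m, AEStronglyMeasurable (r m) P := fun m => by
    have h1 : AEMeasurable (fun ω => |E m ω|) P := (hE m).aemeasurable.abs
    have h2 : AEMeasurable (fun ω => 1 + S m ω) P := (hS m).1.aemeasurable.const_add 1
    exact (h1.div h2).aestronglyMeasurable
  have hrbd : ∀ m ω, ‖r m ω ^ 2‖ ≤ θ₀ ^ 2 := fun m ω => by
    rw [Real.norm_eq_abs, abs_of_nonneg (sq_nonneg _)]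
    exact pow_le_pow_left₀ (hr0 m ω) (hrb m ω) 2
  have hri : ∀ m, Integrable (fun ω => r m ω ^ 2) P := fun m =>
    Integrable.of_bound ((hrm m).pow 2) (θ₀ ^ 2) (ae_of_all _ (hrbd m))
  have hrlim : ∀ ω, Tendsto (fun m => r m ω) atTop (𝓝 0) := fun ω => by
    rw [Metric.tendsto_atTop']
    intro ε hε
    obtain ⟨N, hN⟩ := eventually_atTop.1 (hlim ω (ε / 2) (by positivity))
    refine ⟨N, fun m hm => ?_⟩
    rw [Real.dist_eq, sub_zero, abs_of_nonneg (hr0 m ω)]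
    have := (div_le_iff₀ (hpos m ω)).2 (hN m hm.le)
    linarith
  have hr2 : Tendsto (fun m => ∫ ω, r m ω ^ 2 ∂P) atTop (𝓝 0) := by
    have := tendsto_integral_of_dominated_convergence (μ := P) (fun _ => θ₀ ^ 2)
      (F := fun m ω => r m ω ^ 2) (f := fun _ => 0) (fun m => (hri m).1) (integrable_const _)
      (fun m => ae_of_all _ (hrbd m)) (ae_of_all _ fun ω => by simpa using (hrlim ω).pow 2)
    simpa using this
  refine tendsto_zero_of_le_mul_add (A := 2 + 2 * C)
    (fun m => integral_nonneg fun ω => abs_nonneg _) hr2 fun δ hδ m => ?_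
  have hpt : ∀ ω, |E m ω| ≤ δ * (2 + 2 * S m ω ^ 2) + δ⁻¹ * r m ω ^ 2 := fun ω => by
    have e : |E m ω| = r m ω * (1 + S m ω) := (div_mul_cancel₀ _ (hpos m ω).ne').symm
    have h4 : 0 ≤ δ * (1 - S m ω) ^ 2 := by positivity
    rw [e]
    linarith [(le_abs_self _).trans (abs_mul_le_mul_sq_add hδ (r m ω) (1 + S m ω))]
  have i1 : Integrable (fun ω => 2 * S m ω ^ 2) P := (hS m).integrable_sq.const_mul _
  have i2 : Integrable (fun ω => δ * (2 + 2 * S m ω ^ 2)) P :=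
    ((integrable_const _).add i1).const_mul _
  refine (integral_mono_of_nonneg (ae_of_all _ fun ω => abs_nonneg _)
    (i2.add ((hri m).const_mul δ⁻¹)) (ae_of_all _ hpt)).trans ?_
  rw [integral_add' i2 ((hri m).const_mul _), integral_const_mul, integral_const_mul,
    integral_add (integrable_const _) i1, integral_const_mul]
  simp only [integral_const, probReal_univ, one_smul]
  have := hC m
  gcongr

/-- The square is expanded one summand at a time: `h2` controls the cross terms, and `Q² ≤ K Q` the
diagonal ones. For squared martingale increments `c` is proportional to the mesh, so the bound does
not grow with the number of cells. -/
lemma integral_sq_sum_le [IsProbabilityMeasure P] {Q : ℕ → Ω → ℝ} {m : ℕ} {K c : ℝ}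
    (hc : 0 ≤ c)
    (hQm : ∀ i, AEStronglyMeasurable (Q i) P) (hQ0 : ∀ i ω, 0 ≤ Q i ω)
    (hQK : ∀ i < m, ∀ ω, Q i ω ≤ K) (h1 : ∀ i < m, ∫ ω, Q i ω ∂P ≤ c)
    (h2 : ∀ i < m, ∫ ω, (∑ j ∈ Finset.range i, Q j ω) * Q i ω ∂P ≤
      c * ∫ ω, (∑ j ∈ Finset.range i, Q j ω) ∂P) :
    ∫ ω, (∑ j ∈ Finset.range m, Q j ω) ^ 2 ∂P ≤ 2 * (c * m) ^ 2 + K * (c * m) := by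
  have hQi : ∀ i < m, Integrable (Q i) P := fun i hi => Integrable.of_bound (hQm i) K
    (ae_of_all _ fun ω => by rw [Real.norm_eq_abs, abs_of_nonneg (hQ0 i ω)]; exact hQK i hi ω)
  have hS : ∀ k ≤ m, MemLp (fun ω => ∑ j ∈ Finset.range k, Q j ω) ⊤ P := fun k hk =>
    memLp_finsetSum _ fun j hj => memLp_top_of_bound (hQm j) K (ae_of_all _ fun ω => by
      rw [Real.norm_eq_abs, abs_of_nonneg (hQ0 j ω)]
      exact hQK j ((Finset.mem_range.1 hj).trans_le hk) ω)
  have hES : ∀ k ≤ m, ∫ ω, (∑ j ∈ Finset.range k, Q j ω) ∂P ≤ c * k := fun k hk => by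
    rw [integral_finsetSum _ fun i hi => hQi i ((Finset.mem_range.1 hi).trans_le hk)]
    refine (Finset.sum_le_sum fun i hi => h1 i ((Finset.mem_range.1 hi).trans_le hk)).trans ?_
    simp [mul_comm]
  have key : ∀ k ≤ m, ∫ ω, (∑ j ∈ Finset.range k, Q j ω) ^ 2 ∂P ≤
      (2 * (c * (c * m)) + K * c) * k := by
    intro k hk
    induction k with
    | zero => simp
    | succ k ih =>
      have hk' : k < m := hk
      have I1 : Integrable (fun ω => (∑ j ∈ Finset.range k, Q j ω) ^ 2) P :=
        ((hS k hk'.le).mono_exponent le_top : MemLp _ 2 P).integrable_sq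
      have q2 : MemLp (Q k) 2 P := (memLp_top_of_bound (hQm k) K (ae_of_all _ fun ω => by
        rw [Real.norm_eq_abs, abs_of_nonneg (hQ0 k ω)]
        exact hQK k hk' ω)).mono_exponent le_top
      have I2 : Integrable (fun ω => (∑ j ∈ Finset.range k, Q j ω) * Q k ω) P :=
        ((hS k hk'.le).mono_exponent le_top : MemLp _ 2 P).integrable_mul q2
      have I3 : Integrable (fun ω => Q k ω ^ 2) P := q2.integrable_sq
      have e : ∀ ω, (∑ j ∈ Finset.range (k + 1), Q j ω) ^ 2 =
          (∑ j ∈ Finset.range k, Q j ω) ^ 2 + 2 * ((∑ j ∈ Finset.range k, Q j ω) * Q k ω) +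
            Q k ω ^ 2 := fun ω => by rw [Finset.sum_range_succ]; ring
      simp only [e]
      have I12 : Integrable (fun ω => (∑ j ∈ Finset.range k, Q j ω) ^ 2 +
        2 * ((∑ j ∈ Finset.range k, Q j ω) * Q k ω)) P := I1.add (I2.const_mul 2)
      rw [integral_add I12 I3, integral_add I1 (I2.const_mul 2),
        integral_const_mul]
      have b1 := ih hk'.le
      have b2 := (h2 k hk').trans (mul_le_mul_of_nonneg_left (hES k hk'.le) hc)
      have b3 : ∫ ω, Q k ω ^ 2 ∂P ≤ K * c := by
        have hK : 0 ≤ K := by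
          obtain ⟨ω⟩ : Nonempty Ω := P.nonempty_of_neZero
          exact (hQ0 k ω).trans (hQK k hk' ω)
        calc _ ≤ ∫ ω, K * Q k ω ∂P := integral_mono I3 ((hQi k hk').const_mul K) fun ω => by
              simp only [sq]
              exact mul_le_mul_of_nonneg_right (hQK k hk' ω) (hQ0 k ω)
          _ = K * ∫ ω, Q k ω ∂P := integral_const_mul _ _
          _ ≤ _ := mul_le_mul_of_nonneg_left (h1 k hk') hK
      have b4 : c * (c * (k : ℝ)) ≤ c * (c * m) := by gcongr
      push_cast
      nlinarith
  refine (key m le_rfl).trans (le_of_eq ?_)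
  ring

/-- Continuous semimartingales `Z k = Z k 0 + ∫ b k + M k` with brackets `∫ a k l`. -/
structure IsItoSystem {n : ℕ} (𝓕 : Filtration ℝ≥0 mΩ) (P : Measure Ω)
    (Z M b : Fin n → ℝ≥0 → Ω → ℝ) (a : Fin n → Fin n → ℝ≥0 → Ω → ℝ) : Prop where
  mart : ∀ k, L2Mart 𝓕 P (M k)
  contM : ∀ k, IsBddContinuous 𝓕 (M k)
  contZ : ∀ k, IsBddContinuous 𝓕 (Z k)
  progb : ∀ k, IsBoundedProg 𝓕 (b k)
  proga : ∀ k l, IsBoundedProg 𝓕 (a k l)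
  bracket : ∀ k l, BracketPair 𝓕 P (M k) (M l) (timeInt (a k l))
  decomp : ∀ k t ω, Z k t ω = Z k 0 ω + timeInt (b k) t ω + (M k t ω - M k 0 ω)

/-- The increments and oscillations on the cell `[p, q]` are bounded by `θ`. -/
structure IsSmallCell {n : ℕ} (φ : (Fin n → ℝ) → ℝ) (z M : ℝ≥0 → Fin n → ℝ) (C : ℝ) (p q : ℝ≥0)
    (θ : ℝ) : Prop where
  d1 : ∀ r ∈ Set.Icc p q, ‖fderiv ℝ φ (z p) - fderiv ℝ φ (z r)‖ ≤ θ
  d2 : ∀ r ∈ Set.Icc p q, ‖fderiv ℝ (fderiv ℝ φ) (z p) - fderiv ℝ (fderiv ℝ φ) (z r)‖ ≤ θ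
  d3 : ∀ w ∈ segment ℝ (z p) (z q),
    ‖fderiv ℝ (fderiv ℝ φ) w - fderiv ℝ (fderiv ℝ φ) (z p)‖ ≤ θ
  incr : ‖M q - M p‖ ≤ θ
  time : C * ((q : ℝ) - p) ≤ θ

lemma continuous_fderiv_fderiv {n : ℕ} {φ : (Fin n → ℝ) → ℝ} (hφ : ContDiff ℝ 2 φ) :
    Continuous (fderiv ℝ (fderiv ℝ φ)) :=
  (hφ.fderiv_right (m := 1) (by norm_num)).continuous_fderiv (by norm_num)

lemma grid_mem {s t : ℝ≥0} (hst : s ≤ t) {m j : ℕ} (hj : j ≤ m) : grid s t m j ∈ Set.Icc s t :=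
  ⟨le_grid _ _ _ _, grid_le hst hj⟩

lemma exists_norm_sub_le_of_continuous {V W : Type*} [NormedAddCommGroup V] [ProperSpace V]
    [NormedAddCommGroup W] {f : V → W} (hf : Continuous f) (R : ℝ) {θ : ℝ} (hθ : 0 < θ) :
    ∃ δ > 0, ∀ x ∈ Metric.closedBall 0 R, ∀ y ∈ Metric.closedBall 0 R, dist x y < δ →
      ‖f x - f y‖ ≤ θ := by
  have hc : UniformContinuousOn f (Metric.closedBall 0 R) :=
    (isCompact_closedBall _ _).uniformContinuousOn_of_continuous hf.continuousOn
  obtain ⟨δ, hδ, h⟩ := Metric.uniformContinuousOn_iff.1 hc θ hθ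
  exact ⟨δ, hδ, fun x hx y hy hxy => by rw [← dist_eq_norm]; exact (h x hx y hy hxy).le⟩

/-- Uniform continuity of the derivatives on a ball containing the path, and of the path and the
martingale on `[s,t]`. The threshold depends on the path, so this smallness is only pointwise in
`ω`. -/
lemma eventually_isSmallCell {n : ℕ} {φ : (Fin n → ℝ) → ℝ} (hφ : ContDiff ℝ 2 φ)
    {z M : ℝ≥0 → Fin n → ℝ} (hz : Continuous z) (hM : Continuous M) (C : ℝ) {s t : ℝ≥0}
    (hst : s ≤ t) {R : ℝ} (hR : ∀ r ≤ t, ‖z r‖ ≤ R) {θ : ℝ} (hθ : 0 < θ) :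
    ∀ᶠ m : ℕ in atTop, ∀ j < m + 1,
      IsSmallCell φ z M C (grid s t (m + 1) j) (grid s t (m + 1) (j + 1)) θ := by
  obtain ⟨δ1, hδ1, h1⟩ := exists_norm_sub_le_of_continuous
    (hφ.continuous_fderiv (by norm_num)) R hθ
  obtain ⟨δ2, hδ2, h2⟩ := exists_norm_sub_le_of_continuous
    (W := (Fin n → ℝ) →L[ℝ] (Fin n → ℝ) →L[ℝ] ℝ) (continuous_fderiv_fderiv hφ) R hθ
  have hzu : UniformContinuousOn z (Set.Icc s t) :=
    isCompact_Icc.uniformContinuousOn_of_continuous hz.continuousOn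
  have hMu : UniformContinuousOn M (Set.Icc s t) :=
    isCompact_Icc.uniformContinuousOn_of_continuous hM.continuousOn
  obtain ⟨δ3, hδ3, h3⟩ := Metric.uniformContinuousOn_iff.1 hzu (min δ1 δ2) (lt_min hδ1 hδ2)
  obtain ⟨δ4, hδ4, h4⟩ := Metric.uniformContinuousOn_iff.1 hMu θ hθ
  have hmesh : Tendsto (fun m : ℕ => ((t : ℝ) - s) / ((m + 1 : ℕ) : ℝ)) atTop (𝓝 0) :=
    (tendsto_const_div_atTop_nhds_zero_nat _).comp (tendsto_add_atTop_nat 1)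
  have hmeshC : Tendsto (fun m : ℕ => C * (((t : ℝ) - s) / ((m + 1 : ℕ) : ℝ))) atTop (𝓝 0) := by
    simpa using hmesh.const_mul C
  filter_upwards [hmesh.eventually_lt_const (lt_min hδ3 hδ4), hmeshC.eventually_lt_const hθ]
    with m hm hmC j hj
  have hj1 : grid s t (m + 1) j ∈ Set.Icc s t := grid_mem hst hj.le
  have hj2 : grid s t (m + 1) (j + 1) ∈ Set.Icc s t := grid_mem hst hj
  have hlen := coe_grid_succ_sub s t hst (m + 1) j
  have hle : grid s t (m + 1) j ≤ grid s t (m + 1) (j + 1) := grid_mono _ _ _ (Nat.le_succ j)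
  set p := grid s t (m + 1) j
  set q := grid s t (m + 1) (j + 1)
  have hdist : ∀ r ∈ Set.Icc p q, dist p r < min δ3 δ4 := fun r hr => by
    rw [NNReal.dist_eq, abs_sub_comm, abs_of_nonneg (sub_nonneg.2 (NNReal.coe_le_coe.2 hr.1))]
    have : (r : ℝ) ≤ q := NNReal.coe_le_coe.2 hr.2
    exact lt_of_le_of_lt (by linarith) hm
  have hmem : ∀ r ∈ Set.Icc p q, r ∈ Set.Icc s t := fun r hr =>
    ⟨hj1.1.trans hr.1, hr.2.trans hj2.2⟩
  have hball : ∀ r ∈ Set.Icc s t, z r ∈ Metric.closedBall 0 R := fun r hr => by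
    rw [mem_closedBall_zero_iff]; exact hR r hr.2
  have hzz : ∀ r ∈ Set.Icc p q, dist (z p) (z r) < min δ1 δ2 := fun r hr =>
    h3 p hj1 r (hmem r hr) ((hdist r hr).trans_le (min_le_left _ _))
  have hqq : q ∈ Set.Icc p q := ⟨hle, le_rfl⟩
  refine ⟨fun r hr => ?_, fun r hr => ?_, fun w hw => ?_, ?_, ?_⟩
  · exact h1 _ (hball p hj1) _ (hball r (hmem r hr)) ((hzz r hr).trans_le (min_le_left _ _))
  · exact h2 _ (hball p hj1) _ (hball r (hmem r hr)) ((hzz r hr).trans_le (min_le_right _ _))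
  · refine h2 _ ((convex_closedBall 0 R).segment_subset (hball p hj1) (hball q hj2) hw) _
      (hball p hj1) ?_
    have hs : w ∈ Metric.closedBall (z p) (dist (z p) (z q)) :=
      (convex_closedBall (z p) _).segment_subset (Metric.mem_closedBall_self dist_nonneg)
        (by rw [Metric.mem_closedBall, dist_comm]) hw
    exact (Metric.mem_closedBall.1 hs).trans_lt ((hzz q hqq).trans_le (min_le_right _ _))
  · rw [← dist_eq_norm, dist_comm]
    exact (h4 _ hj1 _ hj2 ((hdist q hqq).trans_le (min_le_right _ _))).le
  · rw [hlen]; exact hmC.le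

/-- In contrast to `eventually_isSmallCell`, the bound is not small but holds for every path and
every cell; it supplies the domination in the passage to the limit. -/
lemma isSmallCell_of_bounds {n : ℕ} {φ : (Fin n → ℝ) → ℝ}
    {z M : ℝ≥0 → Fin n → ℝ} {C : ℝ} (hC : 0 ≤ C) {t : ℝ≥0} {R : ℝ} (hR : ∀ r ≤ t, ‖z r‖ ≤ R)
    {D : ℝ} (hD1 : ∀ w ∈ Metric.closedBall (0 : Fin n → ℝ) R, ‖fderiv ℝ φ w‖ ≤ D)
    (hD2 : ∀ w ∈ Metric.closedBall (0 : Fin n → ℝ) R, ‖fderiv ℝ (fderiv ℝ φ) w‖ ≤ D)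
    (hD3 : ∀ r ≤ t, ‖M r‖ ≤ D) {p q : ℝ≥0} (hpq : p ≤ q) (hq : q ≤ t) :
    IsSmallCell φ z M C p q (2 * D + C * t) := by
  have hball : ∀ r ≤ t, z r ∈ Metric.closedBall 0 R := fun r hr => by
    rw [mem_closedBall_zero_iff]; exact hR r hr
  have hp : p ≤ t := hpq.trans hq
  have hCt : 0 ≤ C * (t : ℝ) := by positivity
  refine ⟨fun r hr => ?_, fun r hr => ?_, fun w hw => ?_, ?_, ?_⟩
  · refine (norm_sub_le _ _).trans ?_
    linarith [hD1 _ (hball p hp), hD1 _ (hball r (hr.2.trans hq))]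
  · refine (norm_sub_le (fderiv ℝ (fderiv ℝ φ) (z p)) _).trans ?_
    linarith [hD2 _ (hball p hp), hD2 _ (hball r (hr.2.trans hq))]
  · refine (norm_sub_le (fderiv ℝ (fderiv ℝ φ) w) _).trans ?_
    linarith [hD2 _ (hball p hp),
      hD2 w ((convex_closedBall 0 R).segment_subset (hball p hp) (hball q hq) hw)]
  · refine (norm_sub_le _ _).trans ?_
    linarith [hD3 p hp, hD3 q hq]
  · have h1 : (q : ℝ) - p ≤ t := by
      have : (q : ℝ) ≤ t := NNReal.coe_le_coe.2 hq
      linarith [p.coe_nonneg]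
    have h0 : 0 ≤ D := (norm_nonneg _).trans (hD3 p hp)
    have := mul_le_mul_of_nonneg_left h1 hC
    linarith

end ItoFormula

/-! ### Itô's formula for bounded continuous semimartingales -/

namespace IsItoSystem

variable {n : ℕ} {Z M b : Fin n → ℝ≥0 → Ω → ℝ} {a : Fin n → Fin n → ℝ≥0 → Ω → ℝ}
  {φ : (Fin n → ℝ) → ℝ}

lemma exists_norm_le {N : Fin n → ℝ≥0 → Ω → ℝ} (hN : ∀ k, IsBddContinuous 𝓕 (N k)) (t : ℝ≥0) :
    ∃ R : ℝ, 0 ≤ R ∧ ∀ r ≤ t, ∀ ω, ‖(fun k => N k r ω)‖ ≤ R := by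
  choose C hC using fun k => (hN k).bdd t
  refine ⟨∑ k, |C k|, by positivity, fun r hr ω => ?_⟩
  refine (pi_norm_le_iff_of_nonneg (by positivity)).2 fun k => ?_
  exact ((hC k r hr ω).trans (le_abs_self _)).trans
    (Finset.single_le_sum (f := fun k => |C k|) (fun i _ => abs_nonneg _) (Finset.mem_univ k))

lemma exists_bddProg_le {ι : Type*} [Finite ι] {c : ι → ℝ≥0 → Ω → ℝ}
    (hc : ∀ k, IsBoundedProg 𝓕 (c k)) : ∃ C : ℝ, 0 ≤ C ∧ ∀ k t ω, |c k t ω| ≤ C := by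
  cases nonempty_fintype ι
  choose C hC using fun k => (hc k).bdd
  refine ⟨∑ k, |C k|, by positivity, fun k t ω => ?_⟩
  exact ((hC k t ω).trans (le_abs_self _)).trans
    (Finset.single_le_sum (f := fun k => |C k|) (fun i _ => abs_nonneg _) (Finset.mem_univ k))

lemma exists_fderiv_le (hφ : ContDiff ℝ 2 φ) (R : ℝ) :
    ∃ D : ℝ, 0 ≤ D ∧ ∀ w ∈ Metric.closedBall (0 : Fin n → ℝ) R, |φ w| ≤ D ∧ ‖fderiv ℝ φ w‖ ≤ D ∧
      ‖fderiv ℝ (fderiv ℝ φ) w‖ ≤ D := by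
  have hK := isCompact_closedBall (0 : Fin n → ℝ) R
  obtain ⟨D0, h0⟩ := hK.exists_bound_of_continuousOn hφ.continuous.continuousOn
  obtain ⟨D1, h1⟩ := hK.exists_bound_of_continuousOn
    (hφ.continuous_fderiv (by norm_num)).continuousOn
  obtain ⟨D2, h2⟩ := hK.exists_bound_of_continuousOn (E := (Fin n → ℝ) →L[ℝ] (Fin n → ℝ) →L[ℝ] ℝ)
    (continuous_fderiv_fderiv hφ).continuousOn
  refine ⟨|D0| + |D1| + |D2|, by positivity, fun w hw => ⟨?_, ?_, ?_⟩⟩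
  · have := h0 w hw
    rw [Real.norm_eq_abs] at this
    linarith [le_abs_self D0, abs_nonneg D1, abs_nonneg D2]
  · linarith [h1 w hw, le_abs_self D1, abs_nonneg D0, abs_nonneg D2]
  · linarith [h2 w hw, le_abs_self D2, abs_nonneg D0, abs_nonneg D1]

/-- The finite variation integrand in the Itô formula, as a process. -/
noncomputable def proc (φ : (Fin n → ℝ) → ℝ) (Z b : Fin n → ℝ≥0 → Ω → ℝ)
    (a : Fin n → Fin n → ℝ≥0 → Ω → ℝ) (r : ℝ≥0) (ω : Ω) : ℝ :=
  itoIntegrand φ (fun k => Z k r ω) (fun k => b k r ω) (fun k l => a k l r ω)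

lemma continuous_path (hZ : ∀ k, IsBddContinuous 𝓕 (Z k)) (ω : Ω) :
    Continuous fun r : ℝ≥0 => fun k => Z k r ω :=
  continuous_pi fun k => (hZ k).continuous ω

lemma continuous_path_toNNReal (hZ : ∀ k, IsBddContinuous 𝓕 (Z k)) (ω : Ω) :
    Continuous fun r : ℝ => fun k => Z k r.toNNReal ω :=
  (continuous_path hZ ω).comp continuous_real_toNNReal

lemma isStronglyProgressive_proc (h : IsItoSystem 𝓕 P Z M b a) (hφ : ContDiff ℝ 2 φ) :
    IsStronglyProgressive 𝓕 (proc φ Z b a) := by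
  intro i
  have hZ : ∀ k, Measurable[Prod.instMeasurableSpace (m₂ := 𝓕 i)]
      fun p : Set.Iic i × Ω => Z k p.1 p.2 := fun k =>
    ((h.contZ k).adapted.isStronglyProgressive_of_continuous (h.contZ k).continuous i).measurable
  have hb : ∀ k, Measurable[Prod.instMeasurableSpace (m₂ := 𝓕 i)]
      fun p : Set.Iic i × Ω => b k p.1 p.2 := fun k => ((h.progb k).prog i).measurable
  have ha : ∀ k l, Measurable[Prod.instMeasurableSpace (m₂ := 𝓕 i)]
      fun p : Set.Iic i × Ω => a k l p.1 p.2 := fun k l => ((h.proga k l).prog i).measurable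
  have hZv : Measurable[Prod.instMeasurableSpace (m₂ := 𝓕 i)]
      fun p : Set.Iic i × Ω => fun k => Z k p.1 p.2 :=
    @measurable_pi_lambda _ _ _ (Prod.instMeasurableSpace (m₂ := 𝓕 i)) _ _ hZ
  have hd1 : ∀ k, Measurable fun z : Fin n → ℝ => fderiv ℝ φ z (Pi.single k 1) := fun k =>
    ((hφ.continuous_fderiv (by norm_num)).clm_apply continuous_const).measurable
  have hd2 : ∀ k l, Measurable fun z : Fin n → ℝ =>
      fderiv ℝ (fderiv ℝ φ) z (Pi.single k 1) (Pi.single l 1) := fun k l =>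
    (((continuous_fderiv_fderiv hφ).clm_apply continuous_const).clm_apply
      continuous_const).measurable
  refine Measurable.stronglyMeasurable ?_
  unfold proc itoIntegrand
  refine Measurable.add ?_ (Measurable.const_mul ?_ _)
  · exact Finset.measurable_fun_sum _ fun k _ => ((hd1 k).comp hZv).mul (hb k)
  · exact Finset.measurable_fun_sum _ fun k _ => Finset.measurable_fun_sum _ fun l _ =>
      ((hd2 k l).comp hZv).mul (ha k l)

lemma intervalIntegrable_proc (h : IsItoSystem 𝓕 P Z M b a) (hφ : ContDiff ℝ 2 φ) (ω : Ω)
    (p q : ℝ) : IntervalIntegrable (fun r : ℝ => proc φ Z b a r.toNNReal ω) volume p q :=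
  (intervalIntegral_itoIntegrand hφ (continuous_path_toNNReal h.contZ ω)
    (fun k => (h.progb k).integrable_section ω p q)
    (fun k l => (h.proga k l).integrable_section ω p q)).1

lemma exists_proc_le (h : IsItoSystem 𝓕 P Z M b a) (hφ : ContDiff ℝ 2 φ) (t : ℝ≥0) :
    ∃ K : ℝ, 0 ≤ K ∧ ∀ r ≤ t, ∀ ω, |φ (fun k => Z k r ω)| ≤ K ∧ |proc φ Z b a r ω| ≤ K := by
  obtain ⟨R, hR0, hR⟩ := exists_norm_le h.contZ t
  obtain ⟨D, hD0, hD⟩ := exists_fderiv_le hφ R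
  obtain ⟨C, hC0, hC⟩ := exists_bddProg_le h.progb
  obtain ⟨C', hC'0, hC'⟩ := exists_bddProg_le (c := fun p : Fin n × Fin n => a p.1 p.2)
    (fun p => h.proga p.1 p.2)
  refine ⟨D + (n * (D * C) + 1 / 2 * (n * (n * (D * C')))), by positivity, fun r hr ω => ?_⟩
  obtain ⟨d0, d1, d2⟩ := hD (fun k => Z k r ω) (by rw [mem_closedBall_zero_iff]; exact hR r hr ω)
  have p1 : |∑ k, fderiv ℝ φ (fun k => Z k r ω) (Pi.single k 1) * b k r ω| ≤ n * (D * C) := by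
    refine (Finset.abs_sum_le_sum_abs _ _).trans ((Finset.sum_le_sum (g := fun _ => D * C)
      fun k _ => ?_).trans (by simp))
    rw [abs_mul]
    exact mul_le_mul ((abs_apply_single_le _ k).trans d1) (hC k r ω) (abs_nonneg _) hD0
  have p2 : |∑ k, ∑ l, fderiv ℝ (fderiv ℝ φ) (fun k => Z k r ω) (Pi.single k 1) (Pi.single l 1) *
      a k l r ω| ≤ n * (n * (D * C')) := by
    refine (Finset.abs_sum_le_sum_abs _ _).trans ((Finset.sum_le_sum
      (g := fun _ => n * (D * C')) fun k _ => ?_).trans (by simp))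
    refine (Finset.abs_sum_le_sum_abs _ _).trans ((Finset.sum_le_sum (g := fun _ => D * C')
      fun l _ => ?_).trans (by simp))
    rw [abs_mul]
    exact mul_le_mul ((abs_apply_single_single_le _ k l).trans d2) (hC' (k, l) r ω)
      (abs_nonneg _) hD0
  refine ⟨d0.trans (le_add_of_nonneg_right (by positivity)), ?_⟩
  refine le_trans ?_ (le_add_of_nonneg_left hD0)
  refine (abs_add_le _ _).trans (add_le_add p1 ?_)
  rw [abs_mul, abs_of_pos (by norm_num : (0 : ℝ) < 1 / 2)]
  exact mul_le_mul_of_nonneg_left p2 (by norm_num)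

lemma stronglyMeasurable_comp (h : IsItoSystem 𝓕 P Z M b a) {f : (Fin n → ℝ) → ℝ}
    (hf : Continuous f) (t : ℝ≥0) : StronglyMeasurable[𝓕 t] fun ω => f (fun k => Z k t ω) := by
  refine Measurable.stronglyMeasurable ?_
  exact hf.measurable.comp (@measurable_pi_lambda _ _ _ (𝓕 t) _ _
    fun k => ((h.contZ k).adapted t).measurable)

/-- The compensated process `φ(Z_t) - ∫₀ᵗ`. -/
noncomputable def comp (φ : (Fin n → ℝ) → ℝ) (Z b : Fin n → ℝ≥0 → Ω → ℝ)
    (a : Fin n → Fin n → ℝ≥0 → Ω → ℝ) (t : ℝ≥0) (ω : Ω) : ℝ :=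
  φ (fun k => Z k t ω) - timeInt (proc φ Z b a) t ω

lemma isBddContinuous_comp (h : IsItoSystem 𝓕 P Z M b a) (hφ : ContDiff ℝ 2 φ) :
    IsBddContinuous 𝓕 (comp φ Z b a) where
  adapted t := (h.stronglyMeasurable_comp hφ.continuous t).sub
    ((h.isStronglyProgressive_proc hφ).timeInt t)
  continuous ω := by
    refine (hφ.continuous.comp (continuous_path h.contZ ω)).sub ?_
    have : Continuous fun t : ℝ => ∫ r in (0 : ℝ)..t, proc φ Z b a r.toNNReal ω :=
      intervalIntegral.continuous_primitive
        (fun a b => h.intervalIntegrable_proc hφ ω a b) 0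
    exact this.comp NNReal.continuous_coe
  bdd T := by
    obtain ⟨K, hK0, hK⟩ := h.exists_proc_le hφ T
    refine ⟨K + K * T, fun t ht ω => ?_⟩
    refine (abs_sub _ _).trans (add_le_add (hK t ht ω).1 ?_)
    have := intervalIntegral.norm_integral_le_of_norm_le_const (a := 0) (b := t) (C := K)
      (f := fun r => proc φ Z b a r.toNNReal ω) (fun r hr => by
        rw [Set.uIoc_of_le t.coe_nonneg] at hr
        exact (hK _ ((Real.toNNReal_le_iff_le_coe.2 hr.2).trans ht) ω).2)
    rw [sub_zero, abs_of_nonneg t.coe_nonneg] at this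
    exact this.trans (mul_le_mul_of_nonneg_left (NNReal.coe_le_coe.2 ht) hK0)

/-- The martingale part of the discretized Itô formula on a cell. -/
noncomputable def cell (φ : (Fin n → ℝ) → ℝ) (Z M : Fin n → ℝ≥0 → Ω → ℝ)
    (a : Fin n → Fin n → ℝ≥0 → Ω → ℝ) (p q : ℝ≥0) (ω : Ω) : ℝ :=
  (∑ k, fderiv ℝ φ (fun i => Z i p ω) (Pi.single k 1) * (M k q ω - M k p ω)) +
    1 / 2 * ∑ k, ∑ l, fderiv ℝ (fderiv ℝ φ) (fun i => Z i p ω) (Pi.single k 1) (Pi.single l 1) *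
      ((M k q ω - M k p ω) * (M l q ω - M l p ω) -
        (timeInt (a k l) q ω - timeInt (a k l) p ω))

/-- The sum of the squared increments on a cell. -/
def sqIncr (M : Fin n → ℝ≥0 → Ω → ℝ) (p q : ℝ≥0) (ω : Ω) : ℝ := ∑ k, (M k q ω - M k p ω) ^ 2

lemma abs_comp_sub_cell_le (h : IsItoSystem 𝓕 P Z M b a) (hφ : ContDiff ℝ 2 φ) {p q t : ℝ≥0}
    (hpq : p ≤ q) (hqt : q ≤ t) {C θ : ℝ} (hC0 : 0 ≤ C) (ω : Ω) (hb : ∀ k r, |b k r ω| ≤ C)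
    (ha : ∀ k l r, |a k l r ω| ≤ C) (hD : ‖fderiv ℝ (fderiv ℝ φ) (fun k => Z k p ω)‖ ≤ C)
    (hs : IsSmallCell φ (fun r k => Z k r ω) (fun r k => M k r ω) C p q θ) :
    |comp φ Z b a q ω - comp φ Z b a p ω - cell φ Z M a p q ω| ≤
      θ * ((n * C + 2 * C ^ 2 + n ^ 2 * C + 2 * C ^ 2 * t) * (q - p) + 2 * sqIncr M p q ω) := by
  have hθ : 0 ≤ θ := (norm_nonneg _).trans hs.incr
  have hpq' : (p : ℝ) ≤ q := NNReal.coe_le_coe.2 hpq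
  have hmem : ∀ r ∈ Set.Icc (p : ℝ) q, r.toNNReal ∈ Set.Icc p q := fun r hr =>
    ⟨NNReal.le_toNNReal_of_coe_le hr.1, Real.toNNReal_le_iff_le_coe.2 hr.2⟩
  have key := abs_ito_cell_le hφ (continuous_path_toNNReal h.contZ ω) (p := p) (q := q) (T := t)
    (C := C) (θ := θ) (b := fun k r => b k r.toNNReal ω) (a := fun k l r => a k l r.toNNReal ω)
    (ΔM := fun k => M k q ω - M k p ω) hpq'
    (by have : (q : ℝ) ≤ t := NNReal.coe_le_coe.2 hqt
        linarith [p.coe_nonneg]) hC0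
    (fun k => (h.progb k).integrable_section ω _ _)
    (fun k l => (h.proga k l).integrable_section ω _ _)
    (fun k => by
      simp only [Real.toNNReal_coe]
      rw [← timeInt_sub (h.progb k), h.decomp k q ω, h.decomp k p ω]; ring)
    (fun k r => hb k _) (fun k l r => ha k l _) (by simpa only [Real.toNNReal_coe] using hD)
    (fun r hr => by simpa only [Real.toNNReal_coe] using hs.d1 _ (hmem r hr))
    (fun r hr => by simpa only [Real.toNNReal_coe] using hs.d2 _ (hmem r hr))
    (fun w hw => by
      simp only [Real.toNNReal_coe] at hw ⊢
      exact hs.d3 w hw)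
    hs.incr hs.time
  simp only [Real.toNNReal_coe] at key
  -- The norm on `Fin n → ℝ` is the maximum norm, which is at most the Euclidean one.
  have hsq : ‖fun k => M k q ω - M k p ω‖ ^ 2 ≤ sqIncr M p q ω := by
    have h0 : 0 ≤ sqIncr M p q ω := Finset.sum_nonneg fun k _ => sq_nonneg _
    rw [← Real.sq_sqrt h0]
    refine pow_le_pow_left₀ (norm_nonneg _) ?_ 2
    refine (pi_norm_le_iff_of_nonneg (Real.sqrt_nonneg _)).2 fun k => ?_
    refine Real.abs_le_sqrt ?_
    exact Finset.single_le_sum (f := fun k => (M k q ω - M k p ω) ^ 2) (fun _ _ => sq_nonneg _)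
      (Finset.mem_univ k)
  have e1 : timeInt (proc φ Z b a) q ω - timeInt (proc φ Z b a) p ω =
      ∫ r in (p : ℝ)..q, proc φ Z b a r.toNNReal ω := by
    unfold timeInt
    rw [intervalIntegral.integral_interval_sub_left]
    exacts [h.intervalIntegrable_proc hφ ω _ _, h.intervalIntegrable_proc hφ ω _ _]
  have e2 : comp φ Z b a q ω - comp φ Z b a p ω = φ (fun k => Z k q ω) - φ (fun k => Z k p ω) -
      ∫ r in (p : ℝ)..q, proc φ Z b a r.toNNReal ω := by
    rw [← e1]; unfold comp; ring
  rw [e2]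
  have e3 : cell φ Z M a p q ω =
      (∑ k, fderiv ℝ φ (fun k => Z k p ω) (Pi.single k 1) * (M k q ω - M k p ω)) +
      1 / 2 * ∑ k, ∑ l, fderiv ℝ (fderiv ℝ φ) (fun k => Z k p ω) (Pi.single k 1) (Pi.single l 1) *
        ((M k q ω - M k p ω) * (M l q ω - M l p ω) -
          ∫ r in (p : ℝ)..q, a k l r.toNNReal ω) := by
    unfold cell
    simp only [timeInt_sub (h.proga _ _)]
  rw [e3]
  refine key.trans (mul_le_mul_of_nonneg_left ?_ hθ)
  gcongr

variable [IsProbabilityMeasure P]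

/-- The derivatives are frozen at the left endpoint `p`, where they are bounded and known; they
multiply martingale increments and compensated products of such increments. -/
lemma condZero_cell (h : IsItoSystem 𝓕 P Z M b a) (hφ : ContDiff ℝ 2 φ) {p q : ℝ≥0}
    (hpq : p ≤ q) : Integrable (cell φ Z M a p q) P ∧ CondZero (𝓕 p) P (cell φ Z M a p q) := by
  obtain ⟨R, hR0, hR⟩ := exists_norm_le h.contZ p
  obtain ⟨D, hD0, hD⟩ := exists_fderiv_le hφ R
  have hb : ∀ ω, (fun k => Z k p ω) ∈ Metric.closedBall (0 : Fin n → ℝ) R := fun ω => by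
    rw [mem_closedBall_zero_iff]; exact hR p le_rfl ω
  have mul : ∀ {η f : Ω → ℝ}, StronglyMeasurable[𝓕 p] η → (∀ ω, |η ω| ≤ D) → Integrable f P →
      CondZero (𝓕 p) P f → Integrable (fun ω => η ω * f ω) P ∧
        CondZero (𝓕 p) P (fun ω => η ω * f ω) := fun hη hηD hf hc => by
    have hi := hf.bdd_mul ((hη.mono (𝓕.le p)).aestronglyMeasurable) (ae_of_all _ hηD)
    exact ⟨hi, hc.mul (𝓕.le p) hf hη.aestronglyMeasurable hi⟩
  have h1 := fun k => mul
    (h.stronglyMeasurable_comp (f := fun z => fderiv ℝ φ z (Pi.single k 1))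
      ((hφ.continuous_fderiv (by norm_num)).clm_apply continuous_const) p)
    (fun ω => (abs_apply_single_le _ k).trans (hD _ (hb ω)).2.1)
    ((h.mart k).integrable_sub p q) ((h.mart k).mart p q hpq)
  have h2 := fun k l => mul
    (h.stronglyMeasurable_comp
      (f := fun z => fderiv ℝ (fderiv ℝ φ) z (Pi.single k 1) (Pi.single l 1))
      (((continuous_fderiv_fderiv hφ).clm_apply continuous_const).clm_apply continuous_const) p)
    (fun ω => (abs_apply_single_single_le _ k l).trans (hD _ (hb ω)).2.2)
    ((h.bracket k l).integrable_cond (h.mart k) (h.mart l) p q) ((h.bracket k l).cond p q hpq)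
  have I1 := integrable_finsetSum (μ := P) Finset.univ fun k _ => (h1 k).1
  have I2 := fun k => integrable_finsetSum (μ := P) Finset.univ fun l _ => (h2 k l).1
  have I3 := integrable_finsetSum (μ := P) Finset.univ fun k _ => I2 k
  have C1 := condZero_sum Finset.univ (fun k _ => (h1 k).1) fun k _ => (h1 k).2
  have C2 := fun k => condZero_sum Finset.univ (fun l _ => (h2 k l).1) fun l _ => (h2 k l).2
  have C3 := condZero_sum Finset.univ (fun k _ => I2 k) fun k _ => C2 k
  exact ⟨I1.add (I3.const_mul _), CondZero.add I1 (I3.const_mul _) C1 (C3.const_mul _)⟩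

/-- Given `𝓕 p`, a squared increment has the same conditional expectation as the increment of the
bracket, whose density is at most `C`. Testing against `η` covers both hypotheses of
`integral_sq_sum_le`. -/
lemma integral_mul_sqIncr_le (h : IsItoSystem 𝓕 P Z M b a) {p q : ℝ≥0}
    (hpq : p ≤ q) {C : ℝ} (ha : ∀ k l r ω, |a k l r ω| ≤ C) {η : Ω → ℝ}
    (hη : StronglyMeasurable[𝓕 p] η) (hη0 : ∀ ω, 0 ≤ η ω) {K : ℝ} (hηK : ∀ ω, η ω ≤ K) :
    ∫ ω, η ω * sqIncr M p q ω ∂P ≤ n * C * (q - p) * ∫ ω, η ω ∂P := by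
  have hηb : ∀ ω, ‖η ω‖ ≤ K := fun ω => by
    rw [Real.norm_eq_abs, abs_of_nonneg (hη0 ω)]; exact hηK ω
  have hηm : AEStronglyMeasurable η P := (hη.mono (𝓕.le p)).aestronglyMeasurable
  have hηi : Integrable η P := Integrable.of_bound hηm K (ae_of_all _ hηb)
  have I1 : ∀ k, Integrable (fun ω => η ω * (M k q ω - M k p ω) ^ 2) P := fun k =>
    ((h.mart k).memLp_sub p q).integrable_sq.bdd_mul hηm (ae_of_all _ hηb)
  have key : ∀ k, ∫ ω, η ω * (M k q ω - M k p ω) ^ 2 ∂P ≤ C * (q - p) * ∫ ω, η ω ∂P := by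
    intro k
    have c := (h.bracket k k).cond p q hpq
    have ci := (h.bracket k k).integrable_cond (h.mart k) (h.mart k) p q
    have := c.integral_mul_eq_zero (𝓕.le p) ci hη.aestronglyMeasurable
      (ci.bdd_mul hηm (ae_of_all _ hηb))
    have I2 : Integrable (fun ω => η ω * (timeInt (a k k) q ω - timeInt (a k k) p ω)) P :=
      (((h.bracket k k).integrable q).sub ((h.bracket k k).integrable p)).bdd_mul hηm
        (ae_of_all _ hηb)
    have e : ∀ ω, η ω * ((M k q ω - M k p ω) * (M k q ω - M k p ω) -
        (timeInt (a k k) q ω - timeInt (a k k) p ω)) = η ω * (M k q ω - M k p ω) ^ 2 -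
        η ω * (timeInt (a k k) q ω - timeInt (a k k) p ω) := fun ω => by ring
    simp only [e] at this
    rw [integral_sub (I1 k) I2, sub_eq_zero] at this
    rw [this, ← integral_const_mul]
    refine integral_mono I2 (hηi.const_mul _) fun ω => ?_
    simp only
    rw [mul_comm]
    refine mul_le_mul_of_nonneg_right ?_ (hη0 ω)
    exact (le_abs_self _).trans
      (abs_timeInt_sub_le (h.proga k k) hpq ω fun r _ _ => ha k k r ω)
  unfold sqIncr
  simp only [Finset.mul_sum]
  rw [integral_finsetSum _ fun k _ => I1 k]
  refine (Finset.sum_le_sum fun k _ => key k).trans (le_of_eq ?_)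
  simp; ring

/-- **Itô's formula.** -/
theorem condZero_comp (h : IsItoSystem 𝓕 P Z M b a) (hφ : ContDiff ℝ 2 φ) {s t : ℝ≥0}
    (hst : s ≤ t) : CondZero (𝓕 s) P fun ω => comp φ Z b a t ω - comp φ Z b a s ω := by
  obtain ⟨R, hR0, hR⟩ := exists_norm_le h.contZ t
  obtain ⟨D, hD0, hD⟩ := exists_fderiv_le hφ R
  obtain ⟨DM, hDM0, hDM⟩ := exists_norm_le h.contM t
  obtain ⟨Cb, hCb0, hCb⟩ := exists_bddProg_le h.progb
  obtain ⟨Ca, hCa0, hCa⟩ := exists_bddProg_le (c := fun p : Fin n × Fin n => a p.1 p.2)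
    (fun p => h.proga p.1 p.2)
  -- One constant dominating the second derivative of `φ` on the ball, the drifts and the bracket
  -- densities.
  set C := D + Cb + Ca with hC
  have hC0 : 0 ≤ C := by positivity
  have hbC : ∀ k r ω, |b k r ω| ≤ C := fun k r ω => (hCb k r ω).trans (by linarith)
  have haC : ∀ k l r ω, |a k l r ω| ≤ C := fun k l r ω => (hCa (k, l) r ω).trans (by linarith)
  have hball : ∀ r ≤ t, ∀ ω, (fun k => Z k r ω) ∈ Metric.closedBall (0 : Fin n → ℝ) R :=
    fun r hr ω => by rw [mem_closedBall_zero_iff]; exact hR r hr ω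
  have hDC : ∀ r ≤ t, ∀ ω, ‖fderiv ℝ (fderiv ℝ φ) (fun k => Z k r ω)‖ ≤ C := fun r hr ω =>
    ((hD _ (hball r hr ω)).2.2).trans (by linarith)
  set g : ℕ → ℕ → ℝ≥0 := fun m j => grid s t (m + 1) j with hg
  have hgm : ∀ m, Monotone (g m) := fun m => grid_mono s t (m + 1)
  have hgt : ∀ m, ∀ j ≤ m + 1, g m j ≤ t := fun m j hj => grid_le hst hj
  have hsg : ∀ m j, s ≤ g m j := fun m j => le_grid _ _ _ _
  set Fm : ℕ → Ω → ℝ := fun m ω => ∑ j ∈ Finset.range (m + 1), cell φ Z M a (g m j) (g m (j + 1)) ω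
    with hFm
  set S : ℕ → Ω → ℝ := fun m ω => ∑ j ∈ Finset.range (m + 1), sqIncr M (g m j) (g m (j + 1)) ω
    with hS
  have hcell := fun m j => h.condZero_cell hφ (hgm m (Nat.le_succ j))
  have hFi : ∀ m, Integrable (Fm m) P := fun m =>
    integrable_finsetSum _ fun j _ => (hcell m j).1
  have hcomp := h.isBddContinuous_comp hφ
  have hfi : Integrable (fun ω => comp φ Z b a t ω - comp φ Z b a s ω) P :=
    (hcomp.integrable t).sub (hcomp.integrable s)
  refine CondZero.of_tendsto_L1 (F := Fm) (fun m => ?_) hFi hfi ?_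
  · exact condZero_sum _ (fun j _ => (hcell m j).1) fun j _ => (hcell m j).2.mono (𝓕.mono (hsg m j))
  have hsq0 : ∀ p q ω, 0 ≤ sqIncr M p q ω := fun p q ω => Finset.sum_nonneg fun k _ => sq_nonneg _
  have hS0 : ∀ m ω, 0 ≤ S m ω := fun m ω => Finset.sum_nonneg fun j _ => hsq0 _ _ _
  have hsqm : ∀ p q r, p ≤ r → q ≤ r → StronglyMeasurable[𝓕 r] (sqIncr M p q) := fun p q r hp hq =>
    Finset.stronglyMeasurable_fun_sum _ fun k _ =>
      ((((h.contM k).adapted q).mono (𝓕.mono hq)).sub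
        (((h.contM k).adapted p).mono (𝓕.mono hp))).pow 2
  have hsqb : ∀ p ≤ t, ∀ q ≤ t, ∀ ω, sqIncr M p q ω ≤ n * (2 * DM) ^ 2 := fun p hp q hq ω => by
    refine (Finset.sum_le_sum (g := fun _ => (2 * DM) ^ 2) fun k _ => ?_).trans (by simp)
    refine sq_le_sq' ?_ ?_
    all_goals
      have h1 := abs_le.1 ((norm_le_pi_norm (fun k => M k p ω) k).trans (hDM p hp ω))
      have h2 := abs_le.1 ((norm_le_pi_norm (fun k => M k q ω) k).trans (hDM q hq ω))
      linarith [h1.1, h1.2, h2.1, h2.2]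
  have hlen : ∀ m j, (g m (j + 1) : ℝ) - g m j = ((t : ℝ) - s) / ((m + 1 : ℕ) : ℝ) := fun m j =>
    coe_grid_succ_sub s t hst (m + 1) j
  have hts : 0 ≤ (t : ℝ) - s := sub_nonneg.2 (NNReal.coe_le_coe.2 hst)
  set L := n * C + 2 * C ^ 2 + n ^ 2 * C + 2 * C ^ 2 * t with hL
  have hL0 : 0 ≤ L := by positivity
  -- The errors of the cells are added up: the lengths telescope to `t - s`, and the squared
  -- increments add up to `S m`.
  have hEbound : ∀ m ω θ, 0 ≤ θ → (∀ j < m + 1, IsSmallCell φ (fun r k => Z k r ω)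
      (fun r k => M k r ω) C (g m j) (g m (j + 1)) θ) →
      |Fm m ω - (comp φ Z b a t ω - comp φ Z b a s ω)| ≤
        θ * (L * (t - s) + 2) * (1 + S m ω) := by
    intro m ω θ hθ hsm
    have e1 : comp φ Z b a t ω - comp φ Z b a s ω = ∑ j ∈ Finset.range (m + 1),
        (comp φ Z b a (g m (j + 1)) ω - comp φ Z b a (g m j) ω) := by
      rw [Finset.sum_range_sub (fun j => comp φ Z b a (g m j) ω)]
      simp only [hg, grid_last hst (Nat.succ_ne_zero m), grid_zero]
    rw [abs_sub_comm, e1, hFm]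
    simp only
    rw [← Finset.sum_sub_distrib]
    refine (Finset.abs_sum_le_sum_abs _ _).trans ?_
    refine (Finset.sum_le_sum fun j hj => h.abs_comp_sub_cell_le hφ (hgm m (Nat.le_succ j))
      (hgt m (j + 1) (Finset.mem_range.1 hj)) hC0 ω (fun k r => hbC k r ω)
      (fun k l r => haC k l r ω) (hDC _ (hgt m j (Finset.mem_range.1 hj).le) ω)
      (hsm j (Finset.mem_range.1 hj))).trans ?_
    rw [← hL, ← Finset.mul_sum, mul_assoc]
    refine mul_le_mul_of_nonneg_left ?_ hθ
    rw [Finset.sum_add_distrib, ← Finset.mul_sum, ← Finset.mul_sum]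
    have e2 : ∑ j ∈ Finset.range (m + 1), ((g m (j + 1) : ℝ) - g m j) = t - s := by
      rw [Finset.sum_range_sub (fun j => (g m j : ℝ))]
      simp only [hg, grid_last hst (Nat.succ_ne_zero m), grid_zero]
    rw [e2]
    have h1 : 0 ≤ L * (t - s) * S m ω := mul_nonneg (mul_nonneg hL0 hts) (hS0 m ω)
    have h2 : ∑ j ∈ Finset.range (m + 1), sqIncr M (g m j) (g m (j + 1)) ω = S m ω := rfl
    rw [h2]
    nlinarith
  have hK0 : 0 ≤ L * (t - s) + 2 := by positivity
  -- `θ₀` comes from the uniform bound of `isSmallCell_of_bounds`. The constant `C` is the bound of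
  -- `integral_sq_sum_le` with `c = n C (t - s) / (m + 1)` and `m + 1` cells, where each sum of
  -- squared increments is at most `K = n (2 DM)²`.
  refine tendsto_integral_abs_of_ratio (S := S) (θ₀ := (2 * (D + DM) + C * t) * (L * (t - s) + 2))
    (C := 2 * (n * C * (t - s)) ^ 2 + n * (2 * DM) ^ 2 * (n * C * (t - s)))
    (fun m => ((hFi m).1.sub hfi.1)) (fun m => ?_) hS0 (fun m => ?_) (fun m ω => ?_)
    (fun ω θ hθ => ?_)
  · refine memLp_finsetSum _ fun j hj => ?_
    have hj' := Finset.mem_range.1 hj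
    refine MemLp.of_bound ((hsqm _ _ t (hgt m j hj'.le) (hgt m (j + 1) hj')).mono
      (𝓕.le t)).aestronglyMeasurable (n * (2 * DM) ^ 2) (ae_of_all _ fun ω => ?_)
    rw [Real.norm_eq_abs, abs_of_nonneg (hsq0 _ _ _)]
    exact hsqb _ (hgt m j hj'.le) _ (hgt m (j + 1) hj') ω
  · have hlen' : ∀ j, n * C * ((g m (j + 1) : ℝ) - g m j) =
        n * C * (((t : ℝ) - s) / ((m + 1 : ℕ) : ℝ)) := fun j => by rw [hlen]
    have := integral_sq_sum_le (P := P) (m := m + 1) (K := n * (2 * DM) ^ 2)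
      (c := n * C * (((t : ℝ) - s) / ((m + 1 : ℕ) : ℝ)))
      (Q := fun j => sqIncr M (g m j) (g m (j + 1))) (by positivity)
      (fun j => ((hsqm _ _ (g m (j + 1)) (hgm m (Nat.le_succ j)) le_rfl).mono
          (𝓕.le _)).aestronglyMeasurable)
      (fun j ω => hsq0 _ _ _)
      (fun j hj ω => hsqb _ (hgt m j hj.le) _ (hgt m (j + 1) hj) ω)
      (fun j hj => by
        have := h.integral_mul_sqIncr_le (hgm m (Nat.le_succ j)) haC (η := fun _ => 1)
          stronglyMeasurable_const (fun _ => zero_le_one) (K := 1) (fun _ => le_rfl)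
        simp only [one_mul, integral_const, probReal_univ, smul_eq_mul, mul_one] at this
        rwa [hlen'] at this)
      (fun j hj => by
        have := h.integral_mul_sqIncr_le (hgm m (Nat.le_succ j)) haC
          (η := fun ω => ∑ i ∈ Finset.range j, sqIncr M (g m i) (g m (i + 1)) ω)
          (Finset.stronglyMeasurable_fun_sum _ fun i hi => hsqm _ _ _
            (hgm m (Finset.mem_range.1 hi).le) (hgm m (Finset.mem_range.1 hi)))
          (fun ω => Finset.sum_nonneg fun i _ => hsq0 _ _ _)
          (K := ∑ i ∈ Finset.range j, (n : ℝ) * (2 * DM) ^ 2)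
          (fun ω => Finset.sum_le_sum fun i hi => hsqb _
            (hgt m i ((Finset.mem_range.1 hi).trans hj).le) _
            (hgt m (i + 1) ((Finset.mem_range.1 hi).trans hj)) ω)
        rwa [hlen'] at this)
    refine this.trans (le_of_eq ?_)
    have e : n * C * (((t : ℝ) - s) / ((m + 1 : ℕ) : ℝ)) * ((m + 1 : ℕ) : ℝ) = n * C * (t - s) := by
      have : ((m + 1 : ℕ) : ℝ) ≠ 0 := by positivity
      field_simp
    rw [e]
  · refine hEbound m ω _ (by positivity) fun j hj => isSmallCell_of_bounds hC0
      (fun r hr => hR r hr ω) (D := D + DM) (fun w hw => (hD w hw).2.1.trans (by linarith))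
      (fun w hw => (hD w hw).2.2.trans (by linarith))
      (fun r hr => (hDM r hr ω).trans (by linarith)) (hgm m (Nat.le_succ j)) (hgt m (j + 1) hj)
  · have hK : 0 < L * (t - s) + 2 := by positivity
    filter_upwards [eventually_isSmallCell hφ (continuous_path h.contZ ω)
      (continuous_path h.contM ω) C hst (fun r hr => hR r hr ω)
      (θ := θ / (L * (t - s) + 2)) (by positivity)] with m hm
    refine (hEbound m ω _ (by positivity) hm).trans (le_of_eq ?_)
    rw [div_mul_cancel₀ _ hK.ne']

end IsItoSystem

/-! ### Lenglart's inequality -/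

section Lenglart

/-- No increment is counted once `v` has reached `δ`, and the last counted one adds at most `h`. -/
lemma sum_ite_lt_le {v : ℕ → ℝ} (hv : Monotone v) (hv0 : v 0 = 0) {h δ : ℝ} (hδ : 0 < δ)
    (hh : 0 ≤ h) (hvh : ∀ j, v (j + 1) ≤ v j + h) (k : ℕ) :
    ∑ j ∈ Finset.range k, (if v j < δ then (1 : ℝ) else 0) * (v (j + 1) - v j) ≤ δ + h := by
  have key : ∀ k, ∑ j ∈ Finset.range k, (if v j < δ then (1 : ℝ) else 0) * (v (j + 1) - v j) ≤ v k ∧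
      ∑ j ∈ Finset.range k, (if v j < δ then (1 : ℝ) else 0) * (v (j + 1) - v j) ≤ δ + h := by
    intro k
    induction k with
    | zero => simp only [Finset.range_zero, Finset.sum_empty, hv0]; exact ⟨le_rfl, by positivity⟩
    | succ k ih =>
      rw [Finset.sum_range_succ]
      have hm := hv (Nat.le_succ k)
      by_cases hk : v k < δ
      · rw [if_pos hk]
        have := hvh k
        exact ⟨by linarith [ih.1], by linarith [ih.1]⟩
      · rw [if_neg hk]
        have e : (0 : ℝ) * (v (k + 1) - v k) = 0 := zero_mul _
        rw [e, add_zero]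
        exact ⟨ih.1.trans hm, ih.2⟩
  exact (key k).2

lemma aestronglyMeasurable_sum_of_forall {m : MeasurableSpace Ω} {ι : Type*} (s : Finset ι)
    {f : ι → Ω → ℝ} (h : ∀ i ∈ s, AEStronglyMeasurable[m] (f i) P) :
    AEStronglyMeasurable[m] (fun ω => ∑ i ∈ s, f i ω) P := by
  classical
  induction s using Finset.induction_on with
  | empty => simpa using aestronglyMeasurable_const
  | insert i s hi ih =>
    simp only [Finset.sum_insert hi]
    exact (h i (Finset.mem_insert_self i s)).add
      (ih fun j hj => h j (Finset.mem_insert_of_mem hj))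

/-- **Lenglart's inequality** at a fixed time. -/
theorem L2Mart.lenglart [IsProbabilityMeasure P] {N : ℝ≥0 → Ω → ℝ} {c : ℝ≥0 → Ω → ℝ}
    (hN : L2Mart 𝓕 P N) (hc : IsBoundedProg 𝓕 c) (hc0 : ∀ r ω, 0 ≤ c r ω)
    (hb : BracketPair 𝓕 P N N (timeInt c)) (t : ℝ≥0) {ε δ : ℝ} (hε : 0 < ε) (hδ : 0 < δ) :
    P.real {ω | ε ≤ |N t ω - N 0 ω| ∧ timeInt c t ω < δ} ≤ δ / ε ^ 2 := by
  obtain ⟨C, hC⟩ := hc.bdd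
  have hC0 : 0 ≤ C := by
    obtain ⟨ω⟩ : Nonempty Ω := P.nonempty_of_neZero
    exact (norm_nonneg _).trans (hC 0 ω)
  have hmono : ∀ ω, Monotone fun r => timeInt c r ω := fun ω p q hpq => by
    have := timeInt_sub hc p q ω
    have h0 : 0 ≤ ∫ r in (p : ℝ)..q, c r.toNNReal ω :=
      intervalIntegral.integral_nonneg (NNReal.coe_le_coe.2 hpq) fun r _ => hc0 _ _
    simp only
    linarith
  have hVm : ∀ r, StronglyMeasurable[𝓕 r] (timeInt c r) := fun r => hc.prog.timeInt r
  have main : ∀ m : ℕ, P.real {ω | ε ≤ |N t ω - N 0 ω| ∧ timeInt c t ω < δ} ≤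
      (δ + C * (t / ((m + 1 : ℕ) : ℝ))) / ε ^ 2 := by
    intro m
    set g : ℕ → ℝ≥0 := grid 0 t (m + 1) with hg
    have hgm : Monotone g := grid_mono _ _ _
    have hg0 : g 0 = 0 := grid_zero _ _ _
    have hgl : g (m + 1) = t := grid_last zero_le (Nat.succ_ne_zero m)
    have hgs : ∀ j, (g (j + 1) : ℝ) - g j = t / ((m + 1 : ℕ) : ℝ) := fun j => by
      have := coe_grid_succ_sub 0 t zero_le (m + 1) j
      simpa using this
    -- The martingale is frozen at the first grid point at which the bracket has reached `δ`. The
    -- frozen process `D` has second moment at most `δ` plus the growth of the bracket over one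
    -- cell, and it equals `N t - N 0` when the bracket stays below `δ`. Chebyshev's inequality and
    -- a refinement of the grid finish the proof.
    set η : ℕ → Ω → ℝ := fun j ω => if timeInt c (g j) ω < δ then 1 else 0 with hη
    have hηm : ∀ j, StronglyMeasurable[𝓕 (g j)] (η j) := fun j =>
      StronglyMeasurable.ite (measurableSet_lt (hVm (g j)).measurable measurable_const)
        stronglyMeasurable_const stronglyMeasurable_const
    have hη1 : ∀ j ω, |η j ω| ≤ 1 := fun j ω => abs_ite_one_le _
    have hηsq : ∀ j ω, η j ω ^ 2 = η j ω := fun j ω => by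
      simp only [hη]; split_ifs <;> simp
    set D : ℕ → Ω → ℝ := fun k ω => ∑ j ∈ Finset.range k, η j ω * (N (g (j + 1)) ω - N (g j) ω)
      with hD
    have hterm : ∀ j, MemLp (fun ω => η j ω * (N (g (j + 1)) ω - N (g j) ω)) 2 P := fun j =>
      (hN.memLp_sub (g j) (g (j + 1))).bdd_mul_two ((hηm j).mono (𝓕.le _)).aestronglyMeasurable
        (hη1 j)
    have hDL : ∀ k, MemLp (D k) 2 P := fun k => memLp_finsetSum _ fun j _ => hterm j
    have hDm : ∀ k, AEStronglyMeasurable[𝓕 (g k)] (D k) P := fun k =>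
      aestronglyMeasurable_sum_of_forall (m := 𝓕 (g k)) (Finset.range k)
        (f := fun j ω => η j ω * (N (g (j + 1)) ω - N (g j) ω)) fun j hj =>
        (((hηm j).mono (𝓕.mono (hgm (Finset.mem_range.1 hj).le))).aestronglyMeasurable).mul
          (hN.adapted_sub (s := g j) (t := g (j + 1)) (hgm (Finset.mem_range.1 hj).le)
            (hgm (Finset.mem_range.1 hj)))
    have hVi : ∀ j, Integrable (fun ω => η j ω * (timeInt c (g (j + 1)) ω - timeInt c (g j) ω)) P :=
      fun j => ((hb.integrable _).sub (hb.integrable _)).bdd_mul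
        ((hηm j).mono (𝓕.le _)).aestronglyMeasurable (ae_of_all _ (hη1 j))
    -- The isometry, cell by cell: mixed terms vanish by the martingale property and squares become
    -- bracket increments.
    have hED : ∀ k, ∫ ω, D k ω ^ 2 ∂P = ∫ ω, ∑ j ∈ Finset.range k,
        η j ω * (timeInt c (g (j + 1)) ω - timeInt c (g j) ω) ∂P := by
      intro k
      induction k with
      | zero => simp [hD]
      | succ k ih =>
        have i1 : Integrable (fun ω => D k ω ^ 2) P := (hDL k).integrable_sq
        have i2 : Integrable (fun ω => η k ω * D k ω * (N (g (k + 1)) ω - N (g k) ω)) P :=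
          ((hDL k).bdd_mul_two ((hηm k).mono (𝓕.le _)).aestronglyMeasurable
            (hη1 k)).integrable_mul (hN.memLp_sub (g k) (g (k + 1)))
        have i3 : Integrable (fun ω => η k ω * (N (g (k + 1)) ω - N (g k) ω) ^ 2) P :=
          (hN.memLp_sub (g k) (g (k + 1))).integrable_sq.bdd_mul
            ((hηm k).mono (𝓕.le _)).aestronglyMeasurable (ae_of_all _ (hη1 k))
        have e : ∀ ω, D (k + 1) ω ^ 2 = D k ω ^ 2 +
            2 * (η k ω * D k ω * (N (g (k + 1)) ω - N (g k) ω)) +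
            η k ω * (N (g (k + 1)) ω - N (g k) ω) ^ 2 := fun ω => by
          have : D (k + 1) ω = D k ω + η k ω * (N (g (k + 1)) ω - N (g k) ω) :=
            Finset.sum_range_succ _ _
          rw [this, add_sq, mul_pow, hηsq]; ring
        have z2 : ∫ ω, η k ω * D k ω * (N (g (k + 1)) ω - N (g k) ω) ∂P = 0 := by
          have := hN.condZero_mul_future (hgm (Nat.le_succ k))
            ((hDL k).bdd_mul_two ((hηm k).mono (𝓕.le _)).aestronglyMeasurable (hη1 k))
            ((hηm k).aestronglyMeasurable.mul (hDm k)) Set.univ MeasurableSet.univ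
          simpa using this
        have z3 : ∫ ω, η k ω * (N (g (k + 1)) ω - N (g k) ω) ^ 2 ∂P =
            ∫ ω, η k ω * (timeInt c (g (k + 1)) ω - timeInt c (g k) ω) ∂P := by
          have ci := hb.integrable_cond hN hN (g k) (g (k + 1))
          have := (hb.cond _ _ (hgm (Nat.le_succ k))).integral_mul_eq_zero (𝓕.le _) ci
            (hηm k).aestronglyMeasurable (ci.bdd_mul
              ((hηm k).mono (𝓕.le _)).aestronglyMeasurable (ae_of_all _ (hη1 k)))
          have e' : ∀ ω, η k ω * ((N (g (k + 1)) ω - N (g k) ω) * (N (g (k + 1)) ω - N (g k) ω) -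
              (timeInt c (g (k + 1)) ω - timeInt c (g k) ω)) =
              η k ω * (N (g (k + 1)) ω - N (g k) ω) ^ 2 -
              η k ω * (timeInt c (g (k + 1)) ω - timeInt c (g k) ω) := fun ω => by ring
          simp only [Nat.succ_eq_add_one, e'] at this
          rwa [integral_sub i3 (hVi k), sub_eq_zero] at this
        simp only [e, Finset.sum_range_succ]
        have i12 : Integrable (fun ω => D k ω ^ 2 +
            2 * (η k ω * D k ω * (N (g (k + 1)) ω - N (g k) ω))) P := i1.add (i2.const_mul 2)
        rw [integral_add i12 i3, integral_add i1 (i2.const_mul 2), integral_const_mul,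
          z2, z3, ih, integral_add (integrable_finsetSum _ fun j _ => hVi j) (hVi k)]
        ring
    have hEb : ∫ ω, D (m + 1) ω ^ 2 ∂P ≤ δ + C * (t / ((m + 1 : ℕ) : ℝ)) := by
      rw [hED]
      have : ∫ _ω, δ + C * (t / ((m + 1 : ℕ) : ℝ)) ∂P = δ + C * (t / ((m + 1 : ℕ) : ℝ)) := by simp
      rw [← this]
      refine integral_mono (integrable_finsetSum _ fun j _ => hVi j) (integrable_const _)
        fun ω => ?_
      refine sum_ite_lt_le (v := fun j => timeInt c (g j) ω) ((hmono ω).comp hgm)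
        (by simp only [hg0, timeInt_zero]) hδ (by positivity) (fun j => ?_) _
      have := abs_timeInt_sub_le hc (hgm (Nat.le_succ j)) ω fun r _ _ => hC r ω
      rw [Nat.succ_eq_add_one, hgs] at this
      linarith [le_abs_self (timeInt c (g (j + 1)) ω - timeInt c (g j) ω)]
    have hmk : P.real {ω | ε ^ 2 ≤ D (m + 1) ω ^ 2} ≤
        (δ + C * (t / ((m + 1 : ℕ) : ℝ))) / ε ^ 2 := by
      have := mul_meas_ge_le_integral_of_nonneg (μ := P) (f := fun ω => D (m + 1) ω ^ 2)
        (ae_of_all _ fun ω => sq_nonneg _) (hDL _).integrable_sq (ε ^ 2)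
      rw [le_div_iff₀ (by positivity), mul_comm]
      exact this.trans hEb
    refine (measureReal_mono ?_).trans hmk
    rintro ω ⟨hω, hV⟩
    have hDe : D (m + 1) ω = N t ω - N 0 ω := by
      have : ∀ j ∈ Finset.range (m + 1), η j ω * (N (g (j + 1)) ω - N (g j) ω) =
          N (g (j + 1)) ω - N (g j) ω := fun j hj => by
        have : timeInt c (g j) ω < δ :=
          (hmono ω (by rw [← hgl]; exact hgm (Finset.mem_range.1 hj).le)).trans_lt hV
        simp only [hη, if_pos this, one_mul]
      simp only [hD]
      rw [Finset.sum_congr rfl this, Finset.sum_range_sub (fun j => N (g j) ω), hg0, hgl]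
    change ε ^ 2 ≤ D (m + 1) ω ^ 2
    rw [hDe, ← sq_abs (N t ω - N 0 ω)]
    exact pow_le_pow_left₀ hε.le hω 2
  have hlim : Tendsto (fun m : ℕ => (t : ℝ) / ((m + 1 : ℕ) : ℝ)) atTop (𝓝 0) :=
    (tendsto_const_div_atTop_nhds_zero_nat _).comp (tendsto_add_atTop_nat 1)
  simpa using ge_of_tendsto' (((hlim.const_mul C).const_add δ).div_const (ε ^ 2)) main

end Lenglart

/-! ### Measurability on path space and exit times from balls -/

section PathSpace

/-- On a compact set, a path in `U` keeps a positive distance from the complement of `U`, and by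
continuity this lower bound need only be tested at countably many times. -/
lemma measurableSet_mapsTo_of_eval {Ω : Type*} {mΩ : MeasurableSpace Ω} {Y : Ω → C(ℝ≥0, E)}
    (hY : ∀ t, Measurable fun ω => Y ω t) {K : Set ℝ≥0} (hK : IsCompact K) {U : Set E}
    (hU : IsOpen U) : MeasurableSet {ω | Set.MapsTo (Y ω) K U} := by
  -- The distance to the empty set is zero by convention, so `U = E` is treated apart.
  rcases Set.eq_empty_or_nonempty Uᶜ with hUe | hUne
  · have : U = Set.univ := by simpa using hUe
    subst this
    convert MeasurableSet.univ using 1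
    ext ω; simp [Set.mapsTo_univ]
  obtain ⟨D, hDK, hDc, hKD⟩ :=
    (TopologicalSpace.IsSeparable.of_separableSpace K).exists_countable_dense_subset
  have : {ω | Set.MapsTo (Y ω) K U} =
      ⋃ n : ℕ, ⋂ d ∈ D, {ω | (1 : ℝ) / (n + 1) ≤ Metric.infDist (Y ω d) Uᶜ} := by
    ext ω
    simp only [Set.mem_iUnion, Set.mem_iInter]
    constructor
    · intro h
      rcases K.eq_empty_or_nonempty with rfl | hKne
      · exact ⟨0, fun d hd => absurd (hDK hd) (Set.notMem_empty d)⟩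
      obtain ⟨x, hx, hmin⟩ := hK.exists_isMinOn hKne
        ((Metric.continuous_infDist_pt Uᶜ).comp (Y ω).continuous).continuousOn
      have hpos : 0 < Metric.infDist (Y ω x) Uᶜ := by
        rw [← hU.isClosed_compl.notMem_iff_infDist_pos hUne]
        exact fun h' => h' (h hx)
      obtain ⟨n, hn⟩ := exists_nat_one_div_lt hpos
      exact ⟨n, fun d hd => hn.le.trans (hmin (hDK hd))⟩
    · rintro ⟨n, hn⟩ x hx
      have hcl : IsClosed {r : ℝ≥0 | (1 : ℝ) / (n + 1) ≤ Metric.infDist (Y ω r) Uᶜ} :=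
        isClosed_le continuous_const ((Metric.continuous_infDist_pt Uᶜ).comp (Y ω).continuous)
      have h1 : x ∈ {r : ℝ≥0 | (1 : ℝ) / (n + 1) ≤ Metric.infDist (Y ω r) Uᶜ} :=
        hcl.closure_subset_iff.2 (fun d hd => hn d hd) (hKD hx)
      have h2 : 0 < Metric.infDist (Y ω x) Uᶜ := lt_of_lt_of_le (by positivity) h1
      rw [← hU.isClosed_compl.notMem_iff_infDist_pos hUne] at h2
      exact not_not.1 h2
  rw [this]
  refine MeasurableSet.iUnion fun n => MeasurableSet.biInter hDc fun d _ => ?_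
  exact measurableSet_le measurable_const
    ((Metric.continuous_infDist_pt Uᶜ).measurable.comp (hY d))

/-- A map into path space is measurable as soon as its evaluations are. -/
lemma measurable_path_of_eval {Ω : Type*} {mΩ : MeasurableSpace Ω} {Y : Ω → C(ℝ≥0, E)}
    (hY : ∀ t, Measurable fun ω => Y ω t) : Measurable Y := by
  have : SecondCountableTopology E := UniformSpace.secondCountable_of_separable E
  -- Path space is second countable, so the subbasic sets of the compact-open topology generate its
  -- Borel σ-algebra.
  have h : pathMeasurableSpace (E := E) = _ :=
    borel_eq_generateFrom_of_subbasis (ContinuousMap.compactOpen_eq (X := ℝ≥0) (Y := E))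
  rw [h]
  refine measurable_generateFrom ?_
  rintro _ ⟨K, hK, U, hU, rfl⟩
  exact measurableSet_mapsTo_of_eval hY hK hU

lemma measurable_eval_pathFiltration {s t : ℝ≥0} (hst : s ≤ t) :
    Measurable[pathFiltration E t] fun x : C(ℝ≥0, E) => x s :=
  Measurable.mono (comap_measurable _)
    (le_biSup (fun s => MeasurableSpace.comap (fun x : C(ℝ≥0, E) => x s) inferInstance) hst) le_rfl

lemma isStronglyProgressive_eval :
    IsStronglyProgressive (pathFiltration E) (fun t (x : C(ℝ≥0, E)) => x t) := by
  have : SecondCountableTopology E := UniformSpace.secondCountable_of_separable E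
  refine StronglyAdapted.isStronglyProgressive_of_continuous (fun t => ?_) fun x => x.continuous
  exact (measurable_eval_pathFiltration le_rfl).stronglyMeasurable

/-- The first time the path leaves the open ball of radius `R`. -/
noncomputable def hit (R : ℝ) (x : C(ℝ≥0, E)) : WithTop ℝ≥0 :=
  sInf ((fun t : ℝ≥0 => (t : WithTop ℝ≥0)) '' {t | R ≤ ‖x t‖})

lemma hit_le {R : ℝ} {x : C(ℝ≥0, E)} {t : ℝ≥0} (h : R ≤ ‖x t‖) : hit R x ≤ t :=
  sInf_le ⟨t, h, rfl⟩

/-- A path that is strictly inside the ball throughout the closed interval `[0,t]` stays inside a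
little longer, which makes the inequality for the exit time strict. -/
lemma lt_hit_iff {R : ℝ} {x : C(ℝ≥0, E)} {t : ℝ≥0} :
    (t : WithTop ℝ≥0) < hit R x ↔ ∀ r ≤ t, ‖x r‖ < R := by
  constructor
  · intro h r hr
    by_contra hR
    exact absurd ((hit_le (not_lt.1 hR)).trans (WithTop.coe_le_coe.2 hr)) (not_le.2 h)
  · intro h
    have hev : ∀ᶠ r in 𝓝 t, ‖x r‖ < R :=
      (x.continuous.norm.tendsto t).eventually_lt_const (h t le_rfl)
    obtain ⟨δ, hδ, hball⟩ := Metric.eventually_nhds_iff.1 hev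
    set t' : ℝ≥0 := t + (δ / 2).toNNReal with ht'
    have hδ2 : 0 < (δ / 2).toNNReal := Real.toNNReal_pos.2 (by positivity)
    have htt : t < t' := lt_add_of_pos_right _ hδ2
    have h' : ∀ r < t', ‖x r‖ < R := fun r hr => by
      rcases le_total r t with hrt | hrt
      · exact h r hrt
      · refine hball ?_
        rw [NNReal.dist_eq, abs_of_nonneg (sub_nonneg.2 (NNReal.coe_le_coe.2 hrt))]
        have : (r : ℝ) < t + δ / 2 := by
          have := NNReal.coe_lt_coe.2 hr
          rwa [ht', NNReal.coe_add, Real.coe_toNNReal _ (by positivity)] at this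
        linarith
    refine lt_of_lt_of_le (WithTop.coe_lt_coe.2 htt) (le_sInf ?_)
    rintro _ ⟨r, hr, rfl⟩
    refine WithTop.coe_le_coe.2 (not_lt.1 fun hlt => ?_)
    exact absurd (h' r hlt) (not_lt.2 hr)

/-- The maximum of the norm over `[0,t]` is attained, so a path that has not left the open ball by
time `t` stays below `R - 1/(n+1)` for some `n`, a condition on countably many times up to `t`.
Hence no right-continuity of the filtration is required. -/
lemma isStoppingTime_hit (R : ℝ) : IsStoppingTime (pathFiltration E) (hit (E := E) R) := by
  intro t
  rw [← MeasurableSet.compl_iff]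
  have : {x : C(ℝ≥0, E) | hit R x ≤ t}ᶜ = ⋃ n : ℕ, ⋂ k : ℕ,
      {x | ‖x (min (TopologicalSpace.denseSeq ℝ≥0 k) t)‖ ≤ R - 1 / (n + 1)} := by
    ext x
    have e : x ∈ {x : C(ℝ≥0, E) | hit R x ≤ t}ᶜ ↔ (t : WithTop ℝ≥0) < hit R x :=
      not_le (a := hit R x) (b := (t : WithTop ℝ≥0))
    rw [e, lt_hit_iff]
    simp only [Set.mem_iUnion, Set.mem_iInter]
    constructor
    · intro h
      obtain ⟨r0, hr0, hmax⟩ := (isCompact_Icc (a := (0 : ℝ≥0)) (b := t)).exists_isMaxOn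
        ⟨0, le_rfl, zero_le⟩ x.continuous.norm.continuousOn
      obtain ⟨n, hn⟩ := exists_nat_one_div_lt (sub_pos.2 (h r0 hr0.2))
      refine ⟨n, fun k => ?_⟩
      have : ‖x (min (TopologicalSpace.denseSeq ℝ≥0 k) t)‖ ≤ ‖x r0‖ :=
        hmax ⟨zero_le, min_le_right _ _⟩
      change ‖x (min (TopologicalSpace.denseSeq ℝ≥0 k) t)‖ ≤ R - 1 / (n + 1)
      linarith
    · rintro ⟨n, hn⟩ r hr
      have hcl : IsClosed {r : ℝ≥0 | ‖x (min r t)‖ ≤ R - 1 / (n + 1)} :=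
        isClosed_le (x.continuous.comp (continuous_id.min continuous_const)).norm continuous_const
      have h1 : r ∈ {r : ℝ≥0 | ‖x (min r t)‖ ≤ R - 1 / (n + 1)} :=
        hcl.closure_subset_iff.2 (by rintro _ ⟨k, rfl⟩; exact hn k)
          (TopologicalSpace.denseRange_denseSeq ℝ≥0 r)
      have h2 : ‖x (min r t)‖ ≤ R - 1 / (n + 1) := h1
      rw [min_eq_left hr] at h2
      have : (0 : ℝ) < 1 / ((n : ℝ) + 1) := by positivity
      linarith
  rw [this]
  refine MeasurableSet.iUnion fun n => MeasurableSet.iInter fun k => ?_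
  exact measurableSet_le
    (measurable_norm.comp (measurable_eval_pathFiltration (min_le_right _ _))) measurable_const

lemma hit_mono {R R' : ℝ} (h : R ≤ R') (x : C(ℝ≥0, E)) : hit R x ≤ hit R' x :=
  sInf_le_sInf (Set.image_mono fun _ ht => le_trans h ht)

lemma norm_lt_of_lt_hit {R : ℝ} {x : C(ℝ≥0, E)} {t : ℝ≥0} (h : (t : WithTop ℝ≥0) < hit R x) :
    ‖x t‖ < R := lt_hit_iff.1 h t le_rfl

/-- Strictly before the exit time the norm is below `R`; take the limit from the left. A path
starting outside the closed ball is stopped at once and violates the bound, whence the hypothesis on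
`x 0`. -/
lemma norm_stopAt_hit_le {R : ℝ} {x : C(ℝ≥0, E)} (h0 : ‖x 0‖ < R) (t : ℝ≥0) :
    ‖x (stopAt t (hit R x))‖ ≤ R := by
  have hcont : ContinuousWithinAt (fun r => ‖x r‖) (Set.Iio (stopAt t (hit R x)))
      (stopAt t (hit R x)) := x.continuous.norm.continuousWithinAt
  rcases eq_or_ne (stopAt t (hit R x)) 0 with h | h
  · rw [h]; exact h0.le
  · have hne : (𝓝[<] (stopAt t (hit R x))).NeBot :=
      nhdsWithin_Iio_neBot' ⟨0, pos_iff_ne_zero.2 h⟩ le_rfl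
    refine le_of_tendsto hcont ?_
    filter_upwards [self_mem_nhdsWithin] with r hr
    exact (norm_lt_of_lt_hit (lt_stopAt_iff.1 hr).2).le

lemma tendsto_hit (x : C(ℝ≥0, E)) : Tendsto (fun n : ℕ => hit (n : ℝ) x) atTop (𝓝 ⊤) := by
  refine tendsto_order.2 ⟨fun a ha => ?_, fun a ha => absurd ha not_top_lt⟩
  lift a to ℝ≥0 using ha.ne
  obtain ⟨C, hC⟩ := (isCompact_Icc (a := (0 : ℝ≥0)) (b := a)).exists_bound_of_continuousOn
    x.continuous.continuousOn
  obtain ⟨N, hN⟩ := exists_nat_gt C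
  filter_upwards [eventually_ge_atTop N] with n hn
  refine lt_hit_iff.2 fun r hr => (hC r ⟨zero_le, hr⟩).trans_lt (hN.trans_le ?_)
  exact_mod_cast hn

end PathSpace

/-! ### Measurability in separable Hilbert spaces -/

section HilbertSpace

/-- Orthonormal vectors are at mutual distance `√2`, so the balls of radius `1/2` around them are
disjoint open sets. -/
lemma Orthonormal.countable_index {K : Type*} [NormedAddCommGroup K] [InnerProductSpace ℝ K]
    [SeparableSpace K] {ι : Type*} {b : ι → K} (hb : Orthonormal ℝ b) :
    Countable ι := by
  have hd : Pairwise (Function.onFun Disjoint fun i => Metric.ball (b i) (1 / 2)) := by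
    intro i j hij
    refine Metric.ball_disjoint_ball ?_
    have h1 : ‖b i - b j‖ ^ 2 = 2 := by
      rw [norm_sub_sq_real, hb.1 i, hb.1 j, hb.2 hij]; norm_num
    rw [dist_eq_norm]
    nlinarith [norm_nonneg (b i - b j)]
  have := hd.countable_of_isOpen_disjoint (fun i => Metric.isOpen_ball)
    fun i => ⟨b i, Metric.mem_ball_self (by norm_num)⟩
  exact this

lemma stronglyMeasurable_of_inner {K : Type*} [NormedAddCommGroup K] [InnerProductSpace ℝ K]
    [CompleteSpace K] [SeparableSpace K] {α : Type*} {mα : MeasurableSpace α}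
    {f : α → K} (h : ∀ k, StronglyMeasurable fun x => inner ℝ k (f x)) : StronglyMeasurable f := by
  obtain ⟨w, b, hb⟩ := exists_hilbertBasis ℝ K
  have : Countable w := b.orthonormal.countable_index
  refine stronglyMeasurable_of_tendsto (atTop : Filter (Finset w))
    (f := fun s x => ∑ i ∈ s, inner ℝ (b i) (f x) • b i)
    (fun s => Finset.stronglyMeasurable_fun_sum _ fun i _ => (h (b i)).smul_const _) ?_
  rw [tendsto_pi_nhds]
  intro x
  have := b.hasSum_repr (f x)
  simp only [b.repr_apply_apply] at this
  exact this

end HilbertSpace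

/-! ### Stopped time integrals and cut-off integrands -/

section StoppedTimeIntegral

lemma timeInt_stopAt (c : ℝ≥0 → Ω → ℝ) (τ : Ω → WithTop ℝ≥0) (t : ℝ≥0) (ω : Ω) :
    timeInt c (stopAt t (τ ω)) ω =
      timeInt (fun r ω => if (r : WithTop ℝ≥0) < τ ω then c r ω else 0) t ω := by
  unfold timeInt
  rw [intervalIntegral.integral_of_le (NNReal.coe_nonneg _),
    intervalIntegral.integral_of_le (NNReal.coe_nonneg _),
    ← integral_indicator measurableSet_Ioc, ← integral_indicator measurableSet_Ioc]
  -- Off the two null times `t` and `t ∧ τ`, strict and weak inequalities coincide, which reconciles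
  -- `r < τ` with the half-open interval of integration.
  have h1 : ∀ᵐ r : ℝ, r ≠ t := Measure.ae_ne volume _
  have h2 : ∀ᵐ r : ℝ, r ≠ stopAt t (τ ω) := Measure.ae_ne volume _
  refine integral_congr_ae ?_
  filter_upwards [h1, h2] with r hr1 hr2
  by_cases h0 : 0 < r
  · have e : r = (r.toNNReal : ℝ) := (Real.coe_toNNReal r h0.le).symm
    have key := lt_stopAt_iff (r := r.toNNReal) (t := t) (τ := τ ω)
    have k1 : r.toNNReal < stopAt t (τ ω) ↔ r ≤ stopAt t (τ ω) := by
      rw [Real.toNNReal_lt_iff_lt_coe h0.le]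
      exact ⟨le_of_lt, fun h => lt_of_le_of_ne h hr2⟩
    have k2 : r.toNNReal < t ↔ r ≤ t := by
      rw [Real.toNNReal_lt_iff_lt_coe h0.le]
      exact ⟨le_of_lt, fun h => lt_of_le_of_ne h hr1⟩
    rw [k1, k2] at key
    by_cases ht : r ≤ t
    · by_cases hτ : (r.toNNReal : WithTop ℝ≥0) < τ ω
      · rw [Set.indicator_of_mem (Set.mem_Ioc.2 ⟨h0, key.2 ⟨ht, hτ⟩⟩),
          Set.indicator_of_mem (Set.mem_Ioc.2 ⟨h0, ht⟩), if_pos hτ]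
      · rw [Set.indicator_of_notMem fun h => hτ (key.1 h.2).2,
          Set.indicator_of_mem (Set.mem_Ioc.2 ⟨h0, ht⟩), if_neg hτ]
    · rw [Set.indicator_of_notMem fun h => ht (key.1 h.2).1,
        Set.indicator_of_notMem fun h => ht h.2]
  · rw [Set.indicator_of_notMem fun h => h0 h.1, Set.indicator_of_notMem fun h => h0 h.1]

lemma MeasureTheory.IsStoppingTime.measurable_stopAt {τ : Ω → WithTop ℝ≥0}
    (hτ : IsStoppingTime 𝓕 τ) (t : ℝ≥0) : Measurable[𝓕 t] fun ω => stopAt t (τ ω) := by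
  refine @measurable_of_Ioi _ _ _ _ _ (𝓕 t) _ _ _ _ fun r => ?_
  have : (fun ω => stopAt t (τ ω)) ⁻¹' Set.Ioi r = {ω | r < t ∧ (r : WithTop ℝ≥0) < τ ω} := by
    ext ω; exact lt_stopAt_iff
  rw [this]
  by_cases hr : r < t
  · have e : {ω | r < t ∧ (r : WithTop ℝ≥0) < τ ω} = {ω | (r : WithTop ℝ≥0) < τ ω} := by
      ext ω; exact and_iff_right hr
    rw [e]
    exact 𝓕.mono hr.le _ (hτ.measurableSet_gt r)
  · have e : {ω | r < t ∧ (r : WithTop ℝ≥0) < τ ω} = ∅ := by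
      ext ω; exact iff_of_false (fun h => hr h.1) (Set.notMem_empty _)
    rw [e]
    exact @MeasurableSet.empty _ (𝓕 t)

lemma MeasureTheory.IsStoppingTime.isStronglyProgressive_ite {K : Type*} [NormedAddCommGroup K]
    {τ : Ω → WithTop ℝ≥0} (hτ : IsStoppingTime 𝓕 τ) {φ : ℝ≥0 → Ω → K}
    (hφ : IsStronglyProgressive 𝓕 φ) :
    IsStronglyProgressive 𝓕 (fun r ω => if (r : WithTop ℝ≥0) < τ ω then φ r ω else 0) := by
  intro i
  refine StronglyMeasurable.ite ?_ (hφ i) stronglyMeasurable_const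
  -- The variable `i ∧ τ` is `𝓕 i`-measurable while `τ` need not be. The time `r = i` is separated
  -- because `i ∧ τ` does not tell whether `τ` exceeds `i`.
  have e : {p : Set.Iic i × Ω | ((p.1 : ℝ≥0) : WithTop ℝ≥0) < τ p.2} =
      {p | (p.1 : ℝ≥0) < stopAt i (τ p.2)} ∪
        {p | (p.1 : ℝ≥0) = i} ∩ {p | (i : WithTop ℝ≥0) < τ p.2} := by
    ext ⟨⟨q, hq⟩, ω⟩
    change ((q : WithTop ℝ≥0) < τ ω) ↔ q < stopAt i (τ ω) ∨ (q = i ∧ (i : WithTop ℝ≥0) < τ ω)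
    rw [lt_stopAt_iff]
    rcases lt_or_eq_of_le (Set.mem_Iic.1 hq) with h | rfl
    · exact ⟨fun h' => Or.inl ⟨h, h'⟩, fun h' => h'.elim (fun h => h.2) fun h'' => absurd h''.1 h.ne⟩
    · exact ⟨fun h' => Or.inr ⟨rfl, h'⟩, fun h' => h'.elim (fun h => h.2) fun h => h.2⟩
  rw [e]
  have m1 : Measurable[Prod.instMeasurableSpace (m₂ := 𝓕 i)] fun p : Set.Iic i × Ω =>
      (p.1 : ℝ≥0) := measurable_subtype_coe.comp (@measurable_fst _ _ _ (𝓕 i))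
  have m2 : Measurable[Prod.instMeasurableSpace (m₂ := 𝓕 i)] fun p : Set.Iic i × Ω =>
      stopAt i (τ p.2) := (hτ.measurable_stopAt i).comp (@measurable_snd _ _ _ (𝓕 i))
  refine MeasurableSet.union (_root_.measurableSet_lt m1 m2) (MeasurableSet.inter ?_ ?_)
  · exact m1 (measurableSet_singleton i)
  · exact (@measurable_snd _ _ _ (𝓕 i)) (hτ.measurableSet_gt i)

end StoppedTimeIntegral

/-! ### Coefficients along a path and the stopped coordinate martingales -/

section Coefficients

variable [CompleteSpace H]

/-- Functions bounded on bounded sets. -/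
def BddOnBalls {E K : Type*} [Norm E] [Norm K] (g : E → K) : Prop :=
  ∀ R : ℝ, ∃ C : ℝ, ∀ e, ‖e‖ ≤ R → ‖g e‖ ≤ C

lemma BddOnBalls.exists_path_bound {K : Type*} [NormedAddCommGroup K] {g : E → K}
    (hg : BddOnBalls g) (x : C(ℝ≥0, E)) (t : ℝ≥0) : ∃ C : ℝ, 0 ≤ C ∧ ∀ r ≤ t, ‖g (x r)‖ ≤ C := by
  obtain ⟨R, hR⟩ := (isCompact_Icc (a := (0 : ℝ≥0)) (b := t)).exists_bound_of_continuousOn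
    x.continuous.continuousOn
  obtain ⟨C, hC⟩ := hg R
  exact ⟨C, (norm_nonneg _).trans (hC _ (hR 0 ⟨le_rfl, zero_le⟩)),
    fun r hr => hC _ (hR r ⟨zero_le, hr⟩)⟩

lemma intervalIntegrable_path {K : Type*} [NormedAddCommGroup K] {g : E → K}
    (hm : StronglyMeasurable g) (hg : BddOnBalls g) (x : C(ℝ≥0, E)) (a b : ℝ) :
    IntervalIntegrable (fun r : ℝ => g (x r.toNNReal)) volume a b := by
  obtain ⟨C, hC0, hC⟩ := hg.exists_path_bound x (max a b).toNNReal
  rw [intervalIntegrable_iff]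
  have : IsFiniteMeasure (volume.restrict (Set.uIoc a b)) :=
    ⟨by rw [Measure.restrict_apply_univ, Set.uIoc]; exact measure_Ioc_lt_top⟩
  refine Integrable.of_bound (C := C) ?_ ?_
  · exact (hm.comp_measurable
      (x.continuous.comp continuous_real_toNNReal).measurable).aestronglyMeasurable
  · refine (ae_restrict_iff' measurableSet_uIoc).2 (ae_of_all _ fun r hr => hC _ ?_)
    exact Real.toNNReal_le_toNNReal hr.2

/-- `g(x(r))` up to the exit time from the ball of radius `R`, and `0` from there on. -/
noncomputable def cutoff {K : Type*} [Zero K] (R : ℝ) (g : E → K) (r : ℝ≥0) (x : C(ℝ≥0, E)) : K :=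
  if (r : WithTop ℝ≥0) < hit R x then g (x r) else 0

lemma isStronglyProgressive_comp_eval {K : Type*} [NormedAddCommGroup K] {g : E → K}
    (hm : StronglyMeasurable g) :
    IsStronglyProgressive (pathFiltration E) (fun r x => g (x r)) := fun i =>
  hm.comp_measurable (isStronglyProgressive_eval i).measurable

lemma isBoundedProg_cutoff {K : Type*} [NormedAddCommGroup K] {g : E → K}
    (hm : StronglyMeasurable g) (hg : BddOnBalls g) (R : ℝ) :
    IsBoundedProg (pathFiltration E) (cutoff R g) := by
  obtain ⟨C, hC⟩ := hg R
  refine ⟨(isStoppingTime_hit R).isStronglyProgressive_ite (isStronglyProgressive_comp_eval hm),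
    |C|, fun t x => ?_⟩
  unfold cutoff
  split_ifs with h
  · exact (hC _ (norm_lt_of_lt_hit h).le).trans (le_abs_self C)
  · simp

/-- The drift of `⟨X, x*⟩`, where `ys = A* xs`. -/
def drift (ι : E →L[ℝ] X) (F : E → X) (xs ys : StrongDual ℝ X) (e : E) : ℝ :=
  ys (ι e) + xs (F e)

/-- The dispersion `G(e)* x*`. -/
noncomputable def disp (G : E → H →L[ℝ] X) (xs : StrongDual ℝ X) (e : E) : H :=
  hilbertAdjoint (G e) xs

lemma inner_disp (G : E → H →L[ℝ] X) (xs : StrongDual ℝ X) (e : E) (h : H) :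
    inner ℝ (disp G xs e) h = xs (G e h) := by
  unfold disp hilbertAdjoint
  rw [InnerProductSpace.toDual_symm_apply]
  rfl

lemma disp_add (G : E → H →L[ℝ] X) (xs xs' : StrongDual ℝ X) (e : E) :
    disp G (xs + xs') e = disp G xs e + disp G xs' e := by
  refine ext_inner_right ℝ fun h => ?_
  rw [inner_add_left, inner_disp, inner_disp, inner_disp, add_apply]

lemma norm_disp_le (G : E → H →L[ℝ] X) (xs : StrongDual ℝ X) (e : E) :
    ‖disp G xs e‖ ≤ ‖xs‖ * ‖G e‖ := by
  unfold disp hilbertAdjoint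
  rw [LinearIsometryEquiv.norm_map]
  exact ContinuousLinearMap.opNorm_comp_le _ _

lemma IsAdjointPair.add {xs ys xs' ys' : StrongDual ℝ X} (h : IsAdjointPair A xs ys)
    (h' : IsAdjointPair A xs' ys') : IsAdjointPair A (xs + xs') (ys + ys') := fun x => by
  rw [add_apply, add_apply, h x, h' x]

namespace IsAdmissibleCoefficients

lemma exists_bound_of_image {K : Type*} [NormedAddCommGroup K] {g : E → K}
    (h : ∀ s : Set E, Bornology.IsBounded s → Bornology.IsBounded (g '' s)) : BddOnBalls g := by
  intro R
  obtain ⟨C, hC⟩ := (h _ (Metric.isBounded_closedBall (x := (0 : E)) (r := R))).exists_norm_le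
  exact ⟨C, fun e he => hC _ ⟨e, by rwa [mem_closedBall_zero_iff], rfl⟩⟩

lemma stronglyMeasurable_drift (hyp : IsAdmissibleCoefficients ι A F G) (xs ys : StrongDual ℝ X) :
    StronglyMeasurable (drift ι F xs ys) :=
  ((ys.comp ι).continuous.stronglyMeasurable).add
    (xs.continuous.comp_stronglyMeasurable hyp.F_measurable)

lemma bddOnBalls_drift (hyp : IsAdmissibleCoefficients ι A F G) (xs ys : StrongDual ℝ X) :
    BddOnBalls (drift ι F xs ys) := by
  intro R
  obtain ⟨C, hC⟩ := exists_bound_of_image hyp.F_bounded R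
  refine ⟨‖ys.comp ι‖ * R + ‖xs‖ * C, fun e he => (norm_add_le _ _).trans (add_le_add ?_ ?_)⟩
  · exact ((ys.comp ι).le_opNorm e).trans (mul_le_mul_of_nonneg_left he (norm_nonneg _))
  · exact (xs.le_opNorm _).trans (mul_le_mul_of_nonneg_left (hC e he) (norm_nonneg _))

lemma bddOnBalls_disp (hyp : IsAdmissibleCoefficients ι A F G) (xs : StrongDual ℝ X) :
    BddOnBalls (disp G xs) := by
  intro R
  obtain ⟨C, hC⟩ := exists_bound_of_image hyp.G_bounded R
  exact ⟨‖xs‖ * C, fun e he => (norm_disp_le G xs e).trans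
    (mul_le_mul_of_nonneg_left (hC e he) (norm_nonneg _))⟩

variable [SeparableSpace H]

lemma stronglyMeasurable_disp (hyp : IsAdmissibleCoefficients ι A F G) (xs : StrongDual ℝ X) :
    StronglyMeasurable (disp G xs) := by
  refine stronglyMeasurable_of_inner fun h => ?_
  have e : (fun x => inner ℝ h (disp G xs x)) = fun x => xs (G x h) := by
    ext x; rw [real_inner_comm, inner_disp]
  rw [e]
  exact xs.continuous.comp_stronglyMeasurable (hyp.G_measurable h)

lemma stronglyMeasurable_inner_disp (hyp : IsAdmissibleCoefficients ι A F G)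
    (xs xs' : StrongDual ℝ X) :
    StronglyMeasurable (fun e => inner ℝ (disp G xs e) (disp G xs' e)) :=
  (hyp.stronglyMeasurable_disp xs).inner (hyp.stronglyMeasurable_disp xs')

lemma bddOnBalls_inner_disp (hyp : IsAdmissibleCoefficients ι A F G) (xs xs' : StrongDual ℝ X) :
    BddOnBalls (fun e => inner ℝ (disp G xs e) (disp G xs' e)) := by
  intro R
  obtain ⟨C, hC⟩ := hyp.bddOnBalls_disp xs R
  obtain ⟨D, hD⟩ := hyp.bddOnBalls_disp xs' R
  exact ⟨C * D, fun e he => (norm_inner_le_norm _ _).trans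
    (mul_le_mul (hC e he) (hD e he) (norm_nonneg _) ((norm_nonneg _).trans (hC e he)))⟩

end IsAdmissibleCoefficients

/-- The process `⟨x(t), x*⟩ - ⟨x(0), x*⟩ - ∫₀ᵗ drift`. -/
noncomputable def martPart (ι : E →L[ℝ] X) (F : E → X) (xs ys : StrongDual ℝ X) (t : ℝ≥0)
    (x : C(ℝ≥0, E)) : ℝ :=
  xs (ι (x t)) - xs (ι (x 0)) - timeInt (fun r (x : C(ℝ≥0, E)) => drift ι F xs ys (x r)) t x

/-- The process `martPart`, stopped upon leaving the ball of radius `R`. -/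
noncomputable def martStop (ι : E →L[ℝ] X) (F : E → X) (R : ℝ) (xs ys : StrongDual ℝ X) (t : ℝ≥0)
    (x : C(ℝ≥0, E)) : ℝ :=
  martPart ι F xs ys (stopAt t (hit R x)) x

lemma martPart_zero (xs ys : StrongDual ℝ X) (x : C(ℝ≥0, E)) : martPart ι F xs ys 0 x = 0 := by
  simp [martPart, timeInt_zero]

lemma martStop_eq (R : ℝ) (xs ys : StrongDual ℝ X) (t : ℝ≥0) (x : C(ℝ≥0, E)) :
    martStop ι F R xs ys t x = xs (ι (x (stopAt t (hit R x)))) - xs (ι (x 0)) -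
      timeInt (cutoff R (drift ι F xs ys)) t x := by
  unfold martStop martPart
  rw [timeInt_stopAt]
  rfl

lemma martStop_stopAt {R R' : ℝ} (h : R ≤ R') (xs ys : StrongDual ℝ X) (t : ℝ≥0) (x : C(ℝ≥0, E)) :
    martStop ι F R' xs ys (stopAt t (hit R x)) x = martStop ι F R xs ys t x := by
  unfold martStop
  rw [stopAt_stopAt t (hit_mono h x)]

lemma stopAt_zero (τ : WithTop ℝ≥0) : stopAt 0 τ = 0 := le_antisymm (stopAt_le _ _) zero_le

lemma martStop_zero (R : ℝ) (xs ys : StrongDual ℝ X) (x : C(ℝ≥0, E)) :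
    martStop ι F R xs ys 0 x = 0 := by
  unfold martStop
  rw [stopAt_zero, martPart_zero]

lemma stopAt_hit_of_le {R : ℝ} {x : C(ℝ≥0, E)} (h : R ≤ ‖x 0‖) (t : ℝ≥0) :
    stopAt t (hit R x) = 0 := by
  rw [stopAt_eq_of_ge zero_le (hit_le h), stopAt_zero]

namespace IsAdmissibleCoefficients

variable [SeparableSpace H]

lemma martPart_add (hyp : IsAdmissibleCoefficients ι A F G) (xs ys xs' ys' : StrongDual ℝ X)
    (t : ℝ≥0) (x : C(ℝ≥0, E)) : martPart ι F (xs + xs') (ys + ys') t x =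
      martPart ι F xs ys t x + martPart ι F xs' ys' t x := by
  have : timeInt (fun r (x : C(ℝ≥0, E)) => drift ι F (xs + xs') (ys + ys') (x r)) t x =
      timeInt (fun r (x : C(ℝ≥0, E)) => drift ι F xs ys (x r)) t x +
      timeInt (fun r (x : C(ℝ≥0, E)) => drift ι F xs' ys' (x r)) t x := by
    unfold timeInt
    rw [← intervalIntegral.integral_add]
    · refine intervalIntegral.integral_congr fun r _ => ?_
      simp only [drift, add_apply]; ring
    · exact intervalIntegrable_path (hyp.stronglyMeasurable_drift xs ys)
        (hyp.bddOnBalls_drift xs ys) x _ _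
    · exact intervalIntegrable_path (hyp.stronglyMeasurable_drift xs' ys')
        (hyp.bddOnBalls_drift xs' ys') x _ _
  unfold martPart
  rw [this, add_apply, add_apply]; ring

lemma continuous_martPart (hyp : IsAdmissibleCoefficients ι A F G) (xs ys : StrongDual ℝ X)
    (x : C(ℝ≥0, E)) : Continuous fun t => martPart ι F xs ys t x := by
  refine (((xs.comp ι).continuous.comp x.continuous).sub continuous_const).sub ?_
  have : Continuous fun t : ℝ => ∫ r in (0 : ℝ)..t, drift ι F xs ys (x r.toNNReal) :=
    intervalIntegral.continuous_primitive (fun a b => intervalIntegrable_path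
      (hyp.stronglyMeasurable_drift xs ys) (hyp.bddOnBalls_drift xs ys) x a b) 0
  exact this.comp NNReal.continuous_coe

lemma stronglyAdapted_martPart (hyp : IsAdmissibleCoefficients ι A F G) (xs ys : StrongDual ℝ X) :
    StronglyAdapted (pathFiltration E) (martPart ι F xs ys) := by
  intro t
  have h1 : ∀ s ≤ t, StronglyMeasurable[pathFiltration E t] fun x : C(ℝ≥0, E) => xs (ι (x s)) :=
    fun s hs => ((xs.comp ι).continuous.measurable.comp
      (measurable_eval_pathFiltration hs)).stronglyMeasurable
  exact ((h1 t le_rfl).sub (h1 0 zero_le)).sub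
    ((isStronglyProgressive_comp_eval (hyp.stronglyMeasurable_drift xs ys)).timeInt t)

lemma isBddContinuous_martStop (hyp : IsAdmissibleCoefficients ι A F G) (R : ℝ)
    (xs ys : StrongDual ℝ X) : IsBddContinuous (pathFiltration E) (martStop ι F R xs ys) where
  adapted := StronglyAdapted.stoppedProcess (hyp.stronglyAdapted_martPart xs ys) (hyp.continuous_martPart xs ys)
    (isStoppingTime_hit R)
  continuous x := (hyp.continuous_martPart xs ys x).comp (continuous_stopAt _)
  bdd T := by
    have hc := isBoundedProg_cutoff (hyp.stronglyMeasurable_drift xs ys)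
      (hyp.bddOnBalls_drift xs ys) R
    obtain ⟨C, hC⟩ := hc.isBddContinuous_timeInt.bdd T
    refine ⟨2 * (‖xs.comp ι‖ * |R|) + C, fun t ht x => ?_⟩
    have hC0 : 0 ≤ C := (abs_nonneg _).trans (hC t ht x)
    -- Paths starting outside the ball are stopped at time zero, where the centred process vanishes;
    -- thus boundedness requires nothing of the initial law.
    rcases le_or_gt R ‖x 0‖ with h | h
    · unfold martStop
      rw [stopAt_hit_of_le h, martPart_zero, abs_zero]
      positivity
    · rw [martStop_eq]
      have b : ∀ e : E, ‖e‖ ≤ R → |xs (ι e)| ≤ ‖xs.comp ι‖ * |R| := fun e he =>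
        ((xs.comp ι).le_opNorm e).trans
          (mul_le_mul_of_nonneg_left (he.trans (le_abs_self R)) (norm_nonneg _))
      have b1 := b _ (norm_stopAt_hit_le h t)
      have b2 := b _ h.le
      refine (abs_sub _ _).trans (add_le_add ((abs_sub _ _).trans ?_) (hC t ht x))
      linarith

end IsAdmissibleCoefficients

/-- The stopped processes `martStop` are square integrable martingales with the brackets prescribed
by the dispersion. -/
structure IsSolutionMeasure (ι : E →L[ℝ] X) (A : X →ₗ.[ℝ] X) (F : E → X) (G : E → H →L[ℝ] X)
    (P : Measure C(ℝ≥0, E)) : Prop where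
  probability : IsProbabilityMeasure P
  mart : ∀ R xs ys, IsAdjointPair A xs ys → L2Mart (pathFiltration E) P (martStop ι F R xs ys)
  bracket : ∀ R xs ys, IsAdjointPair A xs ys →
    BracketPair (pathFiltration E) P (martStop ι F R xs ys) (martStop ι F R xs ys)
      (timeInt (cutoff R fun e => inner ℝ (disp G xs e) (disp G xs e)))

/-- The pairs of a process `martStop` and its integrand `G(x)* x*`, cut off. -/
def PathBase (ι : E →L[ℝ] X) (A : X →ₗ.[ℝ] X) (F : E → X) (G : E → H →L[ℝ] X)
    (N : ℝ≥0 → C(ℝ≥0, E) → ℝ) (φ : ℝ≥0 → C(ℝ≥0, E) → H) : Prop :=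
  ∃ R xs ys, IsAdjointPair A xs ys ∧ N = martStop ι F R xs ys ∧ φ = cutoff R (disp G xs)

namespace IsSolutionMeasure

variable [SeparableSpace H] {P : Measure C(ℝ≥0, E)}

/-- Polarization: the brackets for `x*`, `x'*` and their sum, which again lies in `D(A*)`, determine
the mixed bracket. -/
lemma bracket_same (hyp : IsAdmissibleCoefficients ι A F G) (h : IsSolutionMeasure ι A F G P)
    (R : ℝ) {xs ys xs' ys' : StrongDual ℝ X} (hp : IsAdjointPair A xs ys)
    (hp' : IsAdjointPair A xs' ys') :
    BracketPair (pathFiltration E) P (martStop ι F R xs ys) (martStop ι F R xs' ys')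
      (timeInt (cutoff R fun e => inner ℝ (disp G xs e) (disp G xs' e))) := by
  have := h.probability
  have prog := fun xs xs' => isBoundedProg_cutoff (hyp.stronglyMeasurable_inner_disp xs xs')
    (hyp.bddOnBalls_inner_disp xs xs') R
  refine ⟨fun t => (prog xs xs').integrable_timeInt t, fun s t hst => ?_⟩
  have b1 := h.bracket R xs ys hp
  have b2 := h.bracket R xs' ys' hp'
  have b3 := h.bracket R _ _ (hp.add hp')
  have m1 := h.mart R xs ys hp
  have m2 := h.mart R xs' ys' hp'
  have m3 := h.mart R _ _ (hp.add hp')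
  have key := (((b3.cond s t hst).add (b3.integrable_cond m3 m3 s t)
    ((b1.integrable_cond m1 m1 s t).const_mul (-1)) ((b1.cond s t hst).const_mul (-1))).add
    ((b3.integrable_cond m3 m3 s t).add ((b1.integrable_cond m1 m1 s t).const_mul (-1)))
    ((b2.integrable_cond m2 m2 s t).const_mul (-1)) ((b2.cond s t hst).const_mul (-1))).const_mul
    (1 / 2)
  refine key.congr (ae_of_all _ fun x => ?_)
  have e1 : ∀ r, martStop ι F R (xs + xs') (ys + ys') r x =
      martStop ι F R xs ys r x + martStop ι F R xs' ys' r x := fun r =>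
    hyp.martPart_add xs ys xs' ys' _ x
  have e2 : ∀ r, timeInt (cutoff R fun e => inner ℝ (disp G (xs + xs') e) (disp G (xs + xs') e)) r x
      = timeInt (cutoff R fun e => inner ℝ (disp G xs e) (disp G xs e)) r x +
        (2 * timeInt (cutoff R fun e => inner ℝ (disp G xs e) (disp G xs' e)) r x +
        timeInt (cutoff R fun e => inner ℝ (disp G xs' e) (disp G xs' e)) r x) := fun r => by
    have c1 := timeInt_add (((prog xs xs').const_smul 2)) (prog xs' xs') r x
    have c2 := timeInt_add (prog xs xs) (((prog xs xs').const_smul 2).add (prog xs' xs')) r x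
    simp only [smul_eq_mul] at c1 c2
    rw [← timeInt_const_mul, ← c1, ← c2]
    congr 1
    ext q y
    simp only [cutoff, disp_add]
    split_ifs
    · rw [real_inner_add_add_self]; ring
    · simp
  simp only [Pi.add_apply, e1, e2]
  ring

/-- For different radii `R` and `R'`, both martingales are stopped versions of those for `S = max R
R'`. Stopping one factor and then the other cuts the bracket density off at both exit times, which
is the inner product of the two cut-off integrands. -/
theorem bracketSystem (hyp : IsAdmissibleCoefficients ι A F G) (h : IsSolutionMeasure ι A F G P) :
    BracketSystem (pathFiltration E) P (PathBase ι A F G) where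
  mart := by
    rintro _ _ ⟨R, xs, ys, hp, rfl, rfl⟩
    exact h.mart R xs ys hp
  prog := by
    rintro _ _ ⟨R, xs, ys, hp, rfl, rfl⟩
    exact isBoundedProg_cutoff (hyp.stronglyMeasurable_disp xs) (hyp.bddOnBalls_disp xs) R
  bracket := by
    rintro _ _ _ _ ⟨R, xs, ys, hp, rfl, rfl⟩ ⟨R', xs', ys', hp', rfl, rfl⟩
    have := h.probability
    set S := max R R' with hS
    have prog := isBoundedProg_cutoff (hyp.stronglyMeasurable_inner_disp xs xs')
      (hyp.bddOnBalls_inner_disp xs xs') S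
    have b := h.bracket_same hyp S hp hp'
    have b1 := b.stopped (h.mart S _ _ hp) (h.mart S _ _ hp') (hyp.isBddContinuous_martStop S xs ys)
      prog.isBddContinuous_timeInt (isStoppingTime_hit R)
    have e1 : (fun t (x : C(ℝ≥0, E)) => martStop ι F S xs ys (stopAt t (hit R x)) x) =
        martStop ι F R xs ys := by
      ext t x; exact martStop_stopAt (le_max_left _ _) xs ys t x
    have e2 : (fun t (x : C(ℝ≥0, E)) => martStop ι F S xs' ys' (stopAt t (hit R' x)) x) =
        martStop ι F R' xs' ys' := by
      ext t x; exact martStop_stopAt (le_max_right _ _) xs' ys' t x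
    rw [e1] at b1
    have b2 := b1.symm.stopped (h.mart S _ _ hp') (h.mart R _ _ hp)
      (hyp.isBddContinuous_martStop S xs' ys')
      (prog.isBddContinuous_timeInt.stopped (isStoppingTime_hit R)) (isStoppingTime_hit R')
    rw [e2] at b2
    refine b2.symm.congr fun t => ae_of_all _ fun x => ?_
    rw [timeInt_stopAt _ (hit R), timeInt_stopAt _ (hit R')]
    congr 1
    ext r y
    simp only [cutoff]
    have m1 := hit_mono (le_max_left R R') y
    have m2 := hit_mono (le_max_right R R') y
    by_cases h1 : (r : WithTop ℝ≥0) < hit R y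
    · by_cases h2 : (r : WithTop ℝ≥0) < hit R' y
      · rw [if_pos h2, if_pos h1, if_pos (h1.trans_le m1), if_pos h1, if_pos h2]
      · rw [if_neg h2, if_neg h2, inner_zero_right]
    · rw [if_neg h1, if_neg h1, inner_zero_left, ite_self]

end IsSolutionMeasure

end Coefficients

/-! ### Optional stopping for continuous martingales and local martingales -/

section LocalMartingales

lemma IsBddContinuous.martingale [IsProbabilityMeasure P] {N : ℝ≥0 → Ω → ℝ}
    (h : IsBddContinuous 𝓕 N)
    (hc : ∀ s t, s ≤ t → CondZero (𝓕 s) P fun ω => N t ω - N s ω) : Martingale N 𝓕 P := by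
  refine ⟨h.adapted, fun s t hst => ?_⟩
  have h1 := (hc s t hst).condExp_eq_zero (𝓕.le s) ((h.integrable t).sub (h.integrable s))
  have h2 : P[N t - N s | 𝓕 s] =ᵐ[P] P[N t | 𝓕 s] - P[N s | 𝓕 s] :=
    condExp_sub (h.integrable t) (h.integrable s) _
  have h3 : P[N s | 𝓕 s] = N s := condExp_of_stronglyMeasurable (𝓕.le s) (h.adapted s)
    (h.integrable s)
  have h1' : P[N t - N s | 𝓕 s] =ᵐ[P] 0 := h1
  filter_upwards [h1', h2] with ω e1 e2
  rw [e1, Pi.sub_apply, h3] at e2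
  simp only [Pi.zero_apply] at e2
  linarith

lemma gridStop_mem (g : ℕ → ℝ≥0) (τ : WithTop ℝ≥0) (k : ℕ) :
    ∃ j ≤ k, gridStop g τ k = g j := by
  induction k with
  | zero => exact ⟨0, le_rfl, rfl⟩
  | succ k ih =>
    unfold gridStop
    split_ifs
    · exact ⟨k + 1, le_rfl, rfl⟩
    · obtain ⟨j, hj, e⟩ := ih
      exact ⟨j, hj.trans (Nat.le_succ k), e⟩

lemma isStoppingTime_gridStop {τ : Ω → WithTop ℝ≥0} (hτ : IsStoppingTime 𝓕 τ) {g : ℕ → ℝ≥0}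
    (hg : Monotone g) (k : ℕ) :
    IsStoppingTime 𝓕 (fun ω => ((gridStop g (τ ω) k : ℝ≥0) : WithTop ℝ≥0)) := by
  induction k with
  | zero => exact isStoppingTime_const _ _
  | succ k ih =>
    intro i
    rcases le_or_gt (g k) i with h | h
    · have e : {ω | ((gridStop g (τ ω) (k + 1) : ℝ≥0) : WithTop ℝ≥0) ≤ i} =
          Set.ite {ω | ((g k : ℝ≥0) : WithTop ℝ≥0) < τ ω} {_ω | g (k + 1) ≤ i}
            {ω | ((gridStop g (τ ω) k : ℝ≥0) : WithTop ℝ≥0) ≤ i} := by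
        ext ω
        by_cases hω : ((g k : ℝ≥0) : WithTop ℝ≥0) < τ ω
        · rw [Set.mem_ofPred_eq, gridStop, if_pos hω, WithTop.coe_le_coe]
          exact ⟨fun h => .inl ⟨h, hω⟩, fun h => h.elim (·.1) fun h => absurd hω h.2⟩
        · rw [Set.mem_ofPred_eq, gridStop, if_neg hω]
          exact ⟨fun h => .inr ⟨h, hω⟩, fun h => h.elim (fun h => absurd h.2 hω) (·.1)⟩
      rw [e]
      exact MeasurableSet.ite (𝓕.mono h _ (hτ.measurableSet_gt _)) (.const _) (ih i)
    · convert ih i using 1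
      ext ω
      change ((gridStop g (τ ω) (k + 1) : ℝ≥0) : WithTop ℝ≥0) ≤ i ↔
        ((gridStop g (τ ω) k : ℝ≥0) : WithTop ℝ≥0) ≤ i
      by_cases hω : ((g k : ℝ≥0) : WithTop ℝ≥0) < τ ω
      · rw [gridStop_eq hg hω, gridStop, if_pos hω, WithTop.coe_le_coe, WithTop.coe_le_coe]
        exact iff_of_false (h.trans_le (hg k.le_succ)).not_ge h.not_ge
      · rw [show gridStop g (τ ω) (k + 1) = _ from if_neg hω]

variable [IsProbabilityMeasure P]

lemma MeasureTheory.Martingale.condZero {N : ℝ≥0 → Ω → ℝ} (hN : Martingale N 𝓕 P) {s t : ℝ≥0}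
    (hst : s ≤ t) : CondZero (𝓕 s) P fun ω => N t ω - N s ω := fun B hB => by
  rw [integral_sub (hN.integrable t).integrableOn (hN.integrable s).integrableOn,
    hN.setIntegral_eq hst hB, sub_self]

/-- The martingale is not assumed bounded. Its values at the discretized stopping times are
conditional expectations of `N t`, hence uniformly integrable, so that pointwise convergence along
refined grids becomes convergence in `L¹`. -/
lemma MeasureTheory.Martingale.condZero_stopped {N : ℝ≥0 → Ω → ℝ} (hN : Martingale N 𝓕 P)
    (hc : ∀ ω, Continuous fun t => N t ω) {τ : Ω → WithTop ℝ≥0} (hτ : IsStoppingTime 𝓕 τ)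
    {s t : ℝ≥0} (hst : s ≤ t) (hs : Integrable (fun ω => N (stopAt s (τ ω)) ω) P)
    (ht : Integrable (fun ω => N (stopAt t (τ ω)) ω) P) :
    CondZero (𝓕 s) P fun ω => N (stopAt t (τ ω)) ω - N (stopAt s (τ ω)) ω := by
  set ρ : ℕ → Ω → ℝ≥0 := fun m ω => gridStop (grid s t (m + 1)) (τ ω) (m + 1) with hρ
  have hρst : ∀ m, IsStoppingTime 𝓕 (fun ω => ((ρ m ω : ℝ≥0) : WithTop ℝ≥0)) := fun m =>
    isStoppingTime_gridStop hτ (grid_mono s t (m + 1)) (m + 1)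
  have hρle : ∀ m ω, ρ m ω ≤ t := fun m ω =>
    (gridStop_le (grid_mono s t (m + 1)) (τ ω) (m + 1)).trans
      (grid_last hst (Nat.succ_ne_zero m)).le
  have hρe : ∀ m, (fun ω => N (ρ m ω) ω) =ᵐ[P] P[N t | (hρst m).measurableSpace] := fun m => by
    have := hN.stoppedValue_ae_eq_condExp_of_le_const_of_countable_range (hρst m) (n := t)
      (fun ω => WithTop.coe_le_coe.2 (hρle m ω)) (by
        refine Set.Countable.mono (s₂ := (fun j => ((grid s t (m + 1) j : ℝ≥0) : WithTop ℝ≥0)) ''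
          Set.univ) ?_ (Set.countable_univ.image _)
        rintro _ ⟨ω, rfl⟩
        obtain ⟨j, -, e⟩ := gridStop_mem (grid s t (m + 1)) (τ ω) (m + 1)
        exact ⟨j, trivial, by simp only [hρ, e]⟩)
    exact this
  have hUI : UniformIntegrable (fun m ω => N (ρ m ω) ω) 1 P := by
    have := (hN.integrable t).uniformIntegrable_condExp (ℱ := fun m => (hρst m).measurableSpace)
      (fun m => (hρst m).measurableSpace_le)
    exact this.ae_eq fun m => (hρe m).symm
  have hρi : ∀ m, Integrable (fun ω => N (ρ m ω) ω) P := fun m =>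
    integrable_condExp.congr (hρe m).symm
  have hmax : ∀ ω, N (max s (stopAt t (τ ω))) ω =
      N (stopAt t (τ ω)) ω - N (stopAt s (τ ω)) ω + N s ω := fun ω => by
    rw [← apply_max_stopAt hst (τ ω) (N · ω)]; ring
  have hgi : Integrable (fun ω => N (max s (stopAt t (τ ω))) ω) P := by
    simp only [hmax]
    exact (ht.sub hs).add (hN.integrable s)
  have hlim := tendsto_Lp_finite_of_tendsto_ae le_rfl ENNReal.one_ne_top hUI.1
    (memLp_one_iff_integrable.2 hgi) hUI.2.1 (ae_of_all _ fun ω =>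
      ((hc ω).tendsto _).comp ((tendsto_gridStop hst (τ ω)).comp (tendsto_add_atTop_nat 1)))
  have hss : ∀ m ω, stoppedSum s t (m + 1) (τ ω) (N · ω) = N (ρ m ω) ω - N s ω := fun m ω =>
    stoppedSum_eq _ _ _ _ _
  refine CondZero.of_tendsto_L1 (F := fun m ω => stoppedSum s t (m + 1) (τ ω) (N · ω))
    (fun m => ?_) (fun m => ?_) (ht.sub hs) ?_
  · have hterm : ∀ j, Integrable (fun ω => (if (grid s t (m + 1) j : WithTop ℝ≥0) < τ ω then
        (1 : ℝ) else 0) * (N (grid s t (m + 1) (j + 1)) ω - N (grid s t (m + 1) j) ω)) P := fun j =>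
      ((hN.integrable _).sub (hN.integrable _)).bdd_mul
        ((hτ.stronglyMeasurable_lt _).mono (𝓕.le _)).aestronglyMeasurable
        (ae_of_all _ fun ω => abs_ite_one_le _)
    exact condZero_sum _ (fun j _ => hterm j) fun j _ =>
      ((hN.condZero (grid_mono s t (m + 1) (Nat.le_succ j))).mul (𝓕.le _)
        ((hN.integrable _).sub (hN.integrable _))
        (hτ.stronglyMeasurable_lt _).aestronglyMeasurable (hterm j)).mono
        (𝓕.mono (le_grid s t (m + 1) j))
  · simp only [hss]
    exact (hρi m).sub (hN.integrable s)
  · have h2 := (ENNReal.tendsto_toReal ENNReal.zero_ne_top).comp hlim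
    simp only [ENNReal.toReal_zero] at h2
    refine h2.congr fun m => ?_
    simp only [Function.comp_apply]
    rw [eLpNorm_one_eq_lintegral_enorm, ← integral_norm_eq_lintegral_enorm
      ((hρi m).sub hgi).aestronglyMeasurable]
    refine integral_congr_ae (ae_of_all _ fun ω => ?_)
    simp only [Pi.sub_apply, hss, Real.norm_eq_abs, hmax]
    congr 1; ring

lemma stopAt_comm (t : ℝ≥0) (σ τ : WithTop ℝ≥0) :
    stopAt (stopAt t σ) τ = stopAt (stopAt t τ) σ := by
  induction σ using WithTop.recTopCoe with
  | top => rw [stopAt_top, stopAt_top]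
  | coe c =>
    induction τ using WithTop.recTopCoe with
    | top => rw [stopAt_top, stopAt_top]
    | coe d => simp only [stopAt_coe]; rw [min_right_comm]

/-- Replaces an unknown localizing sequence `σ n` by a stopping time `τ` up to which the centred
process is bounded on bounded time intervals: the martingale stopped at `σ n` is stopped again at
`τ`, the two operations commute, and dominated convergence removes `σ n`. -/
lemma IsLocalMartingale.condZero_stopped {U : ℝ≥0 → Ω → ℝ} (hU : IsLocalMartingale U 𝓕 P)
    (hc : ∀ ω, Continuous fun t => U t ω) {τ : Ω → WithTop ℝ≥0} (hτ : IsStoppingTime 𝓕 τ)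
    (hb : IsBddContinuous 𝓕 fun t ω => U (stopAt t (τ ω)) ω - U 0 ω) {s t : ℝ≥0} (hst : s ≤ t) :
    CondZero (𝓕 s) P fun ω => U (stopAt t (τ ω)) ω - U (stopAt s (τ ω)) ω := by
  obtain ⟨σ, hσ, hM⟩ := hU
  set V : ℝ≥0 → Ω → ℝ := fun t ω => U (stopAt t (τ ω)) ω - U 0 ω with hV
  have key : ∀ n, CondZero (𝓕 s) P fun ω => V (stopAt t (σ n ω)) ω - V (stopAt s (σ n ω)) ω := by
    intro n
    have e : ∀ r ω, stoppedProcess U (σ n) (stopAt r (τ ω)) ω - U 0 ω = V (stopAt r (σ n ω)) ω :=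
      fun r ω => by
        change U (stopAt (stopAt r (τ ω)) (σ n ω)) ω - U 0 ω = _
        rw [stopAt_comm]
    have hi : ∀ r, Integrable (fun ω => V (stopAt r (σ n ω)) ω) P := fun r =>
      (hb.stopped (hσ.isStoppingTime n)).integrable r
    have := (hM n).condZero_stopped (fun ω =>
      ((hc ω).comp (continuous_stopAt (σ n ω))).sub continuous_const) hτ hst
      (by simp only [e]; exact hi s) (by simp only [e]; exact hi t)
    simp only [e] at this
    exact this
  obtain ⟨C, hC⟩ := hb.bdd t
  have : CondZero (𝓕 s) P fun ω => V t ω - V s ω := by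
    refine CondZero.of_tendsto (fun _ => C + C) key (fun n => ?_) (integrable_const _)
      (fun n => ae_of_all _ fun ω => ?_) ?_
    · exact (((hb.stopped (hσ.isStoppingTime n)).integrable t).sub
        ((hb.stopped (hσ.isStoppingTime n)).integrable s)).1
    · exact (abs_sub _ _).trans (add_le_add (hC _ (stopAt_le _ _) ω)
        (hC _ ((stopAt_le _ _).trans hst) ω))
    · filter_upwards [hσ.tendsto_top] with ω hω
      have hev : ∀ᶠ n in atTop, (t : WithTop ℝ≥0) < σ n ω :=
        hω.eventually_const_lt (WithTop.coe_lt_top t)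
      refine tendsto_const_nhds.congr' ?_
      filter_upwards [hev] with n hn
      rw [stopAt_of_le hn.le, stopAt_of_le ((WithTop.coe_le_coe.2 hst).trans hn.le)]
  exact this.congr (ae_of_all _ fun ω => by simp only [hV]; ring)

end LocalMartingales

/-! ### Solution measures solve the full local martingale problem -/

section SolvesOperator

variable [CompleteSpace H] [SeparableSpace H]

/-- The process `⟨x(t ∧ τ), x*⟩`, set to zero if the path starts outside of the ball. -/
noncomputable def coordStop (ι : E →L[ℝ] X) (R : ℝ) (xs : StrongDual ℝ X) (t : ℝ≥0)
    (x : C(ℝ≥0, E)) : ℝ :=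
  if ‖x 0‖ < R then xs (ι (x (stopAt t (hit R x)))) else 0

lemma cutoff_of_le {K : Type*} [Zero K] {R : ℝ} {x : C(ℝ≥0, E)} (h : R ≤ ‖x 0‖) (g : E → K)
    (r : ℝ≥0) : cutoff R g r x = 0 :=
  if_neg fun h' => absurd (lt_hit_iff.1 h' 0 zero_le) (not_lt.2 h)

lemma timeInt_cutoff_of_le {R : ℝ} {x : C(ℝ≥0, E)} (h : R ≤ ‖x 0‖) (g : E → ℝ)
    (t : ℝ≥0) : timeInt (cutoff R g) t x = 0 := by
  simp [timeInt, cutoff_of_le h]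

lemma coordStop_eq (R : ℝ) (xs ys : StrongDual ℝ X) (t : ℝ≥0) (x : C(ℝ≥0, E)) :
    coordStop ι R xs t x = coordStop ι R xs 0 x + timeInt (cutoff R (drift ι F xs ys)) t x +
      martStop ι F R xs ys t x := by
  unfold coordStop
  by_cases h : ‖x 0‖ < R
  · rw [if_pos h, if_pos h, martStop_eq, stopAt_zero]; ring
  · rw [if_neg h, if_neg h, timeInt_cutoff_of_le (not_lt.1 h), martStop,
      stopAt_hit_of_le (not_lt.1 h), martPart_zero]; ring

lemma isBddContinuous_coordStop (hyp : IsAdmissibleCoefficients ι A F G) (R : ℝ)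
    (xs ys : StrongDual ℝ X) : IsBddContinuous (pathFiltration E) (coordStop ι R xs) := by
  have h0 : IsBddContinuous (pathFiltration E) (fun _ x => coordStop ι R xs 0 x) := by
    refine ⟨fun t => ?_, fun x => continuous_const, fun T => ⟨‖xs.comp ι‖ * |R|, fun t _ x => ?_⟩⟩
    · have m0 := measurable_eval_pathFiltration (E := E) (zero_le : 0 ≤ t)
      refine StronglyMeasurable.ite (measurableSet_lt (measurable_norm.comp m0) measurable_const)
        ?_ stronglyMeasurable_const
      simp only [stopAt_zero]
      exact ((xs.comp ι).continuous.measurable.comp m0).stronglyMeasurable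
    · unfold coordStop
      split_ifs with h
      · rw [stopAt_zero]
        exact ((xs.comp ι).le_opNorm _).trans
          (mul_le_mul_of_nonneg_left (h.le.trans (le_abs_self R)) (norm_nonneg _))
      · rw [abs_zero]; positivity
  have h1 := isBoundedProg_cutoff (hyp.stronglyMeasurable_drift xs ys)
      (hyp.bddOnBalls_drift xs ys) R
  have := (h0.add h1.isBddContinuous_timeInt).add (hyp.isBddContinuous_martStop R xs ys)
  convert this using 1
  ext t x
  exact coordStop_eq R xs ys t x

lemma isItoSystem_path (hyp : IsAdmissibleCoefficients ι A F G) {P : Measure C(ℝ≥0, E)}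
    (h : IsSolutionMeasure ι A F G P) {n : ℕ} (R : ℝ) {xs ys : Fin n → StrongDual ℝ X}
    (hp : ∀ k, IsAdjointPair A (xs k) (ys k)) :
    IsItoSystem (pathFiltration E) P (fun k => coordStop ι R (xs k))
      (fun k => martStop ι F R (xs k) (ys k)) (fun k => cutoff R (drift ι F (xs k) (ys k)))
      (fun k l => cutoff R fun e => inner ℝ (disp G (xs k) e) (disp G (xs l) e)) where
  mart k := h.mart R _ _ (hp k)
  contM k := hyp.isBddContinuous_martStop R _ _
  contZ k := isBddContinuous_coordStop hyp R (xs k) (ys k)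
  progb k := isBoundedProg_cutoff (hyp.stronglyMeasurable_drift _ _)
      (hyp.bddOnBalls_drift _ _) R
  proga k l := isBoundedProg_cutoff (hyp.stronglyMeasurable_inner_disp _ _)
      (hyp.bddOnBalls_inner_disp _ _) R
  bracket k l := h.bracket_same hyp R (hp k) (hp l)
  decomp k t x := by rw [martStop_zero, sub_zero]; exact coordStop_eq R _ _ t x

/-- One side differentiates a partial derivative, the other evaluates `D²φ` at two basis vectors.
Evaluation at a fixed vector is linear and continuous, so it commutes with differentiation. -/
lemma cylindricalL_eq {n : ℕ} {φ : (Fin n → ℝ) → ℝ} (hφ : ContDiff ℝ 2 φ)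
    (xs ys : Fin n → StrongDual ℝ X) (e : E) :
    cylindricalL ι F G φ xs ys e = itoIntegrand φ (fun i => xs i (ι e))
      (fun k => drift ι F (xs k) (ys k) e)
      (fun k l => inner ℝ (disp G (xs k) e) (disp G (xs l) e)) := by
  unfold cylindricalL itoIntegrand drift disp
  congr 2
  refine Finset.sum_congr rfl fun k _ => Finset.sum_congr rfl fun l _ => ?_
  rw [mul_comm]
  congr 1
  have hd : DifferentiableAt ℝ (fderiv ℝ φ) (fun i => xs i (ι e)) :=
    ((hφ.fderiv_right (m := 1) (by norm_num)).differentiable (by norm_num)) _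
  rw [fderiv_clm_apply hd (differentiableAt_const _)]
  simp

/-- The exit times from balls of integer radius localize. Up to the exit time the coordinates form a
bounded Itô system, for which Itô's formula is available; afterwards its drift and bracket densities
vanish, so the formula reproduces the stopped process. -/
lemma IsSolutionMeasure.solves (hyp : IsAdmissibleCoefficients ι A F G) {P : Measure C(ℝ≥0, E)}
    (h : IsSolutionMeasure ι A F G P) :
    SolvesLocalMartingaleProblem (operatorGraph ι A F G) P := by
  have := h.probability
  refine ⟨h.probability, ?_⟩
  rintro ⟨f, g⟩ ⟨n, φ, xs, ys, hφ, hp, hf, hg⟩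
  simp only at hf hg
  subst hf hg
  refine ⟨fun n => hit (n : ℝ), ⟨⟨fun n => isStoppingTime_hit _, ae_of_all _ tendsto_hit⟩,
    ae_of_all _ fun x m n hmn => hit_mono (by exact_mod_cast hmn) x⟩, fun m => ?_⟩
  set R : ℝ := (m : ℝ) with hR
  have hI := isItoSystem_path hyp h R hp
  set N := IsItoSystem.comp φ (fun k => coordStop ι R (xs k))
    (fun k => cutoff R (drift ι F (xs k) (ys k)))
    (fun k l => cutoff R fun e => inner ℝ (disp G (xs k) e) (disp G (xs l) e)) with hN
  have hNb : IsBddContinuous (pathFiltration E) N := hI.isBddContinuous_comp hφ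
  have e : (fun t (x : C(ℝ≥0, E)) => stoppedProcess (martingaleProblemProcess
      (fun x => φ fun i => xs i (ι x)) (cylindricalL ι F G φ xs ys)) (hit R) t x -
      martingaleProblemProcess
      (fun x => φ fun i => xs i (ι x)) (cylindricalL ι F G φ xs ys) 0 x) =
      fun t x => N t x + (-1) * N 0 x := by
    ext t x
    change martingaleProblemProcess (fun x => φ fun i => xs i (ι x))
      (cylindricalL ι F G φ xs ys) (stopAt t (hit R x)) x - _ = _
    by_cases hx : ‖x 0‖ < R
    · have c : ∀ r k, coordStop ι R (xs k) r x = xs k (ι (x (stopAt r (hit R x)))) :=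
        fun r k => if_pos hx
      have e1 : ∀ r, N r x = φ (fun i => xs i (ι (x (stopAt r (hit R x))))) -
          timeInt (fun r (x : C(ℝ≥0, E)) => cylindricalL ι F G φ xs ys (x r))
            (stopAt r (hit R x)) x := by
        intro r
        rw [timeInt_stopAt]
        simp only [hN, IsItoSystem.comp, c]
        congr 1
        refine intervalIntegral.integral_congr fun q _ => ?_
        simp only [IsItoSystem.proc, c, cutoff]
        by_cases hq : ((q.toNNReal : ℝ≥0) : WithTop ℝ≥0) < hit R x
        · simp only [if_pos hq]
          rw [stopAt_of_le hq.le, cylindricalL_eq hφ]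
        · simp only [if_neg hq]
          simp [itoIntegrand]
      rw [e1, e1, stopAt_zero, timeInt_zero]
      simp only [martingaleProblemProcess, timeInt, NNReal.coe_zero,
        intervalIntegral.integral_same]
      ring
    -- For a start outside the ball the stopped coordinates are set to zero and `N` is constant, so
    -- both centred processes vanish.
    · have e1 : ∀ r, N r x = φ 0 := by
        intro r
        have c : ∀ r k, coordStop ι R (xs k) r x = 0 := fun r k => if_neg hx
        simp only [hN, IsItoSystem.comp, c]
        have : timeInt (IsItoSystem.proc φ (fun k => coordStop ι R (xs k))
            (fun k => cutoff R (drift ι F (xs k) (ys k)))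
            (fun k l => cutoff R fun e => inner ℝ (disp G (xs k) e) (disp G (xs l) e))) r x = 0 := by
          simp [timeInt, IsItoSystem.proc, itoIntegrand, cutoff_of_le (not_lt.1 hx)]
        rw [this, sub_zero]
        rfl
      rw [e1, e1, stopAt_hit_of_le (not_lt.1 hx)]
      ring
  rw [e]
  have hN0 : IsBddContinuous (pathFiltration E) fun _ x => N 0 x := by
    refine ⟨fun t => (hNb.adapted 0).mono ((pathFiltration E).mono zero_le),
      fun x => continuous_const, fun T => ?_⟩
    obtain ⟨C, hC⟩ := hNb.bdd 0
    exact ⟨C, fun t _ x => hC 0 le_rfl x⟩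
  refine (hNb.add (hN0.smul (-1))).martingale fun s t hst => ?_
  exact (hI.condZero_comp hφ hst).congr (ae_of_all _ fun x => by ring)

end SolvesOperator

/-- Integration by parts for absolutely continuous functions. As `β` is merely integrable, it is the
derivative of its primitive only almost everywhere. -/
lemma integral_primitive_mul_self {β : ℝ → ℝ} {s t : ℝ}
    (hβ : ∀ a b, IntervalIntegrable β volume a b) :
    ∫ r in s..t, (∫ q in s..r, β q) * β r = (∫ q in s..t, β q) ^ 2 / 2 := by
  set f : ℝ → ℝ := fun r => ∫ q in s..r, β q with hf
  have hac : AbsolutelyContinuousOnInterval f s t :=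
    (hβ s t).absolutelyContinuousOnInterval_intervalIntegral Set.left_mem_uIcc
  have h1 := hac.integral_mul_deriv_eq_deriv_mul hac
  have hd : ∀ᵐ r, r ∈ Set.uIoc s t → deriv f r = β r := by
    have := (hβ s t).ae_hasDerivAt_integral
    filter_upwards [this] with r hr hrm
    exact (hr (Set.uIoc_subset_uIcc hrm) s Set.left_mem_uIcc).deriv
  have e1 : ∫ r in s..t, f r * deriv f r = ∫ r in s..t, f r * β r :=
    intervalIntegral.integral_congr_ae (hd.mono fun r hr hm => by rw [hr hm])
  have e2 : ∫ r in s..t, deriv f r * f r = ∫ r in s..t, f r * β r :=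
    intervalIntegral.integral_congr_ae (hd.mono fun r hr hm => by rw [hr hm, mul_comm])
  have e3 : f s = 0 := intervalIntegral.integral_same
  rw [e1, e2, e3] at h1
  simp only [hf] at h1 ⊢
  linarith

/-! ### The minimal problem determines the martingales and their brackets -/

section MinimalProblem

variable [CompleteSpace H] [SeparableSpace H]

lemma cylindricalL_coord (xs ys : StrongDual ℝ X) (e : E) :
    cylindricalL ι F G (n := 1) (fun u => u 0) (fun _ => xs) (fun _ => ys) e =
      drift ι F xs ys e := by
  have h : ∀ z : Fin 1 → ℝ, fderiv ℝ (fun u : Fin 1 → ℝ => u 0) z =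
      ContinuousLinearMap.proj 0 := fun z =>
    (ContinuousLinearMap.proj (R := ℝ) (φ := fun _ : Fin 1 => ℝ) 0).fderiv
  unfold cylindricalL drift
  simp [h]

lemma cylindricalL_coord_sq (xs ys : StrongDual ℝ X) (e : E) :
    cylindricalL ι F G (n := 1) (fun u => u 0 ^ 2) (fun _ => xs) (fun _ => ys) e =
      2 * xs (ι e) * drift ι F xs ys e + inner ℝ (disp G xs e) (disp G xs e) := by
  have h : ∀ z : Fin 1 → ℝ, fderiv ℝ (fun u : Fin 1 → ℝ => u 0 ^ 2) z =
      (2 * z 0) • (ContinuousLinearMap.proj 0 : (Fin 1 → ℝ) →L[ℝ] ℝ) := fun z => by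
    have h1 : HasFDerivAt (fun u : Fin 1 → ℝ => u 0)
        (ContinuousLinearMap.proj 0 : (Fin 1 → ℝ) →L[ℝ] ℝ) z :=
      (ContinuousLinearMap.proj (R := ℝ) (φ := fun _ : Fin 1 => ℝ) 0).hasFDerivAt
    have := (h1.pow 2).fderiv
    simpa using this
  have h2 : ∀ z v : Fin 1 → ℝ, fderiv ℝ (fun u : Fin 1 → ℝ => 2 * u 0) z v = 2 * v 0 :=
    fun z v => by
      have h1 : HasFDerivAt (fun u : Fin 1 → ℝ => u 0)
        (ContinuousLinearMap.proj 0 : (Fin 1 → ℝ) →L[ℝ] ℝ) z :=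
        (ContinuousLinearMap.proj (R := ℝ) (φ := fun _ : Fin 1 => ℝ) 0).hasFDerivAt
      rw [(h1.const_mul 2).fderiv]
      simp
  unfold cylindricalL drift disp
  simp [h, h2]
  ring

variable {P : Measure C(ℝ≥0, E)}

lemma continuous_martingaleProblemProcess {f g : E → ℝ} (hf : Continuous f)
    (hg : StronglyMeasurable g) (hgb : BddOnBalls g) (x : C(ℝ≥0, E)) :
    Continuous fun t => martingaleProblemProcess f g t x := by
  refine (hf.comp x.continuous).sub ?_
  have : Continuous fun t : ℝ => ∫ r in (0 : ℝ)..t, g (x r.toNNReal) :=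
    intervalIntegral.continuous_primitive (fun a b => intervalIntegrable_path hg hgb x a b) 0
  exact this.comp NNReal.continuous_coe

lemma martingaleProblemProcess_stopAt (f g : E → ℝ) (R : ℝ) (t : ℝ≥0) (x : C(ℝ≥0, E)) :
    martingaleProblemProcess f g (stopAt t (hit R x)) x = f (x (stopAt t (hit R x))) -
      timeInt (cutoff R g) t x := by
  unfold martingaleProblemProcess
  congr 1
  exact timeInt_stopAt (fun r (x : C(ℝ≥0, E)) => g (x r)) (hit R) t x

lemma isBddContinuous_stopped_problem {f g : E → ℝ} (hf : Continuous f) (hfb : BddOnBalls f)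
    (hg : StronglyMeasurable g) (hgb : BddOnBalls g) (R : ℝ) :
    IsBddContinuous (pathFiltration E) fun t x =>
      martingaleProblemProcess f g (stopAt t (hit R x)) x - martingaleProblemProcess f g 0 x where
  adapted t := by
    have ad : StronglyAdapted (pathFiltration E) (martingaleProblemProcess f g) := fun t =>
      ((hf.measurable.comp (measurable_eval_pathFiltration le_rfl)).stronglyMeasurable).sub
        ((isStronglyProgressive_comp_eval hg).timeInt t)
    exact (ad.stoppedProcess (fun x => continuous_martingaleProblemProcess hf hg hgb x)
      (isStoppingTime_hit R) t).sub ((ad 0).mono ((pathFiltration E).mono zero_le))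
  continuous x := ((continuous_martingaleProblemProcess hf hg hgb x).comp
    (continuous_stopAt _)).sub continuous_const
  bdd T := by
    obtain ⟨C, hC⟩ := (isBoundedProg_cutoff hg hgb R).isBddContinuous_timeInt.bdd T
    obtain ⟨D, hD⟩ := hfb R
    refine ⟨|D| + |D| + C, fun t ht x => ?_⟩
    have hC0 : 0 ≤ C := (abs_nonneg _).trans (hC t ht x)
    rcases le_or_gt R ‖x 0‖ with h | h
    · rw [stopAt_hit_of_le h, sub_self, abs_zero]; positivity
    · have e0 : martingaleProblemProcess f g 0 x = f (x 0) := by simp [martingaleProblemProcess]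
      rw [martingaleProblemProcess_stopAt, e0]
      have b1 := (hD _ (norm_stopAt_hit_le h t)).trans (le_abs_self D)
      have b2 := (hD _ h.le).trans (le_abs_self D)
      have b3 := hC t ht x
      rw [Real.norm_eq_abs] at b1 b2
      rw [abs_le] at b1 b2 b3 ⊢
      constructor <;> linarith [b1.1, b1.2, b2.1, b2.2, b3.1, b3.2]

lemma condZero_stopped_problem [IsProbabilityMeasure P] {f g : E → ℝ} (hf : Continuous f)
    (hfb : BddOnBalls f) (hg : StronglyMeasurable g) (hgb : BddOnBalls g) (R : ℝ)
    (h : IsLocalMartingale (martingaleProblemProcess f g) (pathFiltration E) P) {s t : ℝ≥0}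
    (hst : s ≤ t) : CondZero (pathFiltration E s) P fun x =>
      (f (x (stopAt t (hit R x))) - timeInt (cutoff R g) t x) -
        (f (x (stopAt s (hit R x))) - timeInt (cutoff R g) s x) := by
  have := h.condZero_stopped (fun x => continuous_martingaleProblemProcess hf hg hgb x)
    (isStoppingTime_hit R) (isBddContinuous_stopped_problem hf hfb hg hgb R) hst
  simpa only [martingaleProblemProcess_stopAt] using this

lemma mem_minOperatorGraph {xs ys : StrongDual ℝ X} (hp : IsAdjointPair A xs ys) :
    ((fun e : E => xs (ι e)), drift ι F xs ys) ∈ minOperatorGraph ι A F G ∧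
    ((fun e : E => xs (ι e) ^ 2), fun e => 2 * xs (ι e) * drift ι F xs ys e +
      inner ℝ (disp G xs e) (disp G xs e)) ∈ minOperatorGraph ι A F G := by
  refine ⟨⟨⟨1, fun u => u 0, fun _ => xs, fun _ => ys, ?_, fun _ => hp, rfl, ?_⟩,
    xs, ys, hp, Or.inl rfl⟩,
    ⟨⟨1, fun u => u 0 ^ 2, fun _ => xs, fun _ => ys, ?_, fun _ => hp, rfl, ?_⟩,
    xs, ys, hp, Or.inr rfl⟩⟩
  · exact contDiff_apply ℝ ℝ 0
  · ext e; exact (cylindricalL_coord xs ys e).symm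
  · exact (contDiff_apply ℝ ℝ 0).pow 2
  · ext e; exact (cylindricalL_coord_sq xs ys e).symm

/-- The integral of `(M_t - M_r) β_r` over `[s, t]` has vanishing conditional expectation. -/
lemma condZero_integral_future {Ω : Type*} {mΩ : MeasurableSpace Ω} {P : Measure Ω}
    [IsProbabilityMeasure P] {𝓕 : Filtration ℝ≥0 mΩ} {M β : ℝ≥0 → Ω → ℝ} (hM : L2Mart 𝓕 P M)
    (hc : IsBddContinuous 𝓕 M) (hβ : IsBoundedProg 𝓕 β) {s t : ℝ≥0} (hst : s ≤ t) :
    CondZero (𝓕 s) P fun ω => ∫ r in (s : ℝ)..t, (M t ω - M r.toNNReal ω) * β r.toNNReal ω := by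
  obtain ⟨C, hC⟩ := hc.bdd t
  obtain ⟨D, hD⟩ := hβ.bdd
  have hst' : (s : ℝ) ≤ t := NNReal.coe_le_coe.2 hst
  intro B hB
  simp only [intervalIntegral.integral_of_le hst']
  have hmM : StronglyMeasurable (fun p : ℝ × Ω => M p.1.toNNReal p.2) :=
    (hc.adapted.isStronglyProgressive_of_continuous hc.continuous).stronglyMeasurable_uncurry
  have hmβ : StronglyMeasurable (fun p : ℝ × Ω => β p.1.toNNReal p.2) :=
    hβ.prog.stronglyMeasurable_uncurry
  have hmt : StronglyMeasurable (fun p : ℝ × Ω => M t p.2) :=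
    (hc.stronglyMeasurable t).comp_measurable measurable_snd
  have hmeas : StronglyMeasurable (fun p : ℝ × Ω => (M t p.2 - M p.1.toNNReal p.2) *
    β p.1.toNNReal p.2) := (hmt.sub hmM).mul hmβ
  have hb : ∀ r ∈ Set.Ioc (s : ℝ) t, ∀ ω, ‖(M t ω - M r.toNNReal ω) * β r.toNNReal ω‖ ≤
      (C + C) * D := fun r hr ω => by
    rw [norm_mul]
    have h1 := (abs_sub (M t ω) (M r.toNNReal ω)).trans (add_le_add (hC t le_rfl ω)
      (hC _ (Real.toNNReal_le_iff_le_coe.2 hr.2) ω))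
    exact mul_le_mul h1 (hD _ _) (norm_nonneg _) ((abs_nonneg _).trans h1)
  have hfin : IsFiniteMeasure (volume.restrict (Set.Ioc (s : ℝ) t)) :=
    ⟨by rw [Measure.restrict_apply_univ]; exact measure_Ioc_lt_top⟩
  have hint : Integrable (Function.uncurry fun (ω : Ω) (r : ℝ) =>
      (M t ω - M r.toNNReal ω) * β r.toNNReal ω)
      ((P.restrict B).prod (volume.restrict (Set.Ioc (s : ℝ) t))) := by
    refine Integrable.of_bound (C := (C + C) * D)
      (hmeas.comp_measurable measurable_swap).aestronglyMeasurable ?_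
    have : ∀ᵐ p ∂((P.restrict B).prod (volume.restrict (Set.Ioc (s : ℝ) t))),
        p.2 ∈ Set.Ioc (s : ℝ) t :=
      Measure.quasiMeasurePreserving_snd.ae (ae_restrict_mem measurableSet_Ioc)
    exact this.mono fun p hp => hb p.2 hp p.1
  rw [integral_integral_swap hint]
  refine setIntegral_eq_zero_of_forall_eq_zero fun r hr => ?_
  have hsr : s ≤ r.toNNReal := NNReal.le_toNNReal_of_coe_le hr.1.le
  have hrt : r.toNNReal ≤ t := Real.toNNReal_le_iff_le_coe.2 hr.2
  have hβm : StronglyMeasurable[𝓕 r.toNNReal] (β r.toNNReal) :=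
    (hβ.prog.stronglyAdapted) _
  have hfut := hM.condZero_mul_future hrt (MemLp.of_bound (p := 2)
    (hβm.mono (𝓕.le _)).aestronglyMeasurable D (ae_of_all _ fun ω => hD _ ω))
    hβm.aestronglyMeasurable B (𝓕.mono hsr _ hB)
  rw [← hfut]
  exact integral_congr_ae (ae_of_all _ fun ω => by simp only; ring)

/-- If `Z = Z 0 + ∫ β + M` and `Z² - ∫ (2 Z β + c)` is a martingale, then `M` has bracket `∫ c`. -/
lemma bracketPair_of_sq {Ω : Type*} {mΩ : MeasurableSpace Ω} {P : Measure Ω}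
    [IsProbabilityMeasure P] {𝓕 : Filtration ℝ≥0 mΩ} {Z M β c : ℝ≥0 → Ω → ℝ} (hM : L2Mart 𝓕 P M)
    (hMc : IsBddContinuous 𝓕 M) (hZ : IsBddContinuous 𝓕 Z) (hβ : IsBoundedProg 𝓕 β)
    (hc : IsBoundedProg 𝓕 c) (hdec : ∀ t ω, Z t ω = Z 0 ω + timeInt β t ω + M t ω)
    (hq : IsBoundedProg 𝓕 fun r ω => 2 * Z r ω * β r ω + c r ω)
    (h : ∀ s t, s ≤ t → CondZero (𝓕 s) P fun ω =>
      (Z t ω ^ 2 - timeInt (fun r ω => 2 * Z r ω * β r ω + c r ω) t ω) -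
        (Z s ω ^ 2 - timeInt (fun r ω => 2 * Z r ω * β r ω + c r ω) s ω)) :
    BracketPair 𝓕 P M M (timeInt c) := by
  refine ⟨fun t => hc.integrable_timeInt t, fun s t hst => ?_⟩
  -- A pathwise identity that needs only ordinary integrals: `Z²` is expanded at time `s`, and in `∫
  -- Z β` the value of `M` at `r` is written as `M t - (M t - M r)`. The two correction terms on the
  -- left have vanishing conditional expectation given `𝓕 s`.
  have hpath : ∀ ω, ((Z t ω ^ 2 - timeInt (fun r ω => 2 * Z r ω * β r ω + c r ω) t ω) -
      (Z s ω ^ 2 - timeInt (fun r ω => 2 * Z r ω * β r ω + c r ω) s ω)) +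
      (-2 * (Z s ω * (M t ω - M s ω)) +
      -2 * ∫ r in (s : ℝ)..t, (M t ω - M r.toNNReal ω) * β r.toNNReal ω) =
      (M t ω - M s ω) * (M t ω - M s ω) - (timeInt c t ω - timeInt c s ω) := fun ω => by
    have hβi := fun a b => hβ.integrable_section ω a b
    have hr := fun {f : ℝ≥0 → Ω → ℝ} (hf : IsBddContinuous 𝓕 f) =>
      (hf.continuous ω).comp continuous_real_toNNReal
    have i1 : IntervalIntegrable (fun r : ℝ => Z r.toNNReal ω * β r.toNNReal ω) volume s t :=
      (hβi _ _).continuousOn_mul (hr hZ).continuousOn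
    have i2 : IntervalIntegrable (fun r : ℝ => (M t ω - M r.toNNReal ω) * β r.toNNReal ω)
        volume s t := (hβi _ _).continuousOn_mul (continuous_const.sub (hr hMc)).continuousOn
    have e1 : timeInt (fun r ω => 2 * Z r ω * β r ω + c r ω) t ω -
        timeInt (fun r ω => 2 * Z r ω * β r ω + c r ω) s ω =
        2 * (∫ r in (s : ℝ)..t, Z r.toNNReal ω * β r.toNNReal ω) +
          (timeInt c t ω - timeInt c s ω) := by
      rw [timeInt_sub hq, timeInt_sub hc, ← intervalIntegral.integral_const_mul,
        ← intervalIntegral.integral_add (i1.const_mul _) (hc.integrable_section ω _ _)]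
      simp only [mul_assoc]
    have hB := timeInt_sub hβ s t ω
    have e2 : ∫ r in (s : ℝ)..t, Z r.toNNReal ω * β r.toNNReal ω =
        (Z s ω + M t ω - M s ω) * (timeInt β t ω - timeInt β s ω) -
        (∫ r in (s : ℝ)..t, (M t ω - M r.toNNReal ω) * β r.toNNReal ω) +
        (timeInt β t ω - timeInt β s ω) ^ 2 / 2 := by
      rw [hB, ← integral_primitive_mul_self hβi, ← intervalIntegral.integral_const_mul,
        ← intervalIntegral.integral_sub ((hβi _ _).const_mul _) i2,
        ← intervalIntegral.integral_add (((hβi _ _).const_mul _).sub i2)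
          ((hβi _ _).continuousOn_mul (intervalIntegral.continuous_primitive hβi _).continuousOn)]
      refine intervalIntegral.integral_congr fun r hr => ?_
      rw [Set.uIcc_of_le (NNReal.coe_le_coe.2 hst)] at hr
      have := timeInt_sub hβ s r.toNNReal ω
      rw [Real.coe_toNNReal r (s.coe_nonneg.trans hr.1)] at this
      rw [← this, hdec r.toNNReal ω, hdec s ω]
      ring
    rw [e2] at e1
    have e3 : Z t ω = Z s ω + (timeInt β t ω - timeInt β s ω) + (M t ω - M s ω) := by
      rw [hdec t, hdec s]; ring
    rw [e3]
    linear_combination -e1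
  have hM2 : Integrable (fun ω => (M t ω - M s ω) * (M t ω - M s ω)) P := (hM.memLp_sub s t).integrable_mul (hM.memLp_sub s t)
  have hV := ((hZ.memLp t 2).integrable_sq.sub (hq.integrable_timeInt t)).sub
    ((hZ.memLp s 2).integrable_sq.sub (hq.integrable_timeInt (P := P) s))
  have hzi : Integrable (fun ω => Z s ω * (M t ω - M s ω)) P :=
    (hZ.memLp s 2).integrable_mul (hM.memLp_sub s t)
  -- Integrability of this term is read off from `hpath`, where all other terms are known to be
  -- integrable.
  have hfi : Integrable (fun ω => -2 * ∫ r in (s : ℝ)..t, (M t ω - M r.toNNReal ω) *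
      β r.toNNReal ω) P := by
    refine (((hM2.sub ((hc.integrable_timeInt t).sub (hc.integrable_timeInt s))).sub hV).sub
      (hzi.const_mul (-2))).congr (ae_of_all _ fun ω => ?_)
    have := hpath ω
    simp only [Pi.sub_apply]
    linarith
  have hzM := hM.condZero_mul_future hst (hZ.memLp s 2) (hZ.adapted s).aestronglyMeasurable
  exact ((h s t hst).add hV ((hzi.const_mul (-2)).add hfi) ((hzM.const_mul (-2)).add
    (hzi.const_mul (-2)) hfi ((condZero_integral_future hM hMc hβ hst).const_mul (-2)))).congr
    (ae_of_all _ hpath)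

/-- Stopped on leaving a ball, the local martingale for `⟨·, x*⟩` is `martStop` up to its initial
value. The one for `⟨·, x*⟩²` identifies the bracket through `bracketPair_of_sq`. -/
theorem isSolutionMeasure_of_min (hyp : IsAdmissibleCoefficients ι A F G)
    (h : SolvesLocalMartingaleProblem (minOperatorGraph ι A F G) P) :
    IsSolutionMeasure ι A F G P := by
  have hprob := h.1
  have hcont : ∀ xs : StrongDual ℝ X, Continuous fun e : E => xs (ι e) := fun xs =>
    (xs.comp ι).continuous
  have hbdd : ∀ xs : StrongDual ℝ X, ∀ R : ℝ, ∀ e : E, ‖e‖ ≤ R →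
      |xs (ι e)| ≤ ‖xs.comp ι‖ * |R| := fun xs R e he =>
    ((xs.comp ι).le_opNorm e).trans
      (mul_le_mul_of_nonneg_left (he.trans (le_abs_self R)) (norm_nonneg _))
  have hmart : ∀ R xs ys, IsAdjointPair A xs ys →
      L2Mart (pathFiltration E) P (martStop ι F R xs ys) := by
    intro R xs ys hp
    have hM := hyp.isBddContinuous_martStop R xs ys
    refine ⟨fun t => hM.memLp t 2, fun t => (hM.adapted t).aestronglyMeasurable,
      fun s t hst => ?_⟩
    have := condZero_stopped_problem (hcont xs) (fun R => ⟨_, fun e he => hbdd xs R e he⟩)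
      (hyp.stronglyMeasurable_drift xs ys) (hyp.bddOnBalls_drift xs ys) R
      (h.2 _ (mem_minOperatorGraph hp).1) hst
    refine this.congr (ae_of_all _ fun x => ?_)
    simp only [martStop_eq]
    ring
  refine ⟨hprob, hmart, fun R xs ys hp => ?_⟩
  set g : E → ℝ := fun e => 2 * xs (ι e) * drift ι F xs ys e +
    inner ℝ (disp G xs e) (disp G xs e) with hg
  have hgm : StronglyMeasurable g :=
    ((((hcont xs).stronglyMeasurable).const_mul 2).mul (hyp.stronglyMeasurable_drift xs ys)).add
      (hyp.stronglyMeasurable_inner_disp xs xs)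
  have hgb : BddOnBalls g := fun R => by
    obtain ⟨C, hC⟩ := hyp.bddOnBalls_drift xs ys R
    obtain ⟨D, hD⟩ := hyp.bddOnBalls_inner_disp xs xs R
    refine ⟨2 * (‖xs.comp ι‖ * |R|) * C + D, fun e he => (norm_add_le _ _).trans
      (add_le_add ?_ (hD e he))⟩
    rw [norm_mul, norm_mul, Real.norm_two]
    have := hbdd xs R e he
    exact mul_le_mul (mul_le_mul_of_nonneg_left this zero_le_two) (hC e he) (norm_nonneg _)
      (by positivity)
  have hsqb : BddOnBalls fun e : E => xs (ι e) ^ 2 := fun R =>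
    ⟨(‖xs.comp ι‖ * |R|) ^ 2, fun e he => by
      rw [Real.norm_eq_abs, abs_pow]
      exact pow_le_pow_left₀ (abs_nonneg _) (hbdd xs R e he) 2⟩
  have hq : cutoff R g = fun r x => 2 * coordStop ι R xs r x * cutoff R (drift ι F xs ys) r x +
      cutoff R (fun e => inner ℝ (disp G xs e) (disp G xs e)) r x := by
    ext r x
    simp only [cutoff, coordStop]
    by_cases hr : (r : WithTop ℝ≥0) < hit R x
    · simp only [if_pos hr, if_pos (lt_hit_iff.1 hr 0 zero_le), stopAt_of_le hr.le, hg]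
    · simp only [if_neg hr, mul_zero, add_zero]
  refine bracketPair_of_sq (hmart R xs ys hp) (hyp.isBddContinuous_martStop R xs ys)
    (isBddContinuous_coordStop hyp R xs ys (F := F)) (isBoundedProg_cutoff
      (hyp.stronglyMeasurable_drift xs ys) (hyp.bddOnBalls_drift xs ys) R)
    (isBoundedProg_cutoff (hyp.stronglyMeasurable_inner_disp xs xs)
      (hyp.bddOnBalls_inner_disp xs xs) R) (coordStop_eq R xs ys)
    (hq ▸ isBoundedProg_cutoff hgm hgb R) fun s t hst => ?_
  rw [← hq]
  refine (condZero_stopped_problem ((hcont xs).pow 2) hsqb hgm hgb R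
    (h.2 _ (mem_minOperatorGraph hp).2) hst).congr (ae_of_all _ fun x => ?_)
  simp only [coordStop]
  split_ifs with hx
  · rfl
  · simp [stopAt_hit_of_le (not_lt.1 hx), timeInt_cutoff_of_le (not_lt.1 hx)]

end MinimalProblem

/-! ### Limits in mean square of elementary integrals -/

section IntClosure

/-- `E ∫₀ᵗ ‖φ(r)‖² dr`. -/
noncomputable def energy (P : Measure Ω) (φ : ℝ≥0 → Ω → K) (t : ℝ≥0) : ℝ :=
  ∫ ω, timeInt (fun r ω => inner ℝ (φ r ω) (φ r ω)) t ω ∂P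

lemma timeInt_nonneg {c : ℝ≥0 → Ω → ℝ} (hc : ∀ r ω, 0 ≤ c r ω) (t : ℝ≥0) (ω : Ω) :
    0 ≤ timeInt c t ω :=
  intervalIntegral.integral_nonneg t.2 fun _ _ => hc _ _

lemma energy_nonneg (φ : ℝ≥0 → Ω → K) (t : ℝ≥0) : 0 ≤ energy P φ t :=
  integral_nonneg fun _ => timeInt_nonneg (fun _ _ => real_inner_self_nonneg) _ _

lemma timeInt_mono {c d : ℝ≥0 → Ω → ℝ} (hc : IsBoundedProg 𝓕 c) (hd : IsBoundedProg 𝓕 d)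
    {t : ℝ≥0} {ω : Ω} (h : ∀ r ≤ t, c r ω ≤ d r ω) : timeInt c t ω ≤ timeInt d t ω :=
  intervalIntegral.integral_mono_on t.2 (hc.integrable_section ω _ _)
    (hd.integrable_section ω _ _) fun r hr => h _ (Real.toNNReal_le_iff_le_coe.2 hr.2)

lemma timeInt_le_timeInt {c : ℝ≥0 → Ω → ℝ} (hc : IsBoundedProg 𝓕 c) (h0 : ∀ r ω, 0 ≤ c r ω)
    {s t : ℝ≥0} (hst : s ≤ t) (ω : Ω) : timeInt c s ω ≤ timeInt c t ω := by
  rw [← sub_nonneg, timeInt_sub hc]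
  exact intervalIntegral.integral_nonneg (NNReal.coe_le_coe.2 hst) fun _ _ => h0 _ _

lemma IsBoundedProg.sub {φ ψ : ℝ≥0 → Ω → K} (h : IsBoundedProg 𝓕 φ) (h' : IsBoundedProg 𝓕 ψ) :
    IsBoundedProg 𝓕 (fun t ω => φ t ω - ψ t ω) := by
  have := h.add (h'.const_smul (-1))
  simpa [sub_eq_add_neg] using this

lemma IsBoundedProg.norm {φ : ℝ≥0 → Ω → K} (h : IsBoundedProg 𝓕 φ) :
    IsBoundedProg 𝓕 (fun t ω => ‖φ t ω‖) := by
  refine ⟨fun i => (h.prog i).norm, ?_⟩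
  obtain ⟨C, hC⟩ := h.bdd
  exact ⟨C, fun t ω => by simpa using hC t ω⟩

lemma energy_mono [IsFiniteMeasure P] {K' : Type*} [NormedAddCommGroup K'] [InnerProductSpace ℝ K']
    {φ : ℝ≥0 → Ω → K} {ψ : ℝ≥0 → Ω → K'} (hφ : IsBoundedProg 𝓕 φ)
    (hψ : IsBoundedProg 𝓕 ψ) {t : ℝ≥0} (h : ∀ r ≤ t, ∀ ω, ‖φ r ω‖ ≤ ‖ψ r ω‖) :
    energy P φ t ≤ energy P ψ t :=
  integral_mono ((hφ.inner hφ).integrable_timeInt t) ((hψ.inner hψ).integrable_timeInt t)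
    fun ω => timeInt_mono (hφ.inner hφ) (hψ.inner hψ) fun r hr => by
      simp only [real_inner_self_eq_norm_sq]
      exact pow_le_pow_left₀ (norm_nonneg _) (h r hr ω) 2

lemma energy_le_energy [IsFiniteMeasure P] {φ : ℝ≥0 → Ω → K} (hφ : IsBoundedProg 𝓕 φ)
    {s t : ℝ≥0} (hst : s ≤ t) : energy P φ s ≤ energy P φ t :=
  integral_mono ((hφ.inner hφ).integrable_timeInt s) ((hφ.inner hφ).integrable_timeInt t)
    fun ω => timeInt_le_timeInt (hφ.inner hφ) (fun _ _ => real_inner_self_nonneg) hst ω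

lemma norm_add_sq_le_two (a b : K) : inner ℝ (a + b) (a + b) ≤ 2 * (inner ℝ a a + inner ℝ b b) := by
  simp only [real_inner_self_eq_norm_sq]
  have := norm_add_le a b
  nlinarith [sq_nonneg (‖a‖ - ‖b‖), norm_nonneg (a + b), norm_nonneg a, norm_nonneg b]

lemma energy_add_le [IsFiniteMeasure P] {φ ψ : ℝ≥0 → Ω → K} (hφ : IsBoundedProg 𝓕 φ)
    (hψ : IsBoundedProg 𝓕 ψ) (t : ℝ≥0) :
    energy P (fun r ω => φ r ω + ψ r ω) t ≤ 2 * (energy P φ t + energy P ψ t) := by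
  unfold energy
  rw [← integral_add ((hφ.inner hφ).integrable_timeInt t) ((hψ.inner hψ).integrable_timeInt t),
    ← integral_const_mul]
  refine integral_mono (((hφ.add hψ).inner (hφ.add hψ)).integrable_timeInt t)
    ((((hφ.inner hφ).integrable_timeInt t).add ((hψ.inner hψ).integrable_timeInt t)).const_mul _)
    fun ω => ?_
  simp only [Pi.add_apply]
  rw [← timeInt_add (hφ.inner hφ) (hψ.inner hψ), ← timeInt_const_mul]
  exact timeInt_mono ((hφ.add hψ).inner (hφ.add hψ))
    (((hφ.inner hφ).add (hψ.inner hψ)).const_smul 2) fun r _ => norm_add_sq_le_two _ _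

lemma energy_sub_le [IsFiniteMeasure P] {φ ψ χ : ℝ≥0 → Ω → K} (hφ : IsBoundedProg 𝓕 φ)
    (hψ : IsBoundedProg 𝓕 ψ) (hχ : IsBoundedProg 𝓕 χ) (t : ℝ≥0) :
    energy P (fun r ω => φ r ω - ψ r ω) t ≤ 2 * (energy P (fun r ω => φ r ω - χ r ω) t +
      energy P (fun r ω => ψ r ω - χ r ω) t) := by
  have h1 : energy P (fun r ω => ψ r ω - χ r ω) t = energy P (fun r ω => χ r ω - ψ r ω) t := by
    unfold energy
    congr 1; ext ω; congr 1; ext r ω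
    rw [← inner_neg_neg, neg_sub]
  rw [h1]
  refine le_trans (le_of_eq ?_) (energy_add_le (hφ.sub hχ) (hχ.sub hψ) t)
  simp only [sub_add_sub_cancel]

variable [IsProbabilityMeasure P]

lemma tendsto_integral_abs_mul {f : ℕ → Ω → ℝ} {g : Ω → ℝ} (hf : ∀ k, MemLp (f k) 2 P)
    (hg : MemLp g 2 P) (h : Tendsto (fun k => ∫ ω, f k ω ^ 2 ∂P) atTop (𝓝 0)) :
    Tendsto (fun k => ∫ ω, |f k ω * g ω| ∂P) atTop (𝓝 0) := by
  refine tendsto_zero_of_le_mul_add (A := ∫ ω, g ω ^ 2 ∂P)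
    (fun k => integral_nonneg fun ω => abs_nonneg _) h fun c hc k => ?_
  have i1 := hg.integrable_sq.const_mul c
  have i2 := (hf k).integrable_sq.const_mul c⁻¹
  rw [← integral_const_mul, ← integral_const_mul, ← integral_add i1 i2]
  exact integral_mono ((hf k).integrable_mul hg).abs (i1.add i2) fun ω => abs_mul_le_mul_sq_add hc _ _

/-- Only one factor varies, so its mean square convergence suffices for the products to converge in
`L¹`. -/
lemma BracketPair.of_tendsto {N N' C : ℝ≥0 → Ω → ℝ} {Nk Ck : ℕ → ℝ≥0 → Ω → ℝ}
    (h : ∀ k, BracketPair 𝓕 P (Nk k) N' (Ck k)) (hNk : ∀ k, L2Mart 𝓕 P (Nk k))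
    (hN : ∀ t, MemLp (N t) 2 P) (hN' : L2Mart 𝓕 P N') (hC : ∀ t, Integrable (C t) P)
    (hlim : ∀ t, Tendsto (fun k => ∫ ω, (Nk k t ω - N t ω) ^ 2 ∂P) atTop (𝓝 0))
    (hlimC : ∀ t, Tendsto (fun k => ∫ ω, |Ck k t ω - C t ω| ∂P) atTop (𝓝 0)) :
    BracketPair 𝓕 P N N' C := by
  refine ⟨hC, fun s t hst => ?_⟩
  have m := fun r k => ((hNk k).memLp r).sub (hN r)
  have m4 := hN'.memLp_sub s t
  have i := fun r k => ((m r k).integrable_mul m4).abs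
  have c := fun r k => (((h k).integrable r).sub (hC r)).abs
  have hik := fun k => (h k).integrable_cond (hNk k) hN' s t
  have hi := (((hN t).sub (hN s)).integrable_mul m4).sub ((hC t).sub (hC s))
  refine CondZero.of_tendsto_L1 (fun k => (h k).cond s t hst) hik hi ?_
  have hsum := ((tendsto_integral_abs_mul (m t) m4 (hlim t)).add
    (tendsto_integral_abs_mul (m s) m4 (hlim s))).add ((hlimC t).add (hlimC s))
  simp only [add_zero] at hsum
  refine squeeze_zero (fun k => integral_nonneg fun ω => abs_nonneg _) (fun k => ?_) hsum
  refine (integral_mono ((hik k).sub hi).abs (((i t k).add (i s k)).add ((c t k).add (c s k)))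
    fun ω => ?_).trans_eq ?_
  · simp only [Pi.add_apply, Pi.sub_apply, Pi.mul_apply]
    have : (Nk k t ω - Nk k s ω) * (N' t ω - N' s ω) - (Ck k t ω - Ck k s ω) -
        ((N t ω - N s ω) * (N' t ω - N' s ω) - (C t ω - C s ω)) =
        ((Nk k t ω - N t ω) * (N' t ω - N' s ω) - (Nk k s ω - N s ω) * (N' t ω - N' s ω)) -
        ((Ck k t ω - C t ω) - (Ck k s ω - C s ω)) := by ring
    rw [this]
    exact (abs_sub _ _).trans (add_le_add (abs_sub _ _) (abs_sub _ _))
  · rw [integral_add' ((i t k).add (i s k)) ((c t k).add (c s k)), integral_add' (i t k) (i s k),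
      integral_add' (c t k) (c s k)]
    rfl

lemma tendsto_timeInt_inner {φ φ' : ℝ≥0 → Ω → K} {φk : ℕ → ℝ≥0 → Ω → K}
    (hk : ∀ k, IsBoundedProg 𝓕 (φk k)) (hφ : IsBoundedProg 𝓕 φ) (hφ' : IsBoundedProg 𝓕 φ')
    (t : ℝ≥0) (hlim : Tendsto (fun k => energy P (fun r ω => φk k r ω - φ r ω) t) atTop (𝓝 0)) :
    Tendsto (fun k => ∫ ω, |timeInt (fun r ω => inner ℝ (φk k r ω) (φ' r ω)) t ω -
      timeInt (fun r ω => inner ℝ (φ r ω) (φ' r ω)) t ω| ∂P) atTop (𝓝 0) := by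
  refine tendsto_zero_of_le_mul_add (A := energy P φ' t)
    (fun k => integral_nonneg fun ω => abs_nonneg _) hlim fun c hc k => ?_
  have hd := (hk k).sub hφ
  have i1 : Integrable (fun ω => c * timeInt (fun r ω => inner ℝ (φ' r ω) (φ' r ω)) t ω) P :=
    ((hφ'.inner hφ').integrable_timeInt t).const_mul c
  have i2 : Integrable (fun ω => c⁻¹ * timeInt (fun r ω =>
      inner ℝ (φk k r ω - φ r ω) (φk k r ω - φ r ω)) t ω) P :=
    ((hd.inner hd).integrable_timeInt t).const_mul c⁻¹
  unfold energy
  rw [← integral_const_mul, ← integral_const_mul, ← integral_add i1 i2]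
  refine integral_mono ((((hk k).inner hφ').integrable_timeInt t).sub
    ((hφ.inner hφ').integrable_timeInt t)).abs (i1.add i2) fun ω => ?_
  simp only [Pi.add_apply, Pi.sub_apply]
  have e0 : timeInt (fun r ω => inner ℝ (φk k r ω) (φ' r ω)) t ω -
      timeInt (fun r ω => inner ℝ (φ r ω) (φ' r ω)) t ω =
      timeInt (fun r ω => inner ℝ (φk k r ω - φ r ω) (φ' r ω)) t ω := by
    simp only [inner_sub_left]
    exact (intervalIntegral.integral_sub (((hk k).inner hφ').integrable_section ω _ _)
      ((hφ.inner hφ').integrable_section ω _ _)).symm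
  have e1 := timeInt_add ((hφ'.inner hφ').const_smul c) ((hd.inner hd).const_smul c⁻¹) t ω
  simp only [smul_eq_mul] at e1
  rw [e0, ← timeInt_const_mul, ← timeInt_const_mul, ← e1]
  have hb := ((hφ'.inner hφ').const_smul c).add ((hd.inner hd).const_smul c⁻¹)
  have key : ∀ a b : K, |inner ℝ a b| ≤ c * inner ℝ b b + c⁻¹ * inner ℝ a a := fun a b => by
    refine (abs_real_inner_le_norm a b).trans ?_
    simp only [real_inner_self_eq_norm_sq]
    exact (le_abs_self _).trans (abs_mul_le_mul_sq_add hc _ _)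
  refine (intervalIntegral.abs_integral_le_integral_abs t.2).trans ?_
  exact timeInt_mono (hd.inner hφ').norm hb fun r _ => key _ _

/-- The pair `(N, φ)` is a limit in mean square of elementary stochastic integrals with respect to
the family `Base`. -/
structure IntClosure (𝓕 : Filtration ℝ≥0 mΩ) (P : Measure Ω)
    (Base : (ℝ≥0 → Ω → ℝ) → (ℝ≥0 → Ω → K) → Prop) (N : ℝ≥0 → Ω → ℝ) (φ : ℝ≥0 → Ω → K) :
    Prop where
  prog : IsBoundedProg 𝓕 φ
  memLp : ∀ t, MemLp (N t) 2 P
  approx : ∃ (Nk : ℕ → ℝ≥0 → Ω → ℝ) (φk : ℕ → ℝ≥0 → Ω → K), (∀ k, Gen 𝓕 Base (Nk k) (φk k)) ∧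
    (∀ t, Tendsto (fun k => energy P (fun r ω => φk k r ω - φ r ω) t) atTop (𝓝 0)) ∧
    ∀ t, Tendsto (fun k => ∫ ω, (Nk k t ω - N t ω) ^ 2 ∂P) atTop (𝓝 0)

lemma integral_sq_eq_eLpNorm {f : Ω → ℝ} (hf : MemLp f 2 P) :
    eLpNorm f 2 P = ENNReal.ofReal (Real.sqrt (∫ ω, f ω ^ 2 ∂P)) := by
  rw [hf.eLpNorm_eq_integral_rpow_norm two_ne_zero ENNReal.ofNat_ne_top, Real.sqrt_eq_rpow]
  simp

lemma tendsto_eLpNorm_iff {f : ℕ → Ω → ℝ} (hf : ∀ k, MemLp (f k) 2 P) :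
    Tendsto (fun k => eLpNorm (f k) 2 P) atTop (𝓝 0) ↔
      Tendsto (fun k => ∫ ω, f k ω ^ 2 ∂P) atTop (𝓝 0) := by
  simp only [integral_sq_eq_eLpNorm (hf _)]
  constructor
  · intro h
    have h1 := (ENNReal.tendsto_toReal ENNReal.zero_ne_top).comp h
    have h2 := h1.pow 2
    refine (h2.congr fun k => ?_).trans (by simp)
    simp only [Function.comp]
    rw [ENNReal.toReal_ofReal (Real.sqrt_nonneg _),
      Real.sq_sqrt (integral_nonneg fun ω => sq_nonneg _)]
  · intro h
    have := ENNReal.tendsto_ofReal ((Real.continuous_sqrt.tendsto 0).comp h)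
    simpa [Function.comp] using this

lemma tendstoInMeasure_of_integral_sq {f : ℕ → Ω → ℝ} {g : Ω → ℝ} (hf : ∀ k, MemLp (f k) 2 P)
    (hg : MemLp g 2 P)
    (h : Tendsto (fun k => ∫ ω, (f k ω - g ω) ^ 2 ∂P) atTop (𝓝 0)) :
    TendstoInMeasure P f atTop g :=
  tendstoInMeasure_of_tendsto_eLpNorm two_ne_zero (fun k => (hf k).1) hg.1
    ((tendsto_eLpNorm_iff fun k => (hf k).sub hg).2 h)

lemma BracketSystem.integral_sq (h : BracketSystem 𝓕 P Base) {N φ} (hN : Base N φ) (t : ℝ≥0) :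
    ∫ ω, (N t ω - N 0 ω) ^ 2 ∂P = energy P φ t := by
  have := h.setIntegral_sq hN (zero_le (a := t)) MeasurableSet.univ
  simp only [Measure.restrict_univ] at this
  rw [this]
  unfold energy timeInt
  simp only [real_inner_self_eq_norm_sq, NNReal.coe_zero]

lemma CondZero.of_tendsto_sq {m : MeasurableSpace Ω} {f : ℕ → Ω → ℝ} {g : Ω → ℝ}
    (hf : ∀ k, MemLp (f k) 2 P) (hg : MemLp g 2 P) (h : ∀ k, CondZero m P (f k))
    (hlim : Tendsto (fun k => ∫ ω, (f k ω - g ω) ^ 2 ∂P) atTop (𝓝 0)) : CondZero m P g := by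
  refine CondZero.of_tendsto_L1 h (fun k => (hf k).integrable one_le_two)
    (hg.integrable one_le_two) ?_
  refine tendsto_zero_of_le_mul_add (A := 1) (fun k => integral_nonneg fun ω => abs_nonneg _) hlim
    fun c hc k => ?_
  have i2 : Integrable (fun ω => c⁻¹ * (f k ω - g ω) ^ 2) P :=
    (((hf k).sub hg).integrable_sq).const_mul _
  have i1 : Integrable (fun _ : Ω => c * 1) P := integrable_const _
  have e1 : c * 1 = ∫ _ω : Ω, c * 1 ∂P := by simp
  rw [e1, ← integral_const_mul, ← integral_add i1 i2]
  refine integral_mono (((hf k).sub hg).integrable one_le_two).abs (i1.add i2) fun ω => ?_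
  simp only [Pi.add_apply, Pi.sub_apply]
  set a := f k ω - g ω
  have e3 : c * |a| ≤ c * (c * 1 + c⁻¹ * a ^ 2) := by
    have : c * (c * 1 + c⁻¹ * a ^ 2) = c ^ 2 + |a| ^ 2 := by rw [sq_abs]; field_simp
    rw [this]
    nlinarith [sq_nonneg (c - |a|), sq_nonneg c, sq_nonneg |a|]
  exact le_of_mul_le_mul_left e3 hc

lemma tendsto_integral_sq_sub {f f' : ℕ → Ω → ℝ} {g g' : Ω → ℝ} (hf : ∀ k, MemLp (f k) 2 P)
    (hg : MemLp g 2 P) (hf' : ∀ k, MemLp (f' k) 2 P) (hg' : MemLp g' 2 P)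
    (h : Tendsto (fun k => ∫ ω, (f k ω - g ω) ^ 2 ∂P) atTop (𝓝 0))
    (h' : Tendsto (fun k => ∫ ω, (f' k ω - g' ω) ^ 2 ∂P) atTop (𝓝 0)) :
    Tendsto (fun k => ∫ ω, ((f k ω - f' k ω) - (g ω - g' ω)) ^ 2 ∂P) atTop (𝓝 0) := by
  have h2 := (h.add h').const_mul 2
  rw [add_zero, mul_zero] at h2
  refine squeeze_zero (fun k => integral_nonneg fun ω => sq_nonneg _) (fun k => ?_) h2
  have i1 : Integrable (fun ω => (f k ω - g ω) ^ 2) P := ((hf k).sub hg).integrable_sq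
  have i2 : Integrable (fun ω => (f' k ω - g' ω) ^ 2) P := ((hf' k).sub hg').integrable_sq
  rw [← integral_add i1 i2, ← integral_const_mul]
  refine integral_mono ((((hf k).sub (hf' k)).sub (hg.sub hg')).integrable_sq)
    ((i1.add i2).const_mul 2) fun ω => ?_
  simp only [Pi.add_apply, Pi.sub_apply]
  nlinarith [sq_nonneg ((f k ω - g ω) + (f' k ω - g' ω))]

lemma L2Mart.of_tendsto {N : ℝ≥0 → Ω → ℝ} {Nk : ℕ → ℝ≥0 → Ω → ℝ} (hNk : ∀ k, L2Mart 𝓕 P (Nk k))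
    (hN : ∀ t, MemLp (N t) 2 P)
    (hlim : ∀ t, Tendsto (fun k => ∫ ω, (Nk k t ω - N t ω) ^ 2 ∂P) atTop (𝓝 0)) :
    L2Mart 𝓕 P N where
  memLp := hN
  adapted t := by
    have h1 := (tendsto_eLpNorm_iff fun k => ((hNk k).memLp t).sub (hN t)).2 (hlim t)
    have h2 := (Lp.tendsto_Lp_iff_tendsto_eLpNorm'' (fun k => Nk k t)
      (fun k => (hNk k).memLp t) (N t) (hN t)).2 h1
    -- Measurability up to null sets is a closed condition in `L²`. Adaptedness in the strict sense
    -- would depend on the choice of the representative of the limit.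
    have h3 := (isClosed_aestronglyMeasurable (F := ℝ) (p := 2) (μ := P) (𝓕.le t)).mem_of_tendsto h2
      (Eventually.of_forall fun k => ((hNk k).adapted t).congr (MemLp.coeFn_toLp _).symm)
    exact AEStronglyMeasurable.congr h3 (MemLp.coeFn_toLp _)
  mart s t hst := CondZero.of_tendsto_sq (fun k => (hNk k).memLp_sub s t) ((hN t).sub (hN s))
    (fun k => (hNk k).mart s t hst) (tendsto_integral_sq_sub (fun k => (hNk k).memLp t) (hN t)
      (fun k => (hNk k).memLp s) (hN s) (hlim t) (hlim s))

lemma IntClosure.l2Mart (h : BracketSystem 𝓕 P Base) {N φ} (hN : IntClosure 𝓕 P Base N φ) :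
    L2Mart 𝓕 P N := by
  obtain ⟨Nk, φk, h1, -, h3⟩ := hN.approx
  exact L2Mart.of_tendsto (fun k => h.gen_mart (h1 k)) hN.memLp h3

lemma IntClosure.of_gen (h : BracketSystem 𝓕 P Base) {N φ} (hN : Gen 𝓕 Base N φ) :
    IntClosure 𝓕 P Base N φ where
  prog := h.gen_prog hN
  memLp := (h.gen_mart hN).memLp
  approx := ⟨fun _ => N, fun _ => φ, fun _ => hN, fun t => by simp [energy, timeInt],
    fun t => by simp⟩

/-- The factors are approximated one after the other: `N'` against an elementary integral first,
then `N` against `N'`. -/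
theorem BracketSystem.intClosure (h : BracketSystem 𝓕 P Base) :
    BracketSystem 𝓕 P (IntClosure 𝓕 P Base) where
  mart hN := hN.l2Mart h
  prog hN := hN.prog
  bracket {N φ N' φ'} hN hN' := by
    obtain ⟨Nk, φk, h1, h2, h3⟩ := hN.approx
    obtain ⟨Nk', φk', h1', h2', h3'⟩ := hN'.approx
    have hc : ∀ {M ψ}, Gen 𝓕 Base M ψ → BracketPair 𝓕 P N' M
        (timeInt fun r ω => inner ℝ (φ' r ω) (ψ r ω)) := fun {M ψ} hM =>
      BracketPair.of_tendsto (fun k => h.gen.bracket (h1' k) hM) (fun k => h.gen_mart (h1' k))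
        hN'.memLp (h.gen_mart hM) (fun t => (hN'.prog.inner (h.gen_prog hM)).integrable_timeInt t)
        h3' fun t => tendsto_timeInt_inner (fun k => h.gen_prog (h1' k)) hN'.prog (h.gen_prog hM)
          t (h2' t)
    refine BracketPair.of_tendsto (fun k => ((hc (h1 k)).symm.congr fun t => ae_of_all _ fun ω => ?_))
      (fun k => h.gen_mart (h1 k)) hN.memLp (hN'.l2Mart h)
      (fun t => (hN.prog.inner hN'.prog).integrable_timeInt t) h3
      fun t => tendsto_timeInt_inner (fun k => h.gen_prog (h1 k)) hN.prog hN'.prog t (h2 t)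
    simp only [real_inner_comm]

end IntClosure

/-! ### Existence of stochastic integrals of approximable integrands -/

section IntClosureExistence

lemma timeInt_congr {c d : ℝ≥0 → Ω → ℝ} {t : ℝ≥0} {ω : Ω}
    (h : ∀ r, 0 < r → r ≤ t → c r ω = d r ω) : timeInt c t ω = timeInt d t ω := by
  refine intervalIntegral.integral_congr_ae (ae_of_all _ fun r hr => ?_)
  rw [Set.uIoc_of_le (NNReal.coe_nonneg t)] at hr
  exact h _ (Real.toNNReal_pos.2 hr.1) (Real.toNNReal_le_iff_le_coe.2 hr.2)

lemma energy_congr {φ ψ : ℝ≥0 → Ω → K} {t : ℝ≥0}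
    (h : ∀ r, 0 < r → r ≤ t → ∀ ω, φ r ω = ψ r ω) : energy P φ t = energy P ψ t := by
  unfold energy
  congr 1; ext ω
  exact timeInt_congr fun r h0 hr => by rw [h r h0 hr ω]

lemma Gen.sub {N N' φ φ'} (h : Gen 𝓕 Base N φ) (h' : Gen 𝓕 Base N' φ') :
    Gen 𝓕 Base (fun t ω => N t ω - N' t ω) (fun t ω => φ t ω - φ' t ω) := by
  have := h.add (h'.smul (-1))
  simpa [sub_eq_add_neg] using this

lemma Gen.sum {κ : Type*} (s : Finset κ) {N : κ → ℝ≥0 → Ω → ℝ} {φ : κ → ℝ≥0 → Ω → K}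
    (h : ∀ i ∈ s, Gen 𝓕 Base (N i) (φ i)) :
    Gen 𝓕 Base (fun t ω => ∑ i ∈ s, N i t ω) (fun t ω => ∑ i ∈ s, φ i t ω) := by
  classical
  induction s using Finset.induction_on with
  | empty => simpa using Gen.zero
  | insert i s hi ih =>
    simp only [Finset.sum_insert hi]
    exact (h i (Finset.mem_insert_self _ _)).add (ih fun j hj => h j (Finset.mem_insert_of_mem hj))

variable [IsProbabilityMeasure P]

/-- Every integrand that can be approximated by elementary ones has a stochastic integral. -/
theorem BracketSystem.exists_intClosure (h : BracketSystem 𝓕 P Base) {φ : ℝ≥0 → Ω → K}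
    (hφ : IsBoundedProg 𝓕 φ) (happ : ∀ (T : ℝ≥0) (ε : ℝ), 0 < ε → ∃ N' φ', Gen 𝓕 Base N' φ' ∧
      energy P (fun r ω => φ' r ω - φ r ω) T ≤ ε) :
    ∃ N, IntClosure 𝓕 P Base N φ ∧ ∀ᵐ ω ∂P, N 0 ω = 0 := by
  -- Energies `(1/4)^k` correspond to summable norms `(1/2)^k`. Differences of the integrals have
  -- norm at most `2 (1/2)^n`; the bound `3 (1/2)^n` below is there for strict inequality.
  choose M ψ hM hψ using fun k : ℕ => happ k ((1 / 4) ^ k) (by positivity)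
  -- Restriction to `(0,k]` makes the approximations start at zero, as the isometry requires; up to
  -- a fixed time it leaves the integrands unchanged as soon as `k` is large.
  set Nk : ℕ → ℝ≥0 → Ω → ℝ := fun k => transform (fun _ => 1) 0 k (M k) with hNk
  set φk : ℕ → ℝ≥0 → Ω → K := fun k t ω => (Set.Ioc (0 : ℝ≥0) k).indicator (fun _ => (1 : ℝ)) t •
    ψ k t ω with hφk
  have hg : ∀ k, Gen 𝓕 Base (Nk k) (φk k) := fun k =>
    Gen.transform (zero_le) stronglyMeasurable_const ⟨1, fun _ => by simp⟩ (hM k)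
  have h0 : ∀ k ω, Nk k 0 ω = 0 := fun k ω => by simp [hNk, transform]
  have he : ∀ (t : ℝ≥0) (k : ℕ), t ≤ k →
      energy P (fun r ω => φk k r ω - φ r ω) t ≤ (1 / 4) ^ k := fun t k htk => by
    refine le_trans (le_of_eq (energy_congr (ψ := fun r ω => ψ k r ω - φ r ω) fun r hr0 hr ω => ?_))
      ((energy_le_energy ((h.gen_prog (hM k)).sub hφ) htk).trans (hψ k))
    simp only [hφk]
    rw [Set.indicator_of_mem (Set.mem_Ioc.2 ⟨hr0, hr.trans htk⟩), one_smul]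
  have hm : ∀ k t, MemLp (Nk k t) 2 P := fun k t => (h.gen_mart (hg k)).memLp t
  have hlim : ∀ t : ℝ≥0, ∃ f : Ω → ℝ, MemLp f 2 P ∧
      Tendsto (fun k => ∫ ω, (Nk k t ω - f ω) ^ 2 ∂P) atTop (𝓝 0) := fun t => by
    obtain ⟨K0, hK0⟩ := exists_nat_ge t
    obtain ⟨f, hf, hf'⟩ := Lp.cauchy_complete_eLpNorm (p := 2) one_le_two
      (f := fun k => Nk (k + K0) t) (fun k => hm _ t)
      (B := fun n => ENNReal.ofReal (3 * (1 / 2) ^ n))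
      (by
        rw [← ENNReal.ofReal_tsum_of_nonneg (fun n => by positivity)
          ((summable_geometric_two).mul_left 3)]
        exact ENNReal.ofReal_ne_top)
      (fun n k l hk hl => by
        have hkl : eLpNorm (Nk (k + K0) t - Nk (l + K0) t) 2 P = _ :=
          integral_sq_eq_eLpNorm ((hm (k + K0) t).sub (hm (l + K0) t))
        rw [hkl]
        refine (ENNReal.ofReal_lt_ofReal_iff (by positivity)).2 ?_
        have e1 := h.gen.integral_sq ((hg (k + K0)).sub (hg (l + K0))) t
        simp only [h0, sub_zero] at e1
        simp only [Pi.sub_apply]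
        rw [e1]
        have e2 := energy_sub_le (P := P) (h.gen_prog (hg (k + K0))) (h.gen_prog (hg (l + K0))) hφ t
        have e3 : ∀ q ≥ n, ((1 : ℝ) / 4) ^ (q + K0) ≤ (1 / 4) ^ n := fun q hq =>
          pow_le_pow_of_le_one (by norm_num) (by norm_num) (by omega)
        have e4 : ∀ q, t ≤ ((q + K0 : ℕ) : ℝ≥0) := fun q => hK0.trans (by push_cast; exact le_add_self)
        have e5 : energy P (fun r ω => φk (k + K0) r ω - φk (l + K0) r ω) t ≤ 4 * (1 / 4) ^ n := by
          linarith [he t _ (e4 k), he t _ (e4 l), e3 k hk, e3 l hl]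
        have e6 : (4 : ℝ) * (1 / 4) ^ n = (2 * (1 / 2) ^ n) ^ 2 := by
          rw [mul_pow, ← pow_mul, mul_comm n 2, pow_mul]; norm_num
        rw [e6] at e5
        have e7 := Real.sqrt_le_sqrt e5
        rw [Real.sqrt_sq (by positivity)] at e7
        refine e7.trans_lt ?_
        have : (0 : ℝ) < (1 / 2) ^ n := by positivity
        linarith)
    refine ⟨f, hf, (tendsto_add_atTop_iff_nat K0).1 ?_⟩
    exact (tendsto_eLpNorm_iff fun k => (hm (k + K0) t).sub hf).1 hf'
  choose N hN hN' using hlim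
  refine ⟨N, ⟨hφ, hN, Nk, φk, hg, fun t => ?_, hN'⟩, ?_⟩
  · obtain ⟨K0, hK0⟩ := exists_nat_ge t
    refine squeeze_zero' (Eventually.of_forall fun k => energy_nonneg _ _)
      (eventually_atTop.2 ⟨K0, fun k hk => he t k (hK0.trans (by exact_mod_cast hk))⟩)
      (tendsto_pow_atTop_nhds_zero_of_lt_one (by norm_num) (by norm_num))
  · have h1 := hN' 0
    simp only [h0, zero_sub, neg_sq] at h1
    have h2 := tendsto_nhds_unique tendsto_const_nhds h1
    have h3 := (integral_eq_zero_iff_of_nonneg (fun ω => sq_nonneg _) (hN 0).integrable_sq).1 h2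
    filter_upwards [h3] with ω hω
    simpa using hω

end IntClosureExistence

/-! ### Orthogonal expansions indexed by the natural numbers -/

section ProjectionSequence

variable [CompleteSpace H] [SeparableSpace H]

/-- An orthonormal basis, padded by zeros so that it is indexed by the natural numbers. -/
lemma exists_basis_seq (H : Type*) [NormedAddCommGroup H] [InnerProductSpace ℝ H] [CompleteSpace H]
    [SeparableSpace H] :
    ∃ e : ℕ → H, (∀ x, HasSum (fun i => inner ℝ (e i) x • e i) x) ∧
      ∀ i j, i ≠ j → inner ℝ (e i) (e j) = 0 := by
  obtain ⟨w, b, -⟩ := exists_hilbertBasis ℝ H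
  have hcount : Countable w := b.orthonormal.countable_index
  obtain ⟨f, hf⟩ := exists_injective_nat w
  classical
  refine ⟨fun k => if h : ∃ i, f i = k then b h.choose else 0, fun x => ?_, fun i j hij => ?_⟩
  · refine (hf.hasSum_iff fun k hk => ?_).1 ((b.hasSum_repr x).congr_fun ?_)
    · have : ¬ ∃ i, f i = k := fun h => hk h
      simp [this]
    · intro i
      have h : ∃ j, f j = f i := ⟨i, rfl⟩
      have h2 : h.choose = i := hf h.choose_spec
      simp only [Function.comp]
      rw [dif_pos h, h2, b.repr_apply_apply]
  · by_cases hi : ∃ a, f a = i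
    · by_cases hj : ∃ a, f a = j
      · simp only [dif_pos hi, dif_pos hj]
        refine b.orthonormal.2 fun h => hij ?_
        rw [← hi.choose_spec, ← hj.choose_spec, h]
      · simp [hj]
    · simp [hi]

/-- Bessel's inequality. The norms of the `e i` are not recorded; the expansion and orthogonality
give `‖y‖² = ⟪y, x⟫` for the partial sum `y`, and the Cauchy–Schwarz inequality concludes. -/
lemma norm_partial_sum_le {e : ℕ → H} (he : ∀ x, HasSum (fun i => inner ℝ (e i) x • e i) x)
    (ho : ∀ i j, i ≠ j → inner ℝ (e i) (e j) = 0) (s : Finset ℕ) (x : H) :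
    ‖∑ i ∈ s, inner ℝ (e i) x • e i‖ ≤ ‖x‖ := by
  set y := ∑ i ∈ s, inner ℝ (e i) x • e i with hy
  have h1 : HasSum (fun j => inner ℝ y (inner ℝ (e j) x • e j)) (inner ℝ y x) :=
    (innerSL ℝ y).hasSum (he x)
  have h2 : HasSum (fun j => inner ℝ y (inner ℝ (e j) x • e j))
      (∑ j ∈ s, inner ℝ y (inner ℝ (e j) x • e j)) := hasSum_sum_of_ne_finset_zero fun j hj => by
    rw [hy, sum_inner]
    refine Finset.sum_eq_zero fun i hi => ?_
    rw [inner_smul_left, inner_smul_right, ho i j (fun h => hj (h ▸ hi))]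
    simp
  have h3 := h1.unique h2
  rw [← inner_sum, ← hy, real_inner_self_eq_norm_sq] at h3
  have h4 := real_inner_le_norm y x
  rw [h3, sq] at h4
  rcases (norm_nonneg y).eq_or_lt with h | h
  · rw [← h]; exact norm_nonneg x
  · exact le_of_mul_le_mul_left h4 h

end ProjectionSequence

/-! ### Approximation of processes continuous in time by elementary processes -/

section Density

lemma ElementaryProcess.isBoundedProg (Φ : ElementaryProcess 𝓕 H) : IsBoundedProg 𝓕 Φ.eval := by
  have h : ∀ s : Finset (Fin Φ.n), IsBoundedProg 𝓕 (fun t ω => ∑ i ∈ s,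
      (Set.Ioc (Φ.a i) (Φ.b i)).indicator (fun _ => Φ.ξ i ω • Φ.h i) t) := fun s => by
    classical
    induction s using Finset.induction_on with
    | empty => simpa using IsBoundedProg.zero
    | insert i s hi ih =>
      simp only [Finset.sum_insert hi]
      refine IsBoundedProg.add ?_ ih
      have := (IsBoundedProg.step (a := Φ.a i) (b := Φ.b i) (Φ.measurable i) (Φ.bounded i)).smul
        (IsBoundedProg.const (Φ.h i))
      convert this using 3 with t ω
      by_cases ht : t ∈ Set.Ioc (Φ.a i) (Φ.b i) <;> simp [ht]
  exact h Finset.univ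

/-- An elementary process with terms indexed by a finite type. -/
noncomputable def ElementaryProcess.ofFintype {κ : Type*} [Fintype κ] (a b : κ → ℝ≥0)
    (hab : ∀ i, a i ≤ b i) (ξ : κ → Ω → ℝ) (hξ : ∀ i, StronglyMeasurable[𝓕 (a i)] (ξ i))
    (hb : ∀ i, ∃ C : ℝ, ∀ ω, |ξ i ω| ≤ C) (h : κ → H) : ElementaryProcess 𝓕 H where
  n := Fintype.card κ
  a i := a ((Fintype.equivFin κ).symm i)
  b i := b ((Fintype.equivFin κ).symm i)
  le _ := hab _
  ξ i := ξ ((Fintype.equivFin κ).symm i)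
  measurable _ := hξ _
  bounded _ := hb _
  h i := h ((Fintype.equivFin κ).symm i)

lemma ElementaryProcess.eval_ofFintype {κ : Type*} [Fintype κ] (a b : κ → ℝ≥0)
    (hab : ∀ i, a i ≤ b i) (ξ : κ → Ω → ℝ) (hξ : ∀ i, StronglyMeasurable[𝓕 (a i)] (ξ i))
    (hb : ∀ i, ∃ C : ℝ, ∀ ω, |ξ i ω| ≤ C) (h : κ → H) (s : ℝ≥0) (ω : Ω) :
    (ElementaryProcess.ofFintype a b hab ξ hξ hb h).eval s ω =
      ∑ i, (Set.Ioc (a i) (b i)).indicator (fun _ => ξ i ω • h i) s :=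
  Equiv.sum_comp (Fintype.equivFin κ).symm
    (fun i => (Set.Ioc (a i) (b i)).indicator (fun _ => ξ i ω • h i) s)

lemma exists_sum_indicator_eq {g : ℕ → ℝ≥0} (hg : Monotone g) (c : ℕ → H) {s : ℝ≥0} (n : ℕ)
    (h0 : g 0 < s) (hn : s ≤ g n) : ∃ j < n, g j < s ∧ s ≤ g (j + 1) ∧
      ∑ i ∈ Finset.range n, (Set.Ioc (g i) (g (i + 1))).indicator (fun _ => c i) s = c j := by
  induction n with
  | zero => exact absurd hn (not_le.2 h0)
  | succ n ih =>
    rw [Finset.sum_range_succ]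
    by_cases h : s ≤ g n
    · obtain ⟨j, hj, h1, h2, h3⟩ := ih h
      refine ⟨j, by omega, h1, h2, ?_⟩
      rw [h3, Set.indicator_of_notMem (fun h' => absurd h (not_le.2 h'.1)), add_zero]
    · push Not at h
      refine ⟨n, by omega, h, hn, ?_⟩
      rw [Set.indicator_of_mem (Set.mem_Ioc.2 ⟨h, hn⟩), Finset.sum_eq_zero, zero_add]
      intro i hi
      refine Set.indicator_of_notMem (fun h' => ?_) _
      exact absurd (h'.2.trans (hg (Finset.mem_range.1 hi))) (not_le.2 h)

variable [IsProbabilityMeasure P] [CompleteSpace H] [SeparableSpace H]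

lemma tendsto_energy_of_bounded {φk : ℕ → ℝ≥0 → Ω → H} (hk : ∀ k, IsBoundedProg 𝓕 (φk k)) {T : ℝ≥0}
    {C : ℝ} (hC : ∀ k r ω, 0 < r → r ≤ T → ‖φk k r ω‖ ≤ C)
    (hlim : ∀ ω, ∀ᵐ r : ℝ, 0 < r → r ≤ T → Tendsto (fun k => φk k r.toNNReal ω) atTop (𝓝 0)) :
    Tendsto (fun k => energy P (φk k) T) atTop (𝓝 0) := by
  have hb : ∀ k (ω : Ω) (r : ℝ), r ∈ Set.uIoc 0 (T : ℝ) →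
      ‖(inner ℝ (φk k r.toNNReal ω) (φk k r.toNNReal ω) : ℝ)‖ ≤ C ^ 2 := fun k ω r hr => by
    rw [Set.uIoc_of_le (NNReal.coe_nonneg T)] at hr
    rw [real_inner_self_eq_norm_sq, Real.norm_of_nonneg (sq_nonneg _)]
    exact pow_le_pow_left₀ (norm_nonneg _) (hC k _ ω (Real.toNNReal_pos.2 hr.1)
      (Real.toNNReal_le_iff_le_coe.2 hr.2)) 2
  have h1 : ∀ ω, Tendsto (fun k => timeInt (fun r ω => inner ℝ (φk k r ω) (φk k r ω)) T ω) atTop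
      (𝓝 0) := fun ω => by
    have : (0 : ℝ) = ∫ r in (0 : ℝ)..T, (0 : ℝ) := by simp
    rw [this]
    refine intervalIntegral.tendsto_integral_filter_of_dominated_convergence (fun _ => C ^ 2)
      (Eventually.of_forall fun k =>
        (((hk k).inner (hk k)).integrable_section ω 0 T).aestronglyMeasurable_restrict_uIoc)
      (Eventually.of_forall fun k => ae_of_all _ fun r hr => hb k ω r hr)
      intervalIntegrable_const ?_
    filter_upwards [hlim ω] with r hr hr'
    rw [Set.uIoc_of_le (NNReal.coe_nonneg T)] at hr'
    have := (hr hr'.1 hr'.2).inner (𝕜 := ℝ) (hr hr'.1 hr'.2)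
    simpa using this
  have h2 : (0 : ℝ) = ∫ _ω : Ω, (0 : ℝ) ∂P := by simp
  rw [h2]
  refine tendsto_integral_of_dominated_convergence (fun _ => C ^ 2 * |(T : ℝ) - 0|)
    (fun k => (((hk k).inner (hk k)).integrable_timeInt T).aestronglyMeasurable)
    (integrable_const _) (fun k => ae_of_all _ fun ω => ?_) (ae_of_all _ h1)
  exact intervalIntegral.norm_integral_le_of_norm_le_const fun r hr => hb k ω r hr

/-- Adapted bounded processes which are continuous up to null sets of times are limits of elementary
processes. -/
lemma exists_elementary_energy_le {a : ℝ≥0 → Ω → H} (ha : IsBoundedProg 𝓕 a)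
    (hcont : ∀ ω, ∀ᵐ r : ℝ, 0 < r → ContinuousAt (fun r => a r ω) r.toNNReal) (T : ℝ≥0) {ε : ℝ}
    (hε : 0 < ε) : ∃ Φ : ElementaryProcess 𝓕 H,
      energy P (fun r ω => Φ.eval r ω - a r ω) T ≤ ε := by
  obtain ⟨e, he, ho⟩ := exists_basis_seq H
  obtain ⟨C, hC⟩ := ha.bdd
  -- The value at the left endpoint of each of `n` cells is projected onto `n` basis vectors, since
  -- an elementary process carries only finitely many fixed vectors of `H`.
  set Φ : ℕ → ElementaryProcess 𝓕 H := fun n => ElementaryProcess.ofFintype (κ := Fin n × Fin n)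
    (fun p => grid 0 T n p.1) (fun p => grid 0 T n (p.1 + 1))
    (fun p => grid_mono 0 T n (Nat.le_succ _))
    (fun p ω => inner ℝ (e p.2) (a (grid 0 T n p.1) ω))
    (fun p => stronglyMeasurable_const.inner (ha.prog.stronglyAdapted _))
    (fun p => ⟨‖e p.2‖ * C, fun ω => (abs_real_inner_le_norm _ _).trans
      (mul_le_mul_of_nonneg_left (hC _ ω) (norm_nonneg _))⟩)
    (fun p => e p.2) with hΦ
  have hev : ∀ n r ω, (Φ n).eval r ω = ∑ j ∈ Finset.range n,
      (Set.Ioc (grid 0 T n j) (grid 0 T n (j + 1))).indicator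
        (fun _ => ∑ i ∈ Finset.range n, inner ℝ (e i) (a (grid 0 T n j) ω) • e i) r :=
    fun n r ω => by
      rw [hΦ, ElementaryProcess.eval_ofFintype, Fintype.sum_prod_type,
        ← Fin.sum_univ_eq_sum_range (fun j => (Set.Ioc (grid 0 T n j) (grid 0 T n (j + 1))).indicator
        (fun _ => ∑ i ∈ Finset.range n, inner ℝ (e i) (a (grid 0 T n j) ω) • e i) r)]
      refine Finset.sum_congr rfl fun j _ => ?_
      by_cases hr : r ∈ Set.Ioc (grid 0 T n j) (grid 0 T n (j + 1))
      · simp only [Set.indicator_of_mem hr]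
        exact Fin.sum_univ_eq_sum_range (fun i => inner ℝ (e i) (a (grid 0 T n j) ω) • e i) n
      · simp only [Set.indicator_of_notMem hr, Finset.sum_const_zero]
  have hloc : ∀ (n : ℕ) (r : ℝ≥0) ω, n ≠ 0 → 0 < r → r ≤ T → ∃ q : ℝ≥0, q ≤ r ∧ r ≤ q + T / n ∧
      (Φ n).eval r ω = ∑ i ∈ Finset.range n, inner ℝ (e i) (a q ω) • e i :=
    fun n r ω hn h0 hr => by
      obtain ⟨j, -, h1, h2, h3⟩ := exists_sum_indicator_eq (grid_mono 0 T n)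
        (fun j => ∑ i ∈ Finset.range n, inner ℝ (e i) (a (grid 0 T n j) ω) • e i) (s := r) n
        (by rwa [grid_zero]) (by rwa [grid_last (zero_le) hn])
      refine ⟨_, h1.le, ?_, (hev n r ω).trans h3⟩
      rw [grid_succ, tsub_zero] at h2
      exact h2
  have hlim : Tendsto (fun n => energy P (fun r ω => (Φ n).eval r ω - a r ω) T) atTop (𝓝 0) := by
    refine (tendsto_add_atTop_iff_nat 1).1 ?_
    refine tendsto_energy_of_bounded (C := C + C) (fun n => (Φ _).isBoundedProg.sub ha)
      (fun n r ω h0 hr => ?_) (fun ω => ?_)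
    · obtain ⟨q, -, -, hq⟩ := hloc (n + 1) r ω (Nat.succ_ne_zero n) h0 hr
      refine (norm_sub_le _ _).trans (add_le_add ?_ (hC _ _))
      rw [hq]
      exact (norm_partial_sum_le he ho _ _).trans (hC _ _)
    · filter_upwards [hcont ω] with r hr h0 hrT
      have h0' := Real.toNNReal_pos.2 h0
      have hrT' : r.toNNReal ≤ T := Real.toNNReal_le_iff_le_coe.2 hrT
      choose q hq1 hq2 hq using fun n : ℕ => hloc (n + 1) r.toNNReal ω (Nat.succ_ne_zero n) h0' hrT'
      have hq0 : Tendsto q atTop (𝓝 r.toNNReal) := by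
        have hm := (tendsto_add_atTop_iff_nat 1).2 (tendsto_mesh 0 T)
        rw [tsub_zero] at hm
        refine tendsto_of_tendsto_of_tendsto_of_le_of_le (g := fun n : ℕ => r.toNNReal - T / ((n + 1 : ℕ) : ℝ≥0))
          ?_ tendsto_const_nhds (fun n => tsub_le_iff_right.2 (hq2 n)) hq1
        have := tendsto_const_nhds (x := r.toNNReal) |>.sub hm
        simpa using this
      have h1 := (hr h0).tendsto.comp hq0
      have h2 : Tendsto (fun n => ∑ i ∈ Finset.range (n + 1), inner ℝ (e i) (a r.toNNReal ω) • e i)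
          atTop (𝓝 (a r.toNNReal ω)) := (tendsto_add_atTop_iff_nat 1).2 (he _).tendsto_sum_nat
      have h3 : Tendsto (fun n => ∑ i ∈ Finset.range (n + 1),
          inner ℝ (e i) (a (q n) ω - a r.toNNReal ω) • e i) atTop (𝓝 0) := by
        refine squeeze_zero_norm (fun n => norm_partial_sum_le he ho _ _) ?_
        have := (h1.sub_const (a r.toNNReal ω)).norm
        simpa [Function.comp] using this
      have h4 := (h3.add h2).sub_const (a r.toNNReal ω)
      rw [zero_add, sub_self] at h4
      refine h4.congr fun n => ?_
      rw [hq n, ← Finset.sum_add_distrib]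
      congr 1
      refine Finset.sum_congr rfl fun i _ => ?_
      rw [inner_sub_right, sub_smul, sub_add_cancel]
  obtain ⟨n, hn⟩ := (hlim.eventually (gt_mem_nhds hε)).exists
  exact ⟨Φ n, hn.le⟩

end Density

/-! ### Adapted maps between filtered spaces -/

section Pullback

variable {Ω₀ : Type*} {mΩ₀ : MeasurableSpace Ω₀} {𝓖 : Filtration ℝ≥0 mΩ₀} {π : Ω → Ω₀}

lemma measurable_prodMap_id {α : Type*} {mα : MeasurableSpace α} {m : MeasurableSpace Ω}
    {m₀ : MeasurableSpace Ω₀} (hπ : Measurable π) : Measurable (fun p : α × Ω => (p.1, π p.2)) :=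
  measurable_fst.prodMk (hπ.comp measurable_snd)

lemma MeasureTheory.IsStronglyProgressive.comp_map {K : Type*} [TopologicalSpace K]
    {φ : ℝ≥0 → Ω₀ → K} (h : IsStronglyProgressive 𝓖 φ) (hπ : ∀ t, Measurable[𝓕 t, 𝓖 t] π) :
    IsStronglyProgressive 𝓕 (fun t ω => φ t (π ω)) := fun i => by
  have h1 : @Measurable _ _ (Subtype.instMeasurableSpace.prod (𝓕 i))
      (Subtype.instMeasurableSpace.prod (𝓖 i)) (fun p : Set.Iic i × Ω => (p.1, π p.2)) :=
    measurable_prodMap_id (hπ i)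
  exact (h i).comp_measurable h1

lemma IsBoundedProg.comp_map {K : Type*} [NormedAddCommGroup K] {φ : ℝ≥0 → Ω₀ → K}
    (h : IsBoundedProg 𝓖 φ) (hπ : ∀ t, Measurable[𝓕 t, 𝓖 t] π) :
    IsBoundedProg 𝓕 (fun t ω => φ t (π ω)) := by
  obtain ⟨C, hC⟩ := h.bdd
  exact ⟨h.prog.comp_map hπ, C, fun t ω => hC t _⟩

lemma CondZero.map {s : ℝ≥0} (hπ : Measurable π) (hπs : Measurable[𝓕 s, 𝓖 s] π)
    {f : Ω₀ → ℝ} (hf : AEStronglyMeasurable f (P.map π))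
    (h : CondZero (𝓕 s) P (fun ω => f (π ω))) : CondZero (𝓖 s) (P.map π) f := fun B hB => by
  rw [setIntegral_map (𝓖.le s B hB) hf hπ.aemeasurable]
  exact h _ (hπs hB)

end Pullback

/-! ### Approximation of measurable coefficients along a continuous process -/

section PathDensity

variable [CompleteSpace H] [SeparableSpace H]

lemma measurable_pathFiltration_of_eval {Y : Ω → C(ℝ≥0, E)}
    (hY : ∀ t, Measurable[𝓕 t] fun ω => Y ω t) (t : ℝ≥0) :
    Measurable[𝓕 t, pathFiltration E t] Y := by
  refine measurable_iff_comap_le.2 ?_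
  change MeasurableSpace.comap Y (⨆ s ≤ t, _) ≤ _
  simp only [MeasurableSpace.comap_iSup, MeasurableSpace.comap_comp]
  exact iSup₂_le fun s hs => ((hY s).mono (𝓕.mono hs) le_rfl).comap_le

/-- A cut-off continuous coefficient can jump only at the exit time, a single instant for each path.
-/
lemma continuousAt_cutoff {v : E → H} (hv : Continuous v) (R : ℝ) (x : C(ℝ≥0, E)) :
    ∀ᵐ r : ℝ, 0 < r → ContinuousAt (fun r => cutoff R v r x) r.toNNReal := by
  have hc : Continuous fun r => v (x r) := hv.comp x.continuous
  obtain h | ⟨c, h⟩ : hit R x = ⊤ ∨ ∃ c : ℝ≥0, hit R x = c := by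
    induction hit R x using WithTop.recTopCoe with
    | top => exact Or.inl rfl
    | coe c => exact Or.inr ⟨c, rfl⟩
  · refine ae_of_all _ fun r _ => hc.continuousAt.congr (Eventually.of_forall fun q => ?_)
    simp only [cutoff, h]
    rw [if_pos (WithTop.coe_lt_top q)]
  · have h1 : ∀ᵐ r : ℝ, r ≠ c := by
      simp [ae_iff]
    filter_upwards [h1] with r hr h0
    have hne : r.toNNReal ≠ c := fun h' => hr (by rw [← h', Real.coe_toNNReal _ h0.le])
    rcases lt_or_gt_of_ne hne with h2 | h2
    · refine hc.continuousAt.congr ?_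
      filter_upwards [Iio_mem_nhds h2] with q hq
      simp only [cutoff, h]
      rw [if_pos (WithTop.coe_lt_coe.2 hq)]
    · refine (continuousAt_const (y := (0 : H))).congr ?_
      filter_upwards [Ioi_mem_nhds h2] with q hq
      simp only [cutoff, h]
      rw [if_neg (not_lt.2 (WithTop.coe_le_coe.2 (le_of_lt hq)))]

variable [IsProbabilityMeasure P]

/-- The process `1_{r < τ} g(Y(r))` is a limit of elementary processes. -/
lemma exists_elementary_energy_cutoff_le {Y : Ω → C(ℝ≥0, E)}
    (hY : ∀ t, Measurable[𝓕 t] fun ω => Y ω t) {g : E → H} (hm : StronglyMeasurable g)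
    (hg : BddOnBalls g) (R : ℝ) (T : ℝ≥0) {ε : ℝ} (hε : 0 < ε) :
    ∃ Φ : ElementaryProcess 𝓕 H,
      energy P (fun r ω => Φ.eval r ω - cutoff R g r (Y ω)) T ≤ ε := by
  have hπ := measurable_pathFiltration_of_eval hY
  obtain ⟨C, hC⟩ := hg R
  have hYp : Measurable (fun p : Ω × ℝ => Y p.1 p.2.toNNReal) := by
    have := (isStronglyProgressive_eval (E := E)).comp_map hπ |>.stronglyMeasurable_uncurry
    exact this.measurable.comp measurable_swap
  -- The image `μ` of `ρ` is the occupation measure of `Y` up to time `T`. A merely measurable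
  -- coefficient is approximated in `L²(μ)` by a bounded continuous `v`, and the cut-off of `v`
  -- along the path is continuous up to a null set of times.
  set ρ : Measure (Ω × ℝ) := P.prod (volume.restrict (Set.Ioc 0 (T : ℝ)))
  set μ : Measure E := ρ.map (fun p : Ω × ℝ => Y p.1 p.2.toNNReal)
  have hρ : IsFiniteMeasure ρ := inferInstance
  have hμ : IsFiniteMeasure μ := inferInstance
  -- Restriction to the open ball makes `g` square integrable; before the exit time the path is in
  -- this ball, so the cut-off process does not notice.
  set g' : E → H := (Metric.ball 0 R).indicator g with hg'
  have hg'm : StronglyMeasurable g' := hm.indicator Metric.isOpen_ball.measurableSet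
  have hg'b : MemLp g' 2 μ := MemLp.of_bound hg'm.aestronglyMeasurable |C| (ae_of_all _ fun e => by
    by_cases he : e ∈ Metric.ball 0 R
    · rw [hg', Set.indicator_of_mem he]
      exact (hC e (mem_ball_zero_iff.1 he).le).trans (le_abs_self C)
    · rw [hg', Set.indicator_of_notMem he, norm_zero]
      exact abs_nonneg C)
  obtain ⟨v, hv, hvm⟩ := hg'b.exists_boundedContinuous_eLpNorm_sub_le ENNReal.ofNat_ne_top
    (ε := ENNReal.ofReal (Real.sqrt (ε / 4))) (by simp; positivity)
  have hvs : StronglyMeasurable (v : E → H) := v.continuous.stronglyMeasurable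
  have hvb : BddOnBalls (v : E → H) := fun _ => ⟨‖v‖, fun e _ => v.norm_coe_le_norm e⟩
  have hcv := (isBoundedProg_cutoff hvs hvb R).comp_map hπ
  have hcg := (isBoundedProg_cutoff hm hg R).comp_map hπ
  obtain ⟨Φ, hΦ⟩ := exists_elementary_energy_le (P := P) hcv
    (fun ω => continuousAt_cutoff v.continuous R (Y ω)) T (ε := ε / 4) (by positivity)
  refine ⟨Φ, ?_⟩
  have h1 := energy_add_le (P := P) (Φ.isBoundedProg.sub hcv) (hcv.sub hcg) T
  simp only [sub_add_sub_cancel] at h1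
  have h2 : energy P (fun r ω => cutoff R v r (Y ω) - cutoff R g r (Y ω)) T ≤ ε / 4 := by
    have hd : MemLp (fun e => g' e - v e) 2 μ := hg'b.sub hvm
    have e1 : ∫ e, ‖g' e - v e‖ ^ 2 ∂μ ≤ ε / 4 := by
      have hv' : eLpNorm (fun e => g' e - v e) 2 μ ≤ _ := hv
      rw [hd.eLpNorm_eq_integral_rpow_norm two_ne_zero ENNReal.ofNat_ne_top] at hv'
      have hv2 := (ENNReal.ofReal_le_ofReal_iff (Real.sqrt_nonneg _)).1 hv'
      simp only [ENNReal.toReal_ofNat, Real.rpow_two] at hv2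
      rw [Real.sqrt_eq_rpow, ← one_div] at hv2
      exact (Real.rpow_le_rpow_iff (integral_nonneg fun _ => sq_nonneg _) (by positivity)
        (by norm_num)).1 hv2
    have hdi : Integrable (fun e => ‖g' e - v e‖ ^ 2) μ := hd.integrable_norm_pow two_ne_zero
    have e2 : ∫ e, ‖g' e - v e‖ ^ 2 ∂μ = ∫ ω, timeInt (fun r ω => ‖g' (Y ω r) - v (Y ω r)‖ ^ 2) T ω ∂P := by
      have hdi' := hdi
      rw [integrable_map_measure hdi.aestronglyMeasurable hYp.aemeasurable] at hdi'
      rw [integral_map hYp.aemeasurable hdi.aestronglyMeasurable]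
      refine (integral_prod _ hdi').trans ?_
      simp only [timeInt, Function.comp, intervalIntegral.integral_of_le (NNReal.coe_nonneg T)]
    rw [e2] at e1
    refine le_trans ?_ e1
    have hd' : IsBoundedProg 𝓕 (fun r ω => ‖g' (Y ω r) - v (Y ω r)‖ ^ 2) := by
      refine ⟨((isStronglyProgressive_comp_eval ((hg'm.sub hvs).norm.pow 2)).comp_map hπ),
        (|C| + ‖v‖) ^ 2, fun t ω => ?_⟩
      rw [Real.norm_of_nonneg (sq_nonneg _)]
      refine pow_le_pow_left₀ (norm_nonneg _) ((norm_sub_le _ _).trans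
        (add_le_add ?_ (v.norm_coe_le_norm _))) 2
      by_cases he : Y ω t ∈ Metric.ball 0 R
      · rw [hg', Set.indicator_of_mem he]
        exact (hC _ (mem_ball_zero_iff.1 he).le).trans (le_abs_self C)
      · rw [hg', Set.indicator_of_notMem he, norm_zero]
        exact abs_nonneg C
    refine integral_mono (((hcv.sub hcg).inner (hcv.sub hcg)).integrable_timeInt T)
      (hd'.integrable_timeInt T) fun ω =>
      timeInt_mono ((hcv.sub hcg).inner (hcv.sub hcg)) hd' fun r _ => ?_
    rw [real_inner_self_eq_norm_sq]
    unfold cutoff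
    split_ifs with h
    · rw [hg', Set.indicator_of_mem (mem_ball_zero_iff.2 (norm_lt_of_lt_hit h)), norm_sub_rev]
    · rw [sub_zero, norm_zero, zero_pow two_ne_zero]; exact sq_nonneg _
  linarith

end PathDensity

/-! ### The bracket system of a cylindrical Wiener process -/

section WienerBase

variable {W : Lp H 2 (volume.restrict (Set.Ioi (0 : ℝ))) →L[ℝ] Lp ℝ 2 P}

/-- The function `1_{(0,t]} ⊗ h`. -/
noncomputable def stepLp (t : ℝ≥0) (h : H) : Lp H 2 (volume.restrict (Set.Ioi (0 : ℝ))) :=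
  indicatorConstLp 2 (measurableSet_Ioc : MeasurableSet (Set.Ioc (0 : ℝ) t))
    (((Measure.restrict_apply_le _ _).trans_lt measure_Ioc_lt_top).ne) h

lemma wienerAt_eq (t : ℝ≥0) (h : H) : wienerAt W t h = W (stepLp t h) := rfl

lemma stepLp_add (t : ℝ≥0) (h h' : H) : stepLp t (h + h') = stepLp t h + stepLp t h' :=
  indicatorConstLp_add.symm

lemma inner_stepLp [CompleteSpace H] (s t : ℝ≥0) (h h' : H) :
    inner ℝ (stepLp s h) (stepLp t h') = (min s t : ℝ≥0) * inner ℝ h h' := by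
  unfold stepLp
  rw [L2.inner_indicatorConstLp_eq_inner_setIntegral ℝ]
  rw [setIntegral_indicatorConstLp measurableSet_Ioc]
  rw [inner_smul_right]
  congr 1
  have h1 : Set.Ioc (0 : ℝ) t ∩ Set.Ioc 0 (s : ℝ) = Set.Ioc 0 ((min s t : ℝ≥0) : ℝ) := by
    ext x; simp only [Set.mem_inter_iff, Set.mem_Ioc, NNReal.coe_min, le_min_iff]; tauto
  have h2 : Set.Ioc (0 : ℝ) ((min s t : ℝ≥0) : ℝ) ⊆ Set.Ioi 0 := fun x hx => hx.1
  rw [h1, measureReal_restrict_apply measurableSet_Ioc, Set.inter_eq_left.2 h2]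
  simp

lemma wienerAt_add (t : ℝ≥0) (h h' : H) :
    ∀ᵐ ω ∂P, wienerAt W t (h + h') ω = wienerAt W t h ω + wienerAt W t h' ω := by
  rw [wienerAt_eq, stepLp_add, map_add]
  exact Lp.coeFn_add _ _

lemma wienerAt_sub (s t : ℝ≥0) (h : H) :
    ∀ᵐ ω ∂P, (W (stepLp t h - stepLp s h) : Ω → ℝ) ω = wienerAt W t h ω - wienerAt W s h ω := by
  rw [map_sub]
  exact Lp.coeFn_sub _ _

lemma setIntegral_of_indep [IsProbabilityMeasure P] {m m' : MeasurableSpace Ω} (hm : m ≤ mΩ)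
    (hm' : m' ≤ mΩ) (hind : Indep m m' P) {f : Ω → ℝ} (hf : StronglyMeasurable[m] f)
    (hfi : Integrable f P) {B : Set Ω} (hB : MeasurableSet[m'] B) :
    ∫ ω in B, f ω ∂P = P.real B * ∫ ω, f ω ∂P := by
  rw [← setIntegral_condExp hm' hfi hB,
    setIntegral_congr_ae (g := fun _ => ∫ ω, f ω ∂P) (hm' _ hB)
      ((condExp_indep_eq hm hm' hf hind).mono fun _ h _ => h)]
  simp

/-- The processes `W(·)h`, as stochastic integrals of the constants `h`. -/
def WienerBase (W : Lp H 2 (volume.restrict (Set.Ioi (0 : ℝ))) →L[ℝ] Lp ℝ 2 P)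
    (N : ℝ≥0 → Ω → ℝ) (φ : ℝ≥0 → Ω → H) : Prop :=
  ∃ h : H, N = (fun t => wienerAt W t h) ∧ φ = fun _ _ => h

/-- Places the elementary integrals from the definition of the stochastic integral within the
bracket calculus, so that Lenglart's inequality and the isometry apply to them. -/
lemma ElementaryProcess.gen (Φ : ElementaryProcess 𝓕 H) :
    Gen 𝓕 (WienerBase W) (Φ.integral W) Φ.eval := by
  have h := Gen.sum (𝓕 := 𝓕) (Base := WienerBase W) Finset.univ fun i _ =>
    Gen.transform (Φ.le i) (Φ.measurable i) (Φ.bounded i) (Gen.base ⟨Φ.h i, rfl, rfl⟩)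
  have e1 : Φ.eval = fun s ω => ∑ i, (Set.Ioc (Φ.a i) (Φ.b i)).indicator (fun _ => Φ.ξ i ω) s •
      Φ.h i := by
    ext s ω
    refine Finset.sum_congr rfl fun i _ => ?_
    by_cases hs : s ∈ Set.Ioc (Φ.a i) (Φ.b i) <;> simp [hs]
  rw [e1]
  exact h

variable [IsProbabilityMeasure P] [CompleteSpace H]

namespace IsCylindricalWiener

lemma integral_increment_mul (hW : IsCylindricalWiener 𝓕 W) {s t : ℝ≥0} (hst : s ≤ t) (h h' : H) :
    ∫ ω, (wienerAt W t h ω - wienerAt W s h ω) * (wienerAt W t h' ω - wienerAt W s h' ω) ∂P =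
      ((t : ℝ) - s) * inner ℝ h h' := by
  have h1 := hW.covariance (stepLp t h - stepLp s h) (stepLp t h' - stepLp s h')
  rw [integral_congr_ae (g := fun ω => (wienerAt W t h ω - wienerAt W s h ω) *
    (wienerAt W t h' ω - wienerAt W s h' ω)) (by
      filter_upwards [wienerAt_sub (W := W) s t h, wienerAt_sub (W := W) s t h'] with ω e1 e2
      rw [e1, e2])] at h1
  rw [h1]
  simp only [inner_sub_left, inner_sub_right, inner_stepLp, min_self, min_eq_left hst,
    min_eq_right hst]
  ring

lemma memLp (t : ℝ≥0) (h : H) : MemLp (wienerAt W t h) 2 P := Lp.memLp _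

lemma setIntegral_increment (hW : IsCylindricalWiener 𝓕 W) {s t : ℝ≥0} (hst : s ≤ t) (h : H)
    {f : ℝ → ℝ} (hf : Measurable f)
    (hfi : Integrable (fun ω => f (wienerAt W t h ω - wienerAt W s h ω)) P) {B : Set Ω}
    (hB : MeasurableSet[𝓕 s] B) :
    ∫ ω in B, f (wienerAt W t h ω - wienerAt W s h ω) ∂P =
      P.real B * ∫ ω, f (wienerAt W t h ω - wienerAt W s h ω) ∂P := by
  refine setIntegral_of_indep ?_ (𝓕.le s) (hW.indep_increments s t hst h) ?_ hfi hB
  · exact (((Lp.stronglyMeasurable _).sub (Lp.stronglyMeasurable _)).measurable).comap_le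
  · exact (hf.comp (comap_measurable _)).stronglyMeasurable

/-- Independence of increments is assumed for one `h` at a time. It yields the brackets of a single
process; mixed brackets follow by polarization, using that `W` is additive in `h` almost surely. -/
theorem bracketSystem (hW : IsCylindricalWiener 𝓕 W) : BracketSystem 𝓕 P (WienerBase W) := by
  have hmem : ∀ s t (h : H), MemLp (fun ω => wienerAt W t h ω - wienerAt W s h ω) 2 P :=
    fun s t h => (memLp t h).sub (memLp s h)
  have hint : ∀ s t (h h' : H), Integrable (fun ω => (wienerAt W t h ω - wienerAt W s h ω) *
      (wienerAt W t h' ω - wienerAt W s h' ω)) P := fun s t h h' =>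
    (hmem s t h).integrable_mul (hmem s t h')
  have hsq : ∀ s t, s ≤ t → ∀ (h : H), CondZero (𝓕 s) P (fun ω =>
      (wienerAt W t h ω - wienerAt W s h ω) * (wienerAt W t h ω - wienerAt W s h ω) -
        ((t : ℝ) - s) * inner ℝ h h) := fun s t hst h B hB => by
    have e1 := hW.setIntegral_increment hst h (f := fun x => x * x) (by fun_prop) (hint s t h h) hB
    rw [integral_sub (hint s t h h).integrableOn (integrable_const _), e1,
      hW.integral_increment_mul hst h h]
    simp
  refine ⟨?_, ?_, ?_⟩
  · rintro N φ ⟨h, rfl, rfl⟩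
    refine ⟨fun t => memLp t h, fun t => hW.adapted t h, fun s t hst B hB => ?_⟩
    have e1 := hW.setIntegral_increment hst h (f := id) measurable_id
      ((hmem s t h).integrable one_le_two) hB
    simp only [id] at e1
    rw [e1, integral_sub ((memLp t h).integrable one_le_two) ((memLp s h).integrable one_le_two)]
    have c1 : ∫ ω, wienerAt W t h ω ∂P = 0 := hW.centered (stepLp t h)
    have c2 : ∫ ω, wienerAt W s h ω ∂P = 0 := hW.centered (stepLp s h)
    rw [c1, c2, sub_zero, mul_zero]
  · rintro N φ ⟨h, rfl, rfl⟩
    exact IsBoundedProg.const h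
  · rintro N φ N' φ' ⟨h, rfl, rfl⟩ ⟨h', rfl, rfl⟩
    have hC : ∀ (t : ℝ≥0) (ω : Ω), timeInt (fun _ _ => (inner ℝ h h' : ℝ)) t ω = t * inner ℝ h h' :=
      fun t ω => by simp [timeInt]
    refine ⟨fun t => by simp only [hC]; exact integrable_const _, fun s t hst => ?_⟩
    have i1 := fun k : H => (hint s t k k).sub (integrable_const (((t : ℝ) - s) * inner ℝ k k))
    have key := (((hsq s t hst (h + h')).add (i1 _) ((i1 h).const_mul (-1))
      ((hsq s t hst h).const_mul (-1))).add ((i1 _).add ((i1 h).const_mul (-1)))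
      ((i1 h').const_mul (-1)) ((hsq s t hst h').const_mul (-1))).const_mul (1 / 2)
    refine key.congr ?_
    filter_upwards [wienerAt_add (W := W) t h h', wienerAt_add (W := W) s h h'] with ω e1 e2
    simp only [Pi.sub_apply, Pi.add_apply, hC]
    rw [e1, e2, real_inner_add_add_self]
    ring

end IsCylindricalWiener

end WienerBase

/-! ### Convergence in measure -/

section InMeasure

lemma MeasureTheory.TendstoInMeasure.add_real {f f' : ℕ → Ω → ℝ} {g g' : Ω → ℝ}
    (h : TendstoInMeasure P f atTop g) (h' : TendstoInMeasure P f' atTop g') :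
    TendstoInMeasure P (fun n ω => f n ω + f' n ω) atTop (fun ω => g ω + g' ω) := by
  rw [tendstoInMeasure_iff_norm] at h h' ⊢
  intro ε hε
  have h1 := (h (ε / 2) (by positivity)).add (h' (ε / 2) (by positivity))
  rw [add_zero] at h1
  refine tendsto_of_tendsto_of_tendsto_of_le_of_le tendsto_const_nhds h1 (fun _ => zero_le)
    fun n => (measure_mono fun ω hω => ?_).trans (measure_union_le _ _)
  change ε ≤ ‖_‖ at hω
  by_contra hc
  simp only [Set.mem_union, Set.mem_setOf_eq, not_or, not_le] at hc
  have := norm_add_le (f n ω - g ω) (f' n ω - g' ω)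
  rw [sub_add_sub_comm] at this
  linarith [hc.1, hc.2]

lemma MeasureTheory.TendstoInMeasure.mul_le_one {f : ℕ → Ω → ℝ} {g : Ω → ℝ}
    (h : TendstoInMeasure P f atTop g) {c : Ω → ℝ} (hc : ∀ ω, |c ω| ≤ 1) :
    TendstoInMeasure P (fun n ω => c ω * f n ω) atTop (fun ω => c ω * g ω) := by
  rw [tendstoInMeasure_iff_norm] at h ⊢
  intro ε hε
  refine tendsto_of_tendsto_of_tendsto_of_le_of_le tendsto_const_nhds (h ε hε) (fun _ => zero_le)
    fun n => measure_mono fun ω hω => ?_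
  change ε ≤ ‖_‖ at hω
  rw [← mul_sub, norm_mul] at hω
  exact hω.trans (mul_le_of_le_one_left (norm_nonneg _) (hc ω))

end InMeasure

lemma lintegral_enorm_sq_eq {Ω : Type*} {mΩ : MeasurableSpace Ω} {𝓕 : Filtration ℝ≥0 mΩ} {H : Type*}
    [NormedAddCommGroup H] [InnerProductSpace ℝ H] {φ : ℝ≥0 → Ω → H} (h : IsBoundedProg 𝓕 φ)
    (t : ℝ≥0) (ω : Ω) :
    ∫⁻ s in Set.Ioc (0 : ℝ) t, ‖φ s.toNNReal ω‖ₑ ^ 2 =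
      ENNReal.ofReal (timeInt (fun r ω => inner ℝ (φ r ω) (φ r ω)) t ω) := by
  rw [timeInt, intervalIntegral.integral_of_le (NNReal.coe_nonneg t),
    ofReal_integral_eq_lintegral_ofReal ((intervalIntegrable_iff_integrableOn_Ioc_of_le
      (NNReal.coe_nonneg t)).1 ((h.inner h).integrable_section ω 0 t))
      (ae_of_all _ fun r => real_inner_self_nonneg)]
  refine lintegral_congr fun r => ?_
  rw [real_inner_self_eq_norm_sq, ENNReal.ofReal_pow (norm_nonneg _), ofReal_norm]

/-! ### Step approximation of the indicator of `r < τ` -/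

section StopStep

/-- A left-continuous step approximation, on `(0,t]`, of the process `1_{r < τ}`. -/
noncomputable def stopStep (t : ℝ≥0) (m : ℕ) (τ : Ω → WithTop ℝ≥0) (r : ℝ≥0) (ω : Ω) : ℝ :=
  ∑ j ∈ Finset.range m, (Set.Ioc (grid 0 t m j) (grid 0 t m (j + 1))).indicator
    (fun _ => if (grid 0 t m j : WithTop ℝ≥0) < τ ω then (1 : ℝ) else 0) r

lemma exists_stopStep_eq (t : ℝ≥0) {m : ℕ} (hm : m ≠ 0) (τ : Ω → WithTop ℝ≥0) {r : ℝ≥0}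
    (h0 : 0 < r) (hr : r ≤ t) (ω : Ω) : ∃ q : ℝ≥0, q < r ∧ r ≤ q + t / m ∧
      stopStep t m τ r ω = if (q : WithTop ℝ≥0) < τ ω then (1 : ℝ) else 0 := by
  obtain ⟨j, -, h1, h2, h3⟩ := exists_sum_indicator_eq (grid_mono 0 t m)
    (fun j => if (grid 0 t m j : WithTop ℝ≥0) < τ ω then (1 : ℝ) else 0) (s := r) m
    (by rwa [grid_zero]) (by rwa [grid_last (zero_le) hm])
  refine ⟨_, h1, ?_, h3⟩
  rwa [grid_succ, tsub_zero] at h2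

lemma abs_stopStep_le (t : ℝ≥0) (m : ℕ) (τ : Ω → WithTop ℝ≥0) {r : ℝ≥0} (h0 : 0 < r) (hr : r ≤ t)
    (ω : Ω) : |stopStep t m τ r ω| ≤ 1 := by
  rcases eq_or_ne m 0 with rfl | hm
  · simp [stopStep]
  · obtain ⟨q, -, -, h⟩ := exists_stopStep_eq t hm τ h0 hr ω
    rw [h]
    exact abs_ite_one_le _

/-- The left endpoint of the cell containing `r` lies strictly below `r` and tends to it, so it
finally compares with `τ` as `r` does. The instant `r = τ` is excluded because there the endpoint
lies below `τ`. -/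
lemma eventually_stopStep_eq (t : ℝ≥0) (τ : Ω → WithTop ℝ≥0) {r : ℝ≥0} (h0 : 0 < r) (hr : r ≤ t) {ω : Ω}
    (hne : (r : WithTop ℝ≥0) ≠ τ ω) : ∀ᶠ m in atTop,
      stopStep t m τ r ω = if (r : WithTop ℝ≥0) < τ ω then (1 : ℝ) else 0 := by
  rcases lt_or_gt_of_ne hne with h | h
  · filter_upwards [eventually_ne_atTop 0] with m hm
    obtain ⟨q, hq, -, hq'⟩ := exists_stopStep_eq t hm τ h0 hr ω
    rw [hq', if_pos h, if_pos ((WithTop.coe_lt_coe.2 hq).trans h)]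
  · obtain ⟨c, hc⟩ := WithTop.ne_top_iff_exists.1 (ne_top_of_lt h)
    rw [← hc] at h ⊢
    have hcr : c < r := WithTop.coe_lt_coe.1 h
    have hmesh := tendsto_mesh 0 t
    rw [tsub_zero] at hmesh
    filter_upwards [eventually_ne_atTop 0, hmesh.eventually (gt_mem_nhds (tsub_pos_of_lt hcr))]
      with m hm hm'
    obtain ⟨q, hq, hq2, hq'⟩ := exists_stopStep_eq t hm τ h0 hr ω
    rw [hq', ← hc, if_neg (not_lt.2 h.le), if_neg]
    rw [WithTop.coe_lt_coe, not_lt]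
    by_contra hqc
    have h1 : r < c + (r - c) := hq2.trans_lt (add_lt_add (not_le.1 hqc) hm')
    rw [add_tsub_cancel_of_le hcr.le] at h1
    exact lt_irrefl _ h1

end StopStep

/-! ### The law of a weak solution is a solution measure -/

section WeakSolutions

variable [CompleteSpace H] [SeparableSpace H]
  {W : Lp H 2 (volume.restrict (Set.Ioi (0 : ℝ))) →L[ℝ] Lp ℝ 2 P} {Y : Ω → C(ℝ≥0, E)}

lemma timeInt_drift (hyp : IsAdmissibleCoefficients ι A F G) (xs ys : StrongDual ℝ X) (t : ℝ≥0)
    (x : C(ℝ≥0, E)) : timeInt (fun r (x : C(ℝ≥0, E)) => drift ι F xs ys (x r)) t x =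
      (∫ s in (0 : ℝ)..t, ys (ι (x s.toNNReal))) + ∫ s in (0 : ℝ)..t, xs (F (x s.toNNReal)) := by
  refine intervalIntegral.integral_add ?_ ?_
  · exact ((ys.continuous.comp ι.continuous).comp
      (x.continuous.comp continuous_real_toNNReal)).intervalIntegrable _ _
  · have h1 := intervalIntegrable_path (hyp.stronglyMeasurable_drift xs 0)
      (hyp.bddOnBalls_drift xs 0) x 0 t
    simpa [drift] using h1

namespace IsWeakSolution

lemma measurable_eval (hsol : IsWeakSolution ι A F G P 𝓕 W Y) (t : ℝ≥0) :
    Measurable[𝓕 t] fun ω => Y ω t := hsol.progressive.adapted t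

lemma measurable_path (hsol : IsWeakSolution ι A F G P 𝓕 W Y) : Measurable Y :=
  measurable_path_of_eval fun t => (hsol.measurable_eval t).mono (𝓕.le t) le_rfl

lemma exists_intClosure (hyp : IsAdmissibleCoefficients ι A F G)
    (hsol : IsWeakSolution ι A F G P 𝓕 W Y) (R : ℝ) (xs : StrongDual ℝ X) :
    ∃ Z, IntClosure 𝓕 P (WienerBase W) Z (fun r ω => cutoff R (disp G xs) r (Y ω)) ∧
      ∀ᵐ ω ∂P, Z 0 ω = 0 := by
  have := hsol.probability
  refine hsol.wiener.bracketSystem.exists_intClosure ((isBoundedProg_cutoff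
    (hyp.stronglyMeasurable_disp xs) (hyp.bddOnBalls_disp xs) R).comp_map
      (measurable_pathFiltration_of_eval hsol.measurable_eval)) fun T ε hε => ?_
  obtain ⟨Φ, hΦ⟩ := exists_elementary_energy_cutoff_le (P := P) hsol.measurable_eval
    (hyp.stronglyMeasurable_disp xs) (hyp.bddOnBalls_disp xs) R T hε
  exact ⟨_, _, Φ.gen, hΦ⟩

/-- Before the exit time the integrand of the equation agrees with its cut-off. Lenglart's
inequality converts convergence in probability of the integrands into that of the integrals on this
event, so there both `Z t` and the stochastic integral of the equation are limits of the same
elementary integrals. -/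
lemma ae_eq_of_lt_hit (hyp : IsAdmissibleCoefficients ι A F G)
    (hsol : IsWeakSolution ι A F G P 𝓕 W Y) (R : ℝ) {xs ys : StrongDual ℝ X}
    (hp : IsAdjointPair A xs ys) {Z : ℝ≥0 → Ω → ℝ}
    (hZ : IntClosure 𝓕 P (WienerBase W) Z (fun r ω => cutoff R (disp G xs) r (Y ω)))
    (hZ0 : ∀ᵐ ω ∂P, Z 0 ω = 0) (t : ℝ≥0) :
    ∀ᵐ ω ∂P, (t : WithTop ℝ≥0) < hit R (Y ω) → Z t ω = martPart ι F xs ys t (Y ω) := by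
  have := hsol.probability
  have hbs := hsol.wiener.bracketSystem
  obtain ⟨I, ⟨-, Φ, hΦ⟩, hI⟩ := hsol.equation xs ys hp
  set c : Ω → ℝ := fun ω => if (t : WithTop ℝ≥0) < hit R (Y ω) then 1 else 0 with hc
  have h1 : TendstoInMeasure P (fun n ω => c ω * (Φ n).integral W t ω) atTop
      (fun ω => c ω * I t ω) := (hΦ t).2.mul_le_one fun ω => abs_ite_one_le _
  have h2 : TendstoInMeasure P (fun n ω => c ω * (Φ n).integral W t ω) atTop
      (fun ω => c ω * Z t ω) := by
    rw [tendstoInMeasure_iff_measureReal_norm]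
    refine fun ε hε => tendsto_order.2
      ⟨fun a ha => .of_forall fun n => ha.trans_le measureReal_nonneg, fun η hη => ?_⟩
    -- This threshold for the bracket makes the bound `δ / ε²` of Lenglart's inequality equal to `η
    -- / 2`.
    have hδ : 0 < η / 2 * ε ^ 2 := by positivity
    have hA := (ENNReal.tendsto_toReal ENNReal.zero_ne_top).comp
      ((hΦ t).1 (ENNReal.ofReal (η / 2 * ε ^ 2)) (ENNReal.ofReal_pos.2 hδ))
    filter_upwards [hA.eventually_lt_const (half_pos hη)] with n hn
    have hD : Gen 𝓕 (IntClosure 𝓕 P (WienerBase W)) _ _ :=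
      (Gen.base (IntClosure.of_gen hbs (Φ n).gen)).sub (Gen.base hZ)
    have hDp := hbs.intClosure.gen.prog hD
    have hL := (hbs.intClosure.gen.mart hD).lenglart (hDp.inner hDp)
      (fun _ _ => real_inner_self_nonneg) (hbs.intClosure.gen.bracket hD hD) t hε hδ
    rw [mul_div_cancel_right₀ _ (by positivity)] at hL
    refine ((ENNReal.toReal_mono (measure_ne_top _ _) (measure_mono_ae (t := _ ∪ _) ?_)).trans
      (measureReal_union_le _ _)).trans_lt ((add_lt_add_of_lt_of_le hn hL).trans_eq (add_halves η))
    filter_upwards [hZ0] with ω h0 (hω : ε ≤ _)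
    by_cases ht : (t : WithTop ℝ≥0) < hit R (Y ω)
    swap
    · simp only [hc, if_neg ht, zero_mul, sub_zero, norm_zero] at hω
      exact absurd hω (not_le.2 hε)
    refine or_iff_not_imp_left.2 fun hV => ⟨?_, not_le.1 fun hV' => hV ?_⟩
    · simp only [hc, if_pos ht, one_mul] at hω
      simpa [h0, ElementaryProcess.integral] using hω
    · refine (ENNReal.ofReal_le_ofReal hV').trans_eq ((lintegral_enorm_sq_eq hDp t ω).symm.trans
        (setLIntegral_congr_fun measurableSet_Ioc fun s hs => ?_))
      have : (s.toNNReal : WithTop ℝ≥0) < hit R (Y ω) :=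
        (WithTop.coe_le_coe.2 (Real.toNNReal_le_iff_le_coe.2 hs.2)).trans_lt ht
      simp only [cutoff, if_pos this, disp]
  have h3 := tendstoInMeasure_ae_unique h2 h1
  filter_upwards [h3, hI t] with ω h hω ht
  simp only [hc, if_pos ht, one_mul] at h
  rw [h, martPart, timeInt_drift hyp, hω]
  ring

/-- The stopped stochastic integral is the stopped martingale part of the coordinate process. -/
lemma ae_eq_martStop (hyp : IsAdmissibleCoefficients ι A F G)
    (hsol : IsWeakSolution ι A F G P 𝓕 W Y) (R : ℝ) {xs ys : StrongDual ℝ X}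
    (hp : IsAdjointPair A xs ys) {Z : ℝ≥0 → Ω → ℝ}
    (hZ : IntClosure 𝓕 P (WienerBase W) Z (fun r ω => cutoff R (disp G xs) r (Y ω)))
    (hZ0 : ∀ᵐ ω ∂P, Z 0 ω = 0) (t : ℝ≥0) :
    ∀ᵐ ω ∂P, Z t ω = martStop ι F R xs ys t (Y ω) := by
  have := hsol.probability
  have hbs := hsol.wiener.bracketSystem
  -- The previous identity holds only strictly before the exit time. A discretized stopping time
  -- overshoots the exit from the ball of radius `R`, but on a fine grid it still precedes the exit
  -- from the ball of radius `R + 1`.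
  obtain ⟨Z', hZ', hZ0'⟩ := hsol.exists_intClosure hyp (R + 1) xs
  have hτ : IsStoppingTime 𝓕 fun ω => hit R (Y ω) := fun s =>
    measurable_pathFiltration_of_eval hsol.measurable_eval s (isStoppingTime_hit (E := E) R s)
  let S : ℕ → ℝ≥0 → Ω → ℝ := fun m r ω => ∑ j ∈ Finset.range m, _root_.transform
    (fun ω => if (grid 0 t m j : WithTop ℝ≥0) < hit R (Y ω) then (1 : ℝ) else 0) (grid 0 t m j)
    (grid 0 t m (j + 1)) Z' r ω
  have hS : ∀ m, Gen 𝓕 (IntClosure 𝓕 P (WienerBase W)) (S m) (fun r ω =>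
      stopStep t m (fun ω => hit R (Y ω)) r ω • cutoff (R + 1) (disp G xs) r (Y ω)) := fun m => by
    simp only [stopStep, Finset.sum_smul]
    exact Gen.sum (Finset.range m) fun j _ => Gen.transform (grid_mono 0 t m (Nat.le_succ j))
      (hτ.stronglyMeasurable_lt (grid 0 t m j)) ⟨1, fun ω => abs_ite_one_le _⟩ (Gen.base hZ')
  have hSL : ∀ m, MemLp (S m t) 2 P := fun m => (hbs.intClosure.gen.mart (hS m)).memLp t
  -- The integrands of the grid sums tend to the cut-off at radius `R` in energy, so by the isometry
  -- the sums tend to `Z t` in mean square.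
  have h1 : TendstoInMeasure P (S · t) atTop (Z t) := by
    refine tendstoInMeasure_of_integral_sq hSL (hZ.memLp t) ?_
    have hD := fun m => (hS m).sub (Gen.base hZ)
    obtain ⟨C, hC⟩ := hZ'.prog.bdd
    obtain ⟨C', hC'⟩ := hZ.prog.bdd
    refine (tendsto_energy_of_bounded (P := P) (T := t) (C := C + C')
      (fun m => hbs.intClosure.gen.prog (hD m)) (fun m r ω h0 hr => ?_) fun ω => ?_).congr fun m => ?_
    · refine (norm_sub_le _ _).trans (add_le_add ?_ (hC' r ω))
      rw [norm_smul]
      exact (mul_le_of_le_one_left (norm_nonneg _) (abs_stopStep_le t m _ h0 hr ω)).trans (hC r ω)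
    · have hne : ∀ᵐ r : ℝ, 0 < r → (r.toNNReal : WithTop ℝ≥0) ≠ hit R (Y ω) := by
        rcases eq_or_ne (hit R (Y ω)) ⊤ with h | h
        · exact ae_of_all _ fun r _ => h ▸ WithTop.coe_ne_top
        · obtain ⟨c, hc⟩ := WithTop.ne_top_iff_exists.1 h
          have h1 : ∀ᵐ r : ℝ, r ≠ c := by simp [ae_iff]
          filter_upwards [h1] with r hr h0 h2
          rw [← hc, WithTop.coe_inj] at h2
          exact hr (by rw [← h2, Real.coe_toNNReal _ h0.le])
      filter_upwards [hne] with r hr h0 hrt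
      refine tendsto_nhds_of_eventually_eq ((eventually_stopStep_eq t (fun ω => hit R (Y ω))
        (Real.toNNReal_pos.2 h0) (Real.toNNReal_le_iff_le_coe.2 hrt) (hr h0)).mono fun m hm => ?_)
      rw [hm]
      unfold cutoff
      by_cases h : (r.toNNReal : WithTop ℝ≥0) < hit R (Y ω)
      · rw [if_pos h, if_pos h, if_pos (h.trans_le (hit_mono (by linarith) _)), one_smul, sub_self]
      · rw [if_neg h, if_neg h, zero_smul, sub_self]
    · rw [← hbs.intClosure.gen.integral_sq (hD m) t]
      refine integral_congr_ae ?_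
      filter_upwards [hZ0] with ω h0
      simp [h0, S, _root_.transform]
  -- Path by path, the same sums finally coincide with the stopped sums of the martingale part,
  -- which converge by continuity.
  have h2 : TendstoInMeasure P (S · t) atTop (fun ω => martStop ι F R xs ys t (Y ω)) := by
    refine tendstoInMeasure_of_tendsto_ae (fun m => (hSL m).1) ?_
    filter_upwards [ae_all_iff.2 fun m => ae_all_iff.2 fun j =>
      hsol.ae_eq_of_lt_hit hyp (R + 1) hp hZ' hZ0' (grid 0 t m j)] with ω hω
    have h3 := tendsto_stoppedSum (zero_le (a := t)) (hit R (Y ω))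
      (hyp.continuous_martPart xs ys (Y ω))
    rw [stopAt_zero, martPart_zero, sub_zero] at h3
    refine h3.congr' ?_
    obtain ⟨δ, hδ, hu⟩ := Metric.uniformContinuousOn_iff.1
      ((isCompact_Icc (a := (0 : ℝ≥0)) (b := t)).uniformContinuousOn_of_continuous
        (Y ω).continuous.continuousOn) 1 one_pos
    have hmesh := NNReal.tendsto_coe.2 (tendsto_mesh 0 t)
    filter_upwards [hmesh.eventually_lt_const hδ] with m hm
    refine Finset.sum_congr rfl fun j hj => ?_
    have hj1 := grid_le (zero_le (a := t)) (Nat.succ_le_of_lt (Finset.mem_range.1 hj))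
    have hj0 := grid_mono 0 t m (Nat.le_succ j)
    rw [_root_.transform, min_eq_right hj1, min_eq_right (hj0.trans hj1)]
    split_ifs with hlt
    · beta_reduce
      have h4 : (grid 0 t m (j + 1) : WithTop ℝ≥0) < hit (R + 1) (Y ω) := lt_hit_iff.2 fun r hr => by
        rcases le_total r (grid 0 t m j) with hrj | hrj
        · linarith [lt_hit_iff.1 hlt r hrj]
        · have h5 := hu r ⟨zero_le, hr.trans hj1⟩ (grid 0 t m j) ⟨zero_le, hj0.trans hj1⟩ (by
              rw [NNReal.dist_eq, abs_of_nonneg (sub_nonneg.2 (NNReal.coe_le_coe.2 hrj))]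
              refine lt_of_le_of_lt (sub_le_sub_right (NNReal.coe_le_coe.2 hr) _) ?_
              rw [grid_succ]
              push_cast
              simpa using hm)
          rw [dist_eq_norm] at h5
          linarith [lt_hit_iff.1 hlt _ le_rfl, norm_sub_norm_le (Y ω r) (Y ω (grid 0 t m j))]
      rw [hω m _ h4, hω m _ ((WithTop.coe_le_coe.2 hj0).trans_lt h4)]
    · simp
  exact tendstoInMeasure_ae_unique h1 h2

/-- The stochastic integrals are martingales for `𝓕`, which may be larger than the filtration
generated by `Y`. Under the law of `Y` the martingale and bracket identities are tested only on
preimages of path events, so they descend once the integrals are identified with functions of the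
path. -/
theorem isSolutionMeasure (hyp : IsAdmissibleCoefficients ι A F G)
    (hsol : IsWeakSolution ι A F G P 𝓕 W Y) : IsSolutionMeasure ι A F G (P.map Y) := by
  have hprob := hsol.probability
  have hYm := hsol.measurable_path
  have hπ := measurable_pathFiltration_of_eval hsol.measurable_eval
  have hmap : IsProbabilityMeasure (P.map Y) := Measure.isProbabilityMeasure_map hYm.aemeasurable
  have hbs := hsol.wiener.bracketSystem
  refine ⟨hmap, fun R xs ys hp => ?_, fun R xs ys hp => ?_⟩
  · have hc := hyp.isBddContinuous_martStop R xs ys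
    obtain ⟨Z, hZ, hZ0⟩ := hsol.exists_intClosure hyp R xs
    have hae := hsol.ae_eq_martStop hyp R hp hZ hZ0
    refine ⟨fun t => hc.memLp t 2, fun t => (hc.adapted t).aestronglyMeasurable, fun s t hst => ?_⟩
    refine CondZero.map hYm (hπ s) ((hc.stronglyMeasurable t).sub
      (hc.stronglyMeasurable s)).aestronglyMeasurable
      (((hZ.l2Mart hbs).mart s t hst).congr ?_)
    filter_upwards [hae s, hae t] with ω h1 h2
    rw [h1, h2]
  · have hc := hyp.isBddContinuous_martStop R xs ys
    obtain ⟨Z, hZ, hZ0⟩ := hsol.exists_intClosure hyp R xs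
    have hae := hsol.ae_eq_martStop hyp R hp hZ hZ0
    have hb := isBoundedProg_cutoff (hyp.stronglyMeasurable_inner_disp xs xs)
      (hyp.bddOnBalls_inner_disp xs xs) R
    refine ⟨fun t => hb.integrable_timeInt t, fun s t hst => ?_⟩
    have hd := (hc.stronglyMeasurable t).sub (hc.stronglyMeasurable s)
    refine CondZero.map hYm (hπ s) ((hd.mul hd).sub ((hb.isBddContinuous_timeInt.stronglyMeasurable
      t).sub (hb.isBddContinuous_timeInt.stronglyMeasurable s))).aestronglyMeasurable
      (((hbs.intClosure.bracket hZ hZ).cond s t hst).congr ?_)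
    have e : ∀ (r : ℝ≥0) ω, timeInt (fun r ω => inner ℝ (cutoff R (disp G xs) r (Y ω))
        (cutoff R (disp G xs) r (Y ω))) r ω =
        timeInt (cutoff R fun e => inner ℝ (disp G xs e) (disp G xs e)) r (Y ω) := fun r ω => by
      unfold timeInt
      congr 1; ext q
      simp only [cutoff]
      split_ifs <;> simp
    filter_upwards [hae s, hae t] with ω h1 h2
    rw [h1, h2, e, e]

end IsWeakSolution

end WeakSolutions

/-! ### Remainder estimates for the cosine -/

section CosTaylor

/-- The error of the second order Taylor expansion of the cosine. -/
noncomputable def cosError (x d : ℝ) : ℝ :=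
  Real.cos (x + d) - Real.cos x + Real.sin x * d + Real.cos x * d ^ 2 / 2

lemma abs_cosError_le_cube (x d : ℝ) (hd : |d| ≤ 1) : |cosError x d| ≤ |d| ^ 3 := by
  have h1 := Real.cos_bound hd
  have h2 : |Real.sin d - (d - d ^ 3 / 6)| ≤ |d| ^ 4 * (5 / 96) :=
    (Real.sin_bound hd).trans (by
      have := pow_le_pow_of_le_one (abs_nonneg d) hd (show 4 ≤ 5 by norm_num)
      have : 0 ≤ |d| ^ 4 := by positivity
      linarith)
  have e : cosError x d = Real.cos x * (Real.cos d - (1 - d ^ 2 / 2))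
      - Real.sin x * (Real.sin d - (d - d ^ 3 / 6)) + Real.sin x * (d ^ 3 / 6) := by
    rw [cosError, Real.cos_add]; ring
  have h3 : |d| ^ 4 ≤ |d| ^ 3 := pow_le_pow_of_le_one (abs_nonneg _) hd (by norm_num)
  have hc := Real.abs_cos_le_one x
  have hs := Real.abs_sin_le_one x
  have h4 : |d ^ 3 / 6| = |d| ^ 3 / 6 := by rw [abs_div, abs_pow]; norm_num
  have h0 : 0 ≤ |d| ^ 3 := by positivity
  calc |cosError x d| ≤ |Real.cos x| * |Real.cos d - (1 - d ^ 2 / 2)|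
      + |Real.sin x| * |Real.sin d - (d - d ^ 3 / 6)| + |Real.sin x| * |d ^ 3 / 6| := by
        rw [e, ← abs_mul, ← abs_mul, ← abs_mul]
        exact (abs_add_le _ _).trans (add_le_add_left (abs_sub _ _) _)
    _ ≤ 1 * (|d| ^ 4 * (5 / 96)) + 1 * (|d| ^ 4 * (5 / 96)) + 1 * (|d| ^ 3 / 6) := by
        rw [h4]; gcongr
    _ ≤ |d| ^ 3 := by linarith

lemma abs_cosError_le (x d : ℝ) : |cosError x d| ≤ 4 * d ^ 2 ∧ |cosError x d| ≤ 4 * |d| ^ 3 := by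
  have h0 : 0 ≤ |d| ^ 3 := by positivity
  have h2 : d ^ 2 = |d| ^ 2 := (sq_abs d).symm
  rcases le_total |d| 1 with hd | hd
  · have h := abs_cosError_le_cube x d hd
    have h3 : |d| ^ 3 ≤ |d| ^ 2 := pow_le_pow_of_le_one (abs_nonneg _) hd (by norm_num)
    constructor <;> nlinarith [sq_nonneg d]
  · have h3 : |d| ^ 2 ≤ |d| ^ 3 := pow_le_pow_right₀ hd (by norm_num)
    have hb : |cosError x d| ≤ 2 + |d| + |d| ^ 2 / 2 := by
      have ha := abs_le.1 (Real.abs_cos_le_one (x + d))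
      have hc := abs_le.1 (Real.abs_cos_le_one x)
      have h4 : |Real.sin x * d| ≤ |d| := by
        rw [abs_mul]; exact mul_le_of_le_one_left (abs_nonneg _) (Real.abs_sin_le_one x)
      have h4 := abs_le.1 h4
      have h5 : |Real.cos x * d ^ 2 / 2| ≤ |d| ^ 2 / 2 := by
        rw [abs_div, abs_mul, abs_two, abs_of_nonneg (sq_nonneg d), ← h2]
        have := mul_le_of_le_one_left (sq_nonneg d) (Real.abs_cos_le_one x)
        linarith
      have h5 := abs_le.1 h5
      rw [cosError, abs_le]
      constructor <;> linarith [ha.1, ha.2, hc.1, hc.2, h4.1, h4.2, h5.1, h5.2]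
    constructor <;> nlinarith

/-- If `|b|` dominates, the quadratic bound gives `4 (2b)²`; otherwise the cubic bound gives `4
(2|a|)³`, and `|a|³ ≤ κ³ + a⁴/κ`. In the application `a` has fourth moments whereas `b` is only
small in mean square. -/
lemma abs_cosError_add_le (x a b : ℝ) {κ : ℝ} (hκ : 0 < κ) :
    |cosError x (a + b)| ≤ 32 * (κ ^ 3 + a ^ 4 / κ) + 16 * b ^ 2 := by
  have h3 : |a| ^ 3 ≤ κ ^ 3 + a ^ 4 / κ := by
    have ha4 : a ^ 4 = |a| ^ 4 := by rw [← abs_pow, abs_of_nonneg (by positivity)]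
    rcases le_total |a| κ with h | h
    · exact (pow_le_pow_left₀ (abs_nonneg _) h 3).trans (le_add_of_nonneg_right (by positivity))
    · refine le_add_of_nonneg_of_le (by positivity) ?_
      rw [le_div_iff₀ hκ, ha4, pow_succ |a| 3]
      gcongr
  obtain ⟨h1, h2⟩ := abs_cosError_le x (a + b)
  have hadd := abs_add_le a b
  rcases le_total |a| |b| with h | h
  · have : (a + b) ^ 2 ≤ 4 * b ^ 2 := by
      rw [← sq_abs (a + b), ← sq_abs b]
      nlinarith [abs_nonneg (a + b), abs_nonneg b]
    have : 0 ≤ |a| ^ 3 := by positivity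
    linarith
  · have : |a + b| ^ 3 ≤ (2 * |a|) ^ 3 := by gcongr; linarith
    nlinarith [sq_nonneg b]

end CosTaylor

/-! ### Fourth moments of increments -/

section FourthMoment

/-- The fourth moments of the increments over intervals of length `h` are of order `h²`. -/
def HasFourthMoments (P : Measure Ω) (N : ℝ≥0 → Ω → ℝ) : Prop :=
  ∃ C : ℝ, 0 ≤ C ∧ ∀ p q : ℝ≥0, p ≤ q → MemLp (fun ω => N q ω - N p ω) 4 P ∧
    ∫ ω, (N q ω - N p ω) ^ 4 ∂P ≤ C * ((q : ℝ) - p) ^ 2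

lemma MeasureTheory.MemLp.integrable_pow_four {f : Ω → ℝ} (hf : MemLp f 4 P) :
    Integrable (fun ω => f ω ^ 4) P := by
  have := (show MemLp f ((4 : ℕ) : ℝ≥0∞) P from hf).integrable_norm_pow (by norm_num)
  refine this.congr (.of_forall fun ω => ?_)
  simp only [Real.norm_eq_abs, ← abs_pow]
  exact abs_of_nonneg (by positivity)

lemma add_pow_four_le (a b : ℝ) : (a + b) ^ 4 ≤ 8 * (a ^ 4 + b ^ 4) := by
  nlinarith [sq_nonneg (a - b), sq_nonneg (a + b), sq_nonneg (a ^ 2 - b ^ 2),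
    mul_nonneg (sq_nonneg (a - b)) (sq_nonneg (a + b)), mul_nonneg (sq_nonneg (a - b)) (sq_nonneg a),
    mul_nonneg (sq_nonneg (a - b)) (sq_nonneg b), sq_nonneg ((a - b) ^ 2)]

/-- Elementary integration keeps the bound since the coefficients `ξ` are bounded. The constant
depends on the process, so nothing is claimed for limits in mean square. -/
lemma HasFourthMoments.gen {Base : (ℝ≥0 → Ω → ℝ) → (ℝ≥0 → Ω → K) → Prop}
    (h : ∀ {N φ}, Base N φ → HasFourthMoments P N) {N φ} (hN : Gen 𝓕 Base N φ) :
    HasFourthMoments P N := by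
  induction hN with
  | zero => exact ⟨0, le_rfl, fun p q _ => ⟨by simp, by simp⟩⟩
  | base hb => exact h hb
  | @add N N' _ _ _ _ ih ih' =>
    obtain ⟨C, hC0, hC⟩ := ih
    obtain ⟨C', hC'0, hC'⟩ := ih'
    refine ⟨8 * (C + C'), by positivity, fun p q hpq => ?_⟩
    obtain ⟨h1, h2⟩ := hC p q hpq
    obtain ⟨h1', h2'⟩ := hC' p q hpq
    have e : (fun ω => N q ω + N' q ω - (N p ω + N' p ω))
        = fun ω => (N q ω - N p ω) + (N' q ω - N' p ω) := by ext ω; ring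
    have hm : MemLp (fun ω => (N q ω - N p ω) + (N' q ω - N' p ω)) 4 P := h1.add h1'
    refine ⟨e ▸ hm, ?_⟩
    calc ∫ ω, (N q ω + N' q ω - (N p ω + N' p ω)) ^ 4 ∂P
        = ∫ ω, ((N q ω - N p ω) + (N' q ω - N' p ω)) ^ 4 ∂P := by
          congr 1; ext ω; ring
      _ ≤ ∫ ω, 8 * ((N q ω - N p ω) ^ 4 + (N' q ω - N' p ω) ^ 4) ∂P :=
          integral_mono hm.integrable_pow_four
            ((h1.integrable_pow_four.add h1'.integrable_pow_four).const_mul 8)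
            fun ω => add_pow_four_le _ _
      _ ≤ 8 * (C + C') * ((q : ℝ) - p) ^ 2 := by
          rw [integral_const_mul, integral_add h1.integrable_pow_four h1'.integrable_pow_four]
          linarith
  | @smul N φ c _ ih =>
    obtain ⟨C, hC0, hC⟩ := ih
    refine ⟨c ^ 4 * C, by positivity, fun p q hpq => ?_⟩
    obtain ⟨h1, h2⟩ := hC p q hpq
    have e : (fun ω => c * N q ω - c * N p ω) = fun ω => c * (N q ω - N p ω) := by ext ω; ring
    refine ⟨e ▸ h1.const_mul c, ?_⟩
    simp_rw [← mul_sub, mul_pow]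
    rw [integral_const_mul, mul_assoc]
    gcongr
  | @transform N φ ξ a b hab hξ hb _ ih =>
    obtain ⟨C, hC0, hC⟩ := ih
    obtain ⟨D, hD⟩ := hb
    refine ⟨D ^ 4 * C, by positivity, fun p q hpq => ?_⟩
    rcases transform_sub_cases ξ hab hpq with h0 | ⟨x, y, hpx, hxy, hyq, -, hx⟩
    · simp only [h0]
      exact ⟨by simp, by simp; positivity⟩
    · simp only [hx]
      obtain ⟨h1, h2⟩ := hC x y hxy
      have hm : MemLp (fun ω => ξ ω * (N y ω - N x ω)) 4 P :=
        (h1.const_mul D).mono ((hξ.mono (𝓕.le a)).aestronglyMeasurable.mul h1.1)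
          (.of_forall fun ω => by
            rw [norm_mul, norm_mul]
            exact mul_le_mul_of_nonneg_right ((hD ω).trans (le_abs_self D)) (norm_nonneg _))
      refine ⟨hm, ?_⟩
      calc ∫ ω, (ξ ω * (N y ω - N x ω)) ^ 4 ∂P ≤ ∫ ω, D ^ 4 * (N y ω - N x ω) ^ 4 ∂P := by
            refine integral_mono hm.integrable_pow_four (h1.integrable_pow_four.const_mul _)
              fun ω => ?_
            have : ξ ω ^ 4 ≤ D ^ 4 := by
              rw [← abs_of_nonneg (by positivity : 0 ≤ ξ ω ^ 4), abs_pow]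
              exact pow_le_pow_left₀ (abs_nonneg _) (hD ω) 4
            simp only [mul_pow]
            gcongr
        _ ≤ D ^ 4 * C * ((q : ℝ) - p) ^ 2 := by
            rw [integral_const_mul, mul_assoc]
            have h3 : ((y : ℝ) - x) ^ 2 ≤ ((q : ℝ) - p) ^ 2 := by
              have h1 : (p : ℝ) ≤ x := hpx
              have h2 : (x : ℝ) ≤ y := hxy
              have h3 : (y : ℝ) ≤ q := hyq
              exact pow_le_pow_left₀ (by linarith) (by linarith) 2
            gcongr
            exact h2.trans (by gcongr)

variable [IsProbabilityMeasure P]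

lemma IsBoundedProg.abs_integral_timeInt_sub_le {c : ℝ≥0 → Ω → ℝ} (hc : IsBoundedProg 𝓕 c)
    {κ : ℝ} {p q : ℝ≥0} (hpq : p ≤ q) (hκ : ∀ r, |∫ ω, c r ω ∂P| ≤ κ) :
    |∫ ω, (timeInt c q ω - timeInt c p ω) ∂P| ≤ κ * ((q : ℝ) - p) := by
  obtain ⟨C, hC⟩ := hc.bdd
  have hpq' : (p : ℝ) ≤ q := hpq
  have hfin : IsFiniteMeasure (volume.restrict (Set.Ioc (p : ℝ) q)) :=
    ⟨by rw [Measure.restrict_apply_univ]; exact measure_Ioc_lt_top⟩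
  have hint : Integrable (Function.uncurry fun (ω : Ω) (r : ℝ) => c r.toNNReal ω)
      (P.prod (volume.restrict (Set.Ioc (p : ℝ) q))) :=
    Integrable.of_bound (C := C) (hc.prog.stronglyMeasurable_uncurry.comp_measurable
      measurable_swap).aestronglyMeasurable (.of_forall fun x => hC _ _)
  simp_rw [timeInt_sub hc, intervalIntegral.integral_of_le hpq']
  rw [integral_integral_swap hint, ← intervalIntegral.integral_of_le hpq']
  have := intervalIntegral.norm_integral_le_of_norm_le_const (a := (p : ℝ)) (b := q)
    (f := fun r : ℝ => ∫ ω, c r.toNNReal ω ∂P) (C := κ) fun r _ => hκ _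
  rwa [abs_of_nonneg (sub_nonneg.2 hpq')] at this

lemma itoIntegrand_pow_four (z : Fin 1 → ℝ) (a : Fin 1 → Fin 1 → ℝ) :
    itoIntegrand (fun z : Fin 1 → ℝ => z 0 ^ 4) z 0 a = 6 * z 0 ^ 2 * a 0 0 := by
  set L : (Fin 1 → ℝ) →L[ℝ] ℝ := ContinuousLinearMap.proj 0 with hL
  have h1 : fderiv ℝ (fun z : Fin 1 → ℝ => z 0 ^ 4) = fun z => (4 * z 0 ^ 3) • L := by
    ext1 z
    have : HasFDerivAt (fun z : Fin 1 → ℝ => L z ^ 4) ((4 * z 0 ^ 3) • L) z :=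
      ((L.hasFDerivAt (x := z)).pow 4).congr_fderiv (by simp [hL])
    exact this.fderiv
  have h2 : HasFDerivAt (fun z : Fin 1 → ℝ => (4 * z 0 ^ 3) • L)
      (((12 * z 0 ^ 2) • L).smulRight L) z := by
    have h3 : HasFDerivAt (fun z : Fin 1 → ℝ => 4 * L z ^ 3) ((12 * z 0 ^ 2) • L) z :=
      (((L.hasFDerivAt (x := z)).pow 3).const_mul 4).congr_fderiv (by
        simp only [smul_smul, hL, ContinuousLinearMap.proj_apply]; congr 1; norm_num; ring)
    exact h3.smul_const L
  unfold itoIntegrand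
  rw [h1, h2.fderiv]
  simp [hL]
  ring

/-- A bounded continuous martingale whose bracket has a bounded density. -/
lemma IsBddContinuous.hasFourthMoments {M : ℝ≥0 → Ω → ℝ} {a : ℝ≥0 → Ω → ℝ}
    (hc : IsBddContinuous 𝓕 M) (hM : L2Mart 𝓕 P M) (ha : IsBoundedProg 𝓕 a)
    (hb : BracketPair 𝓕 P M M (timeInt a)) : HasFourthMoments P M := by
  obtain ⟨D, hD⟩ := ha.bdd
  have hD0 : 0 ≤ D := by
    obtain ⟨ω⟩ : Nonempty Ω := P.nonempty_of_neZero
    exact (norm_nonneg _).trans (hD 0 ω)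
  refine ⟨6 * D ^ 2, by positivity, fun p q hpq => ?_⟩
  have hpq' : (p : ℝ) ≤ q := hpq
  have hξ : StronglyMeasurable[𝓕 p] (fun _ : Ω => (1 : ℝ)) := stronglyMeasurable_const
  have hξb : ∃ C : ℝ, ∀ ω : Ω, |(fun _ : Ω => (1 : ℝ)) ω| ≤ C := ⟨1, fun _ => by simp⟩
  -- `N` is the increment of `M` after `p`, frozen at `q`. It starts at zero and its bracket density
  -- is `a` on `(p,q]`, so Itô's formula for `z⁴` expresses its fourth moment at `q` as the mean of
  -- `∫ 6 N² a` over `(p,q]`.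
  set N := _root_.transform (fun _ : Ω => (1 : ℝ)) p q M with hN
  set c : ℝ≥0 → Ω → ℝ := fun r ω => (Set.Ioc p q).indicator (fun _ => (1 : ℝ)) r * a r ω with hcdef
  have hcp : IsBoundedProg 𝓕 c := (IsBoundedProg.step hξ hξb).smul ha
  have hNc : IsBddContinuous 𝓕 N := hc.transform hpq hξ hξb
  have hNm : L2Mart 𝓕 P N := hM.transform hpq hξ hξb
  have hct : ∀ t ω, timeInt c t ω = timeInt a (min t q) ω - timeInt a (min t p) ω :=
    fun t ω => by
      simp only [hcdef]; rw [timeInt_step_mul ha _ hpq]; simp [_root_.transform]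
  have hNN : BracketPair 𝓕 P N N (timeInt c) := by
    have h1 := (hb.transform hM hM hpq hξ hξb).symm.transform hM hNm hpq hξ hξb
    refine h1.congr fun t => .of_forall fun ω => ?_
    rw [hct]
    simp only [_root_.transform, one_mul, min_assoc, min_self, min_eq_left hpq, min_eq_right hpq,
      sub_self, sub_zero]
  have hN0 : ∀ ω, N 0 ω = 0 := fun ω => by simp [hN, _root_.transform]
  have hNq : ∀ ω, N q ω = M q ω - M p ω := fun ω => by
    simp [hN, _root_.transform, min_eq_right hpq]
  obtain ⟨B, hB⟩ := hc.bdd q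
  have hNB : ∀ t ω, ‖N t ω‖ ≤ B + B := fun t ω => by
    simp only [hN, _root_.transform, one_mul]
    exact (norm_sub_le _ _).trans (add_le_add (hB _ (min_le_right _ _) _)
      (hB _ ((min_le_right _ _).trans hpq) _))
  have hNp : IsBoundedProg 𝓕 N :=
    ⟨hNc.adapted.isStronglyProgressive_of_continuous hNc.continuous, ⟨_, hNB⟩⟩
  -- The second moment contributes one factor `q - p`; the length of the integration interval
  -- contributes the other.
  have hsq : ∀ t, ∫ ω, N t ω ^ 2 ∂P ≤ D * ((q : ℝ) - p) := fun t => by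
    have h1 := hNN.cond 0 t zero_le Set.univ MeasurableSet.univ
    simp only [hN0, timeInt_zero, sub_zero, Measure.restrict_univ] at h1
    have h2 : Integrable (fun ω => N t ω * N t ω) P :=
      (hNm.memLp t).integrable_mul (hNm.memLp t)
    rw [integral_sub h2 (hcp.integrable_timeInt t), sub_eq_zero] at h1
    simp_rw [sq]
    rw [h1]
    have h3 : ∀ ω, timeInt c t ω ≤ D * ((q : ℝ) - p) := fun ω => by
      rw [hct]
      refine (le_abs_self _).trans ((abs_timeInt_sub_le ha (min_le_min le_rfl hpq) ω
        fun r _ _ => hD r ω).trans ?_)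
      refine mul_le_mul_of_nonneg_left ?_ hD0
      rcases le_total t p with h | h
      · rw [min_eq_left h, min_eq_left (h.trans hpq)]; linarith
      · rw [min_eq_right h]
        have : ((min t q : ℝ≥0) : ℝ) ≤ q := min_le_right t q
        linarith
    exact (integral_mono (hcp.integrable_timeInt t) (integrable_const _) h3).trans (by simp)
  have hsys : IsItoSystem 𝓕 P (fun _ : Fin 1 => N) (fun _ => N) (fun _ _ _ => 0) (fun _ _ => c) :=
    ⟨fun _ => hNm, fun _ => hNc, fun _ => hNc, fun _ => .zero, fun _ _ => hcp, fun _ _ => hNN,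
      fun _ t ω => by simp [timeInt]⟩
  have hφ : ContDiff ℝ 2 (fun z : Fin 1 → ℝ => z 0 ^ 4) := by fun_prop
  set f : ℝ≥0 → Ω → ℝ := fun r ω => 6 * N r ω ^ 2 * a r ω with hf
  have hfp : IsBoundedProg 𝓕 f := by
    have := ((hNp.smul hNp).smul ha).const_smul 6
    simpa only [smul_eq_mul, sq, mul_assoc, hf] using this
  have hm4 : MemLp (N q) 4 P := hNc.memLp q 4
  have hI := hsys.condZero_comp hφ (zero_le (a := q)) Set.univ MeasurableSet.univ
  have e : (IsItoSystem.proc (fun z : Fin 1 → ℝ => z 0 ^ 4) (fun _ => N) (fun _ _ _ => 0)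
      (fun _ _ => c)) = fun r ω => (Set.Ioc p q).indicator (fun _ => (fun _ => (1 : ℝ)) ω) r *
        f r ω := by
    ext r ω
    refine (itoIntegrand_pow_four _ _).trans ?_
    simp only [hcdef, hf]; ring
  simp only [IsItoSystem.comp, e, timeInt_step_mul hfp _ hpq, _root_.transform, hN0, min_self,
    min_eq_right hpq, min_eq_left zero_le, one_mul, sub_self, sub_zero, zero_pow four_ne_zero,
    Measure.restrict_univ] at hI
  have hti : Integrable (fun ω => timeInt f q ω - timeInt f p ω) P :=
    (hfp.integrable_timeInt q).sub (hfp.integrable_timeInt p)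
  rw [integral_sub hm4.integrable_pow_four hti, sub_eq_zero] at hI
  simp only [← hNq]
  refine ⟨hm4, ?_⟩
  rw [hI]
  refine (le_abs_self _).trans ((hfp.abs_integral_timeInt_sub_le hpq
    (κ := 6 * D ^ 2 * ((q : ℝ) - p)) fun r => ?_).trans_eq (by ring))
  have hi2 : Integrable (fun ω => N r ω ^ 2) P := (hNm.memLp r).integrable_sq
  calc |∫ ω, 6 * N r ω ^ 2 * a r ω ∂P| ≤ ∫ ω, |6 * N r ω ^ 2 * a r ω| ∂P :=
        abs_integral_le_integral_abs
    _ ≤ ∫ ω, 6 * D * N r ω ^ 2 ∂P := by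
        refine integral_mono_of_nonneg (.of_forall fun ω => abs_nonneg _) (hi2.const_mul _)
          (.of_forall fun ω => ?_)
        have h1 : |a r ω| ≤ D := hD r ω
        simp only [abs_mul, abs_pow, sq_abs, abs_of_nonneg (by norm_num : (0 : ℝ) ≤ 6)]
        nlinarith [sq_nonneg (N r ω)]
    _ ≤ 6 * D ^ 2 * ((q : ℝ) - p) := by
        rw [integral_const_mul]
        nlinarith [hsq r]

end FourthMoment

/-! ### Approximable integrands -/

section Approximable

variable [IsProbabilityMeasure P]

/-- `φ` can be approximated in mean square by integrands generated from `Base`. -/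
def Approximable (𝓕 : Filtration ℝ≥0 mΩ) (P : Measure Ω)
    (Base : (ℝ≥0 → Ω → ℝ) → (ℝ≥0 → Ω → K) → Prop) (φ : ℝ≥0 → Ω → K) : Prop :=
  ∀ (T : ℝ≥0) (ε : ℝ), 0 < ε →
    ∃ N' φ', Gen 𝓕 Base N' φ' ∧ energy P (fun r ω => φ' r ω - φ r ω) T ≤ ε

lemma energy_const_smul (c : ℝ) (φ : ℝ≥0 → Ω → K) (t : ℝ≥0) :
    energy P (fun r ω => c • φ r ω) t = c ^ 2 * energy P φ t := by
  unfold energy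
  rw [← integral_const_mul]
  congr 1; ext ω
  rw [← timeInt_const_mul]
  simp only [inner_smul_left, inner_smul_right, RCLike.conj_to_real]
  congr 1; ext r ω'; ring

namespace Approximable

lemma of_gen {N φ} (h : Gen 𝓕 Base N φ) : Approximable 𝓕 P Base φ := fun T ε hε =>
  ⟨N, φ, h, by simpa [energy, timeInt] using hε.le⟩

lemma add (h : BracketSystem 𝓕 P Base) {φ ψ : ℝ≥0 → Ω → K} (hφ : Approximable 𝓕 P Base φ)
    (hψ : Approximable 𝓕 P Base ψ) (hφp : IsBoundedProg 𝓕 φ) (hψp : IsBoundedProg 𝓕 ψ) :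
    Approximable 𝓕 P Base (fun r ω => φ r ω + ψ r ω) := fun T ε hε => by
  obtain ⟨N, φ', hN, hφ'⟩ := hφ T (ε / 4) (by positivity)
  obtain ⟨N', ψ', hN', hψ'⟩ := hψ T (ε / 4) (by positivity)
  refine ⟨_, _, hN.add hN', ?_⟩
  have := energy_add_le (P := P) ((h.gen_prog hN).sub hφp) ((h.gen_prog hN').sub hψp) T
  simp only [add_sub_add_comm]
  linarith

lemma smul_le (h : BracketSystem 𝓕 P Base) {φ : ℝ≥0 → Ω → K} (hφ : Approximable 𝓕 P Base φ)
    (hφp : IsBoundedProg 𝓕 φ) {u : ℝ≥0 → Ω → ℝ} (hu : IsBoundedProg 𝓕 u)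
    (hgen : ∀ {N φ}, Gen 𝓕 Base N φ → ∃ N', Gen 𝓕 Base N' (fun r ω => u r ω • φ r ω)) :
    Approximable 𝓕 P Base (fun r ω => u r ω • φ r ω) := fun T ε hε => by
  obtain ⟨C, hC⟩ := hu.bdd
  obtain ⟨N, φ', hN, hφ'⟩ := hφ T (ε / (C ^ 2 + 1)) (by positivity)
  obtain ⟨N', hN'⟩ := hgen hN
  refine ⟨N', _, hN', ?_⟩
  have hd := (h.gen_prog hN).sub hφp
  simp only [← smul_sub]
  refine (energy_mono (hu.smul hd) (hd.const_smul C) fun r _ ω => ?_).trans ?_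
  · rw [norm_smul, norm_smul]
    exact mul_le_mul_of_nonneg_right ((hC r ω).trans (le_abs_self C)) (norm_nonneg _)
  · rw [energy_const_smul]
    rw [le_div_iff₀ (by positivity)] at hφ'
    nlinarith [energy_nonneg (P := P) (fun r ω => φ' r ω - φ r ω) T]

/-- Taking closures creates no integrands beyond the reach of the original system. This gives access
to approximations with fourth moments, which are available only for processes generated by `Base`
itself. -/
lemma of_gen_intClosure (h : BracketSystem 𝓕 P Base) {N φ}
    (hN : Gen 𝓕 (IntClosure 𝓕 P Base) N φ) : Approximable 𝓕 P Base φ := by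
  have hp : ∀ {N φ}, Gen 𝓕 (IntClosure 𝓕 P Base) N φ → IsBoundedProg 𝓕 φ :=
    fun h' => h.intClosure.gen_prog h'
  induction hN with
  | zero => exact .of_gen .zero
  | base hb =>
    intro T ε hε
    obtain ⟨Nk, φk, hk, hlim, -⟩ := hb.approx
    obtain ⟨k, hk'⟩ := ((hlim T).eventually (gt_mem_nhds hε)).exists
    exact ⟨_, _, hk k, hk'.le⟩
  | add h1 h2 ih ih' => exact ih.add h ih' (hp h1) (hp h2)
  | smul c h1 ih => exact ih.smul_le h (hp h1) (.const c) fun hg => ⟨_, hg.smul c⟩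
  | transform hab hξ hb h1 ih =>
    exact ih.smul_le h (hp h1) (.step hξ hb) fun hg => ⟨_, hg.transform hab hξ hb⟩

end Approximable

end Approximable

/-! ### Lévy's characterization by cosine transforms -/

section Levy

variable [IsProbabilityMeasure P]

lemma BracketSystem.integral_sq_sub (h : BracketSystem 𝓕 P Base) {N φ} (hN : Base N φ)
    {p q : ℝ≥0} (hpq : p ≤ q) :
    ∫ ω, (N q ω - N p ω) ^ 2 ∂P = energy P φ q - energy P φ p := by
  have h1 := (h.bracket hN hN).cond p q hpq Set.univ MeasurableSet.univ
  have hc := (h.prog hN).inner (h.prog hN)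
  have h2 : Integrable (fun ω => (N q ω - N p ω) * (N q ω - N p ω)) P :=
    ((h.mart hN).memLp_sub p q).integrable_mul ((h.mart hN).memLp_sub p q)
  have h3 : Integrable (fun ω => timeInt (fun r ω => inner ℝ (φ r ω) (φ r ω)) q ω
      - timeInt (fun r ω => inner ℝ (φ r ω) (φ r ω)) p ω) P :=
    (hc.integrable_timeInt q).sub (hc.integrable_timeInt p)
  rw [Measure.restrict_univ, integral_sub h2 h3, sub_eq_zero,
    integral_sub (hc.integrable_timeInt q) (hc.integrable_timeInt p)] at h1
  simp_rw [sq]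
  exact h1

/-- One step of a recursion in time. In the second order expansion of the cosine at `p`, the linear
term integrates to zero by the martingale property, and the quadratic one gives `(c q - c p)/2`
because the bracket is deterministic. In the remainder the increment is split into that of `N'`,
controlled by its fourth moment, and that of `N - N'`, controlled in mean square. -/
lemma abs_setIntegral_cos_sub_le {N N' C : ℝ≥0 → Ω → ℝ} {c : ℝ≥0 → ℝ} (hN : L2Mart 𝓕 P N)
    (hb : BracketPair 𝓕 P N N C) (hC : ∀ t ω, C t ω = c t) {s p q : ℝ≥0} (hsp : s ≤ p)
    (hpq : p ≤ q) (h4 : MemLp (fun ω => N' q ω - N' p ω) 4 P)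
    (h2 : MemLp (fun ω => (N q ω - N' q ω) - (N p ω - N' p ω)) 2 P)
    {B : Set Ω} (hB : MeasurableSet[𝓕 s] B) (θ : ℝ) {κ : ℝ} (hκ : 0 < κ) :
    |(∫ ω in B, Real.cos (N q ω - N s ω + θ) ∂P)
      - (∫ ω in B, Real.cos (N p ω - N s ω + θ) ∂P) * (1 - (c q - c p) / 2)|
    ≤ 32 * (κ ^ 3 + (∫ ω, (N' q ω - N' p ω) ^ 4 ∂P) / κ)
      + 16 * ∫ ω, ((N q ω - N' q ω) - (N p ω - N' p ω)) ^ 2 ∂P := by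
  set X : Ω → ℝ := fun ω => N p ω - N s ω + θ with hX
  set d : Ω → ℝ := fun ω => N q ω - N p ω with hdef
  have hY : ∀ ω, N q ω - N s ω + θ = X ω + d ω := fun ω => by simp only [hX, hdef]; ring
  simp only [hY]
  have hXm : AEStronglyMeasurable[𝓕 p] X P :=
    (hN.adapted_sub hsp le_rfl).add aestronglyMeasurable_const
  have hcosm := Real.continuous_cos.comp_aestronglyMeasurable hXm
  have hsinm := Real.continuous_sin.comp_aestronglyMeasurable hXm
  have hBp := 𝓕.mono hsp _ hB
  have hd : Integrable d P := hN.integrable_sub p q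
  have hbm : ∀ {f g : Ω → ℝ}, AEStronglyMeasurable[𝓕 p] f P → (∀ ω, |f ω| ≤ 1) → Integrable g P →
      Integrable (fun ω => f ω * g ω) P := fun hf h1 hg =>
    hg.bdd_mul (c := 1) (hf.mono (𝓕.le p)) (.of_forall h1)
  have hcos1 : ∀ ω, |Real.cos (X ω)| ≤ 1 := fun ω => Real.abs_cos_le_one _
  have i1 : Integrable (fun ω => Real.sin (X ω) * d ω) P :=
    hbm hsinm (fun ω => Real.abs_sin_le_one _) hd
  have z1 := (hN.mart p q hpq).mul (𝓕.le p) hd hsinm i1 B hBp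
  have hg := hb.integrable_cond hN hN p q
  have i2 : Integrable (fun ω => Real.cos (X ω) * (d ω * d ω - (C q ω - C p ω))) P :=
    hbm hcosm hcos1 hg
  have z2 := (hb.cond p q hpq).mul (𝓕.le p) hg hcosm i2 B hBp
  have i0 : Integrable (fun ω => Real.cos (X ω)) P := by
    simpa using hbm hcosm hcos1 (integrable_const 1)
  have iq : Integrable (fun ω => Real.cos (X ω + d ω)) P :=
    .of_bound (C := 1) (Real.continuous_cos.comp_aestronglyMeasurable
      ((hXm.mono (𝓕.le p)).add hd.1)) (.of_forall fun ω => Real.abs_cos_le_one _)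
  have i3 : Integrable (fun ω => Real.sin (X ω) * d ω
      + 2⁻¹ * (Real.cos (X ω) * (d ω * d ω - (C q ω - C p ω)))) P := i1.add (i2.const_mul _)
  have i4 : Integrable (fun ω => Real.cos (X ω + d ω)
      - Real.cos (X ω) * (1 - (c q - c p) / 2)) P := iq.sub (i0.mul_const _)
  have e : ∀ ω, cosError (X ω) (d ω)
      = (Real.cos (X ω + d ω) - Real.cos (X ω) * (1 - (c q - c p) / 2))
        + (Real.sin (X ω) * d ω + 2⁻¹ * (Real.cos (X ω) * (d ω * d ω - (C q ω - C p ω)))) :=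
    fun ω => by rw [cosError, hC, hC]; ring
  have hE : ∫ ω in B, cosError (X ω) (d ω) ∂P = (∫ ω in B, Real.cos (X ω + d ω) ∂P)
      - (∫ ω in B, Real.cos (X ω) ∂P) * (1 - (c q - c p) / 2) := by
    simp_rw [e]
    rw [integral_add i4.integrableOn i3.integrableOn,
      integral_add i1.integrableOn (i2.const_mul _).integrableOn, integral_const_mul, z1, z2,
      integral_sub iq.integrableOn (i0.mul_const _).integrableOn, integral_mul_const]
    ring
  rw [← hE]
  have hi4 := h4.integrable_pow_four
  have hi2 := h2.integrable_sq
  have j1 : Integrable (fun ω => κ ^ 3 + (N' q ω - N' p ω) ^ 4 / κ) P :=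
    (integrable_const _).add (hi4.div_const κ)
  calc |∫ ω in B, cosError (X ω) (d ω) ∂P|
      ≤ ∫ ω in B, |cosError (X ω) (d ω)| ∂P := abs_integral_le_integral_abs
    _ ≤ ∫ ω, |cosError (X ω) (d ω)| ∂P := by
        refine setIntegral_le_integral ?_ (.of_forall fun ω => abs_nonneg _)
        exact ((i4.add i3).congr (.of_forall fun ω => (e ω).symm)).abs
    _ ≤ ∫ ω, (32 * (κ ^ 3 + (N' q ω - N' p ω) ^ 4 / κ)
        + 16 * ((N q ω - N' q ω) - (N p ω - N' p ω)) ^ 2) ∂P := by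
        refine integral_mono_of_nonneg (.of_forall fun ω => abs_nonneg _)
          ((j1.const_mul 32).add (hi2.const_mul 16)) (.of_forall fun ω => ?_)
        have := abs_cosError_add_le (X ω) (N' q ω - N' p ω)
          ((N q ω - N' q ω) - (N p ω - N' p ω)) hκ
        rwa [show N' q ω - N' p ω + ((N q ω - N' q ω) - (N p ω - N' p ω)) = d ω by
          simp only [hdef]; ring] at this
    _ = _ := by
        rw [integral_add (j1.const_mul 32) (hi2.const_mul 16), integral_const_mul,
          integral_const_mul, integral_add (integrable_const _) (hi4.div_const κ), integral_div]
        simp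

/-- Solves the recursion approximately: with `x` half the increment of `c`, the factor `1 - x`
differs from `exp(-x)` by at most `x²/2`, and earlier errors are not amplified because `exp(-x) ≤
1`. -/
lemma abs_sub_mul_exp_le {f : ℕ → ℝ} {c : ℕ → ℝ} {e : ℕ → ℝ} (hf : ∀ j, |f j| ≤ 1) {n : ℕ}
    (hc : ∀ j < n, c j ≤ c (j + 1))
    (h : ∀ j < n, |f (j + 1) - f j * (1 - (c (j + 1) - c j) / 2)| ≤ e j) :
    |f n - f 0 * Real.exp (-(c n - c 0) / 2)|
      ≤ ∑ j ∈ Finset.range n, (e j + (c (j + 1) - c j) ^ 2 / 8) := by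
  induction n with
  | zero => simp
  | succ n ih =>
    have ih := ih (fun j hj => hc j (hj.trans n.lt_succ_self))
      (fun j hj => h j (hj.trans n.lt_succ_self))
    have h1 := h n n.lt_succ_self
    set x := (c (n + 1) - c n) / 2 with hx
    have hx0 : 0 ≤ x := by have := hc n n.lt_succ_self; rw [hx]; linarith
    have hexp : |Real.exp (-x) - (1 - x)| ≤ x ^ 2 / 2 := by
      have l1 := Real.add_one_le_exp (-x)
      have l2 : Real.exp (-x) ≤ 1 - x + x ^ 2 / 2 := by
        have h3 := Real.quadratic_le_exp_of_nonneg hx0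
        rw [Real.exp_neg, inv_le_iff_one_le_mul₀ (Real.exp_pos x)]
        nlinarith [pow_nonneg hx0 3, pow_nonneg hx0 4, sq_nonneg (1 - x),
          mul_nonneg (add_nonneg (add_nonneg zero_le_one hx0) (by positivity : 0 ≤ x ^ 2 / 2))
            (by nlinarith [sq_nonneg (1 - x)] : 0 ≤ 1 - x + x ^ 2 / 2)]
      rw [abs_le]; constructor <;> nlinarith [sq_nonneg x]
    have hex1 : Real.exp (-x) ≤ 1 := Real.exp_le_one_iff.2 (by linarith)
    rw [Finset.sum_range_succ]
    have e1 : f (n + 1) - f 0 * Real.exp (-(c (n + 1) - c 0) / 2)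
        = (f (n + 1) - f n * (1 - x)) - f n * (Real.exp (-x) - (1 - x))
          + (f n - f 0 * Real.exp (-(c n - c 0) / 2)) * Real.exp (-x) := by
      rw [show -(c (n + 1) - c 0) / 2 = -(c n - c 0) / 2 + -x by rw [hx]; ring, Real.exp_add]
      ring
    rw [e1]
    have h5 : |f n * (Real.exp (-x) - (1 - x))| ≤ x ^ 2 / 2 := by
      rw [abs_mul]
      exact (mul_le_of_le_one_left (abs_nonneg _) (hf n)).trans hexp
    have h6 : |(f n - f 0 * Real.exp (-(c n - c 0) / 2)) * Real.exp (-x)|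
        ≤ |f n - f 0 * Real.exp (-(c n - c 0) / 2)| := by
      rw [abs_mul, Real.abs_exp]
      exact mul_le_of_le_one_right (abs_nonneg _) hex1
    have h7 := (abs_add_le (f (n + 1) - f n * (1 - x) - f n * (Real.exp (-x) - (1 - x)))
      ((f n - f 0 * Real.exp (-(c n - c 0) / 2)) * Real.exp (-x)))
    have h8 := abs_sub (f (n + 1) - f n * (1 - x)) (f n * (Real.exp (-x) - (1 - x)))
    have h9 : x ^ 2 / 2 = (c (n + 1) - c n) ^ 2 / 8 := by rw [hx]; ring
    linarith

/-- **Lévy's characterization**: if the bracket of `N` is deterministic, then the increments of `N`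
are Gaussian and independent of the past. -/
theorem BracketSystem.setIntegral_cos (h : BracketSystem 𝓕 P Base)
    (h4 : ∀ {N φ}, Base N φ → HasFourthMoments P N) {N φ}
    (hN : Gen 𝓕 (IntClosure 𝓕 P Base) N φ) {c : ℝ≥0 → ℝ}
    (hc : ∀ t ω, timeInt (fun r ω => inner ℝ (φ r ω) (φ r ω)) t ω = c t) {s t : ℝ≥0}
    (hst : s ≤ t) {B : Set Ω} (hB : MeasurableSet[𝓕 s] B) (θ : ℝ) :
    ∫ ω in B, Real.cos (N t ω - N s ω + θ) ∂P
      = P.real B * Real.cos θ * Real.exp (-(c t - c s) / 2) := by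
  have h' := h.intClosure.gen
  have hNm := h'.mart hN
  have hφ := h'.prog hN
  obtain ⟨D, hD⟩ := (hφ.inner hφ).bdd
  obtain ⟨ω₀⟩ : Nonempty Ω := P.nonempty_of_neZero
  have hD0 : 0 ≤ D := (norm_nonneg _).trans (hD 0 ω₀)
  have hcm : Monotone c := fun p q hpq => by
    rw [← hc p ω₀, ← hc q ω₀]
    exact timeInt_le_timeInt (hφ.inner hφ) (fun r ω => real_inner_self_nonneg) hpq ω₀
  have hcD : ∀ p q : ℝ≥0, p ≤ q → |c q - c p| ≤ D * ((q : ℝ) - p) := fun p q hpq => by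
    rw [← hc p ω₀, ← hc q ω₀]
    exact abs_timeInt_sub_le (hφ.inner hφ) hpq ω₀ fun r _ _ => hD r ω₀
  set L : ℝ := (t : ℝ) - s with hL
  have hL0 : 0 ≤ L := sub_nonneg.2 hst
  rcases hL0.eq_or_lt with hL' | hL'
  · have : s = t := le_antisymm hst (by have := hL'.symm; rw [hL, sub_eq_zero] at this; exact this.le)
    subst this
    simp [mul_comm]
  set f : ℝ≥0 → ℝ := fun r => ∫ ω in B, Real.cos (N r ω - N s ω + θ) ∂P with hf
  have hf1 : ∀ r, |f r| ≤ 1 := fun r => by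
    refine (norm_setIntegral_le_of_norm_le_const (C := 1) (measure_lt_top P B)
      (f := fun ω => Real.cos (N r ω - N s ω + θ)) fun ω _ => Real.abs_cos_le_one _).trans ?_
    rw [one_mul]; exact measureReal_le_one
  have hfs : f s = P.real B * Real.cos θ := by simp [hf, mul_comm]
  -- Fourth moments are not known for `N`, so it is replaced by an elementary integral `N'` at
  -- energy distance `δ`; the grid is refined with `N'` fixed, and `δ` tends to zero last.
  have key : ∀ δ > 0, |f t - f s * Real.exp (-(c t - c s) / 2)| ≤ 16 * δ := fun δ hδ => by
    obtain ⟨N', φ', hN', hφ'⟩ := Approximable.of_gen_intClosure h hN t δ hδ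
    obtain ⟨C, hC0, hC⟩ := HasFourthMoments.gen h4 hN'
    have hR : Gen 𝓕 (IntClosure 𝓕 P Base) (fun t ω => N t ω - N' t ω)
      (fun t ω => φ t ω - φ' t ω) := hN.sub (.base (IntClosure.of_gen h hN'))
    have hEt : energy P (fun t ω => φ t ω - φ' t ω) t ≤ δ := by
      refine le_trans (le_of_eq ?_) hφ'
      unfold energy
      simp only [real_inner_self_eq_norm_sq, norm_sub_rev]
    have bound : ∀ m : ℕ, |f t - f s * Real.exp (-(c t - c s) / 2)|
        ≤ L * (32 * (1 + C) * √(L / (m + 1 : ℕ)) + D ^ 2 * (L / (m + 1 : ℕ)) / 8) + 16 * δ :=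
      fun m => by
      set g := grid s t (m + 1) with hg
      have hgm : Monotone g := grid_mono s t (m + 1)
      -- With `κ²` the cell length, the fourth moment error per cell is `32 (1 + C) κ³`, and `L/κ²`
      -- cells contribute `32 (1 + C) L κ`, which tends to zero. The mean square errors telescope to
      -- at most `16 δ`.
      set κ := √(L / (m + 1 : ℕ)) with hκ
      have hq : 0 < L / (m + 1 : ℕ) := by positivity
      have hκ0 : 0 < κ := Real.sqrt_pos.2 hq
      have hκ2 : κ ^ 2 = L / (m + 1 : ℕ) := Real.sq_sqrt hq.le
      have hstep : ∀ j, (g (j + 1) : ℝ) - g j = κ ^ 2 := fun j => by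
        rw [hκ2, hg, coe_grid_succ_sub s t hst]
      have hgt : g (m + 1) = t := grid_last hst (Nat.succ_ne_zero m)
      have hgs : g 0 = s := grid_zero s t _
      have H := abs_sub_mul_exp_le (f := fun j => f (g j)) (c := fun j => c (g j))
        (e := fun j => 32 * (κ ^ 3 + C * (κ ^ 2) ^ 2 / κ)
          + 16 * (energy P (fun t ω => φ t ω - φ' t ω) (g (j + 1))
            - energy P (fun t ω => φ t ω - φ' t ω) (g j)))
        (fun j => hf1 _) (n := m + 1) (fun j _ => hcm (hgm j.le_succ)) fun j _ => by
          have hj := hgm j.le_succ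
          obtain ⟨h4m, h4i⟩ := hC _ _ hj
          refine (abs_setIntegral_cos_sub_le hNm (h'.bracket hN hN) hc (le_grid s t _ j) hj h4m
            ((h'.mart hR).memLp_sub _ _) hB θ hκ0).trans ?_
          rw [h'.integral_sq_sub hR hj]
          rw [hstep] at h4i
          gcongr
      simp only [hgt, hgs] at H
      refine H.trans ?_
      rw [Finset.sum_add_distrib, Finset.sum_add_distrib, ← Finset.mul_sum _ _ (16 : ℝ),
        Finset.sum_range_sub (fun j => energy P (fun t ω => φ t ω - φ' t ω) (g j)), hgt, hgs,
        Finset.sum_const, Finset.card_range, nsmul_eq_mul]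
      have hsq : ∑ j ∈ Finset.range (m + 1), (c (g (j + 1)) - c (g j)) ^ 2 / 8
          ≤ (m + 1 : ℕ) * ((D * κ ^ 2) ^ 2 / 8) := by
        refine (Finset.sum_le_card_nsmul _ _ ((D * κ ^ 2) ^ 2 / 8) fun j _ => ?_).trans_eq
          (by rw [Finset.card_range, nsmul_eq_mul])
        have := hcD _ _ (hgm j.le_succ)
        rw [hstep] at this
        rw [← sq_abs]
        gcongr
      have hE0 := energy_nonneg (P := P) (fun t ω => φ t ω - φ' t ω) s
      have hLm : ((m + 1 : ℕ) : ℝ) * κ ^ 2 = L := by rw [hκ2]; field_simp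
      have e1 : ((m + 1 : ℕ) : ℝ) * (32 * (κ ^ 3 + C * (κ ^ 2) ^ 2 / κ))
          = L * (32 * (1 + C) * κ) := by rw [← hLm]; field_simp
      have e2 : ((m + 1 : ℕ) : ℝ) * ((D * κ ^ 2) ^ 2 / 8) = L * (D ^ 2 * κ ^ 2 / 8) := by
        rw [← hLm]; ring
      rw [← hκ2, e1]
      rw [e2] at hsq
      linarith
    have hlim : Tendsto (fun m : ℕ => L * (32 * (1 + C) * √(L / (m + 1 : ℕ))
        + D ^ 2 * (L / (m + 1 : ℕ)) / 8) + 16 * δ) atTop (𝓝 (16 * δ)) := by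
      have h0 : Tendsto (fun m : ℕ => L / ((m + 1 : ℕ) : ℝ)) atTop (𝓝 0) :=
        (tendsto_const_div_atTop_nhds_zero_nat L).comp (tendsto_add_atTop_nat 1)
      have h1 : Tendsto (fun m : ℕ => √(L / ((m + 1 : ℕ) : ℝ))) atTop (𝓝 0) := by
        simpa using h0.sqrt
      simpa using (((h1.const_mul (32 * (1 + C))).add
        ((h0.const_mul (D ^ 2)).div_const 8)).const_mul L).add_const (16 * δ)
    exact ge_of_tendsto' hlim bound
  have h0 : |f t - f s * Real.exp (-(c t - c s) / 2)| ≤ 0 :=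
    le_of_forall_pos_le_add fun ε hε => by
      have := key (ε / 16) (by positivity); linarith
  rw [abs_nonpos_iff, sub_eq_zero, hfs] at h0
  exact h0

end Levy

/-! ### Isometries from equal Gram matrices -/

section Isometries

variable {L : Type*} [NormedAddCommGroup L] [InnerProductSpace ℝ L] [CompleteSpace L]

/-- Families with equal inner products are related by an isometry. -/
lemma exists_clm_of_inner_eq {κ : Type*} {f : κ → K} {Z : κ → L}
    (h : ∀ i j, inner ℝ (Z i) (Z j) = inner ℝ (f i) (f j))
    (hd : DenseRange (Finsupp.linearCombination ℝ f)) :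
    ∃ W : K →L[ℝ] L, (∀ x, W (Finsupp.linearCombination ℝ f x) = Finsupp.linearCombination ℝ Z x) ∧
      ∀ x y, inner ℝ (W x) (W y) = inner ℝ x y := by
  have hi : ∀ x y, inner ℝ (Finsupp.linearCombination ℝ Z x) (Finsupp.linearCombination ℝ Z y)
      = inner ℝ (Finsupp.linearCombination ℝ f x) (Finsupp.linearCombination ℝ f y) := fun x y => by
    simp only [Finsupp.linearCombination_apply, Finsupp.sum, sum_inner, inner_sum,
      inner_smul_left, inner_smul_right, h]
  have hn : ∀ x, ‖Finsupp.linearCombination ℝ Z x‖ ≤ 1 * ‖Finsupp.linearCombination ℝ f x‖ :=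
    fun x => by rw [one_mul, norm_eq_sqrt_real_inner, norm_eq_sqrt_real_inner, hi]
  have hW := LinearMap.extendOfNorm_eq hd ⟨1, hn⟩
  refine ⟨_, hW, fun x y => ?_⟩
  refine hd.induction_on₂ (p := fun x y => inner ℝ ((Finsupp.linearCombination ℝ Z).extendOfNorm
    (Finsupp.linearCombination ℝ f) x) ((Finsupp.linearCombination ℝ Z).extendOfNorm
    (Finsupp.linearCombination ℝ f) y) = inner ℝ x y)
    (isClosed_eq (by fun_prop) (by fun_prop)) (fun x y => ?_) x y
  rw [hW, hW, hi]

end Isometries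

/-! ### Gaussian laws through cosine transforms -/

section Isonormal

variable [IsProbabilityMeasure P]

/-- The characteristic function of a centred Gaussian variable of variance `v` at one, in real
terms. -/
def CosLaw (P : Measure Ω) (X : Ω → ℝ) (v : ℝ) : Prop :=
  ∀ θ, ∫ ω, Real.cos (X ω + θ) ∂P = Real.cos θ * Real.exp (-v / 2)

lemma integral_cexp_mul_I {X : Ω → ℝ} (hX : AEMeasurable X P) :
    ∫ ω, Complex.exp (X ω * Complex.I) ∂P
      = ((∫ ω, Real.cos (X ω) ∂P : ℝ) : ℂ) + ((∫ ω, Real.sin (X ω) ∂P : ℝ) : ℂ) * Complex.I := by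
  have h1 : Integrable (fun ω => Real.cos (X ω)) P := .of_bound (C := 1)
    (Real.measurable_cos.comp_aemeasurable hX).aestronglyMeasurable
    (.of_forall fun ω => Real.abs_cos_le_one _)
  have h2 : Integrable (fun ω => Real.sin (X ω)) P := .of_bound (C := 1)
    (Real.measurable_sin.comp_aemeasurable hX).aestronglyMeasurable
    (.of_forall fun ω => Real.abs_sin_le_one _)
  have h3 : Integrable (fun ω => ((Real.sin (X ω) : ℝ) : ℂ) * Complex.I) P :=
    h2.ofReal.mul_const _
  have h4 : Integrable (fun ω => ((Real.cos (X ω) : ℝ) : ℂ)) P := h1.ofReal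
  rw [← integral_complex_ofReal, ← integral_complex_ofReal, ← integral_mul_const,
    ← integral_add h4 h3]
  congr 1; ext ω
  rw [Complex.exp_mul_I]; simp

lemma cosLaw_of_map_eq {X : Ω → ℝ} (hX : AEMeasurable X P) {v : ℝ≥0}
    (h : P.map X = gaussianReal 0 v) : CosLaw P X v := fun θ => by
  have h1 : charFun (P.map X) 1 = Complex.exp (-v / 2 : ℝ) := by
    rw [h, charFun_gaussianReal]; congr 1; push_cast; ring
  rw [charFun_apply_real, integral_map hX (by fun_prop)] at h1
  simp only [Complex.ofReal_one, one_mul] at h1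
  rw [integral_cexp_mul_I hX, ← Complex.ofReal_exp] at h1
  have hc := congrArg Complex.re h1
  have hs := congrArg Complex.im h1
  simp only [Complex.add_re, Complex.add_im, Complex.mul_re, Complex.mul_im, Complex.ofReal_re,
    Complex.ofReal_im, Complex.I_re, Complex.I_im, mul_zero, mul_one, add_zero,
    zero_add, sub_self] at hc hs
  simp_rw [Real.cos_add]
  have h1 : Integrable (fun ω => Real.cos (X ω)) P := .of_bound (C := 1)
    (Real.measurable_cos.comp_aemeasurable hX).aestronglyMeasurable
    (.of_forall fun ω => Real.abs_cos_le_one _)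
  have h2 : Integrable (fun ω => Real.sin (X ω)) P := .of_bound (C := 1)
    (Real.measurable_sin.comp_aemeasurable hX).aestronglyMeasurable
    (.of_forall fun ω => Real.abs_sin_le_one _)
  rw [integral_sub (h1.mul_const _) (h2.mul_const _), integral_mul_const, integral_mul_const,
    hc, hs]
  ring

/-- The phases `0` and `-π/2` give the real and imaginary parts of the characteristic function. -/
lemma map_eq_of_cosLaw {X : Ω → ℝ} (hX : AEMeasurable X P) {v : ℝ≥0}
    (h : ∀ u : ℝ, CosLaw P (fun ω => u * X ω) (u ^ 2 * v)) : P.map X = gaussianReal 0 v := by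
  have : IsProbabilityMeasure (P.map X) := Measure.isProbabilityMeasure_map hX
  refine Measure.ext_of_charFun (funext fun t => ?_)
  have hc := h t 0
  have hs := h t (-(Real.pi / 2))
  simp only [add_zero, Real.cos_zero, one_mul, ← sub_eq_add_neg, Real.cos_sub_pi_div_two,
    Real.cos_neg, Real.cos_pi_div_two, zero_mul] at hc hs
  rw [charFun_gaussianReal, charFun_apply_real, integral_map hX (by fun_prop)]
  have e := integral_cexp_mul_I (hX.const_mul t)
  rw [hc, hs] at e
  push_cast at e
  rw [e]
  simp only [zero_mul, add_zero, mul_zero, Complex.ofReal_zero, zero_sub]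
  congr 1; ring

/-- An isometry into `L²` which is Gaussian on a dense set is Gaussian. -/
lemma map_eq_gaussianReal_of_dense {W : K →L[ℝ] Lp ℝ 2 P} {s : Set K} (hs : Dense s)
    (h : ∀ f ∈ s, CosLaw P (W f) (‖f‖ ^ 2)) (f : K) :
    P.map (W f) = gaussianReal 0 (‖f‖₊ ^ 2) := by
  have hall : ∀ f, CosLaw P (W f) (‖f‖ ^ 2) := fun f θ => by
    refine hs.induction (P := fun f => ∫ ω, Real.cos (W f ω + θ) ∂P
      = Real.cos θ * Real.exp (-‖f‖ ^ 2 / 2)) (fun f hf => h f hf θ) (isClosed_eq ?_ ?_) f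
    · have hint : ∀ g : Lp ℝ 2 P, Integrable (fun ω => Real.cos (g ω + θ)) P := fun g =>
        .of_bound (C := 1) (Real.continuous_cos.comp_aestronglyMeasurable
          ((Lp.aestronglyMeasurable g).add aestronglyMeasurable_const))
          (.of_forall fun ω => Real.abs_cos_le_one _)
      -- The cosine transform is Lipschitz on `L²`, so the identity passes from the dense set to its
      -- closure.
      have : LipschitzWith 1 fun g : Lp ℝ 2 P => ∫ ω, Real.cos (g ω + θ) ∂P :=
        LipschitzWith.of_dist_le_mul fun g g' => by
          rw [NNReal.coe_one, one_mul, Real.dist_eq, ← integral_sub (hint g) (hint g')]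
          have hd : MemLp (fun ω => g ω - g' ω) 2 P := (Lp.memLp g).sub (Lp.memLp g')
          calc |∫ ω, (Real.cos (g ω + θ) - Real.cos (g' ω + θ)) ∂P|
              ≤ ∫ ω, |Real.cos (g ω + θ) - Real.cos (g' ω + θ)| ∂P := abs_integral_le_integral_abs
            _ ≤ ∫ ω, |g ω - g' ω| ∂P := by
                refine integral_mono ((hint g).sub (hint g')).abs
                  (hd.integrable (by norm_num)).abs fun ω => ?_
                have := Real.abs_cos_sub_cos_le (g ω + θ) (g' ω + θ)
                simpa using this
            _ ≤ dist g g' := by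
                have h1 := eLpNorm_le_eLpNorm_of_exponent_le (p := 1) (q := 2) (by norm_num) hd.1
                rw [Lp.dist_def]
                refine (integral_norm_eq_lintegral_enorm hd.1).trans_le ?_
                rw [← eLpNorm_one_eq_lintegral_enorm]
                exact ENNReal.toReal_mono hd.2.ne h1
      exact this.continuous.comp W.continuous
    · fun_prop
  refine map_eq_of_cosLaw (Lp.aestronglyMeasurable _).aemeasurable fun u θ => ?_
  have := hall (u • f) θ
  rw [norm_smul, mul_pow, Real.norm_eq_abs, sq_abs] at this
  rw [NNReal.coe_pow, coe_nnnorm, ← this]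
  refine integral_congr_ae ?_
  rw [map_smul]
  filter_upwards [Lp.coeFn_smul u (W f)] with ω hω
  simp [hω]

end Isonormal

/-! ### An isonormal process on the space of Gaussian sequences -/

section AuxiliaryWiener

variable [CompleteSpace H] [SeparableSpace H]

/-- The distribution of a sequence of independent standard Gaussian variables. -/
noncomputable def gaussianSeq : Measure (ℕ → ℝ) := Measure.infinitePi fun _ => gaussianReal 0 1

instance : IsProbabilityMeasure gaussianSeq := by unfold gaussianSeq; infer_instance

lemma memLp_coord (i : ℕ) : MemLp (fun x : ℕ → ℝ => x i) 2 gaussianSeq :=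
  (memLp_id_gaussianReal' (μ := 0) (v := 1) 2 (by norm_num)).comp_measurePreserving
    (measurePreserving_eval_infinitePi (fun _ : ℕ => gaussianReal 0 1) i)

lemma iIndepFun_coord : iIndepFun (fun i (x : ℕ → ℝ) => x i) gaussianSeq :=
  iIndepFun_infinitePi (P := fun _ : ℕ => gaussianReal 0 1) (X := fun _ x => x)
    fun _ => measurable_id

lemma integral_coord (i : ℕ) : ∫ x, x i ∂gaussianSeq = 0 := by
  have hmp := measurePreserving_eval_infinitePi (fun _ : ℕ => gaussianReal 0 1) i
  have := integral_map (μ := gaussianSeq) hmp.measurable.aemeasurable (f := fun y : ℝ => y)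
    (by fun_prop)
  rw [← this]; erw [hmp.map_eq]; simp

lemma integral_coord_mul (i j : ℕ) :
    ∫ x, x i * x j ∂gaussianSeq = if i = j then 1 else 0 := by
  have hmp := fun i => measurePreserving_eval_infinitePi (fun _ : ℕ => gaussianReal 0 1) i
  split_ifs with hij
  · subst hij
    have := integral_map (μ := gaussianSeq) (hmp i).measurable.aemeasurable (f := fun y : ℝ => y * y)
      (by fun_prop)
    rw [← this]; erw [(hmp i).map_eq]
    have hv := variance_fun_id_gaussianReal (μ := 0) (v := 1)
    rw [variance_of_integral_eq_zero (by fun_prop) (by simp)] at hv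
    simpa [sq] using hv
  · rw [(iIndepFun_coord.indepFun hij).integral_fun_mul_eq_mul_integral
      (memLp_coord i).1 (memLp_coord j).1, integral_coord, zero_mul]

lemma hasGaussianLaw_coord_sum (s : Finset ℕ) (c : ℕ → ℝ) :
    HasGaussianLaw (fun x : ℕ → ℝ => ∑ i ∈ s, c i * x i) gaussianSeq := by
  have h1 : ∀ i : s, HasGaussianLaw (fun x : ℕ → ℝ => c i * x i) gaussianSeq := fun i =>
    HasGaussianLaw.fun_smul (c i) (HasLaw.hasGaussianLaw (μ := gaussianReal 0 1)
      (measurePreserving_eval_infinitePi (fun _ : ℕ => gaussianReal 0 1) i).hasLaw)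
  have h2 : iIndepFun (fun (i : s) (x : ℕ → ℝ) => c i * x i) gaussianSeq :=
    (iIndepFun_coord.precomp (g := fun i : s => (i : ℕ)) Subtype.val_injective).comp
      (fun (i : s) y => c i * y) fun i => by fun_prop
  have := h2.hasGaussianLaw_fun_sum h1
  simpa only [Finset.sum_coe_sort s fun i => c i * _] using this

/-- An isonormal Gaussian process on the noise space. -/
lemma exists_isonormal (K : Type*) [NormedAddCommGroup K] [InnerProductSpace ℝ K] [CompleteSpace K]
    [SeparableSpace K] : ∃ W : K →L[ℝ] Lp ℝ 2 gaussianSeq,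
      (∀ f g, inner ℝ (W f) (W g) = inner ℝ f g) ∧
      ∀ f, gaussianSeq.map (W f) = gaussianReal 0 (‖f‖₊ ^ 2) := by
  obtain ⟨e, he, ho⟩ := exists_basis_seq K
  have hn : ∀ i, ‖e i‖ * ‖e i‖ = inner ℝ (e i) (e i) := fun i => (real_inner_self_eq_norm_mul_norm _).symm
  -- The factor `‖e i‖` gives the padding vectors the zero variable, so that both families have the
  -- same Gram matrix.
  set Z : ℕ → Lp ℝ 2 gaussianSeq := fun i => ‖e i‖ • (memLp_coord i).toLp _ with hZ
  have hZi : ∀ i j, inner ℝ (Z i) (Z j) = inner ℝ (e i) (e j) := fun i j => by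
    simp only [hZ, inner_smul_left, inner_smul_right, L2.inner_def]
    have : ∫ a, inner ℝ ((memLp_coord i).toLp _ a) ((memLp_coord j).toLp _ a) ∂gaussianSeq
        = ∫ x, x i * x j ∂gaussianSeq := by
      refine integral_congr_ae ?_
      filter_upwards [(memLp_coord i).coeFn_toLp, (memLp_coord j).coeFn_toLp] with x h1 h2
      rw [h1, h2]; simp [mul_comm]
    rw [this, integral_coord_mul]
    split_ifs with h
    · subst h; simp [hn]
    · simp [ho i j h]
  have hd : DenseRange (Finsupp.linearCombination ℝ e) := fun x => by
    refine mem_closure_of_tendsto (he x) (.of_forall fun s => ?_)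
    have : ∑ i ∈ s, inner ℝ (e i) x • e i ∈ LinearMap.range (Finsupp.linearCombination ℝ e) := by
      rw [Finsupp.range_linearCombination]
      exact Submodule.sum_mem _ fun i _ => Submodule.smul_mem _ _ (Submodule.subset_span ⟨i, rfl⟩)
    exact this
  obtain ⟨W, hW, hWi⟩ := exists_clm_of_inner_eq hZi hd
  refine ⟨W, hWi, map_eq_gaussianReal_of_dense hd ?_⟩
  rintro _ ⟨x, rfl⟩
  have hae : (W (Finsupp.linearCombination ℝ e x) : (ℕ → ℝ) → ℝ) =ᵐ[gaussianSeq]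
      fun y => ∑ i ∈ x.support, (x i * ‖e i‖) * y i := by
    rw [hW, Finsupp.linearCombination_apply, Finsupp.sum]
    have h1 : ∀ i ∈ x.support, ∀ᵐ y ∂gaussianSeq, (x i • Z i : Lp ℝ 2 gaussianSeq) y
        = (x i * ‖e i‖) * y i := fun i _ => by
      simp only [hZ, smul_smul]
      filter_upwards [Lp.coeFn_smul (x i * ‖e i‖) ((memLp_coord i).toLp _),
        (memLp_coord i).coeFn_toLp] with y h1 h2
      rw [h1, Pi.smul_apply, h2, smul_eq_mul]
    filter_upwards [Lp.coeFn_finsetSum x.support (fun i => x i • Z i),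
      (ae_ball_iff x.support.countable_toSet).2 h1] with y h2 h3
    rw [h2, Finset.sum_apply]
    exact Finset.sum_congr rfl h3
  have hG := (hasGaussianLaw_coord_sum x.support fun i => x i * ‖e i‖).congr hae.symm
  set X := W (Finsupp.linearCombination ℝ e x) with hX
  have hmean : ∫ y, X y ∂gaussianSeq = 0 := by
    rw [integral_congr_ae hae, integral_finsetSum _ fun i _ =>
      ((memLp_coord i).integrable (by norm_num)).const_mul _]
    simp [integral_const_mul, integral_coord]
  have hmap := hG.map_eq_gaussianReal
  have hv : Var[X; gaussianSeq] = ‖Finsupp.linearCombination ℝ e x‖ ^ 2 := by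
    rw [variance_of_integral_eq_zero hG.aemeasurable hmean, ← real_inner_self_eq_norm_sq, ← hWi,
      L2.inner_def]
    simp [hX, sq]
  rw [hmean] at hmap
  have := cosLaw_of_map_eq hG.aemeasurable hmap
  rwa [hv, Real.coe_toNNReal _ (by positivity)] at this

end AuxiliaryWiener

/-! ### Joint Gaussianity of isonormal processes -/

section Isonormal

variable [IsProbabilityMeasure P]

/-- An isometry into `L²` whose values are centred Gaussian variables. -/
structure IsIsonormal (P : Measure Ω) (W : K →L[ℝ] Lp ℝ 2 P) : Prop where
  inner : ∀ f g, inner ℝ (W f) (W g) = inner ℝ f g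
  law : ∀ f, P.map (W f) = gaussianReal 0 (‖f‖₊ ^ 2)

namespace IsIsonormal

variable {W : K →L[ℝ] Lp ℝ 2 P}

lemma hasGaussianLaw (h : IsIsonormal P W) (f : K) : HasGaussianLaw (W f : Ω → ℝ) P :=
  HasLaw.hasGaussianLaw (μ := gaussianReal 0 (‖f‖₊ ^ 2))
    ⟨(Lp.aestronglyMeasurable _).aemeasurable, h.law f⟩

lemma integral_eq_zero (h : IsIsonormal P W) (f : K) : ∫ ω, W f ω ∂P = 0 := by
  rw [← integral_map (Lp.aestronglyMeasurable (W f)).aemeasurable (f := fun y : ℝ => y)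
    (by fun_prop), h.law]
  simp

lemma integral_mul (h : IsIsonormal P W) (f g : K) :
    ∫ ω, W f ω * W g ω ∂P = Inner.inner ℝ f g := by
  rw [← h.inner, L2.inner_def]
  congr 1; ext ω; simp [mul_comm]

/-- By linearity of `W`, a linear combination of its values is again a value, and hence Gaussian. -/
lemma isGaussianProcess (h : IsIsonormal P W) {κ : Type*} (f : κ → K) :
    IsGaussianProcess (fun i => (W (f i) : Ω → ℝ)) P where
  hasGaussianLaw I := by
    have hX : AEMeasurable (fun ω => I.restrict fun i => W (f i) ω) P :=
      aemeasurable_pi_lambda _ fun i => (Lp.aestronglyMeasurable (W (f i))).aemeasurable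
    refine ⟨⟨fun L => ?_⟩⟩
    have hL : HasGaussianLaw (fun ω => L (I.restrict fun i => W (f i) ω)) P := by
      classical
      set c : I → ℝ := fun i => L fun j => if i = j then 1 else 0 with hc
      refine (h.hasGaussianLaw (∑ i : I, c i • f i)).congr ?_
      simp only [map_sum, map_smul]
      filter_upwards [Lp.coeFn_finsetSum Finset.univ fun i : I => c i • W (f i),
        ae_all_iff.2 fun i : I => Lp.coeFn_smul (c i) (W (f i))] with ω h1 h2
      rw [h1, Finset.sum_apply]
      refine Eq.trans (Finset.sum_congr rfl fun i _ => ?_)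
        (LinearMap.pi_apply_eq_sum_univ L.toLinearMap _).symm
      rw [h2, Pi.smul_apply, smul_eq_mul, smul_eq_mul, mul_comm]
      rfl
    have hL' : HasGaussianLaw L (P.map fun ω => I.restrict fun i => W (f i) ω) := by
      refine ⟨?_⟩
      rw [AEMeasurable.map_map_of_aemeasurable (by fun_prop) hX]
      exact hL.isGaussian_map
    exact hL'.map_eq_gaussianReal

lemma hasFourthMoments_aux (h : IsIsonormal P W) (f : K) :
    MemLp (W f) 4 P ∧ ∫ ω, W f ω ^ 4 ∂P = ‖f‖ ^ 4 * ∫ x, x ^ 4 ∂(gaussianReal 0 1) := by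
  refine ⟨(h.hasGaussianLaw f).memLp (by norm_num), ?_⟩
  rw [← integral_map (Lp.aestronglyMeasurable (W f)).aemeasurable (f := fun y : ℝ => y ^ 4)
    (by fun_prop), h.law]
  have := gaussianReal_map_const_mul (μ := 0) (v := 1) ‖f‖
  rw [mul_zero, mul_one, show NNReal.mk (‖f‖ ^ 2) (sq_nonneg _) = ‖f‖₊ ^ 2 from rfl] at this
  rw [← this, integral_map (by fun_prop) (by fun_prop), ← integral_const_mul]
  congr 1; ext x; ring

end IsIsonormal

end Isonormal

/-! ### The independent cylindrical Wiener process -/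

section Noise

variable [IsProbabilityMeasure P] [CompleteSpace H]
  {W : Lp H 2 (volume.restrict (Set.Ioi (0 : ℝ))) →L[ℝ] Lp ℝ 2 P}

/-- The filtration generated by `W(t) h`. -/
noncomputable def noiseFiltration (W : Lp H 2 (volume.restrict (Set.Ioi (0 : ℝ))) →L[ℝ] Lp ℝ 2 P) :
    Filtration ℝ≥0 mΩ where
  seq t := ⨆ r ≤ t, ⨆ h, MeasurableSpace.comap (wienerAt W r h) inferInstance
  mono' _ _ hij := biSup_mono fun _ h => le_trans h hij
  le' _ := iSup₂_le fun r _ => iSup_le fun h =>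
    (Lp.stronglyMeasurable (W (stepLp r h))).measurable.comap_le

/-- An increment after `s` is uncorrelated with all `W(r)h'`, `r ≤ s`. The whole family being
jointly Gaussian, it is independent of the σ-algebra that they generate. -/
lemma IsIsonormal.isCylindricalWiener (hW : IsIsonormal P W) :
    IsCylindricalWiener (noiseFiltration W) W where
  gaussian := hW.hasGaussianLaw
  centered := hW.integral_eq_zero
  covariance := hW.integral_mul
  adapted t h := by
    have : Measurable[noiseFiltration W t] (wienerAt W t h) :=
      (comap_measurable (wienerAt W t h)).mono
        ((le_iSup (fun h => MeasurableSpace.comap (wienerAt W t h) _) h).trans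
          (le_iSup₂ (f := fun r (_ : r ≤ t) => ⨆ h, MeasurableSpace.comap (wienerAt W r h) _)
            t le_rfl)) le_rfl
    exact this.stronglyMeasurable.aestronglyMeasurable
  indep_increments s t hst h := by
    set X : {r : ℝ≥0 // r ≤ s} × H → Ω → ℝ := fun p => wienerAt W p.1 p.2 with hX
    set Y : Unit → Ω → ℝ := fun _ ω => wienerAt W t h ω - wienerAt W s h ω with hY
    have hg := (hW.isGaussianProcess (Sum.elim (fun p : {r : ℝ≥0 // r ≤ s} × H => stepLp p.1 p.2)
      (fun _ : Unit => stepLp t h - stepLp s h))).congr (Y := Sum.elim X Y) (by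
        rintro (p | p)
        · exact .rfl
        · exact wienerAt_sub s t h)
    have hXm : ∀ p, Measurable (X p) := fun p => (Lp.stronglyMeasurable (W (stepLp p.1 p.2))).measurable
    have hYm : ∀ p, Measurable (Y p) := fun p =>
      (Lp.stronglyMeasurable (W (stepLp t h))).measurable.sub
        (Lp.stronglyMeasurable (W (stepLp s h))).measurable
    have hind := hg.indepFun_of_covariance_eq_zero (fun p => (hXm p).aemeasurable)
      (fun p => (hYm p).aemeasurable) fun p q => by
        have h1 : ∫ ω, X p ω * Y q ω ∂P
            = ∫ ω, W (stepLp p.1 p.2) ω * W (stepLp t h - stepLp s h) ω ∂P :=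
          integral_congr_ae ((wienerAt_sub (W := W) s t h).mono fun ω hω =>
            congrArg (wienerAt W p.1 p.2 ω * ·) hω.symm)
        have m1 : MemLp (X p) 2 P := Lp.memLp _
        have m2 : MemLp (Y q) 2 P := (Lp.memLp (W (stepLp t h))).sub (Lp.memLp (W (stepLp s h)))
        have h0 : ∫ ω, X p ω ∂P = 0 := hW.integral_eq_zero _
        rw [covariance_eq_sub m1 m2, h0, zero_mul, sub_zero]
        refine h1.trans ((hW.integral_mul _ _).trans ?_)
        rw [inner_sub_right, inner_stepLp, inner_stepLp, min_eq_left (p.1.2.trans hst),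
          min_eq_left p.1.2, sub_self]
    refine indep_of_indep_of_le_left (indep_of_indep_of_le_right
      ((IndepFun_iff_Indep _ _ _).1 hind.symm) ?_) ?_
    · refine iSup₂_le fun r hr => iSup_le fun h' => ?_
      have : wienerAt W r h' = (fun x => x (⟨r, hr⟩, h')) ∘ fun ω p => X p ω := rfl
      rw [this, ← MeasurableSpace.comap_comp]
      exact MeasurableSpace.comap_mono (measurable_pi_apply _).comap_le
    · have : (fun ω => wienerAt W t h ω - wienerAt W s h ω) = (fun x => x ()) ∘ fun ω p => Y p ω := rfl
      rw [this, ← MeasurableSpace.comap_comp]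
      exact MeasurableSpace.comap_mono (measurable_pi_apply _).comap_le

lemma IsIsonormal.hasFourthMoments (hW : IsIsonormal P W) {N φ} (hN : WienerBase W N φ) :
    HasFourthMoments P N := by
  obtain ⟨h, rfl, rfl⟩ := hN
  refine ⟨‖h‖ ^ 4 * ∫ x, x ^ 4 ∂(gaussianReal 0 1), by positivity, fun p q hpq => ?_⟩
  obtain ⟨h1, h2⟩ := hW.hasFourthMoments_aux (stepLp q h - stepLp p h)
  have hae := wienerAt_sub (W := W) p q h
  refine ⟨h1.ae_eq hae, ?_⟩
  have hn : ‖stepLp q h - stepLp p h‖ ^ 2 = ((q : ℝ) - p) * ‖h‖ ^ 2 := by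
    rw [← real_inner_self_eq_norm_sq, inner_sub_left, inner_sub_right, inner_sub_right]
    rw [inner_stepLp, inner_stepLp, inner_stepLp, inner_stepLp, min_self, min_self,
      min_eq_left hpq, min_eq_right hpq, real_inner_self_eq_norm_sq]
    ring
  rw [← integral_congr_ae (hae.mono fun ω hω => congrArg (· ^ 4) hω), h2,
    show ‖stepLp q h - stepLp p h‖ ^ 4 = (‖stepLp q h - stepLp p h‖ ^ 2) ^ 2 by ring, hn]
  exact le_of_eq (by ring)

end Noise

/-! ### Products with an independent filtered space -/

section Product

variable {Ω₁ Ω₂ : Type*} {mΩ₁ : MeasurableSpace Ω₁} {mΩ₂ : MeasurableSpace Ω₂} {P₁ : Measure Ω₁}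
  {P₂ : Measure Ω₂} [IsProbabilityMeasure P₁] [IsProbabilityMeasure P₂] {𝓖₁ : Filtration ℝ≥0 mΩ₁}
  {𝓖₂ : Filtration ℝ≥0 mΩ₂}

/-- The product filtration. -/
def prodFiltration (𝓖₁ : Filtration ℝ≥0 mΩ₁) (𝓖₂ : Filtration ℝ≥0 mΩ₂) :
    Filtration ℝ≥0 (mΩ₁.prod mΩ₂) where
  seq t := (𝓖₁ t).prod (𝓖₂ t)
  mono' _ _ hst := sup_le_sup (MeasurableSpace.comap_mono (𝓖₁.mono hst))
    (MeasurableSpace.comap_mono (𝓖₂.mono hst))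
  le' t := sup_le_sup (MeasurableSpace.comap_mono (𝓖₁.le t)) (MeasurableSpace.comap_mono (𝓖₂.le t))

/-- For a fixed second coordinate the sections of `B` are `𝓖₁ s`-measurable, so the integral over
the first factor vanishes. No adaptedness of `g` is needed, and thus `g` may be an increment after
`s`, as in a mixed bracket. -/
lemma CondZero.prod_left {s : ℝ≥0} {f : Ω₁ → ℝ} {g : Ω₂ → ℝ} (h : CondZero (𝓖₁ s) P₁ f)
    (hf : Integrable f P₁) (hg : Integrable g P₂) :
    CondZero (prodFiltration 𝓖₁ 𝓖₂ s) (P₁.prod P₂) (fun ω => f ω.1 * g ω.2) := fun B hB => by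
  have hle := (prodFiltration 𝓖₁ 𝓖₂).le s
  rw [← integral_indicator (hle _ hB),
    integral_prod_symm _ (((hf.mul_prod hg)).indicator (hle _ hB))]
  refine integral_eq_zero_of_ae (.of_forall fun y => ?_)
  have hy : MeasurableSet[𝓖₁ s] {x | (x, y) ∈ B} :=
    (@measurable_prodMk_right Ω₁ Ω₂ (𝓖₁ s) (𝓖₂ s) y) hB
  have e : ∀ x, B.indicator (fun ω : Ω₁ × Ω₂ => f ω.1 * g ω.2) (x, y)
      = {x | (x, y) ∈ B}.indicator f x * g y := fun x => by
    by_cases hx : (x, y) ∈ B <;> simp [Set.indicator, hx]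
  simp only [e, integral_mul_const, integral_indicator (𝓖₁.le s _ hy), h _ hy, zero_mul, Pi.zero_apply]

lemma CondZero.prod_right {s : ℝ≥0} {f : Ω₁ → ℝ} {g : Ω₂ → ℝ} (h : CondZero (𝓖₂ s) P₂ g)
    (hf : Integrable f P₁) (hg : Integrable g P₂) :
    CondZero (prodFiltration 𝓖₁ 𝓖₂ s) (P₁.prod P₂) (fun ω => f ω.1 * g ω.2) := fun B hB => by
  have hle := (prodFiltration 𝓖₁ 𝓖₂).le s
  rw [← integral_indicator (hle _ hB),
    integral_prod _ (((hf.mul_prod hg)).indicator (hle _ hB))]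
  refine integral_eq_zero_of_ae (.of_forall fun x => ?_)
  have hx : MeasurableSet[𝓖₂ s] {y | (x, y) ∈ B} :=
    (@measurable_prodMk_left Ω₁ Ω₂ (𝓖₁ s) (𝓖₂ s) x) hB
  have e : ∀ y, B.indicator (fun ω : Ω₁ × Ω₂ => f ω.1 * g ω.2) (x, y)
      = f x * {y | (x, y) ∈ B}.indicator g y := fun y => by
    by_cases hx : (x, y) ∈ B <;> simp [Set.indicator, hx]
  simp only [e, integral_const_mul, integral_indicator (𝓖₂.le s _ hx), h _ hx, mul_zero, Pi.zero_apply]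

lemma measurable_fst_prodFiltration (t : ℝ≥0) :
    Measurable[prodFiltration 𝓖₁ 𝓖₂ t, 𝓖₁ t] (Prod.fst : Ω₁ × Ω₂ → Ω₁) :=
  @measurable_fst _ _ (𝓖₁ t) (𝓖₂ t)

lemma measurable_snd_prodFiltration (t : ℝ≥0) :
    Measurable[prodFiltration 𝓖₁ 𝓖₂ t, 𝓖₂ t] (Prod.snd : Ω₁ × Ω₂ → Ω₂) :=
  @measurable_snd _ _ (𝓖₁ t) (𝓖₂ t)

/-- Enlarging a filtered probability space by an independent factor gives an extension. -/
lemma isFilteredExtension_fst :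
    IsFilteredExtension (P₁.prod P₂) (prodFiltration 𝓖₁ 𝓖₂) P₁ 𝓖₁ Prod.fst where
  measurePreserving := measurePreserving_fst
  comap_le t := (measurable_fst_prodFiltration t).comap_le
  condExp_eq t B hB := by
    have hi : Integrable (B.indicator fun _ => (1 : ℝ)) P₁ := (integrable_const 1).indicator hB
    set g := P₁[B.indicator (fun _ => (1 : ℝ)) | 𝓖₁ t] with hg
    have hgi : Integrable g P₁ := integrable_condExp
    have hz : CondZero (𝓖₁ t) P₁ (fun x => g x - B.indicator (fun _ => (1 : ℝ)) x) := fun C hC => by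
      rw [integral_sub hgi.integrableOn hi.integrableOn, setIntegral_condExp (𝓖₁.le t) hi hC,
        sub_self]
    have hz' := hz.prod_left (P₂ := P₂) (𝓖₂ := 𝓖₂) (hgi.sub hi) (integrable_const 1)
    refine (ae_eq_condExp_of_forall_setIntegral_eq ((prodFiltration 𝓖₁ 𝓖₂).le t)
      ((hi.comp_fst P₂)) (fun s _ _ => (hgi.comp_fst P₂).integrableOn) (fun s hs _ => ?_)
      (stronglyMeasurable_condExp.comp_measurable
        (measurable_fst_prodFiltration t)).aestronglyMeasurable).symm
    have := hz' s hs
    simp only [mul_one] at this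
    rw [integral_sub (hgi.comp_fst P₂).integrableOn (hi.comp_fst P₂).integrableOn, sub_eq_zero]
      at this
    exact this

variable {K₁ K₂ : Type*} [NormedAddCommGroup K₁] [InnerProductSpace ℝ K₁] [NormedAddCommGroup K₂]
  [InnerProductSpace ℝ K₂]

/-- The first factor of a Hilbert sum. -/
noncomputable def inlL2 : K₁ →L[ℝ] WithLp 2 (K₁ × K₂) :=
  ((WithLp.prodContinuousLinearEquiv 2 ℝ K₁ K₂).symm : K₁ × K₂ →L[ℝ] _).comp
    (ContinuousLinearMap.inl ℝ K₁ K₂)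

/-- The second factor of a Hilbert sum. -/
noncomputable def inrL2 : K₂ →L[ℝ] WithLp 2 (K₁ × K₂) :=
  ((WithLp.prodContinuousLinearEquiv 2 ℝ K₁ K₂).symm : K₁ × K₂ →L[ℝ] _).comp
    (ContinuousLinearMap.inr ℝ K₁ K₂)

lemma inner_inl_inl (a b : K₁) :
    inner ℝ (inlL2 a : WithLp 2 (K₁ × K₂)) (inlL2 b) = inner ℝ a b := by
  simp [inlL2, WithLp.prod_inner_apply]

lemma inner_inr_inr (a b : K₂) :
    inner ℝ (inrL2 a : WithLp 2 (K₁ × K₂)) (inrL2 b) = inner ℝ a b := by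
  simp [inrL2, WithLp.prod_inner_apply]

lemma inner_inl_inr (a : K₁) (b : K₂) :
    inner ℝ (inlL2 a : WithLp 2 (K₁ × K₂)) (inrL2 b) = 0 := by
  simp [inlL2, inrL2, WithLp.prod_inner_apply]

/-- The martingales of two systems, on the product of the underlying spaces. -/
def ProdBase (B₁ : (ℝ≥0 → Ω₁ → ℝ) → (ℝ≥0 → Ω₁ → K₁) → Prop)
    (B₂ : (ℝ≥0 → Ω₂ → ℝ) → (ℝ≥0 → Ω₂ → K₂) → Prop) (N : ℝ≥0 → Ω₁ × Ω₂ → ℝ)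
    (φ : ℝ≥0 → Ω₁ × Ω₂ → WithLp 2 (K₁ × K₂)) : Prop :=
  (∃ N₁ φ₁, B₁ N₁ φ₁ ∧ N = (fun t ω => N₁ t ω.1) ∧ φ = fun t ω => inlL2 (φ₁ t ω.1)) ∨
    ∃ N₂ φ₂, B₂ N₂ φ₂ ∧ N = (fun t ω => N₂ t ω.2) ∧ φ = fun t ω => inrL2 (φ₂ t ω.2)

lemma IsBoundedProg.clm_comp {Ω : Type*} {mΩ : MeasurableSpace Ω} {𝓕 : Filtration ℝ≥0 mΩ}
    {φ : ℝ≥0 → Ω → K₁} (h : IsBoundedProg 𝓕 φ) {K : Type*} [NormedAddCommGroup K] [NormedSpace ℝ K]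
    (L : K₁ →L[ℝ] K) : IsBoundedProg 𝓕 (fun t ω => L (φ t ω)) where
  prog t := L.continuous.comp_stronglyMeasurable (h.prog t)
  bdd := by
    obtain ⟨C, hC⟩ := h.bdd
    exact ⟨‖L‖ * C, fun t ω => (L.le_opNorm _).trans
      (mul_le_mul_of_nonneg_left (hC t ω) (norm_nonneg _))⟩

lemma L2Mart.comp_of {Ω Ω₀ : Type*} {mΩ : MeasurableSpace Ω} {mΩ₀ : MeasurableSpace Ω₀}
    {Q : Measure Ω} {P : Measure Ω₀} [IsProbabilityMeasure P] {𝓕 : Filtration ℝ≥0 mΩ} {𝓖 : Filtration ℝ≥0 mΩ₀} {π : Ω → Ω₀}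
    (hπ : MeasurePreserving π Q P) (hπt : ∀ t, Measurable[𝓕 t, 𝓖 t] π) {N : ℝ≥0 → Ω₀ → ℝ}
    (hN : L2Mart 𝓖 P N)
    (h : ∀ {s f}, CondZero (𝓖 s) P f → Integrable f P → CondZero (𝓕 s) Q (fun ω => f (π ω))) :
    L2Mart 𝓕 Q (fun t ω => N t (π ω)) where
  memLp t := (hN.memLp t).comp_measurePreserving hπ
  adapted t := ⟨fun ω => (hN.adapted t).mk _ (π ω),
    (hN.adapted t).stronglyMeasurable_mk.comp_measurable (hπt t),
    hπ.quasiMeasurePreserving.ae (hN.adapted t).ae_eq_mk⟩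
  mart s t hst := h (hN.mart s t hst) (hN.integrable_sub s t)

/-- Martingales on different factors are independent and have bracket zero, which the orthogonality
of the two summands of the Hilbert sum records. -/
theorem BracketSystem.prod {B₁ : (ℝ≥0 → Ω₁ → ℝ) → (ℝ≥0 → Ω₁ → K₁) → Prop}
    {B₂ : (ℝ≥0 → Ω₂ → ℝ) → (ℝ≥0 → Ω₂ → K₂) → Prop} (h₁ : BracketSystem 𝓖₁ P₁ B₁)
    (h₂ : BracketSystem 𝓖₂ P₂ B₂) :
    BracketSystem (prodFiltration 𝓖₁ 𝓖₂) (P₁.prod P₂) (ProdBase B₁ B₂) := by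
  have z₁ : ∀ {s : ℝ≥0} {f : Ω₁ → ℝ}, CondZero (𝓖₁ s) P₁ f → Integrable f P₁ →
      CondZero (prodFiltration 𝓖₁ 𝓖₂ s) (P₁.prod P₂) (fun ω => f ω.1) := fun {s f} h hf => by
    simpa only [mul_one] using h.prod_left (P₂ := P₂) (𝓖₂ := 𝓖₂) hf (integrable_const 1)
  have z₂ : ∀ {s : ℝ≥0} {f : Ω₂ → ℝ}, CondZero (𝓖₂ s) P₂ f → Integrable f P₂ →
      CondZero (prodFiltration 𝓖₁ 𝓖₂ s) (P₁.prod P₂) (fun ω => f ω.2) := fun {s f} h hf => by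
    simpa only [one_mul] using h.prod_right (P₁ := P₁) (𝓖₁ := 𝓖₁) (integrable_const 1) hf
  have cross : ∀ {N₁} {φ₁ : ℝ≥0 → Ω₁ → K₁} {N₂} {φ₂ : ℝ≥0 → Ω₂ → K₂}, B₁ N₁ φ₁ → B₂ N₂ φ₂ → BracketPair (prodFiltration 𝓖₁ 𝓖₂)
      (P₁.prod P₂) (fun t ω => N₁ t ω.1) (fun t ω => N₂ t ω.2)
      (timeInt fun r ω => inner ℝ (inlL2 (φ₁ r ω.1) : WithLp 2 (K₁ × K₂)) (inrL2 (φ₂ r ω.2))) :=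
    fun {N₁ φ₁ N₂ φ₂} hN₁ hN₂ => by
      have e : ∀ t ω, timeInt (fun r (ω : Ω₁ × Ω₂) => inner ℝ (inlL2 (φ₁ r ω.1) : WithLp 2 (K₁ × K₂))
          (inrL2 (φ₂ r ω.2))) t ω = 0 := fun t ω =>
        (intervalIntegral.integral_congr fun r _ => inner_inl_inr _ _).trans
          intervalIntegral.integral_zero
      refine ⟨fun t => (integrable_zero _ _ _).congr (.of_forall fun ω => (e t ω).symm),
        fun s t hst => ?_⟩
      simp only [e, sub_zero]
      exact ((h₁.mart hN₁).mart s t hst).prod_left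
        ((h₁.mart hN₁).integrable_sub s t) ((h₂.mart hN₂).integrable_sub s t)
  refine ⟨?_, ?_, ?_⟩
  · rintro N φ (⟨N₁, φ₁, h, rfl, rfl⟩ | ⟨N₂, φ₂, h, rfl, rfl⟩)
    · exact (h₁.mart h).comp_of measurePreserving_fst measurable_fst_prodFiltration z₁
    · exact (h₂.mart h).comp_of measurePreserving_snd measurable_snd_prodFiltration z₂
  · rintro N φ (⟨N₁, φ₁, h, rfl, rfl⟩ | ⟨N₂, φ₂, h, rfl, rfl⟩)
    · exact ((h₁.prog h).comp_map measurable_fst_prodFiltration).clm_comp (inlL2 : K₁ →L[ℝ] WithLp 2 (K₁ × K₂))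
    · exact ((h₂.prog h).comp_map measurable_snd_prodFiltration).clm_comp (inrL2 : K₂ →L[ℝ] WithLp 2 (K₁ × K₂))
  · rintro N φ N' φ' (⟨N₁, φ₁, h, rfl, rfl⟩ | ⟨N₂, φ₂, h, rfl, rfl⟩)
      (⟨N₁', φ₁', h', rfl, rfl⟩ | ⟨N₂', φ₂', h', rfl, rfl⟩)
    · have hb := h₁.bracket h h'
      simp only [inner_inl_inl]
      exact ⟨fun t => (hb.integrable t).comp_fst P₂, fun s t hst => z₁ (hb.cond s t hst)
        (hb.integrable_cond (h₁.mart h) (h₁.mart h') s t)⟩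
    · exact cross h h'
    · have := (cross h' h).symm
      simpa only [real_inner_comm] using this
    · have hb := h₂.bracket h h'
      simp only [inner_inr_inr]
      exact ⟨fun t => (hb.integrable t).comp_snd P₁, fun s t hst => z₂ (hb.cond s t hst)
        (hb.integrable_cond (h₂.mart h) (h₂.mart h') s t)⟩

lemma HasFourthMoments.comp {Ω Ω₀ : Type*} {mΩ : MeasurableSpace Ω} {mΩ₀ : MeasurableSpace Ω₀}
    {Q : Measure Ω} {P : Measure Ω₀} {π : Ω → Ω₀} (hπ : MeasurePreserving π Q P)
    {N : ℝ≥0 → Ω₀ → ℝ} (h : HasFourthMoments P N) : HasFourthMoments Q (fun t ω => N t (π ω)) := by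
  obtain ⟨C, h0, hC⟩ := h
  refine ⟨C, h0, fun p q hpq => ⟨(hC p q hpq).1.comp_measurePreserving hπ, ?_⟩⟩
  have h1 := (hC p q hpq).1.integrable_pow_four.aestronglyMeasurable
  rw [← hπ.map_eq] at h1
  have := integral_map hπ.measurable.aemeasurable h1
  rw [hπ.map_eq] at this
  exact this.symm.trans_le (hC p q hpq).2

lemma HasFourthMoments.prodBase {B₁ : (ℝ≥0 → Ω₁ → ℝ) → (ℝ≥0 → Ω₁ → K₁) → Prop}
    {B₂ : (ℝ≥0 → Ω₂ → ℝ) → (ℝ≥0 → Ω₂ → K₂) → Prop}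
    (h₁ : ∀ {N φ}, B₁ N φ → HasFourthMoments P₁ N) (h₂ : ∀ {N φ}, B₂ N φ → HasFourthMoments P₂ N)
    {N φ} (h : ProdBase B₁ B₂ N φ) : HasFourthMoments (P₁.prod P₂) N := by
  rcases h with ⟨N₁, φ₁, h, rfl, rfl⟩ | ⟨N₂, φ₂, h, rfl, rfl⟩
  · exact (h₁ h).comp measurePreserving_fst
  · exact (h₂ h).comp measurePreserving_snd

end Product

/-! ### Coefficients whose cut-offs are limits of integrands -/

section CutoffApproximable

variable [CompleteSpace H] [SeparableSpace H] [CompleteSpace K] [SeparableSpace K]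

/-- Integrates an elementary process against a family of integrals `M h` whose integrands depend
linearly on `h`. It is applied to multiples of one integrand, to a fixed operator, and to a random
isometry. -/
lemma ElementaryProcess.exists_gen (Φ : ElementaryProcess 𝓕 H) {L : ℝ≥0 → Ω → H →ₗ[ℝ] K}
    {M : H → ℝ≥0 → Ω → ℝ} (hM : ∀ h, Gen 𝓕 Base (M h) (fun r ω => L r ω h)) :
    Gen 𝓕 Base (fun t ω => ∑ i, Φ.ξ i ω * (M (Φ.h i) (min t (Φ.b i)) ω -
      M (Φ.h i) (min t (Φ.a i)) ω)) (fun r ω => L r ω (Φ.eval r ω)) := by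
  have h := Gen.sum (𝓕 := 𝓕) (Base := Base) Finset.univ fun i _ =>
    Gen.transform (Φ.le i) (Φ.measurable i) (Φ.bounded i) (hM (Φ.h i))
  have e : (fun r ω => L r ω (Φ.eval r ω)) = fun r ω => ∑ i,
      (Set.Ioc (Φ.a i) (Φ.b i)).indicator (fun _ => Φ.ξ i ω) r • L r ω (Φ.h i) := by
    funext r ω
    rw [ElementaryProcess.eval, map_sum]
    refine Finset.sum_congr rfl fun i _ => ?_
    by_cases hs : r ∈ Set.Ioc (Φ.a i) (Φ.b i) <;> simp [hs]
  rw [e]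
  exact h

variable [IsProbabilityMeasure P]

lemma Approximable.of_tendsto (hB : BracketSystem 𝓕 P Base) {φ : ℝ≥0 → Ω → K}
    {φk : ℕ → ℝ≥0 → Ω → K} (hk : ∀ k, Approximable 𝓕 P Base (φk k))
    (hkp : ∀ k, IsBoundedProg 𝓕 (φk k)) (hφ : IsBoundedProg 𝓕 φ) {C : ℝ}
    (hC : ∀ k r ω, ‖φk k r ω‖ ≤ C)
    (hlim : ∀ r ω, Tendsto (fun k => φk k r ω) atTop (𝓝 (φ r ω))) :
    Approximable 𝓕 P Base φ := fun T ε hε => by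
  obtain ⟨D, hD⟩ := hφ.bdd
  have := tendsto_energy_of_bounded (P := P) (fun k => (hkp k).sub hφ) (T := T) (C := C + D)
    (fun k r ω _ _ => (norm_sub_le _ _).trans (add_le_add (hC k r ω) (hD r ω)))
    (fun ω => ae_of_all _ fun r _ _ => tendsto_sub_nhds_zero_iff.2 (hlim r.toNNReal ω))
  obtain ⟨k, hk'⟩ := (this.eventually (gt_mem_nhds (show 0 < ε / 4 by positivity))).exists
  obtain ⟨N, φ', hN, hφ'⟩ := hk k T (ε / 4) (by positivity)
  refine ⟨N, φ', hN, ?_⟩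
  have h1 := energy_add_le (P := P) ((hB.gen_prog hN).sub (hkp k)) ((hkp k).sub hφ) T
  simp only [sub_add_sub_cancel] at h1
  linarith

/-- `g` is a coefficient all of whose cut-offs along `Y` are, after applying `L`, limits of
integrands of stochastic integrals. -/
structure CutoffApproximable (𝓕 : Filtration ℝ≥0 mΩ) (P : Measure Ω)
    (Base : (ℝ≥0 → Ω → ℝ) → (ℝ≥0 → Ω → K) → Prop) (L : H →L[ℝ] K) (Y : Ω → C(ℝ≥0, E))
    (g : E → H) : Prop where
  measurable : StronglyMeasurable g
  bdd : BddOnBalls g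
  approx : ∀ R : ℝ, Approximable 𝓕 P Base (fun r ω => L (cutoff R g r (Y ω)))

lemma tendsto_cutoff {g : E → H} (r : ℝ≥0) (x : C(ℝ≥0, E)) :
    Tendsto (fun k : ℕ => cutoff k g r x) atTop (𝓝 (g (x r))) :=
  tendsto_nhds_of_eventually_eq <| ((tendsto_hit x).eventually
    (lt_mem_nhds (WithTop.coe_lt_top r))).mono fun _ hk => if_pos hk

namespace CutoffApproximable

variable {L : H →L[ℝ] K} {Y : Ω → C(ℝ≥0, E)} {g g' : E → H}

lemma isBoundedProg (hY : ∀ t, Measurable[𝓕 t] fun ω => Y ω t) (hm : StronglyMeasurable g)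
    (hb : BddOnBalls g) (R : ℝ) : IsBoundedProg 𝓕 (fun r ω => L (cutoff R g r (Y ω))) :=
  ((isBoundedProg_cutoff hm hb R).comp_map (measurable_pathFiltration_of_eval hY)).clm_comp L

lemma of_tendsto (hB : BracketSystem 𝓕 P Base) (hY : ∀ t, Measurable[𝓕 t] fun ω => Y ω t)
    {gk : ℕ → E → H} (hk : ∀ k, CutoffApproximable 𝓕 P Base L Y (gk k))
    (hb : ∀ R : ℝ, ∃ C : ℝ, ∀ k e, ‖e‖ ≤ R → ‖gk k e‖ ≤ C)
    (hlim : ∀ e, Tendsto (fun k => gk k e) atTop (𝓝 (g e))) :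
    CutoffApproximable 𝓕 P Base L Y g := by
  have hm : StronglyMeasurable g :=
    stronglyMeasurable_of_tendsto atTop (fun k => (hk k).measurable) (tendsto_pi_nhds.2 hlim)
  have hg : BddOnBalls g := fun R => by
    obtain ⟨C, hC⟩ := hb R
    exact ⟨C, fun e he => le_of_tendsto (hlim e).norm (.of_forall fun k => hC k e he)⟩
  refine ⟨hm, hg, fun R => ?_⟩
  obtain ⟨C, hC⟩ := hb R
  refine .of_tendsto hB (fun k => (hk k).approx R)
    (fun k => isBoundedProg hY (hk k).measurable (hk k).bdd R) (isBoundedProg hY hm hg R)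
    (C := ‖L‖ * |C|) (fun k r ω => (L.le_opNorm _).trans
      (mul_le_mul_of_nonneg_left ?_ (norm_nonneg _))) (fun r ω => (L.continuous.tendsto _).comp ?_)
  · unfold cutoff
    split_ifs with h
    · exact (hC k _ (norm_lt_of_lt_hit h).le).trans (le_abs_self C)
    · simp
  · unfold cutoff
    split_ifs with h
    · exact hlim _
    · exact tendsto_const_nhds

lemma add (hB : BracketSystem 𝓕 P Base) (hY : ∀ t, Measurable[𝓕 t] fun ω => Y ω t)
    (h : CutoffApproximable 𝓕 P Base L Y g) (h' : CutoffApproximable 𝓕 P Base L Y g') :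
    CutoffApproximable 𝓕 P Base L Y (fun e => g e + g' e) := by
  refine ⟨h.measurable.add h'.measurable, fun R => ?_, fun R => ?_⟩
  · obtain ⟨C, hC⟩ := h.bdd R
    obtain ⟨D, hD⟩ := h'.bdd R
    exact ⟨C + D, fun e he => (norm_add_le _ _).trans (add_le_add (hC e he) (hD e he))⟩
  · have e : (fun r ω => L (cutoff R (fun e => g e + g' e) r (Y ω))) = fun r ω =>
        L (cutoff R g r (Y ω)) + L (cutoff R g' r (Y ω)) := by
      funext r ω
      unfold cutoff
      split_ifs <;> simp
    rw [e]
    exact (h.approx R).add hB (h'.approx R) (isBoundedProg hY h.measurable h.bdd R)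
      (isBoundedProg hY h'.measurable h'.bdd R)

lemma smul_of_bdd (hB : BracketSystem 𝓕 P Base) (hY : ∀ t, Measurable[𝓕 t] fun ω => Y ω t)
    (h : CutoffApproximable 𝓕 P Base L Y g) {u : E → ℝ} (hu : StronglyMeasurable u)
    (hub : BddOnBalls u) : CutoffApproximable 𝓕 P Base L Y (fun e => u e • g e) := by
  refine ⟨hu.smul h.measurable, fun R => ?_, fun R T ε hε => ?_⟩
  · obtain ⟨C, hC⟩ := hub R
    obtain ⟨D, hD⟩ := h.bdd R
    exact ⟨C * D, fun e he => (norm_smul_le _ _).trans (mul_le_mul (hC e he) (hD e he)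
      (norm_nonneg _) ((norm_nonneg _).trans (hC e he)))⟩
  set c : ℝ≥0 → Ω → ℝ := fun r ω => cutoff R u r (Y ω)
  set ψ : ℝ≥0 → Ω → K := fun r ω => L (cutoff R g r (Y ω))
  have hc : IsBoundedProg 𝓕 c :=
    (isBoundedProg_cutoff hu hub R).comp_map (measurable_pathFiltration_of_eval hY)
  have hψ : IsBoundedProg 𝓕 ψ := isBoundedProg hY h.measurable h.bdd R
  have e : (fun r ω => L (cutoff R (fun e => u e • g e) r (Y ω))) = fun r ω => c r ω • ψ r ω := by
    funext r ω
    simp only [c, ψ, cutoff]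
    split_ifs <;> simp
  obtain ⟨C, hC⟩ := hc.bdd
  -- The order matters: `φ` is chosen first, with accuracy depending on the bound of `u`, and then
  -- `Φ`, with accuracy depending on the bound `D` of `φ`. The error is `(Φ - u) φ + u (φ - ψ)`.
  obtain ⟨N, φ, hN, hφ⟩ := h.approx R T (ε / (4 * (C ^ 2 + 1))) (by positivity)
  have hφp := hB.gen_prog hN
  obtain ⟨D, hD⟩ := hφp.bdd
  obtain ⟨Φ, hΦ⟩ := exists_elementary_energy_cutoff_le (P := P) hY hu hub R T
    (ε := ε / (4 * (D ^ 2 + 1))) (by positivity)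
  have hΦp := Φ.isBoundedProg
  have hgen : Gen 𝓕 Base _ (fun r ω => Φ.eval r ω • φ r ω) :=
    Φ.exists_gen (L := fun r ω => LinearMap.toSpanSingleton ℝ K (φ r ω))
      (M := fun k t ω => k * N t ω) fun k => hN.smul k
  refine ⟨_, _, hgen, ?_⟩
  have h1 := energy_add_le (P := P) ((hΦp.sub hc).smul hφp) (hc.smul (hφp.sub hψ)) T
  have h2 : energy P (fun r ω => (Φ.eval r ω - c r ω) • φ r ω) T ≤ ε / 4 := by
    refine (energy_mono ((hΦp.sub hc).smul hφp) ((hΦp.sub hc).const_smul D)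
      fun r _ ω => ?_).trans ?_
    · rw [norm_smul, norm_smul, mul_comm]
      exact mul_le_mul_of_nonneg_right ((hD r ω).trans (le_abs_self D)) (norm_nonneg _)
    · rw [energy_const_smul]
      rw [← div_div, le_div_iff₀ (by positivity)] at hΦ
      nlinarith [energy_nonneg (P := P) (fun r ω => Φ.eval r ω - c r ω) T]
  have h3 : energy P (fun r ω => c r ω • (φ r ω - ψ r ω)) T ≤ ε / 4 := by
    refine (energy_mono (hc.smul (hφp.sub hψ)) ((hφp.sub hψ).const_smul C)
      fun r _ ω => ?_).trans ?_
    · rw [norm_smul, norm_smul]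
      exact mul_le_mul_of_nonneg_right ((hC r ω).trans (le_abs_self C)) (norm_nonneg _)
    · rw [energy_const_smul]
      rw [← div_div, le_div_iff₀ (by positivity)] at hφ
      nlinarith [energy_nonneg (P := P) (fun r ω => φ r ω - ψ r ω) T]
  rw [show (fun r ω => Φ.eval r ω • φ r ω - L (cutoff R (fun e => u e • g e) r (Y ω)))
    = fun r ω => (Φ.eval r ω - c r ω) • φ r ω + c r ω • (φ r ω - ψ r ω) from by
      funext r ω
      rw [sub_smul, smul_sub, sub_add_sub_cancel]
      exact congrArg (_ - ·) (congrFun (congrFun e r) ω)]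
  linarith

/-- The scalar is truncated at level `k`. In a Gram–Schmidt step it is a multiple of `‖w‖⁻²`, which
is unbounded for small `w`, although its product with `w` is bounded. -/
lemma smul (hB : BracketSystem 𝓕 P Base) (hY : ∀ t, Measurable[𝓕 t] fun ω => Y ω t)
    (h : CutoffApproximable 𝓕 P Base L Y g) {u : E → ℝ} (hu : StronglyMeasurable u)
    (hb : BddOnBalls fun e => u e • g e) :
    CutoffApproximable 𝓕 P Base L Y (fun e => u e • g e) := by
  set uk : ℕ → E → ℝ := fun k e => if |u e| ≤ k then u e else 0 with huk
  have hle : ∀ k e, |uk k e| ≤ k := fun k e => by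
    simp only [huk]
    split_ifs with he
    · exact he
    · simp
  refine of_tendsto hB hY (gk := fun k e => uk k e • g e) (fun k => h.smul_of_bdd hB hY
    (hu.ite (measurableSet_le hu.norm.measurable measurable_const) stronglyMeasurable_zero) fun _ => ⟨k, fun e _ => hle k e⟩)
    (fun R => ?_) fun e => ?_
  · obtain ⟨C, hC⟩ := hb R
    refine ⟨C, fun k e he => le_trans ?_ (hC e he)⟩
    rw [norm_smul, norm_smul]
    exact mul_le_mul_of_nonneg_right (by simp only [huk]; split_ifs <;> simp) (norm_nonneg _)
  · refine tendsto_nhds_of_eventually_eq ?_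
    filter_upwards [eventually_ge_atTop ⌈|u e|⌉₊] with k hk
    rw [huk]; exact congrArg (· • g e) (if_pos (Nat.ceil_le.1 hk))

lemma of_elementary (hB : BracketSystem 𝓕 P Base) (hY : ∀ t, Measurable[𝓕 t] fun ω => Y ω t)
    (hM : ∀ h, ∃ M, Gen 𝓕 Base M (fun _ _ => L h)) (hm : StronglyMeasurable g)
    (hb : BddOnBalls g) : CutoffApproximable 𝓕 P Base L Y g := by
  refine ⟨hm, hb, fun R T ε hε => ?_⟩
  choose M hM using hM
  obtain ⟨Φ, hΦ⟩ := exists_elementary_energy_cutoff_le (P := P) (𝓕 := 𝓕) hY hm hb R T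
    (ε := ε / (‖L‖ ^ 2 + 1)) (by positivity)
  have hd := Φ.isBoundedProg.sub ((isBoundedProg_cutoff hm hb R).comp_map
    (measurable_pathFiltration_of_eval hY))
  refine ⟨_, _, Φ.exists_gen (L := fun _ _ => (L : H →ₗ[ℝ] K)) hM, ?_⟩
  simp only [ContinuousLinearMap.coe_coe, ← map_sub]
  have h1 := energy_mono (P := P) (hd.clm_comp L) (hd.norm.const_smul ‖L‖) (t := T)
    fun r _ ω => by simpa using L.le_opNorm (Φ.eval r ω - cutoff R g r (Y ω))
  rw [energy_const_smul] at h1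
  have h2 : energy P (fun r ω => ‖Φ.eval r ω - cutoff R g r (Y ω)‖) T =
      energy P (fun r ω => Φ.eval r ω - cutoff R g r (Y ω)) T := by
    simp [energy]
  rw [h2] at h1
  rw [le_div_iff₀ (by positivity)] at hΦ
  nlinarith [energy_nonneg (P := P) (fun r ω => Φ.eval r ω - cutoff R g r (Y ω)) T]

/-- For a bounded coefficient the cut-offs at integer radii are uniformly bounded and converge
pointwise, so the cut-off can be removed. -/
lemma approximable (hB : BracketSystem 𝓕 P Base) (hY : ∀ t, Measurable[𝓕 t] fun ω => Y ω t)
    (h : CutoffApproximable 𝓕 P Base L Y g) {C : ℝ} (hC : ∀ e, ‖g e‖ ≤ C) :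
    Approximable 𝓕 P Base (fun r ω => L (g (Y ω r))) ∧
      IsBoundedProg 𝓕 (fun r ω => L (g (Y ω r))) := by
  have hp : IsBoundedProg 𝓕 (fun r ω => L (g (Y ω r))) :=
    IsBoundedProg.clm_comp ⟨(isStronglyProgressive_comp_eval h.measurable).comp_map
      (measurable_pathFiltration_of_eval hY), C, fun _ _ => hC _⟩ L
  refine ⟨.of_tendsto hB (fun k : ℕ => h.approx k)
    (fun k => isBoundedProg hY h.measurable h.bdd k) hp (C := ‖L‖ * |C|) (fun k r ω =>
      (L.le_opNorm _).trans (mul_le_mul_of_nonneg_left ?_ (norm_nonneg _)))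
    fun r ω => (L.continuous.tendsto _).comp (tendsto_cutoff r (Y ω)), hp⟩
  unfold cutoff
  split_ifs
  · exact (hC _).trans (le_abs_self C)
  · simp

end CutoffApproximable

end CutoffApproximable

/-! ### Gram–Schmidt and the splitting isometry -/

section Projections

/-- The span of the first `n` terms of a sequence. -/
def spanBelow (f : ℕ → H) (n : ℕ) : Submodule ℝ H := Submodule.span ℝ (f '' Set.Iio n)

instance (f : ℕ → H) (n : ℕ) : FiniteDimensional ℝ (spanBelow f n) :=
  FiniteDimensional.span_of_finite ℝ ((Set.finite_Iio n).image f)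

lemma monotone_spanBelow (f : ℕ → H) : Monotone (spanBelow f) := fun _ _ h =>
  Submodule.span_mono (Set.image_mono (Set.Iio_subset_Iio h))

lemma mem_spanBelow (f : ℕ → H) {i n : ℕ} (h : i < n) : f i ∈ spanBelow f n :=
  Submodule.subset_span ⟨i, h, rfl⟩

/-- A Gram–Schmidt step: the new direction is the component `w` of `f n` orthogonal to the earlier
span. The convention `0⁻¹ = 0` covers the case that `f n` already belongs to the span. -/
lemma starProjection_spanBelow_succ (f : ℕ → H) (n : ℕ) (h : H) :
    (spanBelow f (n + 1)).starProjection h = (spanBelow f n).starProjection h +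
      ((‖f n - (spanBelow f n).starProjection (f n)‖ ^ 2)⁻¹ *
        inner ℝ (f n - (spanBelow f n).starProjection (f n)) h) •
        (f n - (spanBelow f n).starProjection (f n)) := by
  set U := spanBelow f n
  set w := f n - U.starProjection (f n) with hw
  have hle : U ≤ spanBelow f (n + 1) := monotone_spanBelow f n.le_succ
  have hwU : ∀ v ∈ U, inner ℝ w v = 0 := fun v hv => U.starProjection_inner_eq_zero _ v hv
  refine Submodule.eq_starProjection_of_mem_of_inner_eq_zero (add_mem
    (hle (U.starProjection_apply_mem h)) (Submodule.smul_mem _ _ (sub_mem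
      (mem_spanBelow f n.lt_succ_self) (hle (U.starProjection_apply_mem _))))) ?_
  have hU : ∀ v ∈ U, inner ℝ (h - (U.starProjection h + ((‖w‖ ^ 2)⁻¹ * inner ℝ w h) • w)) v = 0 :=
    fun v hv => by
      rw [← sub_sub, inner_sub_left, U.starProjection_inner_eq_zero h v hv, real_inner_smul_left,
        hwU v hv, mul_zero, sub_zero]
  intro v hv
  refine Submodule.span_induction (p := fun v _ => inner ℝ
    (h - (U.starProjection h + ((‖w‖ ^ 2)⁻¹ * inner ℝ w h) • w)) v = 0) ?_ (by simp)
    (fun x y _ _ hx hy => by rw [inner_add_right, hx, hy, add_zero])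
    (fun a x _ hx => by rw [inner_smul_right, hx, mul_zero]) hv
  rintro _ ⟨i, hi, rfl⟩
  rcases (Nat.lt_succ_iff.1 hi).lt_or_eq with hi | rfl
  · exact hU _ (mem_spanBelow f hi)
  · rw [← sub_add_cancel (f i) (U.starProjection (f i)), ← hw, inner_add_right,
      hU _ (U.starProjection_apply_mem _), add_zero, ← sub_sub, inner_sub_left, inner_sub_left,
      real_inner_smul_left, real_inner_self_eq_norm_sq, real_inner_comm _ (U.starProjection h),
      hwU _ (U.starProjection_apply_mem h), sub_zero, real_inner_comm]
    rcases eq_or_ne w 0 with h0 | h0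
    · simp [h0]
    · field_simp
      ring

lemma norm_inner_smul_le (w h : H) : ‖((‖w‖ ^ 2)⁻¹ * inner ℝ w h) • w‖ ≤ ‖h‖ := by
  rw [norm_smul, norm_mul, norm_inv, norm_pow, norm_norm]
  rcases eq_or_ne w 0 with rfl | h0
  · simp
  · have h1 := norm_pos_iff.2 h0
    calc (‖w‖ ^ 2)⁻¹ * ‖inner ℝ w h‖ * ‖w‖ ≤ (‖w‖ ^ 2)⁻¹ * (‖w‖ * ‖h‖) * ‖w‖ := by
          gcongr
          exact norm_inner_le_norm _ _
      _ = ‖h‖ := by field_simp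

/-- The isometry `h ↦ (p h, h - p h)`, for an orthogonal projection `p`. -/
noncomputable def splitL2 (p : H →L[ℝ] H) : H →L[ℝ] WithLp 2 (H × H) :=
  inlL2.comp p + inrL2.comp (ContinuousLinearMap.id ℝ H - p)

lemma inner_splitL2 (U : Submodule ℝ H) [U.HasOrthogonalProjection] (a b : H) :
    inner ℝ (splitL2 U.starProjection a) (splitL2 U.starProjection b) = inner ℝ a b := by
  have h1 := U.starProjection_inner_eq_zero a _ (U.starProjection_apply_mem b)
  have h2 := U.starProjection_inner_eq_zero b _ (U.starProjection_apply_mem a)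
  rw [real_inner_comm] at h2
  simp only [splitL2, ContinuousLinearMap.add_apply, ContinuousLinearMap.comp_apply,
    ContinuousLinearMap.sub_apply, ContinuousLinearMap.id_apply, inner_add_left, inner_add_right,
    inner_inl_inl, inner_inr_inr, inner_inl_inr, real_inner_comm (inlL2 _) (inrL2 _)]
  simp only [inner_sub_left, inner_sub_right] at *
  linarith

lemma splitL2_of_mem {U : Submodule ℝ H} [U.HasOrthogonalProjection] {a : H} (ha : a ∈ U) :
    splitL2 U.starProjection a = inlL2 a := by
  simp [splitL2, Submodule.starProjection_eq_self_iff.2 ha]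

end Projections

/-! ### The isometry that completes the noise -/

section NoiseCoefficient

variable [CompleteSpace H] [SeparableSpace H]

namespace CutoffApproximable

variable [CompleteSpace K] [SeparableSpace K] [IsProbabilityMeasure P] {L : H →L[ℝ] K}
  {Y : Ω → C(ℝ≥0, E)} {f : ℕ → E → H}

/-- Induction along Gram–Schmidt. The projection of an arbitrary coefficient `g` is a combination of
the vectors `w` with measurable scalars; `g` itself need not be approximable. The induction
hypothesis is used for `g` and for the next vector `f n`. -/
lemma starProjection_spanBelow (hB : BracketSystem 𝓕 P Base)
    (hY : ∀ t, Measurable[𝓕 t] fun ω => Y ω t)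
    (hf : ∀ j, CutoffApproximable 𝓕 P Base L Y (f j)) (n : ℕ) :
    ∀ {g : E → H}, StronglyMeasurable g → BddOnBalls g → CutoffApproximable 𝓕 P Base L Y
      (fun e => (spanBelow (fun j => f j e) n).starProjection (g e)) := by
  induction n with
  | zero =>
    intro g _ _
    have e0 : ∀ e, (spanBelow (fun j => f j e) 0).starProjection (g e) = 0 := fun e =>
      Submodule.eq_starProjection_of_mem_of_inner_eq_zero (zero_mem _) (by
        have : spanBelow (fun j => f j e) 0 = ⊥ := by simp [spanBelow]
        simp [this])
    simp only [e0]
    refine ⟨stronglyMeasurable_zero, fun R => ⟨0, by simp⟩, fun R => ?_⟩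
    have : (fun (r : ℝ≥0) (ω : Ω) => L (cutoff R (fun _ => (0 : H)) r (Y ω))) = fun _ _ => 0 := by
      funext r ω
      rw [cutoff, ite_self, map_zero]
    rw [this]
    exact .of_gen .zero
  | succ n ih =>
    intro g hg hb
    simp only [starProjection_spanBelow_succ]
    have hw : CutoffApproximable 𝓕 P Base L Y
        (fun e => f n e - (spanBelow (fun j => f j e) n).starProjection (f n e)) := by
      have := (hf n).add hB hY ((ih (hf n).measurable (hf n).bdd).smul_of_bdd hB hY
        (u := fun _ => -1) stronglyMeasurable_const fun _ => ⟨1, by simp⟩)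
      simpa only [neg_one_smul, ← sub_eq_add_neg] using this
    refine (ih hg hb).add hB hY (hw.smul hB hY ?_ fun R => ?_)
    · exact ((hw.measurable.norm.pow 2).measurable.inv.stronglyMeasurable).mul
        (hw.measurable.inner hg)
    · obtain ⟨C, hC⟩ := hb R
      exact ⟨C, fun e he => (norm_inner_smul_le _ _).trans (hC e he)⟩

lemma starProjection_closure (hB : BracketSystem 𝓕 P Base)
    (hY : ∀ t, Measurable[𝓕 t] fun ω => Y ω t)
    (hf : ∀ j, CutoffApproximable 𝓕 P Base L Y (f j)) (h : H) :
    CutoffApproximable 𝓕 P Base L Y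
      (fun e => (⨆ n, spanBelow (fun j => f j e) n).topologicalClosure.starProjection h) :=
  of_tendsto hB hY (fun n => starProjection_spanBelow hB hY hf n stronglyMeasurable_const
    fun _ => ⟨‖h‖, fun _ _ => le_rfl⟩)
    (fun _ => ⟨‖h‖, fun _ _ _ => Submodule.norm_starProjection_apply_le _ _⟩)
    fun _ => Submodule.starProjection_tendsto_closure_iSup _ (monotone_spanBelow _) h

end CutoffApproximable

variable [SeparableSpace X]

/-- A countable family of elements of `D(A*)` with the same annihilator as `D(A*)`. -/
lemma exists_adjoint_seq (A : X →ₗ.[ℝ] X) : ∃ d b : ℕ → StrongDual ℝ X,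
    (∀ j, IsAdjointPair A (d j) (b j)) ∧
      ∀ xs ys, IsAdjointPair A xs ys → ∀ y, (∀ j, d j y = 0) → xs y = 0 := by
  have : SecondCountableTopology X := UniformSpace.secondCountable_of_separable X
  -- By the Lindelöf property, countably many of the open sets on which some functional from `D(A*)`
  -- does not vanish cover their union.
  obtain ⟨T, hT, hU⟩ := TopologicalSpace.isOpen_iUnion_countable
    (fun p : {p : StrongDual ℝ X × StrongDual ℝ X // IsAdjointPair A p.1 p.2} =>
      {y | p.1.1 y ≠ 0}) fun p => isOpen_ne_fun p.1.1.continuous continuous_const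
  have hz : IsAdjointPair A 0 0 := fun _ => rfl
  obtain ⟨s, hs⟩ := ((hT.insert ⟨(0, 0), hz⟩).exists_eq_range (Set.insert_nonempty _ _))
  refine ⟨fun j => (s j).1.1, fun j => (s j).1.2, fun j => (s j).2, fun xs ys hp y hy => ?_⟩
  by_contra hne
  have : y ∈ ⋃ p : {p : StrongDual ℝ X × StrongDual ℝ X // IsAdjointPair A p.1 p.2},
      {y | p.1.1 y ≠ 0} := Set.mem_iUnion.2 ⟨⟨(xs, ys), hp⟩, hne⟩
  rw [← hU] at this
  obtain ⟨p, hpT, hpy⟩ := Set.mem_iUnion₂.1 this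
  obtain ⟨j, rfl⟩ : p ∈ Set.range s := hs ▸ Set.mem_insert_of_mem _ hpT
  exact hpy (hy j)

variable {Ω' : Type*} {mΩ' : MeasurableSpace Ω'} {P' : Measure Ω'} [IsProbabilityMeasure P']
  {𝓖 : Filtration ℝ≥0 mΩ'} {B' : (ℝ≥0 → Ω' → ℝ) → (ℝ≥0 → Ω' → H) → Prop} {P : Measure C(ℝ≥0, E)}
  [IsProbabilityMeasure P]

/-- There are isometries `T e`, depending measurably on `e`, which take the dispersion
coefficients into the first summand, and for which `T` is integrable with respect to the martingales
of the local martingale problem together with an independent noise. -/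
theorem IsSolutionMeasure.exists_isometry (hyp : IsAdmissibleCoefficients ι A F G)
    (hsol : IsSolutionMeasure ι A F G P) (h' : BracketSystem 𝓖 P' B')
    (hc : ∀ h, ∃ M, B' M (fun _ _ => h)) : ∃ T : E → H →L[ℝ] WithLp 2 (H × H),
      (∀ e a b, inner ℝ (T e a) (T e b) = inner ℝ a b) ∧
      (∀ e xs ys, IsAdjointPair A xs ys → T e (disp G xs e) = inlL2 (disp G xs e)) ∧
      ∀ h, Approximable (prodFiltration (pathFiltration E) 𝓖) (P.prod P')
          (ProdBase (PathBase ι A F G) B') (fun r ω => T (ω.1 r) h) ∧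
        IsBoundedProg (prodFiltration (pathFiltration E) 𝓖) (fun r ω => T (ω.1 r) h) := by
  have hB := (hsol.bracketSystem hyp).prod h'
  obtain ⟨d, b, hd, hann⟩ := exists_adjoint_seq A
  have hY : ∀ t, Measurable[prodFiltration (pathFiltration E) 𝓖 t]
      fun ω : C(ℝ≥0, E) × Ω' => ω.1 t := fun t =>
    ((isStronglyProgressive_comp_eval (E := E) stronglyMeasurable_id).stronglyAdapted t).measurable.comp
      (measurable_fst_prodFiltration t)
  -- Built from the countable family only, so that the projection depends measurably on `e`; below
  -- it is seen to contain `G(e)* x*` for every `x*` in `D(A*)`.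
  let V : E → Submodule ℝ H := fun e =>
    (⨆ n, spanBelow (fun j => disp G (d j) e) n).topologicalClosure
  have hV : ∀ e (h : H), CompleteSpace (V e) := fun e _ =>
    (Submodule.isClosed_topologicalClosure _).completeSpace_coe
  have hdV : ∀ e j, disp G (d j) e ∈ V e := fun e j => Submodule.le_topologicalClosure _
    (Submodule.mem_iSup_of_mem (j + 1) (mem_spanBelow (fun j => disp G (d j) e) j.lt_succ_self))
  have hf : ∀ j, CutoffApproximable (prodFiltration (pathFiltration E) 𝓖) (P.prod P')
      (ProdBase (PathBase ι A F G) B') inlL2 Prod.fst (disp G (d j)) := fun j =>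
    ⟨hyp.stronglyMeasurable_disp _, hyp.bddOnBalls_disp _, fun R =>
      .of_gen (.base (.inl ⟨_, _, ⟨R, d j, b j, hd j, rfl, rfl⟩, rfl, rfl⟩))⟩
  have h1 := fun h => CutoffApproximable.starProjection_closure hB hY hf h
  refine ⟨fun e => splitL2 (V e).starProjection, fun e a b => inner_splitL2 _ a b,
    fun e xs ys hp => splitL2_of_mem ?_, fun h => ?_⟩
  · rw [← Submodule.starProjection_eq_self_iff, ← sub_eq_zero, ← neg_eq_zero, neg_sub]
    -- Let `a` be the component of `G(e)* x*` orthogonal to `V e`. Then all `d j` annihilate `G(e)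
    -- a`, hence so does `x*`, that is, `a` is orthogonal to `G(e)* x*` as well, and therefore to
    -- itself.
    set a := disp G xs e - (V e).starProjection (disp G xs e) with ha
    have ho : ∀ v ∈ V e, inner ℝ a v = 0 := fun v hv => (V e).starProjection_inner_eq_zero _ v hv
    have h0 : inner ℝ (disp G xs e) a = 0 := by
      rw [inner_disp]
      refine hann xs ys hp _ fun j => ?_
      rw [← inner_disp, real_inner_comm]
      exact ho _ (hdV e j)
    have h2 := ho _ ((V e).starProjection_apply_mem (disp G xs e))
    rw [← inner_self_eq_zero (𝕜 := ℝ)]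
    conv_lhs => rw [ha]
    rw [← ha, inner_sub_left, h0, real_inner_comm, h2, sub_zero]
  -- The complementary component is integrated against the auxiliary noise, where all constants are
  -- admissible integrands. The component in `V e` was obtained from the coordinate martingales.
  · have h2 : CutoffApproximable (prodFiltration (pathFiltration E) 𝓖) (P.prod P')
        (ProdBase (PathBase ι A F G) B') inrL2 Prod.fst
        (fun e => h - (V e).starProjection h) := by
      refine .of_elementary hB hY (fun k => ?_) (stronglyMeasurable_const.sub (h1 h).measurable)
        fun R => ⟨‖h‖ + ‖h‖, fun e _ => (norm_sub_le _ _).trans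
          (add_le_add_right (Submodule.norm_starProjection_apply_le _ _) _)⟩
      obtain ⟨M, hM⟩ := hc k
      exact ⟨_, .base (.inr ⟨M, _, hM, rfl, rfl⟩)⟩
    have h3 := (h1 h).approximable hB hY fun e => Submodule.norm_starProjection_apply_le _ h
    have h4 := h2.approximable hB hY (C := ‖h‖ + ‖h‖) fun e => (norm_sub_le _ _).trans
      (add_le_add_right (Submodule.norm_starProjection_apply_le _ _) _)
    exact ⟨h3.1.add hB h4.1 h3.2 h4.2, h3.2.add h4.2⟩

end NoiseCoefficient

/-! ### Density of step functions in `L²(0,∞; H)` -/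

section StepDensity

variable [CompleteSpace H]

/-- Step functions are dense in `L²(0,∞; H)`. -/
lemma denseRange_stepLp : DenseRange (Finsupp.linearCombination ℝ
    fun i : ℝ≥0 × H => (stepLp i.1 i.2 : Lp H 2 (volume.restrict (Set.Ioi (0 : ℝ))))) := by
  have hr : Set.range (Finsupp.linearCombination ℝ
      fun i : ℝ≥0 × H => (stepLp i.1 i.2 : Lp H 2 (volume.restrict (Set.Ioi (0 : ℝ))))) =
      (Submodule.span ℝ (Set.range fun i : ℝ≥0 × H => stepLp i.1 i.2) : Set _) := by
    rw [← Finsupp.range_linearCombination]; rfl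
  rw [DenseRange, hr, Submodule.dense_iff_topologicalClosure_eq_top,
    Submodule.topologicalClosure_eq_top_iff, Submodule.eq_bot_iff]
  intro g hg
  -- A function orthogonal to all step functions has vanishing primitive, and by Lebesgue
  -- differentiation it is zero almost everywhere.
  have h0 : ∀ t : ℝ≥0, ∫ x in (0 : ℝ)..t, g x = 0 := fun t => by
    have h1 : ∀ h : H, inner ℝ h (∫ x in Set.Ioc (0 : ℝ) t, g x) = 0 := fun h => by
      have := hg _ (Submodule.subset_span ⟨(t, h), rfl⟩)
      simp only [stepLp] at this
      rw [L2.inner_indicatorConstLp_eq_inner_setIntegral,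
        Measure.restrict_restrict measurableSet_Ioc,
        Set.inter_eq_left.2 Set.Ioc_subset_Ioi_self] at this
      exact this
    rw [intervalIntegral.integral_of_le (NNReal.coe_nonneg t), ← inner_self_eq_zero (𝕜 := ℝ)]
    exact h1 _
  have hint : ∀ n : ℕ, IntervalIntegrable (g : ℝ → H) volume 0 n := fun n => by
    rw [intervalIntegrable_iff_integrableOn_Ioc_of_le n.cast_nonneg]
    have := integrableOn_Lp_of_measure_ne_top g (s := Set.Ioc (0 : ℝ) n) fact_one_le_two_ennreal.elim
      (((Measure.restrict_apply_le _ _).trans_lt measure_Ioc_lt_top).ne)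
    rwa [IntegrableOn, Measure.restrict_restrict measurableSet_Ioc,
      Set.inter_eq_left.2 Set.Ioc_subset_Ioi_self] at this
  refine (Lp.eq_zero_iff_ae_eq_zero).2 ((ae_restrict_iff' measurableSet_Ioi).2 ?_)
  filter_upwards [ae_all_iff.2 fun n : ℕ => (hint n).ae_hasDerivAt_integral] with x hx hx0
  have hx0' : 0 < x := hx0
  obtain ⟨n, hn⟩ := exists_nat_ge x
  have hd := hx n (by rw [Set.uIcc_of_le n.cast_nonneg]; exact ⟨hx0'.le, hn⟩) 0 Set.left_mem_uIcc
  refine hd.unique ((hasDerivAt_const x (0 : H)).congr_of_eventuallyEq ?_)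
  filter_upwards [lt_mem_nhds hx0'] with y hy
  exact h0 ⟨y, hy.le⟩

end StepDensity

/-! ### From processes with brackets `t ⟪h, h'⟫` to a cylindrical Wiener process -/

section NoiseConstruction

variable [IsProbabilityMeasure P]

lemma timeInt_const {Ω : Type*} (k : ℝ) (t : ℝ≥0) (ω : Ω) : timeInt (fun _ _ => k) t ω = t * k := by
  simp [timeInt]

lemma BracketSystem.integral_mul_of_const (h : BracketSystem 𝓕 P Base) {N N' φ φ'}
    (hN : Base N φ) (hN' : Base N' φ') (h0 : ∀ᵐ ω ∂P, N 0 ω = 0) {k : ℝ}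
    (hk : ∀ r ω, inner ℝ (φ r ω) (φ' r ω) = k) {s t : ℝ≥0} (hst : s ≤ t) :
    ∫ ω, N s ω * N' t ω ∂P = s * k := by
  have hm := h.mart hN
  have hm' := h.mart hN'
  have h1 := (hm'.condZero_mul_future hst (hm.memLp s) (hm.adapted s)) Set.univ .univ
  have h2 := (h.bracket hN hN').cond 0 s zero_le Set.univ .univ
  have i1 : Integrable (fun ω => N s ω * (N' t ω - N' s ω)) P :=
    (hm.memLp s).integrable_mul (hm'.memLp_sub s t)
  have i2 : Integrable (fun ω => N s ω * N' s ω) P := (hm.memLp s).integrable_mul (hm'.memLp s)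
  have i3 : Integrable (fun ω => N' 0 ω * N s ω) P := (hm'.memLp 0).integrable_mul (hm.memLp s)
  have i23 : Integrable (fun ω => N s ω * N' s ω - N' 0 ω * N s ω) P := i2.sub i3
  have h4 := (hm.condZero_mul_future (zero_le : 0 ≤ s) (hm'.memLp 0) (hm'.adapted 0))
    Set.univ .univ
  simp only [hk, Measure.restrict_univ, timeInt_const] at h1 h2 h4
  have e4 : ∫ ω, N' 0 ω * (N s ω - N 0 ω) ∂P = ∫ ω, N' 0 ω * N s ω ∂P :=
    integral_congr_ae (h0.mono fun ω hω => by simp [hω])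
  have e2 : ∫ ω, ((N s ω - N 0 ω) * (N' s ω - N' 0 ω) - (s * k - (0 : ℝ≥0) * k)) ∂P =
      ∫ ω, ((N s ω * N' s ω - N' 0 ω * N s ω) - s * k) ∂P :=
    integral_congr_ae (h0.mono fun ω hω => by simp only [hω, NNReal.coe_zero]; ring)
  rw [e4] at h4
  rw [e2, integral_sub i23 (integrable_const _), integral_sub i2 i3, h4] at h2
  have e1 : ∀ ω, N s ω * N' t ω = N s ω * (N' t ω - N' s ω) + N s ω * N' s ω := fun ω => by ring
  simp only [e1]
  rw [integral_add i1 i2, h1]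
  simp only [integral_const, probReal_univ, smul_eq_mul] at h2
  linarith

/-- Conditioned on any event of `𝓕 s` of positive probability, `X` has the same Gaussian law as
without conditioning, which is independence. -/
lemma indep_of_setIntegral_cos {s : ℝ≥0} {X : Ω → ℝ}
    (hX : AEMeasurable X P) {v : ℝ≥0} (h : ∀ B, MeasurableSet[𝓕 s] B → ∀ u θ : ℝ,
      ∫ ω in B, Real.cos (u * X ω + θ) ∂P = P.real B * Real.cos θ * Real.exp (-(u ^ 2 * v) / 2)) :
    ∀ C, MeasurableSet C → ∀ B, MeasurableSet[𝓕 s] B → P (X ⁻¹' C ∩ B) = P (X ⁻¹' C) * P B := by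
  have h1 : ∀ B, MeasurableSet[𝓕 s] B → P B ≠ 0 → P[|B].map X = gaussianReal 0 v := fun B hB h0 => by
    have := cond_isProbabilityMeasure h0
    refine map_eq_of_cosLaw (hX.mono_ac cond_absolutelyContinuous) fun u θ => ?_
    rw [ProbabilityTheory.cond, integral_smul_measure, h B hB u θ, ENNReal.toReal_inv, smul_eq_mul,
      ← mul_assoc, ← mul_assoc, ← Measure.real, inv_mul_cancel₀, one_mul]
    exact (measureReal_ne_zero_iff).2 h0
  intro C hC B hB
  rcases eq_or_ne (P B) 0 with h0 | h0
  · rw [h0, mul_zero]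
    exact measure_mono_null Set.inter_subset_right h0
  have h2 := (h1 B hB h0).trans (h1 Set.univ .univ (by simp)).symm
  rw [cond_univ] at h2
  have h3 : P[|B].map X C = P.map X C := by rw [h2]
  rw [Measure.map_apply_of_aemeasurable (hX.mono_ac cond_absolutelyContinuous) hC,
    Measure.map_apply_of_aemeasurable hX hC, cond_apply (𝓕.le s _ hB)] at h3
  rw [← h3, mul_comm, ← mul_assoc, ENNReal.mul_inv_cancel h0 (measure_ne_top _ _), one_mul,
    Set.inter_comm]

variable [CompleteSpace H]

/-- Lévy's characterization of cylindrical Wiener processes. -/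
theorem BracketSystem.exists_isCylindricalWiener (h : BracketSystem 𝓕 P Base)
    (h4 : ∀ {N φ}, Base N φ → HasFourthMoments P N) {M : H → ℝ≥0 → Ω → ℝ}
    {ψ : H → ℝ≥0 → Ω → K} (hM : ∀ k, IntClosure 𝓕 P Base (M k) (ψ k))
    (hM0 : ∀ k, ∀ᵐ ω ∂P, M k 0 ω = 0)
    (hψ : ∀ k k' r ω, inner ℝ (ψ k r ω) (ψ k' r ω) = inner ℝ k k') :
    ∃ W : Lp H 2 (volume.restrict (Set.Ioi (0 : ℝ))) →L[ℝ] Lp ℝ 2 P,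
      IsCylindricalWiener 𝓕 W ∧ ∀ t k, ∀ᵐ ω ∂P, wienerAt W t k ω = M k t ω := by
  have hC := h.intClosure
  have hmart := fun k => hC.mart (hM k)
  -- The map from `1_{(0,t]} ⊗ k` to the class of `M k t` preserves inner products and therefore
  -- extends to an isometry `W` on `L²(0,∞; H)`.
  set Z : ℝ≥0 × H → Lp ℝ 2 P := fun i => ((hmart i.2).memLp i.1).toLp (M i.2 i.1)
  have hZ : ∀ i, ∀ᵐ ω ∂P, (Z i : Ω → ℝ) ω = M i.2 i.1 ω := fun i =>
    ((hmart i.2).memLp i.1).coeFn_toLp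
  have hle : ∀ i j, i.1 ≤ j.1 → inner ℝ (Z i) (Z j) = inner ℝ (stepLp i.1 i.2) (stepLp j.1 j.2) :=
    fun i j hij => by
    rw [L2.inner_def, inner_stepLp, min_eq_left hij,
      ← hC.integral_mul_of_const (hM i.2) (hM j.2) (hM0 i.2) (hψ i.2 j.2) hij]
    refine integral_congr_ae ?_
    filter_upwards [hZ i, hZ j] with ω h1 h2
    rw [h1, h2, real_inner_eq_re_inner]
    simp [mul_comm]
  obtain ⟨W, hW, hWi⟩ := exists_clm_of_inner_eq (f := fun i : ℝ≥0 × H => stepLp i.1 i.2) (Z := Z)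
    (fun i j => (le_total i.1 j.1).elim (hle i j) fun hij => by
      rw [real_inner_comm, hle j i hij, real_inner_comm]) denseRange_stepLp
  have hWM : ∀ t k, ∀ᵐ ω ∂P, wienerAt W t k ω = M k t ω := fun t k => by
    have := hW (Finsupp.single (t, k) 1)
    simp only [Finsupp.linearCombination_single, one_smul] at this
    rw [wienerAt_eq, this]
    exact hZ (t, k)
  have hiso : IsIsonormal P W := by
    refine ⟨hWi, map_eq_gaussianReal_of_dense denseRange_stepLp ?_⟩
    rintro _ ⟨x, rfl⟩ θ
    -- The image of a step function is the value at a late time `T` of a single stochastic integral.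
    -- Its bracket is deterministic because `⟪ψ k, ψ k'⟫ = ⟪k, k'⟫`, so Lévy's characterization
    -- gives its Gaussian law.
    set N : ℝ≥0 → Ω → ℝ := fun t ω => ∑ i ∈ x.support,
      x i * transform (fun _ => 1) 0 i.1 (M i.2) t ω
    set φ : ℝ≥0 → Ω → K := fun r ω => ∑ i ∈ x.support,
      x i • (Set.Ioc 0 i.1).indicator (fun _ => (1 : ℝ)) r • ψ i.2 r ω
    have hN : Gen 𝓕 (IntClosure 𝓕 P Base) N φ := Gen.sum _ fun i _ =>
      .smul _ (.transform zero_le stronglyMeasurable_const ⟨1, by simp⟩ (.base (hM i.2)))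
    set c : ℝ≥0 → ℝ := fun t => timeInt (fun r _ => ∑ i ∈ x.support,
      x i * ((Set.Ioc 0 i.1).indicator (fun _ => (1 : ℝ)) r * ∑ j ∈ x.support,
        x j * ((Set.Ioc 0 j.1).indicator (fun _ => (1 : ℝ)) r * inner ℝ j.2 i.2))) t ()
    have hc : ∀ t ω, timeInt (fun r ω => inner ℝ (φ r ω) (φ r ω)) t ω = c t := fun t ω => by
      simp only [c, timeInt, φ, sum_inner, inner_sum, real_inner_smul_left, inner_smul_right, hψ]
    obtain ⟨T, hT⟩ : ∃ T : ℝ≥0, ∀ i ∈ x.support, i.1 ≤ T :=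
      ⟨x.support.sup Prod.fst, fun i hi => Finset.le_sup (f := Prod.fst) hi⟩
    have hN0 : ∀ ω, N 0 ω = 0 := fun ω => by simp [N, transform]
    have hNW : ∀ᵐ ω ∂P, (W (Finsupp.linearCombination ℝ (fun i : ℝ≥0 × H => stepLp i.1 i.2) x) :
        Ω → ℝ) ω = N T ω := by
      rw [hW, Finsupp.linearCombination_apply, Finsupp.sum]
      filter_upwards [Lp.coeFn_finsetSum x.support (fun i => x i • Z i),
        (ae_ball_iff x.support.countable_toSet).2 fun i _ => Lp.coeFn_smul (x i) (Z i),
        (ae_ball_iff x.support.countable_toSet).2 fun i _ => hZ i,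
        (ae_ball_iff x.support.countable_toSet).2 fun i _ => hM0 i.2] with ω h1 h2 h3 h5
      rw [h1, Finset.sum_apply]
      refine Finset.sum_congr rfl fun i hi => ?_
      rw [h2 i hi, Pi.smul_apply, h3 i hi, smul_eq_mul, transform, min_eq_right (hT i hi),
        min_eq_right zero_le, h5 i hi]
      ring
    have hc0 : c 0 = 0 := timeInt_zero _ _
    have hcT : c T = ‖Finsupp.linearCombination ℝ (fun i : ℝ≥0 × H => stepLp i.1 i.2) x‖ ^ 2 := by
      have h1 := hC.gen.integral_sq hN T
      simp only [energy, hc, integral_const, probReal_univ, one_smul, hN0, sub_zero] at h1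
      rw [← real_inner_self_eq_norm_sq, ← hWi, L2.inner_def, ← h1]
      refine integral_congr_ae (hNW.mono fun ω hω => ?_)
      simp only [hω, real_inner_self_eq_norm_sq, Real.norm_eq_abs, sq_abs]
    have h5 := h.setIntegral_cos h4 hN hc (zero_le : 0 ≤ T) .univ θ
    simp only [Measure.restrict_univ, probReal_univ, one_mul, hN0, sub_zero, hc0, hcT] at h5
    rw [← h5]
    exact integral_congr_ae (hNW.mono fun ω hω => by simp only [hω])
  refine ⟨W, ⟨hiso.hasGaussianLaw, hiso.integral_eq_zero, hiso.integral_mul, fun t k =>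
    ((hmart k).adapted t).congr ((hWM t k).mono fun _ h => h.symm), fun s t hst k => ?_⟩, hWM⟩
  rw [Indep_iff]
  rintro _ B ⟨C, hC', rfl⟩ hB
  refine indep_of_setIntegral_cos (𝓕 := 𝓕) (s := s) (v := ‖k‖₊ ^ 2 * (t - s)) ((Lp.aestronglyMeasurable
    (W (stepLp t k))).sub (Lp.aestronglyMeasurable (W (stepLp s k)))).aemeasurable
    (fun B hB u θ => ?_) C hC' B hB
  have h5 := h.setIntegral_cos h4 (.smul u (.base (hM k))) (c := fun t => t * (u ^ 2 * ‖k‖ ^ 2))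
    (fun t ω => by
      rw [← timeInt_const (Ω := Ω) (u ^ 2 * ‖k‖ ^ 2) t ω]
      congr 1
      funext r ω
      exact (real_inner_smul_left _ _ _).trans (by
        rw [real_inner_smul_right, hψ, real_inner_self_eq_norm_sq]; ring)) hst hB θ
  have e : -(t * (u ^ 2 * ‖k‖ ^ 2) - s * (u ^ 2 * ‖k‖ ^ 2)) / 2 =
      -(u ^ 2 * (‖k‖₊ ^ 2 * (t - s) : ℝ≥0)) / 2 := by
    push_cast [NNReal.coe_sub hst]
    ring
  rw [← e, ← h5]
  refine integral_congr_ae (ae_restrict_of_ae ?_)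
  filter_upwards [hWM t k, hWM s k] with ω h1 h2
  simp only [Pi.sub_apply, ← wienerAt_eq, h1, h2, mul_sub]

end NoiseConstruction

/-! ### Elementary approximation without cut-off -/

section IntegrandApproximation

lemma tendsto_measure_hit_le [IsFiniteMeasure P] {Y : Ω → C(ℝ≥0, E)} (hY : Measurable Y)
    (t : ℝ≥0) :
    Tendsto (fun n : ℕ => P {ω | ¬ (t : WithTop ℝ≥0) < hit (n : ℝ) (Y ω)}) atTop (𝓝 0) := by
  rw [← measure_empty (μ := P)]
  refine tendsto_measure_of_ae_tendsto_indicator_of_isFiniteMeasure _ .empty (fun n => ?_)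
    (ae_of_all _ fun ω => ?_)
  · simp only [not_lt]
    exact hY ((pathFiltration E).le t _ (isStoppingTime_hit (n : ℝ) t))
  · filter_upwards [(tendsto_hit (Y ω)).eventually (lt_mem_nhds (WithTop.coe_lt_top t))] with n hn
    simpa using hn

variable [IsProbabilityMeasure P] [CompleteSpace H] [SeparableSpace H]

/-- Elementary approximations of a coefficient along a continuous adapted process. -/
lemma exists_elementary_tendsto {Y : Ω → C(ℝ≥0, E)} (hY : ∀ t, Measurable[𝓕 t] fun ω => Y ω t)
    {g : E → H} (hm : StronglyMeasurable g) (hg : BddOnBalls g) :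
    ∃ Φ : ℕ → ElementaryProcess 𝓕 H,
      (∀ n : ℕ, energy P (fun r ω => (Φ n).eval r ω - cutoff n g r (Y ω)) n ≤ 1 / ((n : ℝ) + 1)) ∧
      ∀ (t : ℝ≥0) (ε : ℝ≥0∞), 0 < ε → Tendsto (fun n => P {ω | ε ≤ ∫⁻ s in Set.Ioc (0 : ℝ) t,
        ‖(Φ n).eval s.toNNReal ω - g (Y ω s.toNNReal)‖ₑ ^ 2}) atTop (𝓝 0) := by
  choose Φ hΦ using fun n : ℕ => exists_elementary_energy_cutoff_le (P := P) hY hm hg n n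
    (ε := 1 / ((n : ℝ) + 1)) (by positivity)
  refine ⟨Φ, hΦ, fun t ε hε => ?_⟩
  wlog htop : ε ≠ ∞ generalizing ε
  · refine tendsto_of_tendsto_of_tendsto_of_le_of_le tendsto_const_nhds
      (this 1 one_pos ENNReal.one_ne_top) (fun _ => zero_le) fun n => measure_mono fun ω hω => ?_
    exact (le_top.trans (not_not.1 htop).ge).trans hω
  have hπ := measurable_pathFiltration_of_eval hY
  have hd : ∀ n : ℕ, IsBoundedProg 𝓕 (fun r ω => (Φ n).eval r ω - cutoff n g r (Y ω)) := fun n =>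
    (Φ n).isBoundedProg.sub ((isBoundedProg_cutoff hm hg n).comp_map hπ)
  set a : ℕ → Ω → ℝ := fun n => timeInt (fun r ω => inner ℝ
    ((Φ n).eval r ω - cutoff n g r (Y ω)) ((Φ n).eval r ω - cutoff n g r (Y ω))) t
  have hlim : Tendsto (fun n => ENNReal.ofReal (∫ ω, a n ω ∂P) / ε) atTop (𝓝 0) := by
    have h1 : Tendsto (fun n => ∫ ω, a n ω ∂P) atTop (𝓝 0) := by
      refine tendsto_of_tendsto_of_tendsto_of_le_of_le' tendsto_const_nhds
        tendsto_one_div_add_atTop_nhds_zero_nat (.of_forall fun n => energy_nonneg _ _) ?_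
      filter_upwards [eventually_ge_atTop ⌈t⌉₊] with n hn
      exact (energy_le_energy (hd n) (Nat.ceil_le.1 hn)).trans (hΦ n)
    have h2 := ENNReal.Tendsto.div_const (ENNReal.tendsto_ofReal h1) (b := ε) (.inr hε.ne')
    simpa using h2
  have hsum := (tendsto_measure_hit_le (P := P) (hY := measurable_path_of_eval fun t =>
    (hY t).mono (𝓕.le t) le_rfl) t).add hlim
  rw [add_zero] at hsum
  refine tendsto_of_tendsto_of_tendsto_of_le_of_le tendsto_const_nhds hsum (fun _ => zero_le)
    fun n => ?_
  -- Markov's inequality handles the paths that have not left the ball of radius `n` by time `t`;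
  -- the remaining paths have probability tending to zero.
  have h3 : P {ω | ε ≤ ENNReal.ofReal (a n ω)} ≤ ENNReal.ofReal (∫ ω, a n ω ∂P) / ε := by
    have hi := ((hd n).inner (hd n)).integrable_timeInt (P := P) t
    rw [ofReal_integral_eq_lintegral_ofReal hi (ae_of_all _ fun ω =>
      timeInt_nonneg (fun _ _ => real_inner_self_nonneg) _ _)]
    exact meas_ge_le_lintegral_div hi.aestronglyMeasurable.aemeasurable.ennreal_ofReal hε.ne' htop
  refine (measure_mono fun ω (hω : ε ≤ _) => ?_).trans ((measure_union_le _ _).trans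
    (add_le_add_right h3 _))
  by_cases ht : (t : WithTop ℝ≥0) < hit (n : ℝ) (Y ω)
  · refine .inr (hω.trans_eq ((setLIntegral_congr_fun measurableSet_Ioc fun s hs => ?_).trans
      (lintegral_enorm_sq_eq (hd n) t ω)))
    have : (s.toNNReal : WithTop ℝ≥0) < hit (n : ℝ) (Y ω) :=
      (WithTop.coe_le_coe.2 (Real.toNNReal_le_iff_le_coe.2 hs.2)).trans_lt ht
    simp only [cutoff]
    rw [if_pos this]
  · exact .inl ht

end IntegrandApproximation

/-! ### Construction of the weak solution on the product space -/

section Existence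

variable [SeparableSpace X] [CompleteSpace H] [SeparableSpace H]

/-- On the product of path space and a space carrying an independent cylindrical Wiener process,
there is a Wiener process which turns the coordinate process into a weak solution. -/
theorem IsSolutionMeasure.exists_isWeakSolution {P : Measure C(ℝ≥0, E)} [IsProbabilityMeasure P]
    (hyp : IsAdmissibleCoefficients ι A F G) (hsol : IsSolutionMeasure ι A F G P) :
    ∃ (𝓖 : Filtration ℝ≥0 (inferInstance : MeasurableSpace (ℕ → ℝ)))
      (W : Lp H 2 (volume.restrict (Set.Ioi (0 : ℝ))) →L[ℝ] Lp ℝ 2 (P.prod gaussianSeq)),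
      IsWeakSolution ι A F G (P.prod gaussianSeq) (prodFiltration (pathFiltration E) 𝓖) W
        Prod.fst := by
  have : Fact ((2 : ℝ≥0∞) ≠ ∞) := ⟨ENNReal.ofNat_ne_top⟩
  obtain ⟨W', hW'i, hW'l⟩ := exists_isonormal (Lp H 2 (volume.restrict (Set.Ioi (0 : ℝ))))
  have hW' : IsIsonormal gaussianSeq W' := ⟨hW'i, hW'l⟩
  have hP := hsol.bracketSystem hyp
  have hN := hW'.isCylindricalWiener.bracketSystem
  have hB := hP.prod hN
  obtain ⟨T, hTi, hTd, hT⟩ := hsol.exists_isometry hyp hN fun h => ⟨_, h, rfl, rfl⟩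
  -- `M h` is the integral of `T h`: that of the projection of `h` against the coordinate
  -- martingales plus that of the remainder of `h` against the auxiliary Wiener process.
  choose M hM hM0 using fun h => hB.exists_intClosure (hT h).2 (hT h).1
  have h4 : ∀ {N φ}, ProdBase (PathBase ι A F G) (WienerBase W') N φ →
      HasFourthMoments (P.prod gaussianSeq) N :=
    HasFourthMoments.prodBase (fun {N φ} h => by
      obtain ⟨R, xs, ys, hp, rfl, rfl⟩ := h
      have hb : PathBase ι A F G _ _ := ⟨R, xs, ys, hp, rfl, rfl⟩
      exact (hyp.isBddContinuous_martStop R xs ys).hasFourthMoments (hP.mart hb)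
        ((hP.prog hb).inner (hP.prog hb)) (hP.bracket hb hb)) hW'.hasFourthMoments
  obtain ⟨W, hW, hWM⟩ := hB.exists_isCylindricalWiener h4 hM hM0 fun k k' r ω => hTi _ k k'
  have hY : ∀ t, Measurable[prodFiltration (pathFiltration E) (noiseFiltration W') t]
      fun ω : C(ℝ≥0, E) × (ℕ → ℝ) => ω.1 t := fun t =>
    (measurable_eval_pathFiltration le_rfl).comp (measurable_fst_prodFiltration t)
  refine ⟨noiseFiltration W', W, inferInstance, hW, ((isStronglyProgressive_eval (E := E)).comp_map
    measurable_fst_prodFiltration).isProgressive, fun xs ys hp => ?_⟩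
  refine ⟨fun t ω => martPart ι F xs ys t ω.1, ⟨ae_of_all _ fun ω =>
    hyp.continuous_martPart xs ys ω.1, ?_⟩, fun t => ae_of_all _ fun ω => ?_⟩
  swap
  · simp only [martPart, timeInt_drift hyp]
    ring
  obtain ⟨Φ, hΦ, hΦlim⟩ := exists_elementary_tendsto (P := P.prod gaussianSeq) hY
    (hyp.stronglyMeasurable_disp xs) (hyp.bddOnBalls_disp xs)
  refine ⟨Φ, fun t => ⟨hΦlim t, ?_⟩⟩
  let 𝓕 := prodFiltration (pathFiltration E) (noiseFiltration W')
  -- `N n` is the elementary integral of `Φ n` against the new Wiener process, seen as an integral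
  -- over the product system with integrand `T (Φ n)`. It is compared with the coordinate martingale
  -- stopped at radius `n`.
  set N : ℕ → ℝ≥0 → C(ℝ≥0, E) × (ℕ → ℝ) → ℝ := fun n t ω => ∑ i, (Φ n).ξ i ω *
    (M ((Φ n).h i) (min t ((Φ n).b i)) ω - M ((Φ n).h i) (min t ((Φ n).a i)) ω)
  have hNgen : ∀ n, Gen 𝓕 (IntClosure 𝓕 (P.prod gaussianSeq)
      (ProdBase (PathBase ι A F G) (WienerBase W'))) (N n) (fun r ω => T (ω.1 r) ((Φ n).eval r ω)) :=
    fun n => (Φ n).exists_gen (L := fun r ω => (T (ω.1 r) : H →ₗ[ℝ] WithLp 2 (H × H)))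
      fun h => .base (hM h)
  have hSgen : ∀ n : ℕ, Gen 𝓕 (IntClosure 𝓕 (P.prod gaussianSeq)
      (ProdBase (PathBase ι A F G) (WienerBase W')))
      (fun t ω => martStop ι F n xs ys t ω.1)
      (fun r ω => inlL2 (cutoff n (disp G xs) r ω.1)) := fun n =>
    .base (.of_gen hB (.base (.inl ⟨_, _, ⟨n, xs, ys, hp, rfl, rfl⟩, rfl, rfl⟩)))
  have hmart := fun n => hB.intClosure.gen_mart ((hNgen n).sub (hSgen n))
  have hsq : Tendsto (fun n : ℕ => ∫ ω, (N n t ω - martStop ι F n xs ys t ω.1 - 0) ^ 2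
      ∂(P.prod gaussianSeq)) atTop (𝓝 0) := by
    refine tendsto_of_tendsto_of_tendsto_of_le_of_le' tendsto_const_nhds
      tendsto_one_div_add_atTop_nhds_zero_nat
      (.of_forall fun n => integral_nonneg fun ω => sq_nonneg _) ?_
    filter_upwards [eventually_ge_atTop ⌈t⌉₊] with n hn
    have h1 := hB.intClosure.gen.integral_sq ((hNgen n).sub (hSgen n)) t
    have h0 : ∀ ω, N n 0 ω = 0 := fun ω => by simp [N]
    simp only [h0, martStop_zero, sub_zero] at h1
    simp only [sub_zero]
    rw [h1]
    refine le_trans (le_of_eq ?_) ((energy_le_energy ((Φ n).isBoundedProg.sub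
      ((isBoundedProg_cutoff (hyp.stronglyMeasurable_disp xs) (hyp.bddOnBalls_disp xs) n).comp_map
        measurable_fst_prodFiltration)) (Nat.ceil_le.1 hn)).trans (hΦ n))
    -- Since `T` acts on the dispersion as the embedding into the first summand, both integrands are
    -- images under `T`. Its isometry reduces the energy of their difference to the approximation
    -- error of `Φ n`, at most `1/(n+1)`.
    have hc : ∀ r (x : C(ℝ≥0, E)), (inlL2 (cutoff n (disp G xs) r x) : WithLp 2 (H × H)) =
        T (x r) (cutoff n (disp G xs) r x) := fun r x => by
      unfold cutoff
      split_ifs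
      · exact (hTd _ xs ys hp).symm
      · simp
    simp only [energy, hc, ← map_sub, hTi]
  have h1 := tendstoInMeasure_of_integral_sq (fun n => (hmart n).memLp t) (g := fun _ => 0)
    (memLp_const 0) hsq
  have h2 : TendstoInMeasure (P.prod gaussianSeq) (fun (n : ℕ) ω => martStop ι F n xs ys t ω.1)
      atTop (fun ω => martPart ι F xs ys t ω.1) := by
    refine tendstoInMeasure_of_tendsto_ae (fun n => ((hB.intClosure.gen_mart (hSgen n)).memLp
      t).aestronglyMeasurable) (ae_of_all _ fun ω => tendsto_nhds_of_eventually_eq ?_)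
    filter_upwards [(tendsto_hit ω.1).eventually (lt_mem_nhds (WithTop.coe_lt_top t))] with n hn
    rw [martStop, stopAt_of_le hn.le]
  refine (h1.add_real h2).congr (fun n => ?_) (.of_forall fun ω => by simp)
  filter_upwards [ae_all_iff.2 fun i => hWM (min t ((Φ n).b i)) ((Φ n).h i),
    ae_all_iff.2 fun i => hWM (min t ((Φ n).a i)) ((Φ n).h i)] with ω ha hb
  simp only [N, sub_add_cancel, ElementaryProcess.integral, ha, hb]

end Existence

end

theorem theorem3p3 {E : Type u} {X : Type v} {H : Type w}
    [NormedAddCommGroup E] [NormedSpace ℝ E] [CompleteSpace E]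
    [TopologicalSpace.SeparableSpace E] [MeasurableSpace E] [BorelSpace E]
    [NormedAddCommGroup X] [NormedSpace ℝ X] [CompleteSpace X]
    [TopologicalSpace.SeparableSpace X]
    [NormedAddCommGroup H] [InnerProductSpace ℝ H] [CompleteSpace H]
    [TopologicalSpace.SeparableSpace H]
    (ι : E →L[ℝ] X) (A : X →ₗ.[ℝ] X) (F : E → X) (G : E → H →L[ℝ] X)
    (hyp : IsAdmissibleCoefficients ι A F G) :
    (∀ (Ω : Type z) (mΩ : MeasurableSpace Ω) (P : Measure Ω) (𝓕 : Filtration ℝ≥0 mΩ)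
      (W : Lp H 2 (volume.restrict (Set.Ioi (0 : ℝ))) →L[ℝ] Lp ℝ 2 P)
      (Y : Ω → C(ℝ≥0, E)),
      IsWeakSolution ι A F G P 𝓕 W Y →
        Measurable Y ∧ SolvesLocalMartingaleProblem (operatorGraph ι A F G) (P.map Y)) ∧
    (∀ P : Measure C(ℝ≥0, E),
      SolvesLocalMartingaleProblem (minOperatorGraph ι A F G) P →
        ∃ (Ω : Type u) (mΩ : MeasurableSpace Ω) (Q : Measure Ω) (𝓕 : Filtration ℝ≥0 mΩ)
          (W : Lp H 2 (volume.restrict (Set.Ioi (0 : ℝ))) →L[ℝ] Lp ℝ 2 Q)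
          (Y : Ω → C(ℝ≥0, E)),
          IsWeakSolution ι A F G Q 𝓕 W Y ∧ Q.map Y = P ∧
            IsFilteredExtension Q 𝓕 P (pathFiltration E) Y) := by
  refine ⟨fun Ω mΩ P 𝓕 W Y hsol => ⟨hsol.measurable_path,
    (hsol.isSolutionMeasure hyp).solves hyp⟩, fun P hP => ?_⟩
  have := hP.1
  obtain ⟨𝓖, W, hW⟩ := (isSolutionMeasure_of_min hyp hP).exists_isWeakSolution hyp
  exact ⟨C(ℝ≥0, E) × (ℕ → ℝ), _, P.prod gaussianSeq, _, W, Prod.fst, hW,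
    measurePreserving_fst.map_eq, isFilteredExtension_fst⟩
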